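/- **Setting.** Fix an integer $k\ge 1$. For $N\ge 0$ let $\mathcal A_N$ be the free supercommutative $\mathbb C$-algebra on the entries of $N\times N$ matrices $D^nA_i,\ D^nB_i$ (bosonic) and $D^n\psi^A_i,\ D^n\psi^B_i$ (fermionic), $i=1,2$, $n\ge 0$; let $D$ be the even derivation that raises $n$ by one. The letters $B,\psi^A$ are bifundamentals of $U(N)\times U(N)$ and $A,\psi^B$ anti-bifundamentals. Scalars have charge $\mathcal D+J_3=\tfrac12$, fermions $\tfrac32$, and each $D$ adds $2$. With $\epsilon_{12}=\epsilon^{12}=1$ and $2X_{[r}Y_{s]}=X_rY_s-X_sY_r$, the one-loop supercharge $\mathcal Q$ is the odd derivation with $$\mathcal QA_i=\mathcal QB_i=0,\qquad \mathcal Q\psi^A_i=\tfrac{4\pi i}{k}\epsilon_{rs}B_rA_iB_s,\qquad \mathcal Q\psi^B_i=-\tfrac{4\pi i}{k}\epsilon_{rs}A_rB_iA_s,$$ and, for $\phi=D^nX$ with $n\ge0$, $\hat\omega=\tfrac{8\pi}{k}(A_{[1}\psi^A_{2]}+\psi^B_{[1}B_{2]})$ and $\omega=\tfrac{8\pi}{k}(\psi^A_{[2}A_{1]}+B_{[2}\psi^B_{1]})$,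 $$\mathcal Q(D\phi)=D(\mathcal Q\phi)+\hat\omega\phi\mp\phi\,\omega\quad(X=A,\psi^B),\qquad \mathcal Q(D\phi)=D(\mathcal Q\phi)+\omega\phi\mp\phi\,\hat\omega\quad(X=B,\psi^A),$$ where the upper sign is for bosonic and the lower sign for fermionic $\phi$. The gauge-invariant operators (zero-monopole sector) at order $x^d$ are the linear combinations of products of traces $(w)=\mathrm{Tr}\,w$ of cyclically alternating words $w$ (bifundamental and anti-bifundamental letters alternate) of total charge $d$; $H^d_N$ is the space of $\mathcal Q$-closed ones modulo $\mathcal Q$-exact ones. The trace relations of $N\times N$ matrices hold automatically. The flavour group $SU(2)_u\times SU(2)_v$ (and its complexification) acts with $A,\psi^A$ doublets of $SU(2)_u$ and $B,\psi^B$ doublets of $SU(2)_v$; $(\mathbf m,\mathbf n)$ is its irreducible representation of dimension $mn$, and $\chi_n(w)=\sum_{j=0}^{n-1}w^{n-1-2j}$. An $N$-independent multi-trace expression is *monotone* if it is $\mathcal Q$-closed for every $N$; the multi-graviton part $H^d_{2,\rm grav}\subset H^d_2$ is the set of classes of monotone expressions. The symbols $s^{ij}_{kl}$, $s^{ijk}_{lmn}$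 are the symmetrisers of two and three indices (with weights $\tfrac12$, $\tfrac16$), and repeated indices are summed. **Claim.** (1) The following multi-trace expressions are monotone. * Order $x^0$: the identity, $(\mathbf 1,\mathbf 1)$. * Order $x$: $(A_iB_p)$, $(\mathbf 2,\mathbf 2)$. * Order $x^2$, bosons: $s^{ij}_{kl}s^{pq}_{rs}(A_iB_pA_jB_q)$ and $s^{ij}_{kl}s^{pq}_{rs}(A_iB_p)(A_jB_q)$, each $(\mathbf 3,\mathbf 3)$; $\epsilon^{ij}\epsilon^{pq}(A_iB_p)(A_jB_q)$, $(\mathbf 1,\mathbf 1)$. * Order $x^2$, fermions: $s^{ij}_{kl}(A_i\psi^A_j)$, $(\mathbf 3,\mathbf 1)$; $s^{pq}_{rs}(B_p\psi^B_q)$, $(\mathbf 1,\mathbf 3)$; $\epsilon^{ij}(A_i\psi^A_j-B_i\psi^B_j)$, $(\mathbf 1,\mathbf 1)$. * Order $x^3$, bosons: $s^{ijk}_{lmn}s^{pqr}_{stu}(A_iB_p)(A_jB_qA_kB_r)$, $(\mathbf 4,\mathbf 4)$; $s^{ijk}_{lmn}\epsilon^{qr}(A_iB_pA_jB_q)(A_kB_r)$,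 $(\mathbf 4,\mathbf 2)$; $s^{pqr}_{stu}\epsilon^{jk}(A_iB_pA_jB_q)(A_kB_r)$, $(\mathbf 2,\mathbf 4)$; $s^{ijk}_{lmn}s^{pqr}_{stu}(A_iB_p)(A_jB_q)(A_kB_r)$, $(\mathbf 4,\mathbf 4)$; $\epsilon^{ij}\epsilon^{pq}(A_iB_p)(A_jB_q)(A_kB_r)$, $(\mathbf 2,\mathbf 2)$; $D(A_iB_p)$, $(\mathbf 2,\mathbf 2)$; $(i\,B_pDA_i+\psi^A_i\psi^B_p)$ (the coefficient $i$ is the imaginary unit), $(\mathbf 2,\mathbf 2)$. * Order $x^3$, single-trace fermions: $s^{ijk}_{lmn}(\psi^A_iA_jB_pA_k)$, $(\mathbf 4,\mathbf 2)$; $s^{pqr}_{stu}(\psi^B_pB_qA_iB_r)$, $(\mathbf 2,\mathbf 4)$; $\epsilon^{ij}(\psi^A_iA_jB_qA_p-\psi^B_iB_jA_pB_q+\psi^A_pA_iB_qA_j)$, $(\mathbf 2,\mathbf 2)$. * Order $x^3$, double-trace fermions: $\epsilon^{ij}(A_i\psi^A_j-B_i\psi^B_j)(A_kB_l)$, $(\mathbf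 2,\mathbf 2)$; $s^{ijk}_{lmn}(\psi^A_iA_j)(B_pA_k)$, $(\mathbf 4,\mathbf 2)$; $s^{pqr}_{stu}(\psi^B_pB_q)(A_iB_r)$, $(\mathbf 2,\mathbf 4)$; $s^{ij}_{lm}\epsilon^{lk}(\psi^A_iA_j)(A_kB_p)$, $(\mathbf 2,\mathbf 2)$; $s^{pq}_{ts}\epsilon^{tr}(\psi^B_pB_q)(B_rA_i)$, $(\mathbf 2,\mathbf 2)$. (2) The four fermionic operators $$\mathcal O_f=\epsilon^{ij}(\psi^A_iA_jB_kA_l+\psi^B_iB_jA_lB_k)-\tfrac34\epsilon^{ij}(B_kA_l)(\psi^A_iA_j+\psi^B_iB_j),\qquad k,l\in\{1,2\},$$ at order $x^3$, of type $(\mathbf 2,\mathbf 2)$, satisfy $\mathcal Q\mathcal O_f=0$ for $N=2$ and $\mathcal Q\mathcal O_f\ne0$ for every $N\ge3$. (3) For $N=2$ and every $d\le3$, $H^d_2$ is the direct sum of the spans of the classes of the multiplets of order $x^d$ in (1) and (2), and $H^d_{2,\rm grav}$ is the sum of those in (1). In $H^d_2$ each of these spans is a subrepresentation isomorphic to the irreducible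 representation indicated, with the statistics indicated. (4) The traces of $(-1)^Fu^{q_1-q_2}v^{q_1+q_2}$ over $H^0_2,\dots,H^3_2$, for $u,v\in\mathbb C^\times$, are $1$, $\chi_2(u)\chi_2(v)$, $2\chi_3(u)\chi_3(v)-\chi_3(u)-\chi_3(v)$ and $2\chi_4(u)\chi_4(v)-\chi_4(u)\chi_2(v)-\chi_2(u)\chi_4(v)-2\chi_2(u)\chi_2(v)$. Those over $H^0_{2,\rm grav},\dots,H^3_{2,\rm grav}$ are the same except that the last term of the last one is $-\chi_2(u)\chi_2(v)$. (5) Let $\mathcal I(x;u,v)$ be the zero-flux superconformal index of the $U(2)_k\times U(2)_{-k}$ theory, $$\mathcal I=\frac14\oint\prod_{i=1}^2\frac{dz_i}{2\pi iz_i}\oint\prod_{j=1}^2\frac{dw_j}{2\pi iw_j}\Bigl(1-\tfrac{z_1}{z_2}\Bigr)\Bigl(1-\tfrac{z_2}{z_1}\Bigr)\Bigl(1-\tfrac{w_1}{w_2}\Bigr)\Bigl(1-\tfrac{w_2}{w_1}\Bigr)\prod_{i,j=1}^2\prod_{\pm}\mathcal I_{\rm ch}\bigl(u^{\pm1}\tfrac{z_i}{w_j}\bigr)\mathcal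 I_{\rm ch}\bigl(v^{\pm1}\tfrac{w_j}{z_i}\bigr),$$ with unit circles as contours and $\mathcal I_{\rm ch}(z)=\prod_{n\ge0}\frac{1-x^{3/2+2n}z^{-1}}{1-x^{1/2+2n}z}$. For fixed $u,v\in\mathbb C^\times$ and $x^{1/2}\to0$, $\mathcal I$ equals $\sum_{d\le3}x^d$ times the traces over $H^d_2$, up to $O(x^4)$; and $\mathcal I-\sum_{d\le3}x^d\,\mathrm{Tr}_{H^d_{2,\rm grav}}(-1)^Fu^{q_1-q_2}v^{q_1+q_2}=-\chi_2(u)\chi_2(v)x^3+O(x^4)$. -/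

import Mathlib

open scoped TensorProduct Asymptotics

noncomputable section

namespace ABJM

/-! ### Letters -/

/-- The four kinds of elementary fields: the scalars `A`, `B` and the fermions `ψ^A`, `ψ^B`. -/
inductive Kind
  | A
  | B
  | psiA
  | psiB

/-- Statistics: `true` for the fermions. -/
def Kind.odd : Kind → Bool
  | .A => false
  | .B => false
  | .psiA => true
  | .psiB => true

/-- `true` for the bifundamental fields `B`, `ψ^A`, `false` for the anti-bifundamental fields
`A`, `ψ^B`. -/
def Kind.bif : Kind → Bool
  | .A => false
  | .B => true
  | .psiA => true
  | .psiB => false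

/-- A BPS letter `D^n X_i`, where `X` is one of `A, B, ψ^A, ψ^B` and `i` is the doublet index
(the values `1, 2` are written `0, 1`). -/
structure Letter where
  kind : Kind
  der : ℕ
  idx : Fin 2

/-- Twice the charge `𝒟 + J₃` of a letter: `1/2` for scalars, `3/2` for fermions, `2` for every
derivative. -/
def Letter.charge2 (l : Letter) : ℕ := (if l.kind.odd then 3 else 1) + 4 * l.der

/-! ### The supercommutative algebra of matrix entries -/

/-- The entries of the `N × N` matrices of letters. -/
abbrev Gen (N : ℕ) : Type := Letter × Fin N × Fin N

/-- The sign of the exchange of two objects of given parities. -/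
def sgn (a b : Bool) : ℂ := if a && b then -1 else 1

/-- Bosonic entries commute with everything, fermionic entries anticommute with each other. -/
inductive Rel (N : ℕ) : FreeAlgebra ℂ (Gen N) → FreeAlgebra ℂ (Gen N) → Prop
  | comm (x y : Gen N) : Rel N (FreeAlgebra.ι ℂ x * FreeAlgebra.ι ℂ y)
      (sgn x.1.kind.odd y.1.kind.odd • (FreeAlgebra.ι ℂ y * FreeAlgebra.ι ℂ x))

/-- The free supercommutative algebra on the matrix entries of all letters. -/
def Alg (N : ℕ) : Type := RingQuot (Rel N)

instance (N : ℕ) : Ring (Alg N) := inferInstanceAs (Ring (RingQuot (Rel N)))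

instance (N : ℕ) : Algebra ℂ (Alg N) := inferInstanceAs (Algebra ℂ (RingQuot (Rel N)))

/-- The quotient map from the free algebra. -/
def proj (N : ℕ) : FreeAlgebra ℂ (Gen N) →ₐ[ℂ] Alg N := RingQuot.mkAlgHom ℂ (Rel N)

theorem proj_surjective (N : ℕ) : Function.Surjective (proj N) :=
  RingQuot.mkAlgHom_surjective ℂ (Rel N)

/-- The entry `(a, b)` of a letter as an element of the algebra. -/
def gen {N : ℕ} (x : Gen N) : Alg N := proj N (FreeAlgebra.ι ℂ x)

theorem gen_mul_gen {N : ℕ} (x y : Gen N) :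
    gen x * gen y = sgn x.1.kind.odd y.1.kind.odd • (gen y * gen x) := by
  have h : proj N _ = proj N _ := RingQuot.mkAlgHom_rel ℂ (Rel.comm x y)
  simpa [gen] using h

/-- The universal property of `Alg N`. -/
def lift {N : ℕ} {R : Type*} [Ring R] [Algebra ℂ R] (f : Gen N → R)
    (hf : ∀ x y, f x * f y = sgn x.1.kind.odd y.1.kind.odd • (f y * f x)) : Alg N →ₐ[ℂ] R :=
  RingQuot.liftAlgHom ℂ ⟨FreeAlgebra.lift ℂ f, by
    rintro _ _ ⟨x, y⟩
    simpa using hf x y⟩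

@[simp] theorem lift_gen {N : ℕ} {R : Type*} [Ring R] [Algebra ℂ R] (f : Gen N → R)
    (hf : ∀ x y, f x * f y = sgn x.1.kind.odd y.1.kind.odd • (f y * f x)) (x : Gen N) :
    lift f hf (gen x) = f x := by
  exact (RingQuot.liftAlgHom_mkAlgHom_apply ℂ (FreeAlgebra.lift ℂ f) _ _).trans
    (FreeAlgebra.lift_ι_apply f x)

theorem algHom_ext {N : ℕ} {R : Type*} [Ring R] [Algebra ℂ R] {f g : Alg N →ₐ[ℂ] R}
    (h : ∀ x, f (gen x) = g (gen x)) : f = g := by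
  refine RingQuot.ringQuot_ext' (S := ℂ) f g ?_
  apply FreeAlgebra.hom_ext
  funext x
  exact h x

/-! ### Matrices of letters, the derivative and the fermion parity -/

/-- The `N × N` matrix of a letter. -/
def mat (N : ℕ) (l : Letter) : Matrix (Fin N) (Fin N) (Alg N) :=
  Matrix.of fun a b => gen (l, a, b)

/-- The operator `(-1)^F`, as an automorphism of the algebra. -/
def parity (N : ℕ) : Alg N →ₐ[ℂ] Alg N :=
  lift (fun x => (if x.1.kind.odd then (-1 : ℂ) else 1) • gen x) fun x y => by
    rw [smul_mul_smul_comm, smul_mul_smul_comm, gen_mul_gen x y, smul_comm, mul_comm]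

/-- The letter `D X` for a letter `X`. -/
def Letter.D (l : Letter) : Letter := ⟨l.kind, l.der + 1, l.idx⟩

/-- Auxiliary homomorphism `X ↦ (X, D X; 0, X)` that encodes the derivation `D`. -/
def derHom (N : ℕ) : Alg N →ₐ[ℂ] Matrix (Fin 2) (Fin 2) (Alg N) :=
  lift (fun x => !![gen x, gen (x.1.D, x.2); 0, gen x]) fun x y => by
    have h1 := gen_mul_gen x y
    have h2 := gen_mul_gen (x.1.D, x.2) y
    have h3 := gen_mul_gen x (y.1.D, y.2)
    simp only [Letter.D] at h2 h3 ⊢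
    ext i j
    fin_cases i <;> fin_cases j <;>
      simp [Matrix.mul_apply, Fin.sum_univ_two, h1, h2, h3, smul_add, add_comm]

/-- The covariant derivative `D`, an even derivation with `D (D^n X) = D^(n+1) X`. -/
def der (N : ℕ) : Alg N →ₗ[ℂ] Alg N where
  toFun X := derHom N X 0 1
  map_add' X Y := by simp
  map_smul' c X := by simp

theorem derHom_diag {N : ℕ} (X : Alg N) :
    derHom N X 0 0 = X ∧ derHom N X 1 1 = X ∧ derHom N X 1 0 = 0 := by
  obtain ⟨Y, rfl⟩ := proj_surjective N X
  induction Y using FreeAlgebra.induction with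
  | grade0 r =>
    rw [AlgHom.commutes, AlgHom.commutes]
    simp [Matrix.algebraMap_matrix_apply]
  | grade1 x =>
    change derHom N (gen x) 0 0 = gen x ∧ derHom N (gen x) 1 1 = gen x ∧ derHom N (gen x) 1 0 = 0
    simp [derHom]
  | mul a b ha hb =>
    simp only [map_mul, Matrix.mul_apply, Fin.sum_univ_two]
    simp [ha, hb]
  | add a b ha hb =>
    simp only [map_add, Matrix.add_apply]
    simp [ha, hb]

@[simp] theorem der_gen {N : ℕ} (x : Gen N) : der N (gen x) = gen (x.1.D, x.2) := by
  simp [der, derHom]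

theorem der_mul {N : ℕ} (X Y : Alg N) : der N (X * Y) = der N X * Y + X * der N Y := by
  change derHom N (X * Y) 0 1 = derHom N X 0 1 * Y + X * derHom N Y 0 1
  rw [map_mul, Matrix.mul_apply, Fin.sum_univ_two, (derHom_diag X).1, (derHom_diag Y).2.1, add_comm]

@[simp] theorem parity_gen {N : ℕ} (x : Gen N) :
    parity N (gen x) = (if x.1.kind.odd then (-1 : ℂ) else 1) • gen x := by
  simp [parity]

theorem parity_der {N : ℕ} (X : Alg N) : parity N (der N X) = der N (parity N X) := by
  have h : (derHom N).comp (parity N) = (parity N).mapMatrix.comp (derHom N) := by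
    apply algHom_ext
    intro x
    ext i j
    cases hx : x.1.kind.odd <;> fin_cases i <;> fin_cases j <;> simp [derHom, Letter.D, hx]
  exact (congrFun (congrFun (DFunLike.congr_fun h X) 0) 1).symm

/-- `X` is homogeneous of parity `p`: it supercommutes with the generators accordingly and is an
eigenvector of `(-1)^F`. -/
def HasParity {N : ℕ} (p : Bool) (X : Alg N) : Prop :=
  (∀ x : Gen N, gen x * X = sgn x.1.kind.odd p • (X * gen x)) ∧
    parity N X = (if p then (-1 : ℂ) else 1) • X

theorem HasParity.gen {N : ℕ} (x : Gen N) : HasParity x.1.kind.odd (gen x) :=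
  ⟨fun y => gen_mul_gen y x, parity_gen x⟩

theorem HasParity.zero {N : ℕ} (p : Bool) : HasParity p (0 : Alg N) :=
  ⟨fun x => by simp, by simp⟩

theorem HasParity.add {N : ℕ} {p : Bool} {X Y : Alg N} (hX : HasParity p X)
    (hY : HasParity p Y) : HasParity p (X + Y) :=
  ⟨fun x => by rw [mul_add, add_mul, hX.1 x, hY.1 x, smul_add],
    by rw [map_add, hX.2, hY.2, smul_add]⟩

theorem HasParity.smul {N : ℕ} {p : Bool} {X : Alg N} (c : ℂ) (hX : HasParity p X) :
    HasParity p (c • X) :=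
  ⟨fun x => by rw [mul_smul_comm, hX.1 x, smul_mul_assoc, smul_comm],
    by rw [map_smul, hX.2, smul_comm]⟩

theorem HasParity.sub {N : ℕ} {p : Bool} {X Y : Alg N} (hX : HasParity p X)
    (hY : HasParity p Y) : HasParity p (X - Y) :=
  ⟨fun x => by rw [mul_sub, sub_mul, hX.1 x, hY.1 x, smul_sub],
    by rw [map_sub, hX.2, hY.2, smul_sub]⟩

theorem HasParity.sum {N : ℕ} {p : Bool} {ι : Type*} (s : Finset ι) (f : ι → Alg N)
    (h : ∀ i ∈ s, HasParity p (f i)) : HasParity p (∑ i ∈ s, f i) := by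
  classical
  induction s using Finset.induction_on with
  | empty => simpa using HasParity.zero p
  | insert a s ha ih =>
    rw [Finset.sum_insert ha]
    exact (h a (by simp)).add (ih fun i hi => h i (by simp [hi]))

theorem HasParity.mul {N : ℕ} {p q : Bool} {X Y : Alg N} (hX : HasParity p X)
    (hY : HasParity q Y) : HasParity (xor p q) (X * Y) := by
  refine ⟨fun x => ?_, ?_⟩
  · rw [← mul_assoc, hX.1 x, smul_mul_assoc, mul_assoc, hY.1 x, mul_smul_comm, smul_smul, mul_assoc]
    congr 1
    cases x.1.kind.odd <;> cases p <;> cases q <;> simp [sgn]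
  · rw [map_mul, hX.2, hY.2, smul_mul_smul_comm]
    cases p <;> cases q <;> simp

theorem HasParity.der {N : ℕ} {p : Bool} {X : Alg N} (hX : HasParity p X) :
    HasParity p (der N X) := by
  refine ⟨fun x => ?_, by rw [parity_der, hX.2, map_smul]⟩
  have h := congrArg (ABJM.der N) (hX.1 x)
  have h2 := hX.1 (x.1.D, x.2)
  rw [map_smul, der_mul, der_mul, der_gen, h2, smul_add] at h
  simp only [Letter.D] at h
  rw [add_comm] at h
  exact add_right_cancel h

/-! ### The one-loop supercharge -/

/-- The antisymmetric tensor with `ε_{12} = ε^{12} = 1`. -/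
def eps (i j : Fin 2) : ℂ := if i = j then 0 else if i < j then 1 else -1

/-- The combination `2 (A_[1 ψ^A_2] + ψ^B_[1 B_2])`, with `2 X_[1 Y_2] = X_1 Y_2 - X_2 Y_1`. -/
def connHat (N : ℕ) : Matrix (Fin N) (Fin N) (Alg N) :=
  mat N ⟨.A, 0, 0⟩ * mat N ⟨.psiA, 0, 1⟩ - mat N ⟨.A, 0, 1⟩ * mat N ⟨.psiA, 0, 0⟩
    + (mat N ⟨.psiB, 0, 0⟩ * mat N ⟨.B, 0, 1⟩ - mat N ⟨.psiB, 0, 1⟩ * mat N ⟨.B, 0, 0⟩)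

/-- The combination `2 (ψ^A_[2 A_1] + B_[2 ψ^B_1])`. -/
def conn (N : ℕ) : Matrix (Fin N) (Fin N) (Alg N) :=
  mat N ⟨.psiA, 0, 1⟩ * mat N ⟨.A, 0, 0⟩ - mat N ⟨.psiA, 0, 0⟩ * mat N ⟨.A, 0, 1⟩
    + (mat N ⟨.B, 0, 1⟩ * mat N ⟨.psiB, 0, 0⟩ - mat N ⟨.B, 0, 0⟩ * mat N ⟨.psiB, 0, 1⟩)

/-- The action of the one-loop supercharge `𝒬` at level `k` on the letters.  On the letters with
derivatives it is the rule `𝒬 (D φ) = D (𝒬 φ) + (𝒬 𝒜) φ ∓ φ (𝒬 𝒜')`, where `𝒬 𝒜`, `𝒬 𝒜'` are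
the variations of the two gauge connections, with the upper sign for bosonic `φ`. -/
def Qmat (N k : ℕ) : Kind → ℕ → Fin 2 → Matrix (Fin N) (Fin N) (Alg N)
  | .A, 0, _ => 0
  | .B, 0, _ => 0
  | .psiA, 0, i => (4 * Real.pi * Complex.I / k : ℂ) •
      ∑ r, ∑ s, eps r s • (mat N ⟨.B, 0, r⟩ * mat N ⟨.A, 0, i⟩ * mat N ⟨.B, 0, s⟩)
  | .psiB, 0, i => (-(4 * Real.pi * Complex.I / k) : ℂ) •
      ∑ r, ∑ s, eps r s • (mat N ⟨.A, 0, r⟩ * mat N ⟨.B, 0, i⟩ * mat N ⟨.A, 0, s⟩)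
  | .A, n + 1, i => (Qmat N k .A n i).map (der N) +
      (4 * Real.pi / k : ℂ) • (connHat N * mat N ⟨.A, n, i⟩ - mat N ⟨.A, n, i⟩ * conn N)
  | .B, n + 1, i => (Qmat N k .B n i).map (der N) +
      (4 * Real.pi / k : ℂ) • (conn N * mat N ⟨.B, n, i⟩ - mat N ⟨.B, n, i⟩ * connHat N)
  | .psiA, n + 1, i => (Qmat N k .psiA n i).map (der N) +
      (4 * Real.pi / k : ℂ) • (conn N * mat N ⟨.psiA, n, i⟩ + mat N ⟨.psiA, n, i⟩ * connHat N)
  | .psiB, n + 1, i => (Qmat N k .psiB n i).map (der N) +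
      (4 * Real.pi / k : ℂ) • (connHat N * mat N ⟨.psiB, n, i⟩ + mat N ⟨.psiB, n, i⟩ * conn N)

/-- All entries of a matrix have parity `p`. -/
def MatParity {N : ℕ} (p : Bool) (M : Matrix (Fin N) (Fin N) (Alg N)) : Prop :=
  ∀ a b, HasParity p (M a b)

theorem MatParity.mat {N : ℕ} (l : Letter) : MatParity l.kind.odd (mat N l) :=
  fun a b => HasParity.gen (l, a, b)

theorem MatParity.mul {N : ℕ} {p q : Bool} {M M' : Matrix (Fin N) (Fin N) (Alg N)}
    (h : MatParity p M) (h' : MatParity q M') : MatParity (xor p q) (M * M') := fun a b => by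
  rw [Matrix.mul_apply]
  exact HasParity.sum _ _ fun i _ => (h a i).mul (h' i b)

theorem MatParity.add {N : ℕ} {p : Bool} {M M' : Matrix (Fin N) (Fin N) (Alg N)}
    (h : MatParity p M) (h' : MatParity p M') : MatParity p (M + M') :=
  fun a b => (h a b).add (h' a b)

theorem MatParity.sub {N : ℕ} {p : Bool} {M M' : Matrix (Fin N) (Fin N) (Alg N)}
    (h : MatParity p M) (h' : MatParity p M') : MatParity p (M - M') :=
  fun a b => (h a b).sub (h' a b)

theorem MatParity.smul {N : ℕ} {p : Bool} {M : Matrix (Fin N) (Fin N) (Alg N)} (c : ℂ)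
    (h : MatParity p M) : MatParity p (c • M) := fun a b => (h a b).smul c

theorem MatParity.der {N : ℕ} {p : Bool} {M : Matrix (Fin N) (Fin N) (Alg N)}
    (h : MatParity p M) : MatParity p (M.map (der N)) := fun a b => (h a b).der

theorem MatParity.zero {N : ℕ} (p : Bool) :
    MatParity p (0 : Matrix (Fin N) (Fin N) (Alg N)) := fun _ _ => HasParity.zero p

theorem MatParity.sum {N : ℕ} {p : Bool} {ι : Type*} (s : Finset ι)
    (f : ι → Matrix (Fin N) (Fin N) (Alg N)) (h : ∀ i ∈ s, MatParity p (f i)) :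
    MatParity p (∑ i ∈ s, f i) := fun a b => by
  rw [Matrix.sum_apply]
  exact HasParity.sum _ _ fun i hi => h i hi a b

theorem conn_parity (N : ℕ) : MatParity true (conn N) :=
  (((MatParity.mat ⟨.psiA, 0, 1⟩).mul (MatParity.mat ⟨.A, 0, 0⟩)).sub
      ((MatParity.mat ⟨.psiA, 0, 0⟩).mul (MatParity.mat ⟨.A, 0, 1⟩))).add
    (((MatParity.mat ⟨.B, 0, 1⟩).mul (MatParity.mat ⟨.psiB, 0, 0⟩)).sub
      ((MatParity.mat ⟨.B, 0, 0⟩).mul (MatParity.mat ⟨.psiB, 0, 1⟩)))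

theorem connHat_parity (N : ℕ) : MatParity true (connHat N) :=
  (((MatParity.mat ⟨.A, 0, 0⟩).mul (MatParity.mat ⟨.psiA, 0, 1⟩)).sub
      ((MatParity.mat ⟨.A, 0, 1⟩).mul (MatParity.mat ⟨.psiA, 0, 0⟩))).add
    (((MatParity.mat ⟨.psiB, 0, 0⟩).mul (MatParity.mat ⟨.B, 0, 1⟩)).sub
      ((MatParity.mat ⟨.psiB, 0, 1⟩).mul (MatParity.mat ⟨.B, 0, 0⟩)))

theorem Qmat_parity (N k : ℕ) (t : Kind) (n : ℕ) (i : Fin 2) :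
    MatParity (!t.odd) (Qmat N k t n i) := by
  induction n with
  | zero =>
    cases t
    · exact MatParity.zero _
    · exact MatParity.zero _
    · exact MatParity.smul _ (MatParity.sum _ _ fun r _ => MatParity.sum _ _ fun s _ =>
        MatParity.smul _ (((MatParity.mat _).mul (MatParity.mat _)).mul (MatParity.mat _)))
    · exact MatParity.smul _ (MatParity.sum _ _ fun r _ => MatParity.sum _ _ fun s _ =>
        MatParity.smul _ (((MatParity.mat _).mul (MatParity.mat _)).mul (MatParity.mat _)))
  | succ n ih =>
    cases t
    · exact ih.der.add (MatParity.smul _ (((connHat_parity N).mul (MatParity.mat ⟨.A, n, i⟩)).sub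
        ((MatParity.mat ⟨.A, n, i⟩).mul (conn_parity N))))
    · exact ih.der.add (MatParity.smul _ (((conn_parity N).mul (MatParity.mat ⟨.B, n, i⟩)).sub
        ((MatParity.mat ⟨.B, n, i⟩).mul (connHat_parity N))))
    · exact ih.der.add (MatParity.smul _ (((conn_parity N).mul (MatParity.mat ⟨.psiA, n, i⟩)).add
        ((MatParity.mat ⟨.psiA, n, i⟩).mul (connHat_parity N))))
    · exact ih.der.add (MatParity.smul _
        (((connHat_parity N).mul (MatParity.mat ⟨.psiB, n, i⟩)).add
          ((MatParity.mat ⟨.psiB, n, i⟩).mul (conn_parity N))))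

/-- Auxiliary homomorphism `X ↦ ((-1)^F X, 𝒬 X; 0, X)` that encodes the odd derivation `𝒬`. -/
def QHom (N k : ℕ) : Alg N →ₐ[ℂ] Matrix (Fin 2) (Fin 2) (Alg N) :=
  lift (fun x => !![parity N (gen x), Qmat N k x.1.kind x.1.der x.1.idx x.2.1 x.2.2; 0, gen x])
    fun x y => by
    have h1 := gen_mul_gen x y
    have h2 := (Qmat_parity N k x.1.kind x.1.der x.1.idx x.2.1 x.2.2).1 y
    have h3 := (Qmat_parity N k y.1.kind y.1.der y.1.idx y.2.1 y.2.2).1 x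
    ext i j
    fin_cases i <;> fin_cases j
    · have h := congrArg (parity N) h1
      rw [map_smul, map_mul, map_mul] at h
      cases hx : x.1.kind.odd <;> cases hy : y.1.kind.odd <;>
        simpa [Matrix.mul_apply, Fin.sum_univ_two, hx, hy] using h
    · simp only [Matrix.mul_apply, Fin.sum_univ_two, parity_gen, Matrix.smul_apply]
      simp only [Fin.zero_eta, Fin.mk_one, Matrix.of_apply, Matrix.cons_val', Matrix.cons_val_zero,
        Matrix.cons_val_one, Matrix.cons_val_fin_one, smul_mul_assoc]
      rw [h2, h3, smul_add, smul_smul, smul_smul, smul_smul, add_comm]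
      cases x.1.kind.odd <;> cases y.1.kind.odd <;> simp [sgn]
    · simp [Matrix.mul_apply, Fin.sum_univ_two]
    · simp [Matrix.mul_apply, Fin.sum_univ_two, h1]

/-- The one-loop supercharge `𝒬` of the level `k` theory. -/
def Q (N k : ℕ) : Alg N →ₗ[ℂ] Alg N where
  toFun X := QHom N k X 0 1
  map_add' X Y := by simp
  map_smul' c X := by simp

@[simp] theorem Q_gen {N k : ℕ} (x : Gen N) :
    Q N k (gen x) = Qmat N k x.1.kind x.1.der x.1.idx x.2.1 x.2.2 := by
  simp [Q, QHom]

theorem QHom_diag {N k : ℕ} (X : Alg N) :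
    QHom N k X 0 0 = parity N X ∧ QHom N k X 1 1 = X ∧ QHom N k X 1 0 = 0 := by
  obtain ⟨Y, rfl⟩ := proj_surjective N X
  induction Y using FreeAlgebra.induction with
  | grade0 r =>
    rw [AlgHom.commutes, AlgHom.commutes, AlgHom.commutes]
    simp [Matrix.algebraMap_matrix_apply]
  | grade1 x =>
    change QHom N k (gen x) 0 0 = parity N (gen x) ∧ QHom N k (gen x) 1 1 = gen x ∧
      QHom N k (gen x) 1 0 = 0
    simp [QHom]
  | mul a b ha hb =>
    simp only [map_mul, Matrix.mul_apply, Fin.sum_univ_two]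
    simp [ha, hb]
  | add a b ha hb =>
    simp only [map_add, Matrix.add_apply]
    simp [ha, hb]

/-- The graded Leibniz rule. -/
theorem Q_mul {N k : ℕ} (X Y : Alg N) :
    Q N k (X * Y) = Q N k X * Y + parity N X * Q N k Y := by
  change QHom N k (X * Y) 0 1 = QHom N k X 0 1 * Y + parity N X * QHom N k Y 0 1
  rw [map_mul, Matrix.mul_apply, Fin.sum_univ_two, (QHom_diag X).1, (QHom_diag Y).2.1, add_comm]

theorem Q_algebraMap {N k : ℕ} (c : ℂ) : Q N k (algebraMap ℂ (Alg N) c) = 0 := by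
  change QHom N k (algebraMap ℂ (Alg N) c) 0 1 = 0
  rw [AlgHom.commutes]
  simp [Matrix.algebraMap_matrix_apply]

theorem parity_parity {N : ℕ} (X : Alg N) : parity N (parity N X) = X := by
  have h : (parity N).comp (parity N) = AlgHom.id ℂ (Alg N) := by
    apply algHom_ext
    intro x
    cases hx : x.1.kind.odd <;> simp [hx]
  exact DFunLike.congr_fun h X

theorem Q_parity {N k : ℕ} (X : Alg N) : Q N k (parity N X) = -parity N (Q N k X) := by
  obtain ⟨Y, rfl⟩ := proj_surjective N X
  induction Y using FreeAlgebra.induction with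
  | grade0 r => simp [Q_algebraMap]
  | grade1 x =>
    change Q N k (parity N (gen x)) = -parity N (Q N k (gen x))
    have h := (Qmat_parity N k x.1.kind x.1.der x.1.idx x.2.1 x.2.2).2
    rw [parity_gen, map_smul, Q_gen, h]
    cases x.1.kind.odd <;> simp
  | mul a b ha hb =>
    simp only [map_mul, Q_mul, map_add, parity_parity, ha, hb]
    noncomm_ring
  | add a b ha hb =>
    simp only [map_add, ha, hb, neg_add]

/-! ### The flavour symmetry -/

/-- `SL(2, ℂ)`, the complexification of `SU(2)`. -/
abbrev SL2 : Type := Matrix.SpecialLinearGroup (Fin 2) ℂ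

/-- The complexification of the flavour group `SU(2)_u × SU(2)_v`. -/
abbrev Flavor : Type := SL2 × SL2

/-- `A`, `ψ^A` are doublets of the first factor, `B`, `ψ^B` of the second one. -/
def Flavor.on (g : Flavor) : Kind → Matrix (Fin 2) (Fin 2) ℂ
  | .A => g.1
  | .B => g.2
  | .psiA => g.1
  | .psiB => g.2

/-- The action `X_i ↦ ∑_j g_{ji} X_j` of the flavour group on the letters and their products. -/
def flavorHom (N : ℕ) (g : Flavor) : Alg N →ₐ[ℂ] Alg N :=
  lift (fun x => ∑ j, g.on x.1.kind j x.1.idx • gen (⟨x.1.kind, x.1.der, j⟩, x.2)) fun x y => by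
    simp only [Fin.sum_univ_two, add_mul, mul_add, smul_mul_smul_comm, smul_add]
    simp only [gen_mul_gen (⟨x.1.kind, x.1.der, _⟩, x.2) (⟨y.1.kind, y.1.der, _⟩, y.2)]
    simp only [smul_smul, mul_comm]
    abel

@[simp] theorem flavorHom_gen {N : ℕ} (g : Flavor) (x : Gen N) : flavorHom N g (gen x) =
    ∑ j, g.on x.1.kind j x.1.idx • gen (⟨x.1.kind, x.1.der, j⟩, x.2) := by
  simp [flavorHom]

theorem flavorHom_one (N : ℕ) : flavorHom N 1 = AlgHom.id ℂ (Alg N) := by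
  apply algHom_ext
  rintro ⟨⟨t, n, i⟩, x⟩
  fin_cases i <;> cases t <;> simp [Fin.sum_univ_two, Flavor.on]

theorem flavorHom_mul (N : ℕ) (g h : Flavor) :
    flavorHom N (g * h) = (flavorHom N g).comp (flavorHom N h) := by
  apply algHom_ext
  rintro ⟨⟨t, n, i⟩, x⟩
  cases t <;> simp [Fin.sum_univ_two, Flavor.on, Matrix.mul_apply, add_smul, smul_smul,
    mul_comm] <;> abel

theorem flavorHom_parity {N : ℕ} (g : Flavor) (X : Alg N) :
    flavorHom N g (parity N X) = parity N (flavorHom N g X) := by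
  have h : (flavorHom N g).comp (parity N) = (parity N).comp (flavorHom N g) := by
    apply algHom_ext
    intro x
    cases hx : x.1.kind.odd <;> simp [hx, Fin.sum_univ_two]
    abel
  exact DFunLike.congr_fun h X

theorem flavorHom_der {N : ℕ} (g : Flavor) (X : Alg N) :
    flavorHom N g (der N X) = der N (flavorHom N g X) := by
  have h : (flavorHom N g).mapMatrix.comp (derHom N) = (derHom N).comp (flavorHom N g) := by
    apply algHom_ext
    intro x
    ext i j
    fin_cases i <;> fin_cases j <;> simp [derHom, Letter.D, Fin.sum_univ_two]
  exact congrFun (congrFun (DFunLike.congr_fun h X) 0) 1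

/-- The flavour action on matrices. -/
abbrev flavorMap (N : ℕ) (g : Flavor) :
    Matrix (Fin N) (Fin N) (Alg N) →ₐ[ℂ] Matrix (Fin N) (Fin N) (Alg N) :=
  (flavorHom N g).mapMatrix

theorem flavorMap_mat {N : ℕ} (g : Flavor) (l : Letter) : flavorMap N g (mat N l) =
    ∑ j, g.on l.kind j l.idx • mat N ⟨l.kind, l.der, j⟩ := by
  ext a b
  simp [mat, Fin.sum_univ_two]

theorem SL2.det_eq (g : SL2) : g 0 0 * g 1 1 - g 0 1 * g 1 0 = 1 := by
  have h := g.det_coe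
  rwa [Matrix.det_fin_two] at h

theorem flavorMap_conn {N : ℕ} (g : Flavor) : flavorMap N g (conn N) = conn N := by
  have h1 := SL2.det_eq g.1
  have h2 := SL2.det_eq g.2
  simp only [conn, map_add, map_sub, map_mul, flavorMap_mat, Fin.sum_univ_two, Flavor.on, add_mul,
    mul_add, smul_mul_smul_comm]
  match_scalars <;> simp <;> first
    | ring1
    | linear_combination h1
    | linear_combination -h1
    | linear_combination h2
    | linear_combination -h2

theorem flavorMap_connHat {N : ℕ} (g : Flavor) : flavorMap N g (connHat N) = connHat N := by
  have h1 := SL2.det_eq g.1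
  have h2 := SL2.det_eq g.2
  simp only [connHat, map_add, map_sub, map_mul, flavorMap_mat, Fin.sum_univ_two, Flavor.on,
    add_mul, mul_add, smul_mul_smul_comm]
  match_scalars <;> simp <;> first
    | ring1
    | linear_combination h1
    | linear_combination -h1
    | linear_combination h2
    | linear_combination -h2

theorem flavorMap_der {N : ℕ} (g : Flavor) (M : Matrix (Fin N) (Fin N) (Alg N)) :
    flavorMap N g (M.map (der N)) = (flavorMap N g M).map (der N) := by
  ext a b
  simp [flavorHom_der]

theorem flavorMap_Qmat {N k : ℕ} (g : Flavor) (t : Kind) (n : ℕ) (i : Fin 2) :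
    flavorMap N g (Qmat N k t n i) = ∑ j, g.on t j i • Qmat N k t n j := by
  have h1 := SL2.det_eq g.1
  have h2 := SL2.det_eq g.2
  induction n with
  | zero =>
    cases t
    · simp [Qmat]
    · simp [Qmat]
    · simp only [Qmat, map_smul, map_add, map_mul, flavorMap_mat, Fin.sum_univ_two, Flavor.on,
        add_mul, mul_add, smul_mul_smul_comm, eps]
      match_scalars <;> simp <;> first
        | ring1
        | (right; ring1)
        | linear_combination (4 * Real.pi * Complex.I / k * g.1 0 i) * h2
        | linear_combination (4 * Real.pi * Complex.I / k * g.1 1 i) * h2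
        | linear_combination -(4 * Real.pi * Complex.I / k * g.1 0 i) * h2
        | linear_combination -(4 * Real.pi * Complex.I / k * g.1 1 i) * h2
    · simp only [Qmat, map_smul, map_add, map_mul, flavorMap_mat, Fin.sum_univ_two, Flavor.on,
        add_mul, mul_add, smul_mul_smul_comm, eps]
      match_scalars <;> simp <;> first
        | ring1
        | (right; ring1)
        | linear_combination (4 * Real.pi * Complex.I / k * g.2 0 i) * h1
        | linear_combination (4 * Real.pi * Complex.I / k * g.2 1 i) * h1
  | succ n ih =>
    have hd : ∀ (c d : ℂ) (M M' : Matrix (Fin N) (Fin N) (Alg N)),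
        (c • M + d • M').map (der N) = c • M.map (der N) + d • M'.map (der N) := fun c d M M' => by
      ext a b
      simp
    cases t <;>
      (simp only [Qmat, map_add, map_sub, map_smul, map_mul, flavorMap_der, ih, flavorMap_conn,
        flavorMap_connHat, flavorMap_mat, Fin.sum_univ_two, hd, add_mul, mul_add, smul_mul_assoc,
        mul_smul_comm]
       module)

theorem flavorHom_Q {N k : ℕ} (g : Flavor) (X : Alg N) :
    flavorHom N g (Q N k X) = Q N k (flavorHom N g X) := by
  have h : (flavorHom N g).mapMatrix.comp (QHom N k) = (QHom N k).comp (flavorHom N g) := by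
    apply algHom_ext
    intro x
    have h1 := congrFun (congrFun (flavorMap_Qmat (k := k) g x.1.kind x.1.der x.1.idx) x.2.1) x.2.2
    have h2 := flavorHom_parity g (gen x)
    simp only [AlgHom.mapMatrix_apply, Matrix.map_apply, Fin.sum_univ_two, Matrix.add_apply,
      Matrix.smul_apply] at h1
    ext i j
    fin_cases i <;> fin_cases j <;>
      simp [QHom, Fin.sum_univ_two, h1]
    simpa [Fin.sum_univ_two] using h2
  exact congrFun (congrFun (DFunLike.congr_fun h X) 0) 1

/-! ### Gauge-invariant operators -/

/-- A word can be traced if bifundamental and anti-bifundamental letters alternate cyclically. -/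
def GaugeWord (w : List Letter) : Prop :=
  w ≠ [] ∧ Even w.length ∧ w.IsChain fun l l' => l.kind.bif ≠ l'.kind.bif

/-- Twice the charge `𝒟 + J₃` of a word. -/
def wordCharge2 (w : List Letter) : ℕ := (w.map Letter.charge2).sum

/-- Formal multi-trace expressions, whose generators are formal traces of words; they make sense
for every rank `N`. -/
abbrev Formal : Type := FreeAlgebra ℂ (List Letter)

/-- The formal trace of a word. -/
def tr (w : List Letter) : Formal := FreeAlgebra.ι ℂ w

/-- The evaluation of formal multi-trace expressions on `N × N` matrices. -/
def ev (N : ℕ) : Formal →ₐ[ℂ] Alg N :=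
  FreeAlgebra.lift ℂ fun w => ((w.map (mat N)).prod).trace

/-- Formal multi-trace operators at order `x^d`. -/
def formalOps (d : ℕ) : Submodule ℂ Formal :=
  Submodule.span ℂ {T | ∃ L : List (List Letter), (∀ w ∈ L, GaugeWord w) ∧
    (L.map wordCharge2).sum = 2 * d ∧ T = (L.map tr).prod}

/-- The gauge-invariant operators of the rank `N` theory at order `x^d`; all trace relations of
`N × N` matrices hold here. -/
def ops (N d : ℕ) : Submodule ℂ (Alg N) := (formalOps d).map (ev N).toLinearMap

/-- The data of a letter that the flavour group preserves. -/
def Letter.shape (l : Letter) : Kind × ℕ := (l.kind, l.der)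

theorem gaugeWord_of_shape {w w' : List Letter} (h : w'.map Letter.shape = w.map Letter.shape)
    (hw : GaugeWord w) : GaugeWord w' := by
  have hl : w'.length = w.length := by simpa using congrArg List.length h
  obtain ⟨h1, h2, h3⟩ := hw
  refine ⟨?_, hl ▸ h2, ?_⟩
  · rintro rfl
    exact h1 (List.length_eq_zero_iff.1 hl.symm)
  · have e : ∀ v : List Letter, (v.IsChain fun l l' => l.kind.bif ≠ l'.kind.bif) ↔
        (v.map Letter.shape).IsChain fun l l' => l.1.bif ≠ l'.1.bif := fun v => by
      rw [List.isChain_map]; rfl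
    rw [e, h, ← e]
    exact h3

theorem wordCharge2_of_shape {w w' : List Letter}
    (h : w'.map Letter.shape = w.map Letter.shape) : wordCharge2 w' = wordCharge2 w := by
  have e : ∀ v : List Letter, wordCharge2 v =
      ((v.map Letter.shape).map fun p => (if p.1.odd then 3 else 1) + 4 * p.2).sum := fun v => by
    rw [List.map_map]; rfl
  rw [e, h, ← e]

theorem flavor_word (N : ℕ) (g : Flavor) (w : List Letter) :
    flavorMap N g (w.map (mat N)).prod ∈ Submodule.span ℂ
      {M | ∃ w' : List Letter, w'.map Letter.shape = w.map Letter.shape ∧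
        M = (w'.map (mat N)).prod} := by
  induction w with
  | nil =>
    refine Submodule.subset_span ⟨[], rfl, ?_⟩
    simp only [List.map_nil, List.prod_nil, map_one]
  | cons l w ih =>
    have e : ((l :: w).map (mat N)).prod = mat N l * (w.map (mat N)).prod := by simp
    rw [e, map_mul, flavorMap_mat, Finset.sum_mul]
    refine Submodule.sum_mem _ fun j _ => ?_
    rw [smul_mul_assoc]
    refine Submodule.smul_mem _ _ ?_
    refine Submodule.span_induction (p := fun M _ => mat N ⟨l.kind, l.der, j⟩ * M ∈
      Submodule.span ℂ {M | ∃ w' : List Letter, w'.map Letter.shape = (l :: w).map Letter.shape ∧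
        M = (w'.map (mat N)).prod}) ?_ ?_ ?_ ?_ ih
    · rintro _ ⟨w', hw', rfl⟩
      exact Submodule.subset_span ⟨⟨l.kind, l.der, j⟩ :: w', by simp [hw', Letter.shape], by simp⟩
    · rw [mul_zero]; exact Submodule.zero_mem _
    · intro a b _ _ ha hb
      rw [mul_add]; exact Submodule.add_mem _ ha hb
    · intro c a _ ha
      rw [mul_smul_comm]; exact Submodule.smul_mem _ _ ha

theorem flavor_tr (N : ℕ) (g : Flavor) (w : List Letter) :
    flavorHom N g (ev N (tr w)) ∈ Submodule.span ℂ
      {X | ∃ w' : List Letter, w'.map Letter.shape = w.map Letter.shape ∧ X = ev N (tr w')} := by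
  have h := Submodule.mem_map_of_mem (f := Matrix.traceLinearMap (Fin N) ℂ (Alg N))
    (flavor_word N g w)
  rw [Submodule.map_span] at h
  have e : Matrix.traceLinearMap (Fin N) ℂ (Alg N) (flavorMap N g (w.map (mat N)).prod) =
      flavorHom N g (ev N (tr w)) := by
    simp [ev, tr, Matrix.trace, map_sum]
  rw [e] at h
  refine Submodule.span_mono ?_ h
  rintro _ ⟨_, ⟨w', hw', rfl⟩, rfl⟩
  exact ⟨w', hw', by simp [ev, tr]⟩

theorem flavor_multi (N : ℕ) (g : Flavor) (L : List (List Letter)) :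
    flavorHom N g (ev N (L.map tr).prod) ∈ Submodule.span ℂ
      {X | ∃ L' : List (List Letter), L'.map (List.map Letter.shape) =
        L.map (List.map Letter.shape) ∧ X = ev N (L'.map tr).prod} := by
  induction L with
  | nil =>
    refine Submodule.subset_span ⟨[], rfl, ?_⟩
    simp only [List.map_nil, List.prod_nil, map_one]
  | cons w L ih =>
    have e : ((w :: L).map tr).prod = tr w * (L.map tr).prod := by simp
    rw [e, map_mul, map_mul]
    have h := Submodule.mul_mem_mul (flavor_tr N g w) ih
    rw [Submodule.span_mul_span] at h
    refine Submodule.span_mono ?_ h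
    rintro _ ⟨_, ⟨w', hw', rfl⟩, _, ⟨L', hL', rfl⟩, rfl⟩
    exact ⟨w' :: L', by simp [hw', hL'], by simp⟩

theorem flavorHom_mem_ops {N d : ℕ} (g : Flavor) {X : Alg N} (hX : X ∈ ops N d) :
    flavorHom N g X ∈ ops N d := by
  obtain ⟨T, hT, rfl⟩ := hX
  refine Submodule.span_induction (p := fun T _ => flavorHom N g (ev N T) ∈ ops N d)
    ?_ ?_ ?_ ?_ hT
  · rintro _ ⟨L, hL, hd, rfl⟩
    refine Submodule.span_le.2 ?_ (flavor_multi N g L)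
    rintro _ ⟨L', hL', rfl⟩
    refine Submodule.mem_map_of_mem (Submodule.subset_span ⟨L', ?_, ?_, rfl⟩)
    · intro w' hw'
      have h : w'.map Letter.shape ∈ L.map (List.map Letter.shape) := by
        rw [← hL']; exact List.mem_map_of_mem hw'
      obtain ⟨w, hw, hww⟩ := List.mem_map.1 h
      exact gaugeWord_of_shape hww.symm (hL w hw)
    · have e : ∀ K : List (List Letter), (K.map wordCharge2).sum = ((K.map (List.map
          Letter.shape)).map fun v =>
            (v.map fun p => (if p.1.odd then 3 else 1) + 4 * p.2).sum).sum := fun K => by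
        rw [List.map_map]
        congr 1
        refine List.map_congr_left fun w _ => ?_
        rw [Function.comp, List.map_map]; rfl
      rw [e, hL', ← e, hd]
  · simp
  · intro a b _ _ ha hb
    rw [map_add, map_add]; exact Submodule.add_mem _ ha hb
  · intro c a _ ha
    rw [map_smul, map_smul]; exact Submodule.smul_mem _ _ ha

theorem parity_word (N : ℕ) (w : List Letter) : ∃ p : Bool, MatParity p (w.map (mat N)).prod := by
  induction w with
  | nil =>
    refine ⟨false, fun a b => ⟨fun x => ?_, ?_⟩⟩ <;> by_cases h : a = b <;>
      simp [h, sgn]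
  | cons l w ih =>
    obtain ⟨p, hp⟩ := ih
    exact ⟨_, (MatParity.mat l).mul hp⟩

theorem parity_multi (N : ℕ) (L : List (List Letter)) :
    ∃ p : Bool, HasParity p (ev N (L.map tr).prod) := by
  induction L with
  | nil => exact ⟨false, fun x => by simp [sgn], by simp⟩
  | cons w L ih =>
    obtain ⟨q, hq⟩ := ih
    obtain ⟨p, hp⟩ := parity_word N w
    refine ⟨xor p q, ?_⟩
    rw [List.map_cons, List.prod_cons, map_mul]
    refine HasParity.mul ?_ hq
    simp only [ev, tr, FreeAlgebra.lift_ι_apply, Matrix.trace, Matrix.diag]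
    exact HasParity.sum _ _ fun i _ => hp i i

theorem parity_mem_ops {N d : ℕ} {X : Alg N} (hX : X ∈ ops N d) : parity N X ∈ ops N d := by
  obtain ⟨T, hT, rfl⟩ := hX
  refine Submodule.span_induction (p := fun T _ => parity N (ev N T) ∈ ops N d) ?_ ?_ ?_ ?_ hT
  · rintro _ ⟨L, hL, hd, rfl⟩
    obtain ⟨p, hp⟩ := parity_multi N L
    rw [hp.2]
    exact Submodule.smul_mem _ _ (Submodule.mem_map_of_mem
      (Submodule.subset_span ⟨L, hL, hd, rfl⟩))
  · simp
  · intro a b _ _ ha hb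
    rw [map_add, map_add]; exact Submodule.add_mem _ ha hb
  · intro c a _ ha
    rw [map_smul, map_smul]; exact Submodule.smul_mem _ _ ha

/-! ### The `𝒬`-cohomology -/

/-- `𝒬`-closed gauge-invariant operators at order `x^d`. -/
def closed (N k d : ℕ) : Submodule ℂ (Alg N) := ops N d ⊓ LinearMap.ker (Q N k)

/-- `𝒬`-exact operators at order `x^d`. -/
def exact (N k d : ℕ) : Submodule ℂ (Alg N) := (ops N d).map (Q N k)

/-- The `𝒬`-cohomology of gauge-invariant operators at order `x^d`. -/
abbrev Coh (N k d : ℕ) : Type := closed N k d ⧸ (exact N k d).submoduleOf (closed N k d)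

theorem flavorHom_mem_closed {N k d : ℕ} (g : Flavor) {X : Alg N} (hX : X ∈ closed N k d) :
    flavorHom N g X ∈ closed N k d := by
  refine ⟨flavorHom_mem_ops g hX.1, ?_⟩
  change Q N k (flavorHom N g X) = 0
  rw [← flavorHom_Q, LinearMap.mem_ker.1 hX.2, map_zero]

theorem flavorHom_mem_exact {N k d : ℕ} (g : Flavor) {X : Alg N} (hX : X ∈ exact N k d) :
    flavorHom N g X ∈ exact N k d := by
  obtain ⟨Y, hY, rfl⟩ := hX
  exact ⟨flavorHom N g Y, flavorHom_mem_ops g hY, (flavorHom_Q g Y).symm⟩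

theorem parity_mem_closed {N k d : ℕ} {X : Alg N} (hX : X ∈ closed N k d) :
    parity N X ∈ closed N k d := by
  refine ⟨parity_mem_ops hX.1, ?_⟩
  change Q N k (parity N X) = 0
  rw [Q_parity, LinearMap.mem_ker.1 hX.2, map_zero, neg_zero]

theorem parity_mem_exact {N k d : ℕ} {X : Alg N} (hX : X ∈ exact N k d) :
    parity N X ∈ exact N k d := by
  obtain ⟨Y, hY, rfl⟩ := hX
  refine ⟨-parity N Y, Submodule.neg_mem _ (parity_mem_ops hY), ?_⟩
  rw [map_neg, Q_parity, neg_neg]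

/-- The flavour representation on the cohomology. -/
def flavorRep (N k d : ℕ) : Representation ℂ Flavor (Coh N k d) where
  toFun g := Submodule.mapQ _ _
    ((flavorHom N g).toLinearMap.restrict fun _ hX => flavorHom_mem_closed g hX)
    fun _ hX => flavorHom_mem_exact g hX
  map_one' := by
    ext X
    simp [LinearMap.restrict_apply, flavorHom_one]
  map_mul' g h := by
    ext X
    simp [LinearMap.restrict_apply, flavorHom_mul]
    rfl

/-- `(-1)^F` on the cohomology. -/
def parityCoh (N k d : ℕ) : Coh N k d →ₗ[ℂ] Coh N k d :=
  Submodule.mapQ _ _ ((parity N).toLinearMap.restrict fun _ hX => parity_mem_closed hX)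
    fun _ hX => parity_mem_exact hX

/-- The cohomology classes represented by the closed operators in `W`. -/
def classes {N : ℕ} (k d : ℕ) (W : Submodule ℂ (Alg N)) : Submodule ℂ (Coh N k d) :=
  (W.submoduleOf (closed N k d)).map (Submodule.mkQ _)

/-- Formal operators at order `x^d` that are `𝒬`-closed for every rank. -/
def monotone (k d : ℕ) : Submodule ℂ Formal :=
  formalOps d ⊓ ⨅ N : ℕ, LinearMap.ker (Q N k ∘ₗ (ev N).toLinearMap)

/-- The monotone (multi-graviton) part of the rank `N` cohomology. -/
def gravitons (N k d : ℕ) : Submodule ℂ (Coh N k d) :=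
  classes k d ((monotone k d).map (ev N).toLinearMap)

/-! ### Irreducible representations and characters -/

/-- The space of homogeneous polynomials of degree `n - 1` in two variables. -/
abbrev V (n : ℕ) : Type := MvPolynomial.homogeneousSubmodule (Fin 2) ℂ (n - 1)

/-- The substitution `X_i ↦ ∑_j g_{ji} X_j`. -/
def subst (g : SL2) : MvPolynomial (Fin 2) ℂ →ₐ[ℂ] MvPolynomial (Fin 2) ℂ :=
  MvPolynomial.aeval fun i => ∑ j, g j i • MvPolynomial.X j

theorem subst_mem (g : SL2) {n : ℕ} {P : MvPolynomial (Fin 2) ℂ}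
    (hP : P ∈ MvPolynomial.homogeneousSubmodule (Fin 2) ℂ n) :
    subst g P ∈ MvPolynomial.homogeneousSubmodule (Fin 2) ℂ n := by
  have h := MvPolynomial.IsHomogeneous.aeval (n := 1) hP
    (fun i => ∑ j, g j i • (MvPolynomial.X j : MvPolynomial (Fin 2) ℂ)) fun i => by
      refine MvPolynomial.IsHomogeneous.sum _ _ _ fun j _ => ?_
      rw [← MvPolynomial.mem_homogeneousSubmodule]
      exact Submodule.smul_mem _ _ (MvPolynomial.isHomogeneous_X _ _)
  rwa [one_mul] at h

/-- The irreducible representation of dimension `n` (for `n ≥ 1`). -/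
def irrep (n : ℕ) : Representation ℂ SL2 (V n) where
  toFun g := (subst g).toLinearMap.restrict fun _ hP => subst_mem g hP
  map_one' := by
    have h : subst 1 = AlgHom.id ℂ _ := by
      apply MvPolynomial.algHom_ext
      intro i
      fin_cases i <;> simp [subst, Fin.sum_univ_two]
    ext P
    simp [LinearMap.restrict_apply, h]
  map_mul' g g' := by
    have h : subst (g * g') = (subst g).comp (subst g') := by
      apply MvPolynomial.algHom_ext
      intro i
      simp [subst, Fin.sum_univ_two, Matrix.mul_apply, add_smul, smul_smul, mul_comm]
      abel
    ext P
    simp [LinearMap.restrict_apply, h]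
    rfl

/-- The irreducible representation `(m, n)` of the flavour group, of dimension `m n`. -/
def irrepTensor (m n : ℕ) : Representation ℂ Flavor (V m ⊗[ℂ] V n) :=
  Representation.tprod ((irrep m).comp (MonoidHom.fst SL2 SL2))
    ((irrep n).comp (MonoidHom.snd SL2 SL2))

/-- The character `w^(n-1) + w^(n-3) + ⋯ + w^(1-n)` of the `n`-dimensional representation. -/
def chi (n : ℕ) (w : ℂˣ) : ℂ := ∑ j ∈ Finset.range n, (w : ℂ) ^ ((n : ℤ) - 1 - 2 * j)

/-- The Cartan element with eigenvalue `w⁻¹` on the first and `w` on the second member of a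
doublet. -/
def cartan (w : ℂˣ) : SL2 := ⟨!![(w : ℂ)⁻¹, 0; 0, (w : ℂ)], by simp [Matrix.det_fin_two]⟩

/-- The operator `(-1)^F u^(q₁-q₂) v^(q₁+q₂)` on the cohomology at order `x^d`. -/
def indexOp (N k d : ℕ) (u v : ℂˣ) : Coh N k d →ₗ[ℂ] Coh N k d :=
  parityCoh N k d ∘ₗ flavorRep N k d (cartan u, cartan v)

open scoped Classical in
/-- The trace of `(-1)^F u^(q₁-q₂) v^(q₁+q₂)` over a flavour-stable and parity-stable space of
classes (and `0` for a space that is not stable). -/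
def superTrace {N k d : ℕ} (W : Submodule ℂ (Coh N k d)) (u v : ℂˣ) : ℂ :=
  if h : ∀ X ∈ W, indexOp N k d u v X ∈ W then
    LinearMap.trace ℂ W ((indexOp N k d u v).restrict h) else 0

/-! ### The superconformal index in the zero-flux sector, with `s = x^(1/2)` -/

/-- The contribution of a chiral multiplet. -/
def chiral (s z : ℂ) : ℂ := ∏' n : ℕ, (1 - s ^ (3 + 4 * n) * z⁻¹) / (1 - s ^ (1 + 4 * n) * z)

/-- The contribution of a vector multiplet. -/
def vec {N : ℕ} (z : Fin N → ℂ) : ℂ :=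
  ∏ i, ∏ j ∈ Finset.Ioi i, (1 - z i / z j) * (1 - z j / z i)

/-- The matrix integral over the unit tori for the zero-flux index of the
`U(N)_k × U(N)_{-k}` theory. -/
def zeroFluxIndex (N : ℕ) (s : ℂ) (u v : ℂˣ) : ℂ :=
  ((N.factorial : ℂ) ^ 2)⁻¹ * ((2 * Real.pi * Complex.I) ^ N)⁻¹ ^ 2 *
    torusIntegral (fun z : Fin N → ℂ => torusIntegral (fun w : Fin N → ℂ =>
      (∏ i, z i)⁻¹ * (∏ j, w j)⁻¹ * vec z * vec w * ∏ i, ∏ j,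
        (chiral s ((u : ℂ)⁻¹ * z i / w j) * chiral s ((u : ℂ) * z i / w j) *
          chiral s ((v : ℂ)⁻¹ * w j / z i) * chiral s ((v : ℂ) * w j / z i))) 0 1) 0 1

/-! ### The table of operators -/

/-- The letters without derivatives, and the once-derived scalars. -/
def lA (i : Fin 2) : Letter := ⟨.A, 0, i⟩
def lB (i : Fin 2) : Letter := ⟨.B, 0, i⟩
def lPsiA (i : Fin 2) : Letter := ⟨.psiA, 0, i⟩
def lPsiB (i : Fin 2) : Letter := ⟨.psiB, 0, i⟩
def lDA (i : Fin 2) : Letter := (lA i).D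
def lDB (i : Fin 2) : Letter := (lB i).D

def delta (i j : Fin 2) : ℂ := if i = j then 1 else 0

/-- The symmetriser of two indices. -/
def sym2 (i j p q : Fin 2) : ℂ := (delta i p * delta j q + delta i q * delta j p) / 2

/-- The symmetriser of three indices. -/
def sym3 (i j k p q r : Fin 2) : ℂ :=
  (delta i p * delta j q * delta k r + delta i q * delta j r * delta k p +
    delta i r * delta j p * delta k q + delta i r * delta j q * delta k p +
    delta i q * delta j p * delta k r + delta i p * delta j r * delta k q) / 6

/-- The multiplets of cohomology classes up to order `x^3`.  The names display the traces, followed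
by the flavour representation; `unit` is the identity operator and `fortuitous` is the multiplet
of the operators `𝒪_f`. -/
inductive Multiplet
  | unit
  | AB
  | ABAB_33
  | AB_AB_33
  | AB_AB_11
  | psiAA_31
  | psiBB_13
  | current_11
  | AB_ABAB_44
  | AB_ABAB_42
  | AB_ABAB_24
  | AB_AB_AB_44
  | AB_AB_AB_22
  | DAB_22
  | ADB_22
  | psiABA_42
  | psiBAB_24
  | psiYYY_22
  | current_AB_22
  | psiAA_AB_42
  | psiBB_AB_24
  | psiAA_AB_22
  | psiBB_AB_22
  | fortuitous

namespace Multiplet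

/-- The order in `x`. -/
def order : Multiplet → ℕ
  | unit => 0
  | AB => 1
  | ABAB_33 | AB_AB_33 | AB_AB_11 | psiAA_31 | psiBB_13 | current_11 => 2
  | _ => 3

/-- `true` for fermionic multiplets. -/
def odd : Multiplet → Bool
  | psiAA_31 | psiBB_13 | current_11 => true
  | psiABA_42 | psiBAB_24 | psiYYY_22 => true
  | current_AB_22 | psiAA_AB_42 | psiBB_AB_24 | psiAA_AB_22 | psiBB_AB_22 => true
  | fortuitous => true
  | _ => false

/-- The dimension of the `SU(2)_u` representation. -/
def dimU : Multiplet → ℕ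
  | unit | AB_AB_11 | psiBB_13 | current_11 => 1
  | ABAB_33 | AB_AB_33 | psiAA_31 => 3
  | AB_ABAB_44 | AB_ABAB_42 | AB_AB_AB_44 | psiABA_42 | psiAA_AB_42 => 4
  | _ => 2

/-- The dimension of the `SU(2)_v` representation. -/
def dimV : Multiplet → ℕ
  | unit | AB_AB_11 | psiAA_31 | current_11 => 1
  | ABAB_33 | AB_AB_33 | psiBB_13 => 3
  | AB_ABAB_44 | AB_ABAB_24 | AB_AB_AB_44 | psiBAB_24 | psiBB_AB_24 => 4
  | _ => 2

/-- The representatives of a multiplet: all components of a tensor of multi-trace operators. -/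
def reps : Multiplet → Set Formal
  | unit => {1}
  | AB => {T | ∃ i p, T = tr [lA i, lB p]}
  | ABAB_33 => {T | ∃ k l r s, T = ∑ i, ∑ j, ∑ p, ∑ q,
      (sym2 i j k l * sym2 p q r s) • tr [lA i, lB p, lA j, lB q]}
  | AB_AB_33 => {T | ∃ k l r s, T = ∑ i, ∑ j, ∑ p, ∑ q,
      (sym2 i j k l * sym2 p q r s) • (tr [lA i, lB p] * tr [lA j, lB q])}
  | AB_AB_11 => {∑ i, ∑ j, ∑ p, ∑ q,
      (eps i j * eps p q) • (tr [lA i, lB p] * tr [lA j, lB q])}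
  | psiAA_31 => {T | ∃ k l, T = ∑ i, ∑ j, sym2 i j k l • tr [lA i, lPsiA j]}
  | psiBB_13 => {T | ∃ r s, T = ∑ p, ∑ q, sym2 p q r s • tr [lB p, lPsiB q]}
  | current_11 => {∑ i, ∑ j, eps i j • (tr [lA i, lPsiA j] - tr [lB i, lPsiB j])}
  | AB_ABAB_44 => {T | ∃ l m n s t u, T = ∑ i, ∑ j, ∑ k, ∑ p, ∑ q, ∑ r,
      (sym3 i j k l m n * sym3 p q r s t u) •
        (tr [lA i, lB p] * tr [lA j, lB q, lA k, lB r])}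
  | AB_ABAB_42 => {T | ∃ l m n p, T = ∑ i, ∑ j, ∑ k, ∑ q, ∑ r,
      (sym3 i j k l m n * eps q r) • (tr [lA i, lB p, lA j, lB q] * tr [lA k, lB r])}
  | AB_ABAB_24 => {T | ∃ s t u i, T = ∑ j, ∑ k, ∑ p, ∑ q, ∑ r,
      (sym3 p q r s t u * eps j k) • (tr [lA i, lB p, lA j, lB q] * tr [lA k, lB r])}
  | AB_AB_AB_44 => {T | ∃ l m n s t u, T = ∑ i, ∑ j, ∑ k, ∑ p, ∑ q, ∑ r,
      (sym3 i j k l m n * sym3 p q r s t u) •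
        (tr [lA i, lB p] * tr [lA j, lB q] * tr [lA k, lB r])}
  | AB_AB_AB_22 => {T | ∃ k r, T = ∑ i, ∑ j, ∑ p, ∑ q,
      (eps i j * eps p q) • (tr [lA i, lB p] * tr [lA j, lB q] * tr [lA k, lB r])}
  | DAB_22 => {T | ∃ i p, T = tr [lDA i, lB p] + tr [lA i, lDB p]}
  | ADB_22 => {T | ∃ i p, T = Complex.I • tr [lB p, lDA i] + tr [lPsiA i, lPsiB p]}
  | psiABA_42 => {T | ∃ l m n p, T = ∑ i, ∑ j, ∑ k,
      sym3 i j k l m n • tr [lPsiA i, lA j, lB p, lA k]}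
  | psiBAB_24 => {T | ∃ s t u i, T = ∑ p, ∑ q, ∑ r,
      sym3 p q r s t u • tr [lPsiB p, lB q, lA i, lB r]}
  | psiYYY_22 => {T | ∃ p q, T = ∑ i, ∑ j, eps i j • (tr [lPsiA i, lA j, lB q, lA p] -
      tr [lPsiB i, lB j, lA p, lB q] + tr [lPsiA p, lA i, lB q, lA j])}
  | current_AB_22 => {T | ∃ k l, T = ∑ i, ∑ j,
      eps i j • ((tr [lA i, lPsiA j] - tr [lB i, lPsiB j]) * tr [lA k, lB l])}
  | psiAA_AB_42 => {T | ∃ l m n p, T = ∑ i, ∑ j, ∑ k,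
      sym3 i j k l m n • (tr [lPsiA i, lA j] * tr [lB p, lA k])}
  | psiBB_AB_24 => {T | ∃ s t u i, T = ∑ p, ∑ q, ∑ r,
      sym3 p q r s t u • (tr [lPsiB p, lB q] * tr [lA i, lB r])}
  | psiAA_AB_22 => {T | ∃ m p, T = ∑ i, ∑ j, ∑ l, ∑ k,
      (sym2 i j l m * eps l k) • (tr [lPsiA i, lA j] * tr [lA k, lB p])}
  | psiBB_AB_22 => {T | ∃ s i, T = ∑ p, ∑ q, ∑ t, ∑ r,
      (sym2 p q t s * eps t r) • (tr [lPsiB p, lB q] * tr [lB r, lA i])}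
  | fortuitous => {T | ∃ k l, T = ∑ i, ∑ j, eps i j •
      (tr [lPsiA i, lA j, lB k, lA l] + tr [lPsiB i, lB j, lA l, lB k] -
        (3 / 4 : ℂ) • (tr [lB k, lA l] * (tr [lPsiA i, lA j] + tr [lPsiB i, lB j])))}

/-- The classes of a multiplet in the cohomology of the `U(2)_k × U(2)_{-k}` theory. -/
def space (k d : ℕ) (m : Multiplet) : Submodule ℂ (Coh 2 k d) :=
  classes k d ((Submodule.span ℂ m.reps).map (ev 2).toLinearMap)

end Multiplet

end ABJM

end

open scoped TensorProduct Asymptotics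

noncomputable section

namespace ABJM

/-! ### Vector-valued polynomials -/

/-! Every letter has positive charge, so up to order $x^3$ only ten shapes of single traces occur,
and `Q` is explicit on them. Scalar traces are closed, a trace with one fermion goes to ε-contracted
scalar traces, and the traces with a derivative or with two fermions all go to multiples of one
fermionic operator, `E2`. The multi-gravitons are closed at every rank by cyclicity alone: an
ε-contraction is killed by symmetrisation or cancels between the $A$ and the $B$ half
(`Multiplet.Q_reps`).

The decisive order is $x^3$. With coefficients independent of $N$, an operator is a sum of scalars,
multi-gravitons, `E2` (exact), and four families `kap1`, `kap2`, `evFort`, `allP2`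
(`exists_decomposition`). Its variation is a combination of the even expressions `y1`, `y2`, `y3`
and of the odd `E2` (`Q_decomposition`), and parity separates the two kinds. At rank two `y3`
vanishes, as a linear consequence of the polarised Cayley-Hamilton identity of 2 × 2 matrices
(`trace_identity`, `y3_two_aux`); this is why $\mathcal O_f$ is closed there. The remaining `y1`,
`y2` and `E2` are independent (`coefficients_eq_zero_two`, `E2_coefficients_eq_zero`), and the same
trace identity makes every scalar operator a multi-graviton modulo exact ones (`S6_mem`,
`S4S2_mem`). So closed operators are exact ones, multi-gravitons and $\mathcal O_f$. From rank three
on, `y1`, `y2`, `y3` are independent (`coefficients_eq_zero_of_le`): $\mathcal O_f$ is no longer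
closed. As the coefficients of the decomposition do not depend on the rank, closure at rank three
also removes $\mathcal O_f$ from every monotone expression (`monotone3_mem`).

For independence, the image of `Q` vanishes on diagonal matrices (`diag_Q`), so evaluation there
descends to cohomology. Dual numbers as entries make fermions and derivatives visible, and a finite
list of evaluations separates the highest-weight classes of all multiplets, $\mathcal O_f$ included
(`coefficients_eq_zero`). Unipotent flavour elements extend this to all components
(`linearIndependent_of_highestWeight`). Covariance is checked on generating polynomials in auxiliary
vectors on which the flavour group acts (`Multiplet.flavorHom_poly`). The components are weight
vectors, so the graded characters are sums over multiplets (`superTrace_iSup`).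

For the index put $s = x^{1/2}$. Each chiral factor is a polynomial up to $O(s^8)$, uniformly on the
tori (`approx_chiral`). The truncated integrand is a product of a polynomial in the $z_i/w_j$ and
one in the $w_j/z_i$. The integral pairs only equal degrees $n$, and degree $n$ carries $s^{2n} =
x^n$ (`exists_pairing_evalAt`), so four degrees matter. Their coefficients are power sums, whose
$U(2)$ scalar products are the numbers `gram_000_000` to `gram_001_001`; `index_expansion` collects
the result. -/

theorem eq_zero_of_forall_sum_pow_smul {W : Type*} [AddCommGroup W] [Module ℂ W] (n : ℕ)
    (w : ℕ → W) (h : ∀ t : ℂ, ∑ a ∈ Finset.range n, t ^ a • w a = 0) :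
    ∀ a < n, w a = 0 := by
  intro a ha
  by_contra hne
  -- Functionals separate points, so a nonzero coefficient stays nonzero under some `f`, and the
  -- relation becomes a scalar polynomial vanishing on all of ℂ.
  obtain ⟨f, hf⟩ : ∃ f : Module.Dual ℂ W, f (w a) ≠ 0 := by
    by_contra hcon
    push Not at hcon
    exact hne ((Module.forall_dual_apply_eq_zero_iff ℂ _).1 hcon)
  let p : Polynomial ℂ := ∑ b ∈ Finset.range n, Polynomial.monomial b (f (w b))
  have hp : p = 0 := by
    apply Polynomial.funext
    intro t
    have := congrArg f (h t)
    simp only [map_sum, map_smul, map_zero, smul_eq_mul] at this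
    simp [p, Polynomial.eval_finsetSum, Polynomial.eval_monomial]
    rw [← this]
    exact Finset.sum_congr rfl fun b _ => mul_comm _ _
  apply hf
  have := congrArg (fun q => Polynomial.coeff q a) hp
  simpa [p, Polynomial.coeff_monomial, ha] using this

/-! ### A basis of the irreducible representations -/

/-- The exponent of the monomial `X₀^(n-1-a) X₁^a`. -/
def expo (n a : ℕ) : Fin 2 →₀ ℕ := Finsupp.single 0 (n - 1 - a) + Finsupp.single 1 a

theorem expo_injective (n : ℕ) {a b : ℕ} (h : expo n a = expo n b) : a = b := by
  have := DFunLike.congr_fun h 1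
  simpa [expo] using this

theorem expo_eq {n : ℕ} {s : Fin 2 →₀ ℕ} (hs : s 0 + s 1 = n - 1) : s = expo n (s 1) := by
  ext i
  fin_cases i
  · simp [expo]; omega
  · simp [expo]

/-- The monomial `X₀^(n-1-a) X₁^a` in the representation of dimension `n`. -/
def vmon (n : ℕ) (a : Fin n) : V n :=
  ⟨MvPolynomial.monomial (expo n a) 1, by
    rw [MvPolynomial.mem_homogeneousSubmodule]
    apply MvPolynomial.isHomogeneous_monomial
    have := a.2
    simp [expo, Finsupp.degree, Finset.sum_subset (Finset.subset_univ _), Fin.sum_univ_two]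
    omega⟩

/-- Coordinates on the representation of dimension `n`. -/
def vequiv (n : ℕ) (hn : 0 < n) : V n ≃ₗ[ℂ] (Fin n → ℂ) where
  toFun P a := MvPolynomial.coeff (expo n a) P.1
  map_add' P R := by ext; simp
  map_smul' c P := by ext; simp
  invFun f := ∑ a, f a • vmon n a
  left_inv P := by
    ext s
    simp only [Submodule.coe_sum, Submodule.coe_smul, MvPolynomial.coeff_sum,
      MvPolynomial.coeff_smul, vmon, MvPolynomial.coeff_monomial, smul_eq_mul]
    by_cases hs : s 0 + s 1 = n - 1
    · have hlt : s 1 < n := by omega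
      rw [Finset.sum_eq_single ⟨s 1, hlt⟩]
      · rw [← expo_eq hs]; simp
      · intro b _ hb
        rw [if_neg]; · simp
        intro he
        apply hb
        ext
        have := DFunLike.congr_fun he 1
        simpa [expo] using this
      · simp
    · rw [Finset.sum_eq_zero]
      · symm
        have hP := P.2
        rw [MvPolynomial.mem_homogeneousSubmodule] at hP
        apply hP.coeff_eq_zero
        rwa [Finsupp.degree_eq_sum, Fin.sum_univ_two]
      · intro b _
        rw [if_neg]; · simp
        rintro rfl
        apply hs
        have := b.2
        simp [expo]; omega
  right_inv f := by
    ext a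
    simp only [Submodule.coe_sum, Submodule.coe_smul, MvPolynomial.coeff_sum,
      MvPolynomial.coeff_smul, vmon, MvPolynomial.coeff_monomial, smul_eq_mul]
    rw [Finset.sum_eq_single a]
    · simp
    · intro b _ hb
      rw [if_neg]; · simp
      intro he
      exact hb (Fin.ext (expo_injective n he))
    · simp

/-- The monomial basis of the representation of dimension `n`. -/
def vbasis (n : ℕ) (hn : 0 < n) : Module.Basis (Fin n) ℂ (V n) := Module.Basis.ofEquivFun (vequiv n hn)

theorem vbasis_apply (n : ℕ) (hn : 0 < n) (a : Fin n) : vbasis n hn a = vmon n a := by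
  rw [vbasis, Module.Basis.coe_ofEquivFun]
  change ∑ b, (Pi.single a 1 : Fin n → ℂ) b • vmon n b = vmon n a
  simp [Pi.single_apply]

/-- The `(n-1)`-st power of a linear form. -/
def vpow (n : ℕ) (x : Fin 2 → ℂ) : V n :=
  ⟨(∑ i, x i • MvPolynomial.X i) ^ (n - 1), by
    rw [MvPolynomial.mem_homogeneousSubmodule]
    have h : MvPolynomial.IsHomogeneous (∑ i, x i • (MvPolynomial.X i : MvPolynomial (Fin 2) ℂ)) 1 :=
      MvPolynomial.IsHomogeneous.sum _ _ _ fun j _ => by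
        rw [← MvPolynomial.mem_homogeneousSubmodule]
        exact Submodule.smul_mem _ _ (MvPolynomial.isHomogeneous_X _ _)
    simpa using h.pow (n - 1)⟩

/-- The coefficient of the monomial `X₀^(n-1-a) X₁^a` in the power of a linear form. -/
def powCoeff (n a : ℕ) (x : Fin 2 → ℂ) : ℂ := ((n - 1).choose a : ℂ) * x 0 ^ (n - 1 - a) * x 1 ^ a

theorem vpow_eq (n : ℕ) (hn : 0 < n) (x : Fin 2 → ℂ) :
    vpow n x = ∑ a : Fin n, powCoeff n a x • vmon n a := by
  apply Subtype.ext
  simp only [vpow, Submodule.coe_sum, Submodule.coe_smul, vmon, Fin.sum_univ_two]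
  rw [add_comm, add_pow, Fin.sum_univ_eq_sum_range (fun a => powCoeff n a x •
    (MvPolynomial.monomial (expo n a) 1 : MvPolynomial (Fin 2) ℂ)) n, Nat.sub_add_cancel hn]
  refine Finset.sum_congr rfl fun a _ => ?_
  rw [expo, ← mul_one (1 : ℂ), ← MvPolynomial.monomial_mul, powCoeff]
  simp only [MvPolynomial.smul_eq_C_mul, mul_pow, MvPolynomial.X_pow_eq_monomial, map_mul, map_pow,
    map_natCast]
  ring

/-- On powers of linear forms the group acts by its defining matrix on the coefficient vector; this
turns equivariance into polynomial identities in `x`. -/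
theorem irrep_vpow (n : ℕ) (g : SL2) (x : Fin 2 → ℂ) :
    irrep n g (vpow n x) = vpow n (g.1.mulVec x) := by
  apply Subtype.ext
  change subst g ((∑ i, x i • MvPolynomial.X i) ^ (n - 1)) = _
  simp only [map_pow, map_add, map_smul, subst, MvPolynomial.aeval_X, vpow, Fin.sum_univ_two,
    Matrix.mulVec, dotProduct]
  congr 1
  simp only [smul_add, smul_smul, add_smul]
  module

/-- Along the curve $(1, t)$ the power is $\sum_a t^a \binom{n-1}{a}$ times the monomials. Modulo
the span it vanishes for all `t`, hence so does each coefficient, and the binomials are nonzero. -/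
theorem span_vpow (n : ℕ) (hn : 0 < n) : Submodule.span ℂ (Set.range (vpow n)) = ⊤ := by
  rw [eq_top_iff, ← (vbasis n hn).span_eq, Submodule.span_le]
  rintro _ ⟨a, rfl⟩
  rw [vbasis_apply]
  by_contra hcon
  let U := Submodule.span ℂ (Set.range (vpow n))
  have key := eq_zero_of_forall_sum_pow_smul n
    (fun a => if h : a < n then ((n - 1).choose a : ℂ) • U.mkQ (vmon n ⟨a, h⟩) else 0) (fun t => by
      have h1 : U.mkQ (vpow n ![1, t]) = 0 := by
        rw [Submodule.mkQ_apply, Submodule.Quotient.mk_eq_zero]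
        exact Submodule.subset_span ⟨_, rfl⟩
      rw [vpow_eq n hn, map_sum] at h1
      refine Eq.trans ?_ h1
      rw [← Fin.sum_univ_eq_sum_range (fun a => t ^ a • if h : a < n then
        ((n - 1).choose a : ℂ) • U.mkQ (vmon n ⟨a, h⟩) else 0) n]
      refine Finset.sum_congr rfl fun a _ => ?_
      rw [dif_pos a.2, map_smul, smul_smul]
      congr 1
      simp [powCoeff, mul_comm]) a a.2
  rw [dif_pos a.2] at key
  have hc : ((n - 1).choose a : ℂ) ≠ 0 := by
    have : 0 < (n - 1).choose a := Nat.choose_pos (by have := a.2; omega)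
    exact_mod_cast this.ne'
  have := (smul_eq_zero.1 key).resolve_left hc
  rw [Submodule.mkQ_apply, Submodule.Quotient.mk_eq_zero] at this
  exact hcon this

/-! ### Equivariant maps out of the irreducible representations -/

section Equivariant

variable {W : Type*} [AddCommGroup W] [Module ℂ W]

/-- The linear map that sends the products of monomials to a given family of vectors. -/
def tensorMap (m n : ℕ) (hm : 0 < m) (hn : 0 < n) (φ : ℕ → ℕ → W) : V m ⊗[ℂ] V n →ₗ[ℂ] W :=
  ((vbasis m hm).tensorProduct (vbasis n hn)).constr ℂ fun p => φ p.1 p.2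

theorem tensorMap_vmon {m n : ℕ} (hm : 0 < m) (hn : 0 < n) (φ : ℕ → ℕ → W) (a : Fin m)
    (b : Fin n) : tensorMap m n hm hn φ (vmon m a ⊗ₜ vmon n b) = φ a b := by
  rw [← vbasis_apply m hm, ← vbasis_apply n hn, ← Module.Basis.tensorProduct_apply, tensorMap,
    Module.Basis.constr_basis]

/-- The generating function of a family of vectors. -/
def genFun (m n : ℕ) (φ : ℕ → ℕ → W) (x y : Fin 2 → ℂ) : W :=
  ∑ a ∈ Finset.range m, ∑ b ∈ Finset.range n, (powCoeff m a x * powCoeff n b y) • φ a b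

theorem tensorMap_vpow {m n : ℕ} (hm : 0 < m) (hn : 0 < n) (φ : ℕ → ℕ → W) (x y : Fin 2 → ℂ) :
    tensorMap m n hm hn φ (vpow m x ⊗ₜ vpow n y) = genFun m n φ x y := by
  simp only [vpow_eq m hm, vpow_eq n hn, TensorProduct.sum_tmul, TensorProduct.tmul_sum, map_sum,
    TensorProduct.smul_tmul_smul, map_smul, tensorMap_vmon]
  rw [genFun, Finset.sum_range, Finset.sum_comm]
  refine Finset.sum_congr rfl fun a _ => ?_
  rw [Finset.sum_range]

/-- The family of vectors transforms in the representation `(m, n)`. -/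
def IsTensor (ρ : Representation ℂ Flavor W) (m n : ℕ) (φ : ℕ → ℕ → W) : Prop :=
  ∀ (g : Flavor) (x y : Fin 2 → ℂ),
    ρ g (genFun m n φ x y) = genFun m n φ (g.1.1.mulVec x) (g.2.1.mulVec y)

/-- Both sides are bilinear in the tensor factors, and powers of linear forms span each factor; on
products of powers the claim is the hypothesis `IsTensor`. -/
theorem IsTensor.tensorMap {ρ : Representation ℂ Flavor W} {m n : ℕ} {φ : ℕ → ℕ → W}
    (h : IsTensor ρ m n φ) (hm : 0 < m) (hn : 0 < n) (g : Flavor) (v : V m ⊗[ℂ] V n) :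
    ABJM.tensorMap m n hm hn φ (irrepTensor m n g v) = ρ g (ABJM.tensorMap m n hm hn φ v) := by
  induction v using TensorProduct.induction_on with
  | zero => simp
  | add v w hv hw => simp only [map_add, hv, hw]
  | tmul P R =>
    have hP : P ∈ Submodule.span ℂ (Set.range (vpow m)) := by rw [span_vpow m hm]; trivial
    have hR : R ∈ Submodule.span ℂ (Set.range (vpow n)) := by rw [span_vpow n hn]; trivial
    induction hP using Submodule.span_induction with
    | zero => simp
    | add P P' _ _ h1 h2 => simp only [TensorProduct.add_tmul, map_add, h1, h2]
    | smul c P _ h1 => simp only [← TensorProduct.smul_tmul', map_smul, h1]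
    | mem P hP =>
      obtain ⟨x, rfl⟩ := hP
      induction hR using Submodule.span_induction with
      | zero => simp
      | add P P' _ _ h1 h2 => simp only [TensorProduct.tmul_add, map_add, h1, h2]
      | smul c P _ h1 => simp only [TensorProduct.tmul_smul, map_smul, h1]
      | mem R hR =>
        obtain ⟨y, rfl⟩ := hR
        rw [tensorMap_vpow, h, ← tensorMap_vpow hm hn]
        congr 1
        simp [irrepTensor, irrep_vpow]

end Equivariant

/-! ### Highest-weight vectors -/

section HighestWeight

variable {W : Type*} [AddCommGroup W] [Module ℂ W]

/-- Chains of vectors that are generated by unipotent transformations are linearly independent as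
soon as their end points are. -/
theorem linearIndependent_chain {ι : Type*} [Fintype ι] (n : ι → ℕ) (hn : ∀ i, 0 < n i)
    (w : ι → ℕ → W) (U : ℂ → W →ₗ[ℂ] W)
    (hU : ∀ t i a, a < n i → U t (w i a) =
      ∑ c ∈ Finset.range (n i), ((a.choose c : ℂ) * t ^ (a - c)) • w i c)
    (h0 : LinearIndependent ℂ fun i => w i 0) :
    LinearIndependent ℂ fun p : Σ i, Fin (n i) => w p.1 p.2 := by
  classical
  rw [Fintype.linearIndependent_iff]
  intro c hc
  let C : ι → ℕ → ℂ := fun i a => if h : a < n i then c ⟨i, a, h⟩ else 0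
  have hCn : ∀ i a, n i ≤ a → C i a = 0 := fun i a h => dif_neg (by omega)
  let M := Finset.univ.sup n
  have hM : ∀ i, n i ≤ M := fun i => Finset.le_sup (Finset.mem_univ i)
  have rel : ∑ i, ∑ a ∈ Finset.range (n i), C i a • w i a = 0 := by
    rw [← hc, Fintype.sum_sigma]
    refine Finset.sum_congr rfl fun i _ => ?_
    rw [Finset.sum_range]
    refine Finset.sum_congr rfl fun a _ => ?_
    simp [C]
  -- Induction downwards on the position `N` in the chains: beyond `M` there is nothing, and once
  -- all coefficients above `N` vanish, those at `N` are read off from the top power of `t`.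
  have key : ∀ j N, M ≤ N + j → ∀ i, C i N = 0 := by
    intro j
    induction j with
    | zero => intro N hN i; exact hCn i N ((hM i).trans hN)
    | succ j ih =>
      intro N hN
      have hz : ∀ i a, N < a → C i a = 0 := fun i a ha => ih a (by omega) i
      have rel2 : ∑ i, ∑ a ∈ Finset.range (N + 1), C i a • w i a = 0 := by
        rw [← rel]
        refine Finset.sum_congr rfl fun i _ => ?_
        have h1 := Finset.sum_subset (s₁ := Finset.range (N + 1)) (s₂ := Finset.range (N + 1 + n i))
          (f := fun a => C i a • w i a) (fun a => by simp; omega) (fun a _ h => by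
            rw [hz i a (by simpa using h), zero_smul])
        have h2 := Finset.sum_subset (s₁ := Finset.range (n i)) (s₂ := Finset.range (N + 1 + n i))
          (f := fun a => C i a • w i a) (fun a => by simp; omega) (fun a _ h => by
            rw [hCn i a (by simpa using h), zero_smul])
        rw [h1, h2]
      -- `T k` is the coefficient of $t^k$ after applying `U t` to the shortened relation. For `k =
      -- N` only `a = N`, `d = 0` contribute, which leaves a relation among the end points.
      let T : ℕ → W := fun k => ∑ i, ∑ a ∈ Finset.range (N + 1), ∑ d ∈ Finset.range (n i),
        (if d + k = a then C i a * (a.choose d : ℂ) else 0) • w i d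
      have hT : ∀ t : ℂ, ∑ k ∈ Finset.range (N + 1), t ^ k • T k = 0 := by
        intro t
        rw [← map_zero (U t), ← rel2]
        simp only [T, map_sum, map_smul, Finset.smul_sum]
        rw [Finset.sum_comm]
        refine Finset.sum_congr rfl fun i _ => ?_
        rw [Finset.sum_comm]
        refine Finset.sum_congr rfl fun a ha => ?_
        by_cases han : a < n i
        · rw [hU t i a han, Finset.smul_sum, Finset.sum_comm]
          refine Finset.sum_congr rfl fun d _ => ?_
          by_cases hd : d ≤ a
          · rw [Finset.sum_eq_single (a - d)]
            · rw [if_pos (by omega), smul_smul, smul_smul]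
              congr 1; ring
            · intro b _ hb
              rw [if_neg (by omega), zero_smul, smul_zero]
            · intro h
              exact absurd (Finset.mem_range.2 (by have := Finset.mem_range.1 ha; omega)) h
          · rw [Nat.choose_eq_zero_of_lt (by omega), Finset.sum_eq_zero]
            · simp
            · intro b _
              rw [if_neg (by omega), zero_smul, smul_zero]
        · rw [hCn i a (by omega)]
          simp
      have hN0 := eq_zero_of_forall_sum_pow_smul (N + 1) T hT N (by omega)
      have hTN : T N = ∑ i, C i N • w i 0 := by
        refine Finset.sum_congr rfl fun i _ => ?_
        rw [Finset.sum_eq_single N, Finset.sum_eq_single 0]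
        · simp
        · intro b _ hb
          rw [if_neg (by omega), zero_smul]
        · intro h; exact absurd (Finset.mem_range.2 (hn i)) h
        · intro a ha hne
          refine Finset.sum_eq_zero fun d _ => ?_
          rw [if_neg, zero_smul]
          have := Finset.mem_range.1 ha
          omega
        · simp
      rw [hTN] at hN0
      exact Fintype.linearIndependent_iff.1 h0 _ hN0
  rintro ⟨i, a⟩
  have := key M a (by omega) i
  simpa [C] using this

/-- The unipotent element that sends `X₁` to `X₁ + t X₀`. -/
def unip (t : ℂ) : SL2 := ⟨!![1, t; 0, 1], by simp [Matrix.det_fin_two]⟩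

theorem irrep_unip (n : ℕ) (t : ℂ) (a : Fin n) :
    irrep n (unip t) (vmon n a) =
      ∑ c : Fin n, (((a : ℕ).choose c : ℂ) * t ^ ((a : ℕ) - c)) • vmon n c := by
  apply Subtype.ext
  change subst (unip t) (MvPolynomial.monomial (expo n a) 1) = _
  have e : ∀ b : ℕ, (MvPolynomial.monomial (expo n b) 1 : MvPolynomial (Fin 2) ℂ) =
      MvPolynomial.X 0 ^ (n - 1 - b) * MvPolynomial.X 1 ^ b := fun b => by
    rw [expo, ← mul_one (1 : ℂ), ← MvPolynomial.monomial_mul, MvPolynomial.X_pow_eq_monomial,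
      MvPolynomial.X_pow_eq_monomial]
  have e0 : subst (unip t) (MvPolynomial.X 0) = MvPolynomial.X 0 := by
    simp [subst, unip, Fin.sum_univ_two]
  have e1 : subst (unip t) (MvPolynomial.X 1) =
      MvPolynomial.X 1 + t • MvPolynomial.X 0 := by
    simp [subst, unip, Fin.sum_univ_two, add_comm]
  rw [e, map_mul, map_pow, map_pow, e0, e1, add_pow]
  simp only [Submodule.coe_sum, Submodule.coe_smul, vmon, e]
  -- The binomial sum stops at `a`; the terms up to `n` are added because their binomial
  -- coefficients are zero.
  have hsub := Finset.sum_subset (s₁ := Finset.range (a + 1)) (s₂ := Finset.range n)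
    (f := fun c => (MvPolynomial.X 1 ^ c * (t • MvPolynomial.X 0) ^ ((a : ℕ) - c) *
      ((a : ℕ).choose c : MvPolynomial (Fin 2) ℂ)))
    (fun c => by have := a.2; simp; omega) (fun c _ h => by
      rw [Nat.choose_eq_zero_of_lt (by simp at h; omega)]; simp)
  rw [hsub, Finset.mul_sum, Finset.sum_range]
  refine Finset.sum_congr rfl fun c _ => ?_
  by_cases hc : (c : ℕ) ≤ a
  · have : n - 1 - (c : ℕ) = (n - 1 - a) + (a - c) := by have := a.2; omega
    rw [this, smul_pow, pow_add, MvPolynomial.smul_eq_C_mul, MvPolynomial.smul_eq_C_mul, map_mul,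
      map_natCast]
    ring
  · rw [Nat.choose_eq_zero_of_lt (by omega)]
    simp

theorem irrep_one_vmon (n : ℕ) (a : Fin n) : irrep n 1 (vmon n a) = vmon n a := by
  rw [map_one]; rfl

/-- The action on monomials is carried over by the equivariant map `tensorMap`, which sends products
of monomials to the components. -/
theorem IsTensor.unip_fst {ρ : Representation ℂ Flavor W} {m n : ℕ} {φ : ℕ → ℕ → W}
    (h : IsTensor ρ m n φ) (hm : 0 < m) (hn : 0 < n) (t : ℂ) {a b : ℕ} (ha : a < m) (hb : b < n) :
    ρ (unip t, 1) (φ a b) =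
      ∑ c ∈ Finset.range m, ((a.choose c : ℂ) * t ^ (a - c)) • φ c b := by
  have := h.tensorMap hm hn (unip t, 1) (vmon m ⟨a, ha⟩ ⊗ₜ vmon n ⟨b, hb⟩)
  rw [tensorMap_vmon] at this
  rw [← this, irrepTensor, Representation.tprod_apply, TensorProduct.map_tmul]
  simp only [MonoidHom.comp_apply, MonoidHom.coe_fst, MonoidHom.coe_snd]
  rw [irrep_unip m, irrep_one_vmon, TensorProduct.sum_tmul, map_sum, Finset.sum_range]
  refine Finset.sum_congr rfl fun c _ => ?_
  rw [← TensorProduct.smul_tmul', map_smul, tensorMap_vmon]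

theorem IsTensor.unip_snd {ρ : Representation ℂ Flavor W} {m n : ℕ} {φ : ℕ → ℕ → W}
    (h : IsTensor ρ m n φ) (hm : 0 < m) (hn : 0 < n) (t : ℂ) {a b : ℕ} (ha : a < m) (hb : b < n) :
    ρ (1, unip t) (φ a b) =
      ∑ c ∈ Finset.range n, ((b.choose c : ℂ) * t ^ (b - c)) • φ a c := by
  have := h.tensorMap hm hn (1, unip t) (vmon m ⟨a, ha⟩ ⊗ₜ vmon n ⟨b, hb⟩)
  rw [tensorMap_vmon] at this
  rw [← this, irrepTensor, Representation.tprod_apply, TensorProduct.map_tmul]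
  simp only [MonoidHom.comp_apply, MonoidHom.coe_fst, MonoidHom.coe_snd]
  rw [irrep_unip n, irrep_one_vmon, TensorProduct.tmul_sum, map_sum, Finset.sum_range]
  refine Finset.sum_congr rfl fun c _ => ?_
  rw [TensorProduct.tmul_smul, map_smul, tensorMap_vmon]

/-- Families of tensors are linearly independent as soon as their highest-weight vectors are. -/
theorem linearIndependent_of_highestWeight {ι : Type*} [Fintype ι] (ρ : Representation ℂ Flavor W)
    (m n : ι → ℕ) (hm : ∀ i, 0 < m i) (hn : ∀ i, 0 < n i) (φ : ι → ℕ → ℕ → W)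
    (hφ : ∀ i, IsTensor ρ (m i) (n i) (φ i)) (h0 : LinearIndependent ℂ fun i => φ i 0 0) :
    LinearIndependent ℂ fun p : Σ i, Fin (m i) × Fin (n i) => φ p.1 p.2.1 p.2.2 := by
  -- The second factor generates the components `(0, b)` from `(0, 0)`; the first factor then
  -- generates `(a, b)`, with the pairs `(i, b)` as labels of the chains.
  have h1 := linearIndependent_chain n hn (fun i b => φ i 0 b) (fun t => ρ (1, unip t))
    (fun t i b hb => (hφ i).unip_snd (hm i) (hn i) t (hm i) hb) h0
  have h2 := linearIndependent_chain (fun p : Σ i, Fin (n i) => m p.1) (fun p => hm p.1)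
    (fun p a => φ p.1 a p.2) (fun t => ρ (unip t, 1))
    (fun t p a ha => (hφ p.1).unip_fst (hm p.1) (hn p.1) t ha p.2.2) h1
  refine h2.comp (fun p : Σ i, Fin (m i) × Fin (n i) => ⟨⟨p.1, p.2.2⟩, p.2.1⟩) ?_
  rintro ⟨i, a, b⟩ ⟨j, c, d⟩ h
  simp only [Sigma.mk.injEq] at h
  obtain ⟨⟨rfl, h2⟩, h3⟩ := h
  simp only [heq_eq_eq] at h2 h3
  subst h2 h3
  rfl

theorem iSupIndep_span_of_linearIndependent {ι : Type*} {κ : ι → Type*} (v : (Σ i, κ i) → W)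
    (hv : LinearIndependent ℂ v) :
    iSupIndep fun i => Submodule.span ℂ (Set.range fun k => v ⟨i, k⟩) := by
  rw [iSupIndep_def]
  intro i
  have h := hv.disjoint_span_image (s := {p | p.1 = i}) (t := {p | p.1 ≠ i})
    (Set.disjoint_left.2 fun p h1 h2 => h2 h1)
  refine h.mono (Submodule.span_mono ?_) (iSup₂_le fun j hj => Submodule.span_mono ?_)
  · rintro _ ⟨k, rfl⟩
    exact ⟨⟨i, k⟩, rfl, rfl⟩
  · rintro _ ⟨k, rfl⟩
    exact ⟨⟨j, k⟩, hj, rfl⟩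

/-! ### The subrepresentation spanned by a family of tensors -/

/-- The span of a family of vectors. -/
def tensorSpan (m n : ℕ) (φ : ℕ → ℕ → W) : Submodule ℂ W :=
  Submodule.span ℂ {X | ∃ a < m, ∃ b < n, X = φ a b}

theorem tensorSpan_eq_range (m n : ℕ) (φ : ℕ → ℕ → W) :
    tensorSpan m n φ = Submodule.span ℂ (Set.range fun p : Fin m × Fin n => φ p.1 p.2) := by
  rw [tensorSpan]
  congr 1
  ext X
  constructor
  · rintro ⟨a, ha, b, hb, rfl⟩; exact ⟨(⟨a, ha⟩, ⟨b, hb⟩), rfl⟩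
  · rintro ⟨⟨a, b⟩, rfl⟩; exact ⟨a, a.2, b, b.2, rfl⟩

theorem range_tensorMap {m n : ℕ} (hm : 0 < m) (hn : 0 < n) (φ : ℕ → ℕ → W) :
    LinearMap.range (tensorMap m n hm hn φ) = tensorSpan m n φ := by
  rw [tensorMap, Module.Basis.constr_range, tensorSpan_eq_range]

theorem tensorMap_injective {m n : ℕ} (hm : 0 < m) (hn : 0 < n) (φ : ℕ → ℕ → W)
    (h : LinearIndependent ℂ fun p : Fin m × Fin n => φ p.1 p.2) :
    Function.Injective (tensorMap m n hm hn φ) := by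
  exact Module.Basis.injective_constr_of_linearIndependent _ h

theorem IsTensor.exists_subrepresentation {ρ : Representation ℂ Flavor W} {m n : ℕ}
    {φ : ℕ → ℕ → W} (h : IsTensor ρ m n φ) (hm : 0 < m) (hn : 0 < n)
    (hli : LinearIndependent ℂ fun p : Fin m × Fin n => φ p.1 p.2) :
    ∃ S : Subrepresentation ρ, S.toSubmodule = tensorSpan m n φ ∧
      Nonempty ((irrepTensor m n).Equiv S.toRepresentation) := by
  have hr := range_tensorMap hm hn φ
  refine ⟨⟨tensorSpan m n φ, fun g v hv => ?_⟩, rfl, ⟨Representation.Equiv.mk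
    ((LinearEquiv.ofInjective _ (tensorMap_injective hm hn φ hli)).trans
      (LinearEquiv.ofEq _ _ hr)) fun g => ?_⟩⟩
  · rw [← hr] at hv ⊢
    obtain ⟨w, rfl⟩ := hv
    exact ⟨_, h.tensorMap hm hn g w⟩
  · refine LinearMap.ext fun v => Subtype.ext ?_
    exact h.tensorMap hm hn g v

end HighestWeight

/-! ### Characters -/

theorem irrep_cartan (n : ℕ) (w : ℂˣ) (a : Fin n) :
    irrep n (cartan w) (vmon n a) = ((w : ℂ) ^ (2 * (a : ℤ) - (n - 1))) • vmon n a := by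
  apply Subtype.ext
  change subst (cartan w) (MvPolynomial.monomial (expo n a) 1) = _
  have e : ∀ b : ℕ, (MvPolynomial.monomial (expo n b) 1 : MvPolynomial (Fin 2) ℂ) =
      MvPolynomial.X 0 ^ (n - 1 - b) * MvPolynomial.X 1 ^ b := fun b => by
    rw [expo, ← mul_one (1 : ℂ), ← MvPolynomial.monomial_mul, MvPolynomial.X_pow_eq_monomial,
      MvPolynomial.X_pow_eq_monomial]
  have e0 : subst (cartan w) (MvPolynomial.X 0) = (w : ℂ)⁻¹ • MvPolynomial.X 0 := by
    simp [subst, cartan, Fin.sum_univ_two]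
  have e1 : subst (cartan w) (MvPolynomial.X 1) = (w : ℂ) • MvPolynomial.X 1 := by
    simp [subst, cartan, Fin.sum_univ_two]
  rw [e, map_mul, map_pow, map_pow, e0, e1, smul_pow, smul_pow, smul_mul_smul_comm]
  simp only [Submodule.coe_smul, vmon, e]
  congr 1
  have ha : n = (n - 1 - a) + a + 1 := by have := a.2; omega
  have hz : (2 * (a : ℤ) - (n - 1)) = -((n - 1 - (a : ℕ) : ℕ) : ℤ) + (a : ℕ) := by omega
  rw [hz, zpow_add₀ w.ne_zero, zpow_neg, zpow_natCast, zpow_natCast, inv_pow]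

/-! ### Traces of words -/

theorem ev_tr (N : ℕ) (w : List Letter) : ev N (tr w) = ((w.map (mat N)).prod).trace := by
  simp [ev, tr]

/-- The statistics of a word. -/
def wordOdd (w : List Letter) : Bool := (w.map fun l => l.kind.odd).foldr xor false

theorem matParity_word (N : ℕ) (w : List Letter) :
    MatParity (wordOdd w) (w.map (mat N)).prod := by
  induction w with
  | nil =>
    refine fun a b => ⟨fun x => ?_, ?_⟩ <;> by_cases h : a = b <;>
      simp [h, sgn, wordOdd]
  | cons l w ih => exact (MatParity.mat l).mul ih

theorem hasParity_ev_tr (N : ℕ) (w : List Letter) : HasParity (wordOdd w) (ev N (tr w)) := by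
  rw [ev_tr]
  exact HasParity.sum _ _ fun i _ => matParity_word N w i i

/-- Commuting with the generators propagates to the whole algebra, so even elements are central.
Scalar traces can therefore be handled as elements of a commutative ring. -/
theorem HasParity.commute {N : ℕ} {X : Alg N} (h : HasParity false X) (Y : Alg N) :
    Y * X = X * Y := by
  obtain ⟨Y, rfl⟩ := proj_surjective N Y
  induction Y using FreeAlgebra.induction with
  | grade0 r => rw [AlgHom.commutes, Algebra.commutes]
  | grade1 x =>
    have := h.1 x
    simpa [sgn] using! this
  | mul a b ha hb => rw [map_mul, mul_assoc, hb, ← mul_assoc, ha, mul_assoc]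
  | add a b ha hb => rw [map_add, add_mul, mul_add, ha, hb]

theorem trace_mul_comm_of_even {N : ℕ} {M : Matrix (Fin N) (Fin N) (Alg N)}
    (h : MatParity false M) (M' : Matrix (Fin N) (Fin N) (Alg N)) :
    (M * M').trace = (M' * M).trace := by
  simp only [Matrix.trace, Matrix.diag, Matrix.mul_apply]
  rw [Finset.sum_comm]
  exact Finset.sum_congr rfl fun a _ => Finset.sum_congr rfl fun b _ => ((h b a).commute _).symm

/-- Cyclicity of the trace. -/
theorem ev_tr_rotate (N : ℕ) (l : Letter) (w : List Letter) :
    ev N (tr (l :: w)) = sgn l.kind.odd (wordOdd w) • ev N (tr (w ++ [l])) := by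
  simp only [ev_tr, List.map_cons, List.prod_cons, List.map_append, List.prod_append, List.map_nil,
    List.prod_nil, mul_one]
  simp only [Matrix.trace, Matrix.diag, Matrix.mul_apply, Finset.smul_sum]
  rw [Finset.sum_comm]
  refine Finset.sum_congr rfl fun b _ => Finset.sum_congr rfl fun a _ => ?_
  exact (matParity_word N w b a).1 (l, a, b)

theorem ev_tr_rotate_left (N : ℕ) {l : Letter} (w : List Letter) (h : l.kind.odd = false) :
    ev N (tr (l :: w)) = ev N (tr (w ++ [l])) := by
  rw [ev_tr_rotate, h]; simp [sgn]

theorem ev_tr_rotate_right (N : ℕ) {l : Letter} (w : List Letter) (h : wordOdd w = false) :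
    ev N (tr (l :: w)) = ev N (tr (w ++ [l])) := by
  rw [ev_tr_rotate, h]; simp [sgn]

/-! ### The single traces of order at most $x^3$, as functions of their flavour indices -/

section Traces

variable (N : ℕ)

/-- Up to rotation, and a sign for two fermions, these ten shapes exhaust the single traces of order
at most $x^3$. -/
def S2 (i p : Fin 2) : Alg N := ev N (tr [lA i, lB p])
def S4 (i p j q : Fin 2) : Alg N := ev N (tr [lA i, lB p, lA j, lB q])
def S6 (i p j q k r : Fin 2) : Alg N := ev N (tr [lA i, lB p, lA j, lB q, lA k, lB r])
def F2 (i j : Fin 2) : Alg N := ev N (tr [lPsiA i, lA j])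
def G2 (p q : Fin 2) : Alg N := ev N (tr [lPsiB p, lB q])
def F4 (i j p k : Fin 2) : Alg N := ev N (tr [lPsiA i, lA j, lB p, lA k])
def G4 (p q i r : Fin 2) : Alg N := ev N (tr [lPsiB p, lB q, lA i, lB r])
def D1 (i p : Fin 2) : Alg N := ev N (tr [lDA i, lB p])
def D2 (i p : Fin 2) : Alg N := ev N (tr [lA i, lDB p])
def P2 (i p : Fin 2) : Alg N := ev N (tr [lPsiA i, lPsiB p])

variable {N}

theorem S4_rotate (i p j q : Fin 2) : S4 N i p j q = S4 N j q i p := by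
  rw [S4, ev_tr_rotate_left N _ rfl, List.cons_append, ev_tr_rotate_left N _ rfl]; rfl

theorem S6_rotate (i p j q k r : Fin 2) : S6 N i p j q k r = S6 N j q k r i p := by
  rw [S6, ev_tr_rotate_left N _ rfl, List.cons_append, ev_tr_rotate_left N _ rfl]; rfl

theorem S2_even (i p : Fin 2) : HasParity false (S2 N i p) := hasParity_ev_tr N _
theorem S4_even (i p j q : Fin 2) : HasParity false (S4 N i p j q) := hasParity_ev_tr N _
theorem S6_even (i p j q k r : Fin 2) : HasParity false (S6 N i p j q k r) := hasParity_ev_tr N _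
theorem F4_odd (i j p k : Fin 2) : HasParity true (F4 N i j p k) := hasParity_ev_tr N _
theorem G4_odd (i j p k : Fin 2) : HasParity true (G4 N i j p k) := hasParity_ev_tr N _

theorem S2_mul_comm (i p : Fin 2) (X : Alg N) : X * S2 N i p = S2 N i p * X :=
  (S2_even i p).commute X

end Traces

/-! ### The supercharge on traces -/

section Supercharge

variable {N k : ℕ}

theorem Q_trace (M : Matrix (Fin N) (Fin N) (Alg N)) :
    Q N k M.trace = (M.map (Q N k)).trace := by
  simp [Matrix.trace]

theorem Qmap_mul (M M' : Matrix (Fin N) (Fin N) (Alg N)) :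
    (M * M').map (Q N k) = M.map (Q N k) * M' + M.map (parity N) * M'.map (Q N k) := by
  ext a b
  simp [Matrix.mul_apply, Q_mul, Finset.sum_add_distrib]

theorem Qmap_mat (l : Letter) : (mat N l).map (Q N k) = Qmat N k l.kind l.der l.idx := by
  ext a b
  simp [mat]

theorem parity_mat (l : Letter) :
    (mat N l).map (parity N) = (if l.kind.odd then (-1 : ℂ) else 1) • mat N l := by
  ext a b
  simp [mat]

theorem Qmat_A (i : Fin 2) : Qmat N k .A 0 i = 0 := rfl
theorem Qmat_B (i : Fin 2) : Qmat N k .B 0 i = 0 := rfl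

/-- The coefficient of `𝒬 ψ`. -/
def cQ (k : ℕ) : ℂ := 4 * Real.pi * Complex.I / k

/-- The coefficient of the variation of the gauge connections. -/
def cD (k : ℕ) : ℂ := 4 * Real.pi / k

/-- This relative factor is compensated by the imaginary unit in the multiplet `ADB_22`. -/
theorem cQ_eq (k : ℕ) : cQ k = Complex.I * cD k := by rw [cQ, cD]; ring

theorem Qmat_psiA (i : Fin 2) : Qmat N k .psiA 0 i = cQ k • ∑ r, ∑ s, eps r s •
    (mat N (lB r) * mat N (lA i) * mat N (lB s)) := rfl

theorem Qmat_psiB (i : Fin 2) : Qmat N k .psiB 0 i = (-cQ k) • ∑ r, ∑ s, eps r s •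
    (mat N (lA r) * mat N (lB i) * mat N (lA s)) := rfl

theorem Qmat_DA (i : Fin 2) : Qmat N k .A 1 i =
    cD k • (connHat N * mat N (lA i) - mat N (lA i) * conn N) := by
  have : (0 : Matrix (Fin N) (Fin N) (Alg N)).map (der N) = 0 := by ext; simp
  simp only [Qmat, this, zero_add]
  rfl

theorem Qmat_DB (i : Fin 2) : Qmat N k .B 1 i =
    cD k • (conn N * mat N (lB i) - mat N (lB i) * connHat N) := by
  have : (0 : Matrix (Fin N) (Fin N) (Alg N)).map (der N) = 0 := by ext; simp
  simp only [Qmat, this, zero_add]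
  rfl

theorem Q_S2 (i p : Fin 2) : Q N k (S2 N i p) = 0 := by
  simp [S2, ev_tr, Q_trace, Qmap_mul, Qmap_mat, lA, lB, Qmat_A, Qmat_B]

theorem Q_S4 (i p j q : Fin 2) : Q N k (S4 N i p j q) = 0 := by
  simp [S4, ev_tr, Q_trace, Qmap_mul, Qmap_mat, lA, lB, Qmat_A, Qmat_B]

theorem Q_S6 (i p j q t r : Fin 2) : Q N k (S6 N i p j q t r) = 0 := by
  simp [S6, ev_tr, Q_trace, Qmap_mul, Qmap_mat, lA, lB, Qmat_A, Qmat_B]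

theorem Q_F2 (i j : Fin 2) :
    Q N k (F2 N i j) = cQ k • ∑ r, ∑ s, eps r s • S4 N i s j r := by
  have h : ∀ r s, S4 N i s j r = (mat N (lB r) * mat N (lA i) * mat N (lB s) * mat N (lA j)).trace :=
    fun r s => by
      have := ev_tr_rotate_left N (l := lB r) [lA i, lB s, lA j] rfl
      simpa [S4, ev_tr, mul_assoc] using this.symm
  simp only [F2, ev_tr, List.map_cons, List.map_nil, List.prod_cons, List.prod_nil, mul_one,
    Q_trace, Qmap_mul, Qmap_mat]
  simp only [lPsiA, lA, Qmat_A, mul_zero, add_zero, Qmat_psiA]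
  simp only [h, Matrix.smul_mul, Finset.sum_mul, Matrix.trace_smul, Matrix.trace_sum, lA]

theorem Q_G2 (p q : Fin 2) :
    Q N k (G2 N p q) = (-cQ k) • ∑ r, ∑ s, eps r s • S4 N r p s q := by
  simp only [G2, ev_tr, List.map_cons, List.map_nil, List.prod_cons, List.prod_nil, mul_one,
    Q_trace, Qmap_mul, Qmap_mat]
  simp only [lPsiB, lB, Qmat_B, mul_zero, add_zero, Qmat_psiB]
  simp only [Matrix.smul_mul, Finset.sum_mul, Matrix.trace_smul, Matrix.trace_sum, S4, ev_tr,
    List.map_cons, List.map_nil, List.prod_cons, List.prod_nil, mul_one, mul_assoc, lB]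

theorem Q_F4 (i j p t : Fin 2) :
    Q N k (F4 N i j p t) = cQ k • ∑ r, ∑ s, eps r s • S6 N i s j p t r := by
  have h : ∀ r s, S6 N i s j p t r = (mat N (lB r) * (mat N (lA i) * (mat N (lB s) *
      (mat N (lA j) * (mat N (lB p) * mat N (lA t)))))).trace :=
    fun r s => by
      have := ev_tr_rotate_left N (l := lB r) [lA i, lB s, lA j, lB p, lA t] rfl
      simpa [ev_tr, S6, mul_assoc] using this.symm
  simp only [F4, ev_tr, List.map_cons, List.map_nil, List.prod_cons, List.prod_nil, mul_one,
    Q_trace, Qmap_mul, Qmap_mat]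
  simp only [lPsiA, lA, lB, Qmat_A, Qmat_B, zero_mul, mul_zero, add_zero, Qmat_psiA]
  simp only [h, Matrix.smul_mul, Finset.sum_mul, Matrix.trace_smul, Matrix.trace_sum, lA, lB,
    mul_assoc]

theorem Q_G4 (p q i t : Fin 2) :
    Q N k (G4 N p q i t) = (-cQ k) • ∑ r, ∑ s, eps r s • S6 N r p s q i t := by
  simp only [G4, ev_tr, List.map_cons, List.map_nil, List.prod_cons, List.prod_nil, mul_one,
    Q_trace, Qmap_mul, Qmap_mat]
  simp only [lPsiB, lA, lB, Qmat_A, Qmat_B, zero_mul, mul_zero, add_zero, Qmat_psiB]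
  simp only [S6, ev_tr, List.map_cons, List.map_nil, List.prod_cons, List.prod_nil, mul_one,
    Matrix.smul_mul, Finset.sum_mul, Matrix.trace_smul, Matrix.trace_sum, lA, lB, mul_assoc]

/-- The fermionic operator that is proportional to `𝒬 Tr(DA_i B_p)`. -/
def E2 (N : ℕ) (i p : Fin 2) : Alg N :=
  -∑ r, ∑ s, eps r s • (G4 N p r i s + F4 N i r p s)

theorem Q_P2 (i p : Fin 2) : Q N k (P2 N i p) = (-cQ k) • E2 N i p := by
  have h : ∀ r s, G4 N p r i s = (mat N (lB r) * (mat N (lA i) * (mat N (lB s) *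
      mat N (lPsiB p)))).trace :=
    fun r s => by
      have := ev_tr_rotate_right N (l := lPsiB p) [lB r, lA i, lB s] rfl
      simpa [ev_tr, G4, mul_assoc] using this
  simp only [P2, ev_tr, List.map_cons, List.map_nil, List.prod_cons, List.prod_nil, mul_one,
    Q_trace, Qmap_mul, Qmap_mat, parity_mat]
  simp only [lPsiA, lPsiB, Qmat_psiA, Qmat_psiB, Kind.odd]
  simp only [E2, h, F4, ev_tr, List.map_cons, List.map_nil, List.prod_cons, List.prod_nil, mul_one,
    Matrix.smul_mul, Matrix.mul_smul, Finset.sum_mul, Finset.mul_sum, Matrix.trace_smul,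
    Matrix.trace_sum, Matrix.trace_add, mul_assoc, lPsiA, lPsiB, smul_add, Finset.sum_add_distrib,
    if_true]
  simp only [neg_smul, one_smul, smul_neg, Finset.sum_neg_distrib]
  module

theorem trace_connHat (i p : Fin 2) : (connHat N * mat N (lA i) * mat N (lB p)).trace =
    ∑ a, ∑ b, eps a b • (F4 N b i p a + G4 N a b i p) := by
  have h : ∀ a b, F4 N b i p a = (mat N (lA a) * (mat N (lPsiA b) * (mat N (lA i) *
      mat N (lB p)))).trace :=
    fun a b => by
      have := ev_tr_rotate_left N (l := lA a) [lPsiA b, lA i, lB p] rfl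
      simpa [ev_tr, F4, mul_assoc] using this.symm
  simp only [connHat, h, G4, ev_tr, List.map_cons, List.map_nil, List.prod_cons, List.prod_nil,
    mul_one, add_mul, sub_mul, mul_assoc, Matrix.trace_add, Matrix.trace_sub, Fin.sum_univ_two, eps,
    lA, lB, lPsiA, lPsiB]
  simp
  module

theorem trace_conn (i p : Fin 2) : (mat N (lA i) * conn N * mat N (lB p)).trace =
    ∑ a, ∑ b, eps a b • (F4 N b a p i + G4 N a p i b) := by
  have h : ∀ a b, F4 N b a p i = (mat N (lA i) * (mat N (lPsiA b) * (mat N (lA a) *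
      mat N (lB p)))).trace :=
    fun a b => by
      have := ev_tr_rotate_left N (l := lA i) [lPsiA b, lA a, lB p] rfl
      simpa [ev_tr, F4, mul_assoc] using this.symm
  have h' : ∀ a b, G4 N a p i b = (mat N (lA i) * (mat N (lB b) * (mat N (lPsiB a) *
      mat N (lB p)))).trace :=
    fun a b => by
      have := ev_tr_rotate_left N (l := lA i) [lB b, lPsiB a, lB p] rfl
      have h2 := ev_tr_rotate_left N (l := lB b) [lPsiB a, lB p, lA i] rfl
      simp [ev_tr, G4] at this h2 ⊢
      rw [this, h2]
  simp only [conn, h, h', add_mul, sub_mul, mul_add, mul_sub, mul_assoc, Matrix.trace_add,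
    Matrix.trace_sub, Fin.sum_univ_two, eps, lA, lB, lPsiA, lPsiB]
  simp
  module

/-- A Schouten identity: with two flavour values an antisymmetrisation over three indices vanishes,
which moves the contraction from the outer letters onto the letters that follow. It is checked on
the four index values. -/
theorem trace_connHat_sub_trace_conn (i p : Fin 2) :
    (connHat N * mat N (lA i) * mat N (lB p)).trace -
      (mat N (lA i) * conn N * mat N (lB p)).trace = E2 N i p := by
  rw [trace_connHat, trace_conn, E2]
  fin_cases i <;> fin_cases p <;> simp [Fin.sum_univ_two, eps] <;> module

/-- The variations of `D1`, `D2` and `P2` are `E2` times `cD k`, `-cD k` and `-cQ k`. Two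
independent combinations are thus closed, the multiplets `DAB_22` and `ADB_22`, and `E2` is exact.
-/
theorem Q_D1 (i p : Fin 2) : Q N k (D1 N i p) = cD k • E2 N i p := by
  simp only [D1, ev_tr, List.map_cons, List.map_nil, List.prod_cons, List.prod_nil, mul_one,
    Q_trace, Qmap_mul, Qmap_mat]
  simp only [lDA, lB, Letter.D, lA, Qmat_B, mul_zero, add_zero, Qmat_DA, zero_add,
    ← trace_connHat_sub_trace_conn]
  simp only [Matrix.smul_mul, Matrix.trace_smul, sub_mul, Matrix.trace_sub]

theorem Q_D2 (i p : Fin 2) : Q N k (D2 N i p) = (-cD k) • E2 N i p := by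
  -- The connection is odd, but the block that it passes is even, so no sign appears.
  have h : (mat N (lA i) * mat N (lB p) * connHat N).trace =
      (connHat N * mat N (lA i) * mat N (lB p)).trace := by
    rw [mul_assoc (connHat N)]
    exact trace_mul_comm_of_even ((MatParity.mat (lA i)).mul (MatParity.mat (lB p))) _
  simp only [D2, ev_tr, List.map_cons, List.map_nil, List.prod_cons, List.prod_nil, mul_one,
    Q_trace, Qmap_mul, Qmap_mat, parity_mat]
  simp only [lDB, lA, Letter.D, lB, Qmat_A, zero_mul, zero_add, Qmat_DB,
    ← trace_connHat_sub_trace_conn]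
  simp only [lA, lB] at h
  simp only [Kind.odd, Bool.false_eq_true, if_false, one_smul, Matrix.mul_smul, Matrix.trace_smul,
    mul_sub, Matrix.trace_sub, ← mul_assoc, h]
  module

end Supercharge

/-! ### Membership in the space of formal operators -/

theorem gaugeWord_two {a b : Letter} (h : a.kind.bif ≠ b.kind.bif) : GaugeWord [a, b] :=
  ⟨by simp, ⟨1, rfl⟩, by simpa using h⟩

theorem gaugeWord_four {a b c d : Letter} (h : a.kind.bif ≠ b.kind.bif)
    (h' : b.kind.bif ≠ c.kind.bif) (h'' : c.kind.bif ≠ d.kind.bif) : GaugeWord [a, b, c, d] :=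
  ⟨by simp, ⟨2, rfl⟩, by simpa using ⟨h, h', h''⟩⟩

theorem tr_mem_formalOps {d : ℕ} {w : List Letter} (h : GaugeWord w) (hd : wordCharge2 w = 2 * d) :
    tr w ∈ formalOps d :=
  Submodule.subset_span ⟨[w], by simpa using h, by simpa using hd, by simp⟩

theorem tr_mul_tr_mem_formalOps {d : ℕ} {w w' : List Letter} (h : GaugeWord w) (h' : GaugeWord w')
    (hd : wordCharge2 w + wordCharge2 w' = 2 * d) : tr w * tr w' ∈ formalOps d :=
  Submodule.subset_span ⟨[w, w'], by simpa using ⟨h, h'⟩, by simpa using hd, by simp⟩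

theorem tr_mul_tr_mul_tr_mem_formalOps {d : ℕ} {w w' w'' : List Letter} (h : GaugeWord w)
    (h' : GaugeWord w') (h'' : GaugeWord w'')
    (hd : wordCharge2 w + wordCharge2 w' + wordCharge2 w'' = 2 * d) :
    tr w * tr w' * tr w'' ∈ formalOps d :=
  Submodule.subset_span ⟨[w, w', w''], by simpa using ⟨h, h', h''⟩, by simpa [add_assoc] using hd,
    by simp [mul_assoc]⟩

theorem Multiplet.reps_subset_formalOps (m : Multiplet) {T : Formal} (hT : T ∈ m.reps) :
    T ∈ formalOps m.order := by
  have h0 : (1 : Formal) ∈ formalOps 0 :=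
    Submodule.subset_span ⟨[], by simp, by simp, by simp⟩
  cases m <;> simp only [reps, Set.mem_ofPred_eq, Set.mem_singleton_iff] at hT
  case unit => rw [hT]; exact h0
  all_goals
    -- On an equation an anonymous-constructor pattern substitutes, so a single pattern fits every
    -- number of free indices.
    obtain ⟨_, _, _, _, _, _, rfl⟩ := hT
    repeat' first
      | refine Submodule.sum_mem _ fun _ _ => ?_
      | refine Submodule.sub_mem _ ?_ ?_
      | refine Submodule.add_mem _ ?_ ?_
      | refine Submodule.smul_mem _ _ ?_
    all_goals
      (try simp only [mul_add, sub_mul])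
      repeat' first
      | refine Submodule.sub_mem _ ?_ ?_
      | refine Submodule.add_mem _ ?_ ?_
    all_goals first
      | refine tr_mul_tr_mul_tr_mem_formalOps ?_ ?_ ?_ ?_
      | refine tr_mul_tr_mem_formalOps ?_ ?_ ?_
      | refine tr_mem_formalOps ?_ ?_
    all_goals first
      | rfl
      | exact gaugeWord_two Bool.false_ne_true
      | exact gaugeWord_two Bool.false_ne_true.symm
      | exact gaugeWord_four Bool.false_ne_true Bool.false_ne_true.symm Bool.false_ne_true
      | exact gaugeWord_four Bool.false_ne_true.symm Bool.false_ne_true Bool.false_ne_true.symm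

/-! ### Evaluation of the representatives -/

section Evaluation

variable (N : ℕ)

theorem ev_AB (i p : Fin 2) : ev N (tr [lA i, lB p]) = S2 N i p := rfl
theorem ev_BA (i p : Fin 2) : ev N (tr [lB p, lA i]) = S2 N i p := by
  rw [ev_tr_rotate_left N _ rfl]; rfl
theorem ev_ABAB (i p j q : Fin 2) : ev N (tr [lA i, lB p, lA j, lB q]) = S4 N i p j q := rfl
theorem ev_BABA (i p j q : Fin 2) : ev N (tr [lB q, lA i, lB p, lA j]) = S4 N i p j q := by
  rw [ev_tr_rotate_left N _ rfl]; rfl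
theorem ev_BABABA (i p j q t r : Fin 2) :
    ev N (tr [lB r, lA i, lB p, lA j, lB q, lA t]) = S6 N i p j q t r := by
  rw [ev_tr_rotate_left N _ rfl]; rfl
theorem ev_psiAA (i j : Fin 2) : ev N (tr [lPsiA i, lA j]) = F2 N i j := rfl
theorem ev_ApsiA (i j : Fin 2) : ev N (tr [lA j, lPsiA i]) = F2 N i j := by
  rw [ev_tr_rotate_left N _ rfl]; rfl
theorem ev_psiBB (i j : Fin 2) : ev N (tr [lPsiB i, lB j]) = G2 N i j := rfl
theorem ev_BpsiB (i j : Fin 2) : ev N (tr [lB j, lPsiB i]) = G2 N i j := by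
  rw [ev_tr_rotate_left N _ rfl]; rfl
theorem ev_psiABA (i j p t : Fin 2) : ev N (tr [lPsiA i, lA j, lB p, lA t]) = F4 N i j p t := rfl
theorem ev_psiBAB (i j p t : Fin 2) : ev N (tr [lPsiB i, lB j, lA p, lB t]) = G4 N i j p t := rfl
theorem ev_DAB (i p : Fin 2) : ev N (tr [lDA i, lB p]) = D1 N i p := rfl
theorem ev_BDA (i p : Fin 2) : ev N (tr [lB p, lDA i]) = D1 N i p := by
  rw [ev_tr_rotate_left N _ rfl]; rfl
theorem ev_ADB (i p : Fin 2) : ev N (tr [lA i, lDB p]) = D2 N i p := rfl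
theorem ev_psiApsiB (i p : Fin 2) : ev N (tr [lPsiA i, lPsiB p]) = P2 N i p := rfl

end Evaluation

theorem sum_sym2 {M : Type*} [AddCommGroup M] [Module ℂ M] (f : Fin 2 → Fin 2 → M) (l m : Fin 2) :
    ∑ i, ∑ j, sym2 i j l m • f i j = (1 / 2 : ℂ) • (f l m + f m l) := by
  fin_cases l <;> fin_cases m <;> simp [Fin.sum_univ_two, sym2, delta] <;> module

theorem sum_sym3 {M : Type*} [AddCommGroup M] [Module ℂ M] (f : Fin 2 → Fin 2 → Fin 2 → M)
    (l m n : Fin 2) : ∑ i, ∑ j, ∑ k, sym3 i j k l m n • f i j k =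
      (1 / 6 : ℂ) • (f l m n + f m n l + f n l m + f l n m + f m l n + f n m l) := by
  fin_cases l <;> fin_cases m <;> fin_cases n <;> simp [Fin.sum_univ_two, sym3, delta] <;> module

theorem sum_eps {M : Type*} [AddCommGroup M] [Module ℂ M] (f : Fin 2 → Fin 2 → M) :
    ∑ i, ∑ j, eps i j • f i j = f 0 1 - f 1 0 := by
  simp [Fin.sum_univ_two, eps]; module

/-! ### Closure of the multi-graviton representatives at every rank -/

section Closed

variable {N k : ℕ}

theorem Q_mul_S2 (X : Alg N) (i p : Fin 2) : Q N k (X * S2 N i p) = Q N k X * S2 N i p := by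
  rw [Q_mul, Q_S2, mul_zero, add_zero]

theorem Q_mul_S4 (X : Alg N) (i p j q : Fin 2) :
    Q N k (X * S4 N i p j q) = Q N k X * S4 N i p j q := by
  rw [Q_mul, Q_S4, mul_zero, add_zero]

theorem Q_F2' (i j : Fin 2) :
    Q N k (F2 N i j) = cQ k • (S4 N i 1 j 0 - S4 N i 0 j 1) := by
  rw [Q_F2, sum_eps]

theorem Q_G2' (i j : Fin 2) :
    Q N k (G2 N i j) = (-cQ k) • (S4 N 0 i 1 j - S4 N 1 i 0 j) := by
  rw [Q_G2, sum_eps]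

theorem Q_F4' (i j p t : Fin 2) :
    Q N k (F4 N i j p t) = cQ k • (S6 N i 1 j p t 0 - S6 N i 0 j p t 1) := by
  rw [Q_F4, sum_eps]

theorem Q_G4' (p q i t : Fin 2) :
    Q N k (G4 N p q i t) = (-cQ k) • (S6 N 0 p 1 q i t - S6 N 1 p 0 q i t) := by
  rw [Q_G4, sum_eps]

/-- The scalar operator that is proportional to `𝒬 Tr(ψ^A_[1 A_2])`. -/
def S4' (N : ℕ) : Alg N := S4 N 0 1 1 0 - S4 N 0 0 1 1

/-- Rotating the four-letter trace exchanges the two $A$'s together with the two $B$'s, so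
contracting the $B$ indices antisymmetrises the $A$ indices too: only the singlet `S4'` survives.
The same singlet with the same coefficient arises from `G2`, hence the difference of the two
singlets is closed. -/
theorem Q_F2_eps (i j : Fin 2) : Q N k (F2 N i j) = (cQ k * eps i j) • S4' N := by
  rw [Q_F2', S4']
  have h := S4_rotate (N := N)
  fin_cases i <;> fin_cases j <;> simp [eps]
  · right; rw [h 0 1 0 0, sub_self]
  · rw [h 1 1 0 0, h 1 0 0 1]; module
  · right; rw [h 1 1 1 0, sub_self]

theorem Q_G2_eps (i j : Fin 2) : Q N k (G2 N i j) = (cQ k * eps i j) • S4' N := by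
  rw [Q_G2', S4']
  have h := S4_rotate (N := N)
  fin_cases i <;> fin_cases j <;> simp [eps]
  · right; rw [h 1 0 0 0, sub_self]
  · rw [h 1 0 0 1]; module
  · rw [h 1 1 0 0]
  · right; rw [h 1 1 0 1, sub_self]

/-- Among the three $B$ letters of the variation two carry equal indices. A rotation therefore turns
one term of the contraction into the other with permuted $A$ indices, and the sum over permutations
cancels. -/
theorem Q_sym_F4 (l m n p : Fin 2) :
    Q N k (F4 N l m p n + F4 N m n p l + F4 N n l p m + F4 N l n p m + F4 N m l p n + F4 N n m p l)
      = 0 := by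
  have h := S6_rotate (N := N)
  have h0 : ∀ i j k, S6 N i 0 j 0 k 1 = S6 N k 1 i 0 j 0 := fun i j k => by rw [h k]
  have h1 : ∀ i j k, S6 N i 1 j 1 k 0 = S6 N k 0 i 1 j 1 := fun i j k => by rw [h k]
  simp only [map_add, Q_F4']
  fin_cases p
  · simp only [Fin.zero_eta, h0]; module
  · simp only [Fin.mk_one, h1]; module

theorem Q_sym_G4 (l m n i : Fin 2) :
    Q N k (G4 N l m i n + G4 N m n i l + G4 N n l i m + G4 N l n i m + G4 N m l i n + G4 N n m i l)
      = 0 := by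
  have h := S6_rotate (N := N)
  have h0 : ∀ a b c, S6 N 1 a 0 b 0 c = S6 N 0 b 0 c 1 a := fun i j k => h _ _ _ _ _ _
  have h1 : ∀ a b c, S6 N 0 a 1 b 1 c = S6 N 1 b 1 c 0 a := fun i j k => h _ _ _ _ _ _
  have h2 : ∀ a b c, S6 N 0 a 1 b 0 c = S6 N 0 c 0 a 1 b := fun i j k => (h _ _ _ _ _ _).symm
  have h3 : ∀ a b c, S6 N 1 a 0 b 1 c = S6 N 1 c 1 a 0 b := fun i j k => (h _ _ _ _ _ _).symm
  simp only [map_add, Q_G4']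
  fin_cases i
  · simp only [Fin.zero_eta, h0, h2]; module
  · simp only [Fin.mk_one, h1, h3]; module

/-- Rotation of a trace towards its lexicographically smallest form. -/
theorem S6_rotate_of_lt (i p j q t r : Fin 2)
    (_ : 32 * j.1 + 16 * q.1 + 8 * t.1 + 4 * r.1 + 2 * i.1 + p.1 <
      32 * i.1 + 16 * p.1 + 8 * j.1 + 4 * q.1 + 2 * t.1 + r.1) :
    S6 N i p j q t r = S6 N j q t r i p := S6_rotate i p j q t r

/-- The hypothesis compares the index strings read as binary numbers; as a side condition it makes
rewriting by rotations in both directions terminate. -/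
theorem S6_rotate_of_lt' (i p j q t r : Fin 2)
    (_ : 32 * t.1 + 16 * r.1 + 8 * i.1 + 4 * p.1 + 2 * j.1 + q.1 <
      32 * i.1 + 16 * p.1 + 8 * j.1 + 4 * q.1 + 2 * t.1 + r.1) :
    S6 N i p j q t r = S6 N t r i p j q := (S6_rotate t r i p j q).symm

/-- Pure scalars are closed because `Q` kills $A$ and $B$. For the fermions the variation is
ε-contracted, and it is killed by symmetrisation or cancels between the $A$ and $B$ halves; the
derivative multiplets are the combinations in which the multiples of `E2` cancel. -/
theorem Multiplet.Q_reps (m : Multiplet) (hm : m ≠ .fortuitous) {T : Formal} (hT : T ∈ m.reps) :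
    Q N k (ev N T) = 0 := by
  cases m <;> simp only [reps, Set.mem_ofPred_eq, Set.mem_singleton_iff] at hT
  case unit =>
    rw [hT, map_one]
    exact (congrArg _ (map_one (algebraMap ℂ _)).symm).trans (Q_algebraMap 1)
  case fortuitous => exact absurd rfl hm
  case psiAA_31 =>
    obtain ⟨l, m, rfl⟩ := hT
    rw [sum_sym2]
    fin_cases l <;> fin_cases m <;> simp [ev_ApsiA, Q_F2_eps, eps]
  case psiBB_13 =>
    obtain ⟨l, m, rfl⟩ := hT
    rw [sum_sym2]
    fin_cases l <;> fin_cases m <;> simp [ev_BpsiB, Q_G2_eps, eps]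
  case current_11 =>
    subst hT
    rw [sum_eps]
    simp [ev_ApsiA, ev_BpsiB, Q_G2_eps, Q_F2_eps]
  case DAB_22 =>
    obtain ⟨i, p, rfl⟩ := hT
    simp [ev_DAB, ev_ADB, Q_D1, Q_D2]
  case ADB_22 =>
    obtain ⟨i, p, rfl⟩ := hT
    simp [ev_BDA, ev_psiApsiB, Q_D1, Q_P2, cQ_eq, smul_smul]
  case psiABA_42 =>
    obtain ⟨l, m, n, p, rfl⟩ := hT
    rw [sum_sym3 (fun i j k => tr [lPsiA i, lA j, lB p, lA k]), map_smul, map_smul]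
    simp only [map_add, ev_psiABA]
    simp only [← map_add, Q_sym_F4, smul_zero]
  case psiBAB_24 =>
    obtain ⟨l, m, n, p, rfl⟩ := hT
    rw [sum_sym3 (fun i j k => tr [lPsiB i, lB j, lA p, lB k]), map_smul, map_smul]
    simp only [map_add, ev_psiBAB]
    simp only [← map_add, Q_sym_G4, smul_zero]
  case psiYYY_22 =>
    obtain ⟨p, q, rfl⟩ := hT
    rw [sum_eps]
    simp only [map_add, map_sub, ev_psiABA, ev_psiBAB, Q_F4', Q_G4']
    fin_cases p <;> fin_cases q <;> simp [S6_rotate_of_lt, S6_rotate_of_lt'] <;> first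
      | module
      | (rw [S6_rotate 0 1 0 0 1 0, S6_rotate 0 1 1 0 0 0, S6_rotate 1 0 0 0 0 1]; module)
      | (rw [S6_rotate 0 1 1 1 0 0, S6_rotate 1 1 0 0 0 1]; module)
  case current_AB_22 =>
    obtain ⟨a, b, rfl⟩ := hT
    rw [sum_eps]
    simp only [map_sub, map_mul, ev_AB, ev_ApsiA, ev_BpsiB, Q_mul_S2, Q_F2_eps, Q_G2_eps]
    simp [eps]
  case psiAA_AB_42 =>
    obtain ⟨l, m, n, p, rfl⟩ := hT
    rw [sum_sym3 (fun i j k => tr [lPsiA i, lA j] * tr [lB p, lA k])]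
    simp only [map_smul, map_add, map_mul, ev_psiAA, ev_BA, Q_mul_S2, Q_F2_eps]
    fin_cases l <;> fin_cases m <;> fin_cases n <;> simp [eps]
  case psiBB_AB_24 =>
    obtain ⟨l, m, n, p, rfl⟩ := hT
    rw [sum_sym3 (fun i j k => tr [lPsiB i, lB j] * tr [lA p, lB k])]
    simp only [map_smul, map_add, map_mul, ev_psiBB, ev_AB, Q_mul_S2, Q_G2_eps]
    fin_cases l <;> fin_cases m <;> fin_cases n <;> simp [eps]
  case psiAA_AB_22 =>
    obtain ⟨m, p, rfl⟩ := hT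
    simp only [map_sum, map_smul, map_mul, ev_psiAA, ev_AB, Q_mul_S2, Q_F2_eps]
    fin_cases m <;> simp [Fin.sum_univ_two, eps, sym2, delta]
  case psiBB_AB_22 =>
    obtain ⟨m, p, rfl⟩ := hT
    simp only [map_sum, map_smul, map_mul, ev_psiBB, ev_BA, Q_mul_S2, Q_G2_eps]
    fin_cases m <;> simp [Fin.sum_univ_two, eps, sym2, delta]
  all_goals
    obtain ⟨_, _, _, _, _, _, rfl⟩ := hT
    simp [ev_AB, ev_ABAB, Q_mul_S2, Q_mul_S4, Q_S2, Q_S4]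

end Closed

/-! ### Classification of the gauge-invariant operators of low order -/

theorem Letter.charge2_odd (l : Letter) : l.charge2 % 2 = 1 := by
  rw [Letter.charge2]; split_ifs <;> omega

theorem Letter.eq_of_charge2_eq_one {l : Letter} (h : l.charge2 = 1) :
    (l.kind.bif = false → l = lA l.idx) ∧ (l.kind.bif = true → l = lB l.idx) := by
  obtain ⟨t, n, i⟩ := l
  cases t <;> simp [Letter.charge2, Kind.odd] at h <;> simp [Kind.bif, lA, lB, h]
  all_goals omega

theorem Letter.eq_of_charge2_eq_three {l : Letter} (h : l.charge2 = 3) :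
    (l.kind.bif = false → l = lPsiB l.idx) ∧ (l.kind.bif = true → l = lPsiA l.idx) := by
  obtain ⟨t, n, i⟩ := l
  cases t <;> simp [Letter.charge2, Kind.odd] at h <;> simp [Kind.bif, lPsiA, lPsiB, h]
  all_goals omega

theorem Letter.eq_of_charge2_eq_five {l : Letter} (h : l.charge2 = 5) :
    (l.kind.bif = false → l = lDA l.idx) ∧ (l.kind.bif = true → l = lDB l.idx) := by
  obtain ⟨t, n, i⟩ := l
  cases t <;> simp [Letter.charge2, Kind.odd] at h <;>
    simp [Kind.bif, lDA, lDB, lA, lB, Letter.D] <;> omega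

theorem wordCharge2_cons (l : Letter) (w : List Letter) :
    wordCharge2 (l :: w) = l.charge2 + wordCharge2 w := by
  simp [wordCharge2]

theorem wordCharge2_nil : wordCharge2 [] = 0 := rfl

/-- Doubled charges of letters are odd and positive. This bounds the length of a word and fixes its
parity, so each order admits finitely many shapes. -/
theorem length_le_wordCharge2 (w : List Letter) :
    w.length ≤ wordCharge2 w ∧ (wordCharge2 w) % 2 = w.length % 2 := by
  induction w with
  | nil => simp [wordCharge2]
  | cons l w ih =>
    have := l.charge2_odd
    rw [wordCharge2_cons, List.length_cons]
    omega

/-- The algebra of multi-trace operators for all ranks. -/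
abbrev AllRanks : Type := ∀ N : ℕ, Alg N

/-- Evaluation for all ranks. -/
def evAll : Formal →ₐ[ℂ] AllRanks := AlgHom.pi ev

theorem evAll_apply (T : Formal) (N : ℕ) : evAll T N = ev N T := rfl

/-- Families over all ranks: a decomposition in `AllRanks` has coefficients independent of the rank,
so that closure at rank three can restrict the form of an operator at rank two. -/
def allS2 (i p : Fin 2) : AllRanks := fun N => S2 N i p
def allS4 (i p j q : Fin 2) : AllRanks := fun N => S4 N i p j q
def allS6 (i p j q t r : Fin 2) : AllRanks := fun N => S6 N i p j q t r
def allF2 (i j : Fin 2) : AllRanks := fun N => F2 N i j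
def allG2 (p q : Fin 2) : AllRanks := fun N => G2 N p q
def allF4 (i j p t : Fin 2) : AllRanks := fun N => F4 N i j p t
def allG4 (p q i r : Fin 2) : AllRanks := fun N => G4 N p q i r
def allD1 (i p : Fin 2) : AllRanks := fun N => D1 N i p
def allD2 (i p : Fin 2) : AllRanks := fun N => D2 N i p
def allP2 (i p : Fin 2) : AllRanks := fun N => P2 N i p

theorem allS2_mul_comm (i p : Fin 2) (X : AllRanks) : X * allS2 i p = allS2 i p * X :=
  funext fun N => S2_mul_comm i p (X N)

/-- Single traces of order `x`. -/
inductive Single1 : AllRanks → Prop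
  | S2 (i p : Fin 2) : Single1 (allS2 i p)

/-- Single traces of order `x^2`. -/
inductive Single2 : AllRanks → Prop
  | S4 (i p j q : Fin 2) : Single2 (allS4 i p j q)
  | F2 (i j : Fin 2) : Single2 (allF2 i j)
  | G2 (i j : Fin 2) : Single2 (allG2 i j)

/-- Single traces of order `x^3`. -/
inductive Single3 : AllRanks → Prop
  | S6 (i p j q t r : Fin 2) : Single3 (allS6 i p j q t r)
  | F4 (i j p t : Fin 2) : Single3 (allF4 i j p t)
  | G4 (i j p t : Fin 2) : Single3 (allG4 i j p t)
  | D1 (i p : Fin 2) : Single3 (allD1 i p)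
  | D2 (i p : Fin 2) : Single3 (allD2 i p)
  | P2 (i p : Fin 2) : Single3 (allP2 i p)

theorem single1_of_gaugeWord {w : List Letter} (h : GaugeWord w) (hc : wordCharge2 w = 2) :
    Single1 (evAll (tr w)) := by
  obtain ⟨h0, h1, h2⟩ := h
  have hl := length_le_wordCharge2 w
  match w with
  | [] => exact absurd rfl h0
  | [a] => exact absurd h1 (by simp)
  | [a, b] =>
    simp only [wordCharge2_cons, wordCharge2_nil] at hc
    have ha := a.charge2_odd
    have hb := b.charge2_odd
    have ha' := Letter.eq_of_charge2_eq_one (l := a) (by omega)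
    have hb' := Letter.eq_of_charge2_eq_one (l := b) (by omega)
    simp only [List.isChain_cons_cons, List.isChain_singleton, and_true] at h2
    cases e : a.kind.bif <;> cases e' : b.kind.bif <;> simp only [e, e'] at h2
    · exact absurd rfl h2
    · rw [ha'.1 e, hb'.2 e']; exact .S2 _ _
    · rw [ha'.2 e, hb'.1 e']
      rw [show evAll (tr [lB a.idx, lA b.idx]) = allS2 b.idx a.idx from
        funext fun N => ev_BA N _ _]
      exact .S2 _ _
    · exact absurd rfl h2
  | a :: b :: c :: w =>
    simp only [List.length_cons] at hl; omega

theorem single2_of_gaugeWord {w : List Letter} (h : GaugeWord w) (hc : wordCharge2 w = 4) :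
    Single2 (evAll (tr w)) := by
  obtain ⟨h0, h1, h2⟩ := h
  have hl := length_le_wordCharge2 w
  match w with
  | [] => exact absurd rfl h0
  | [a] => exact absurd h1 (by simp)
  | [a, b] =>
    simp only [wordCharge2_cons, wordCharge2_nil] at hc
    have ha := a.charge2_odd
    have hb := b.charge2_odd
    simp only [List.isChain_cons_cons, List.isChain_singleton, and_true] at h2
    obtain ⟨hca, hcb⟩ | ⟨hca, hcb⟩ : (a.charge2 = 1 ∧ b.charge2 = 3) ∨
      (a.charge2 = 3 ∧ b.charge2 = 1) := by omega
    · have ha' := Letter.eq_of_charge2_eq_one hca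
      have hb' := Letter.eq_of_charge2_eq_three hcb
      cases e : a.kind.bif <;> cases e' : b.kind.bif <;> simp only [e, e'] at h2
      · exact absurd rfl h2
      · rw [ha'.1 e, hb'.2 e', show evAll (tr [lA a.idx, lPsiA b.idx]) = allF2 b.idx a.idx from
          funext fun N => ev_ApsiA N _ _]
        exact .F2 _ _
      · rw [ha'.2 e, hb'.1 e', show evAll (tr [lB a.idx, lPsiB b.idx]) = allG2 b.idx a.idx from
          funext fun N => ev_BpsiB N _ _]
        exact .G2 _ _
      · exact absurd rfl h2
    · have ha' := Letter.eq_of_charge2_eq_three hca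
      have hb' := Letter.eq_of_charge2_eq_one hcb
      cases e : a.kind.bif <;> cases e' : b.kind.bif <;> simp only [e, e'] at h2
      · exact absurd rfl h2
      · rw [ha'.1 e, hb'.2 e']; exact .G2 _ _
      · rw [ha'.2 e, hb'.1 e']; exact .F2 _ _
      · exact absurd rfl h2
  | [a, b, c] => exact absurd h1 (by simp [Nat.even_iff])
  | [a, b, c, d] =>
    simp only [wordCharge2_cons, wordCharge2_nil] at hc
    have ha := a.charge2_odd
    have hb := b.charge2_odd
    have hc' := c.charge2_odd
    have hd := d.charge2_odd
    have ha' := Letter.eq_of_charge2_eq_one (l := a) (by omega)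
    have hb' := Letter.eq_of_charge2_eq_one (l := b) (by omega)
    have hc' := Letter.eq_of_charge2_eq_one (l := c) (by omega)
    have hd' := Letter.eq_of_charge2_eq_one (l := d) (by omega)
    simp only [List.isChain_cons_cons, List.isChain_singleton, and_true] at h2
    obtain ⟨h3, h4, h5⟩ := h2
    cases e : a.kind.bif
    · have e1 : b.kind.bif = true := by simpa [e] using h3
      have e2 : c.kind.bif = false := by simpa [e1] using h4
      have e3 : d.kind.bif = true := by simpa [e2] using h5
      rw [ha'.1 e, hb'.2 e1, hc'.1 e2, hd'.2 e3]
      exact .S4 _ _ _ _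
    · have e1 : b.kind.bif = false := by simpa [e] using h3
      have e2 : c.kind.bif = true := by simpa [e1] using h4
      have e3 : d.kind.bif = false := by simpa [e2] using h5
      rw [ha'.2 e, hb'.1 e1, hc'.2 e2, hd'.1 e3,
        show evAll (tr [lB a.idx, lA b.idx, lB c.idx, lA d.idx]) =
          allS4 b.idx c.idx d.idx a.idx from funext fun N => ev_BABA N _ _ _ _]
      exact .S4 _ _ _ _
  | a :: b :: c :: d :: e :: w =>
    simp only [List.length_cons] at hl; omega

section Rotations

variable (N : ℕ)

theorem ev_rot_odd_even (l : Letter) (w : List Letter) (h : l.kind.odd = false ∨ wordOdd w = false) :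
    ev N (tr (w ++ [l])) = ev N (tr (l :: w)) := by
  rcases h with h | h
  · exact (ev_tr_rotate_left N w h).symm
  · exact (ev_tr_rotate_right N w h).symm

theorem ev_ABApsiA (i j p t : Fin 2) : ev N (tr [lA j, lB p, lA t, lPsiA i]) = F4 N i j p t :=
  ev_rot_odd_even N (lPsiA i) [lA j, lB p, lA t] (.inr rfl)
theorem ev_BApsiAA (i j p t : Fin 2) : ev N (tr [lB p, lA t, lPsiA i, lA j]) = F4 N i j p t :=
  (ev_rot_odd_even N (lA j) [lB p, lA t, lPsiA i] (.inl rfl)).trans (ev_ABApsiA N i j p t)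
theorem ev_ApsiAAB (i j p t : Fin 2) : ev N (tr [lA t, lPsiA i, lA j, lB p]) = F4 N i j p t :=
  (ev_rot_odd_even N (lB p) [lA t, lPsiA i, lA j] (.inl rfl)).trans (ev_BApsiAA N i j p t)
theorem ev_BABpsiB (i j p t : Fin 2) : ev N (tr [lB j, lA p, lB t, lPsiB i]) = G4 N i j p t :=
  ev_rot_odd_even N (lPsiB i) [lB j, lA p, lB t] (.inr rfl)
theorem ev_ABpsiBB (i j p t : Fin 2) : ev N (tr [lA p, lB t, lPsiB i, lB j]) = G4 N i j p t :=
  (ev_rot_odd_even N (lB j) [lA p, lB t, lPsiB i] (.inl rfl)).trans (ev_BABpsiB N i j p t)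
theorem ev_BpsiBBA (i j p t : Fin 2) : ev N (tr [lB t, lPsiB i, lB j, lA p]) = G4 N i j p t :=
  (ev_rot_odd_even N (lA p) [lB t, lPsiB i, lB j] (.inl rfl)).trans (ev_ABpsiBB N i j p t)
theorem ev_DBA (i p : Fin 2) : ev N (tr [lDB p, lA i]) = D2 N i p :=
  ev_rot_odd_even N (lA i) [lDB p] (.inl rfl)
theorem ev_psiBpsiA (i p : Fin 2) : ev N (tr [lPsiB p, lPsiA i]) = -P2 N i p := by
  rw [ev_tr_rotate]
  change sgn true true • P2 N i p = _
  simp [sgn]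

end Rotations

/-- A span, and not the set of traces itself, is needed only for two fermions in the order
$\psi^B\psi^A$, whose rotation produces a sign. -/
theorem single3_of_gaugeWord {w : List Letter} (h : GaugeWord w) (hc : wordCharge2 w = 6) :
    evAll (tr w) ∈ Submodule.span ℂ {X | Single3 X} := by
  obtain ⟨h0, h1, h2⟩ := h
  have hl := length_le_wordCharge2 w
  match w with
  | [] => exact absurd rfl h0
  | [a] => exact absurd h1 (by simp)
  | [a, b] =>
    simp only [wordCharge2_cons, wordCharge2_nil] at hc
    have ha := a.charge2_odd
    have hb := b.charge2_odd
    simp only [List.isChain_cons_cons, List.isChain_singleton, and_true] at h2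
    obtain ⟨hca, hcb⟩ | ⟨hca, hcb⟩ | ⟨hca, hcb⟩ : (a.charge2 = 1 ∧ b.charge2 = 5) ∨
      (a.charge2 = 5 ∧ b.charge2 = 1) ∨ (a.charge2 = 3 ∧ b.charge2 = 3) := by omega
    · have ha' := Letter.eq_of_charge2_eq_one hca
      have hb' := Letter.eq_of_charge2_eq_five hcb
      cases e : a.kind.bif <;> cases e' : b.kind.bif <;> simp only [e, e'] at h2
      · exact absurd rfl h2
      · rw [ha'.1 e, hb'.2 e']
        exact Submodule.subset_span (.D2 _ _)
      · rw [ha'.2 e, hb'.1 e', show evAll (tr [lB a.idx, lDA b.idx]) = allD1 b.idx a.idx from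
          funext fun N => ev_BDA N _ _]
        exact Submodule.subset_span (.D1 _ _)
      · exact absurd rfl h2
    · have ha' := Letter.eq_of_charge2_eq_five hca
      have hb' := Letter.eq_of_charge2_eq_one hcb
      cases e : a.kind.bif <;> cases e' : b.kind.bif <;> simp only [e, e'] at h2
      · exact absurd rfl h2
      · rw [ha'.1 e, hb'.2 e']
        exact Submodule.subset_span (.D1 _ _)
      · rw [ha'.2 e, hb'.1 e', show evAll (tr [lDB a.idx, lA b.idx]) = allD2 b.idx a.idx from
          funext fun N => ev_DBA N _ _]
        exact Submodule.subset_span (.D2 _ _)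
      · exact absurd rfl h2
    · have ha' := Letter.eq_of_charge2_eq_three hca
      have hb' := Letter.eq_of_charge2_eq_three hcb
      cases e : a.kind.bif <;> cases e' : b.kind.bif <;> simp only [e, e'] at h2
      · exact absurd rfl h2
      · rw [ha'.1 e, hb'.2 e', show evAll (tr [lPsiB a.idx, lPsiA b.idx]) = -allP2 b.idx a.idx from
          funext fun N => ev_psiBpsiA N _ _]
        exact Submodule.neg_mem _ (Submodule.subset_span (.P2 _ _))
      · rw [ha'.2 e, hb'.1 e']
        exact Submodule.subset_span (.P2 _ _)
      · exact absurd rfl h2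
  | [a, b, c] => exact absurd h1 (by simp [Nat.even_iff])
  | [a, b, c, d] =>
    refine Submodule.subset_span ?_
    simp only [wordCharge2_cons, wordCharge2_nil] at hc
    have ha := a.charge2_odd
    have hb := b.charge2_odd
    have hc' := c.charge2_odd
    have hd := d.charge2_odd
    simp only [List.isChain_cons_cons, List.isChain_singleton, and_true] at h2
    obtain ⟨h3, h4, h5⟩ := h2
    have e1 : b.kind.bif = !a.kind.bif := by cases h : a.kind.bif <;> simpa [h] using h3
    have e2 : c.kind.bif = a.kind.bif := by cases h : a.kind.bif <;> simpa [h, e1] using h4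
    have e3 : d.kind.bif = !a.kind.bif := by cases h : a.kind.bif <;> simpa [h, e2] using h5
    obtain ⟨hca, hcb, hcc, hcd⟩ | ⟨hca, hcb, hcc, hcd⟩ | ⟨hca, hcb, hcc, hcd⟩ |
      ⟨hca, hcb, hcc, hcd⟩ :
      (a.charge2 = 3 ∧ b.charge2 = 1 ∧ c.charge2 = 1 ∧ d.charge2 = 1) ∨
      (a.charge2 = 1 ∧ b.charge2 = 3 ∧ c.charge2 = 1 ∧ d.charge2 = 1) ∨
      (a.charge2 = 1 ∧ b.charge2 = 1 ∧ c.charge2 = 3 ∧ d.charge2 = 1) ∨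
      (a.charge2 = 1 ∧ b.charge2 = 1 ∧ c.charge2 = 1 ∧ d.charge2 = 3) := by omega
    · have ha := Letter.eq_of_charge2_eq_three hca
      have hb := Letter.eq_of_charge2_eq_one hcb
      have hc := Letter.eq_of_charge2_eq_one hcc
      have hd := Letter.eq_of_charge2_eq_one hcd
      cases e : a.kind.bif <;> rw [e] at e1 e2 e3
      · rw [ha.1 e, hb.2 e1, hc.1 e2, hd.2 e3]; exact .G4 _ _ _ _
      · rw [ha.2 e, hb.1 e1, hc.2 e2, hd.1 e3]; exact .F4 _ _ _ _
    · have ha := Letter.eq_of_charge2_eq_one hca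
      have hb := Letter.eq_of_charge2_eq_three hcb
      have hc := Letter.eq_of_charge2_eq_one hcc
      have hd := Letter.eq_of_charge2_eq_one hcd
      cases e : a.kind.bif <;> rw [e] at e1 e2 e3
      · rw [ha.1 e, hb.2 e1, hc.1 e2, hd.2 e3,
          show evAll (tr [lA a.idx, lPsiA b.idx, lA c.idx, lB d.idx]) = allF4 _ _ _ _ from
            funext fun N => ev_ApsiAAB N _ _ _ _]
        exact .F4 _ _ _ _
      · rw [ha.2 e, hb.1 e1, hc.2 e2, hd.1 e3,
          show evAll (tr [lB a.idx, lPsiB b.idx, lB c.idx, lA d.idx]) = allG4 _ _ _ _ from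
            funext fun N => ev_BpsiBBA N _ _ _ _]
        exact .G4 _ _ _ _
    · have ha := Letter.eq_of_charge2_eq_one hca
      have hb := Letter.eq_of_charge2_eq_one hcb
      have hc := Letter.eq_of_charge2_eq_three hcc
      have hd := Letter.eq_of_charge2_eq_one hcd
      cases e : a.kind.bif <;> rw [e] at e1 e2 e3
      · rw [ha.1 e, hb.2 e1, hc.1 e2, hd.2 e3,
          show evAll (tr [lA a.idx, lB b.idx, lPsiB c.idx, lB d.idx]) = allG4 _ _ _ _ from
            funext fun N => ev_ABpsiBB N _ _ _ _]
        exact .G4 _ _ _ _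
      · rw [ha.2 e, hb.1 e1, hc.2 e2, hd.1 e3,
          show evAll (tr [lB a.idx, lA b.idx, lPsiA c.idx, lA d.idx]) = allF4 _ _ _ _ from
            funext fun N => ev_BApsiAA N _ _ _ _]
        exact .F4 _ _ _ _
    · have ha := Letter.eq_of_charge2_eq_one hca
      have hb := Letter.eq_of_charge2_eq_one hcb
      have hc := Letter.eq_of_charge2_eq_one hcc
      have hd := Letter.eq_of_charge2_eq_three hcd
      cases e : a.kind.bif <;> rw [e] at e1 e2 e3
      · rw [ha.1 e, hb.2 e1, hc.1 e2, hd.2 e3,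
          show evAll (tr [lA a.idx, lB b.idx, lA c.idx, lPsiA d.idx]) = allF4 _ _ _ _ from
            funext fun N => ev_ABApsiA N _ _ _ _]
        exact .F4 _ _ _ _
      · rw [ha.2 e, hb.1 e1, hc.2 e2, hd.1 e3,
          show evAll (tr [lB a.idx, lA b.idx, lB c.idx, lPsiB d.idx]) = allG4 _ _ _ _ from
            funext fun N => ev_BABpsiB N _ _ _ _]
        exact .G4 _ _ _ _
  | [a, b, c, d, e] => exact absurd h1 (by simp [Nat.even_iff])
  | [a, b, c, d, f, g] =>
    refine Submodule.subset_span ?_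
    simp only [wordCharge2_cons, wordCharge2_nil] at hc
    have ha := a.charge2_odd
    have hb := b.charge2_odd
    have hc' := c.charge2_odd
    have hd := d.charge2_odd
    have hf := f.charge2_odd
    have hg := g.charge2_odd
    have ha' := Letter.eq_of_charge2_eq_one (l := a) (by omega)
    have hb' := Letter.eq_of_charge2_eq_one (l := b) (by omega)
    have hc' := Letter.eq_of_charge2_eq_one (l := c) (by omega)
    have hd' := Letter.eq_of_charge2_eq_one (l := d) (by omega)
    have hf' := Letter.eq_of_charge2_eq_one (l := f) (by omega)
    have hg' := Letter.eq_of_charge2_eq_one (l := g) (by omega)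
    simp only [List.isChain_cons_cons, List.isChain_singleton, and_true] at h2
    obtain ⟨h3, h4, h5, h6, h7⟩ := h2
    cases e : a.kind.bif
    · have e1 : b.kind.bif = true := by simpa [e] using h3
      have e2 : c.kind.bif = false := by simpa [e1] using h4
      have e3 : d.kind.bif = true := by simpa [e2] using h5
      have e4 : f.kind.bif = false := by simpa [e3] using h6
      have e5 : g.kind.bif = true := by simpa [e4] using h7
      rw [ha'.1 e, hb'.2 e1, hc'.1 e2, hd'.2 e3, hf'.1 e4, hg'.2 e5]
      exact .S6 _ _ _ _ _ _
    · have e1 : b.kind.bif = false := by simpa [e] using h3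
      have e2 : c.kind.bif = true := by simpa [e1] using h4
      have e3 : d.kind.bif = false := by simpa [e2] using h5
      have e4 : f.kind.bif = true := by simpa [e3] using h6
      have e5 : g.kind.bif = false := by simpa [e4] using h7
      rw [ha'.2 e, hb'.1 e1, hc'.2 e2, hd'.1 e3, hf'.2 e4, hg'.1 e5,
        show evAll (tr [lB a.idx, lA b.idx, lB c.idx, lA d.idx, lB f.idx, lA g.idx]) =
          allS6 b.idx c.idx d.idx f.idx g.idx a.idx from funext fun N => ev_BABABA N _ _ _ _ _ _]
      exact .S6 _ _ _ _ _ _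
  | a :: b :: c :: d :: e :: f :: g :: w =>
    simp only [List.length_cons] at hl; omega

theorem two_le_wordCharge2 {w : List Letter} (h : GaugeWord w) :
    2 ≤ wordCharge2 w ∧ wordCharge2 w % 2 = 0 := by
  have hl := length_le_wordCharge2 w
  obtain ⟨h0, h1, -⟩ := h
  have := List.length_pos_iff.2 h0
  obtain ⟨n, hn⟩ := h1
  omega

theorem gaugeList_cons {L : List (List Letter)} (hL : ∀ w ∈ L, GaugeWord w) :
    2 * L.length ≤ (L.map wordCharge2).sum := by
  induction L with
  | nil => simp
  | cons w L ih =>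
    have := two_le_wordCharge2 (hL w (by simp))
    have := ih fun w hw => hL w (by simp [hw])
    simp only [List.map_cons, List.sum_cons, List.length_cons]
    omega

theorem evAll_mem_of_formalOps_zero {T : Formal} (hT : T ∈ formalOps 0) :
    evAll T ∈ Submodule.span ℂ {(1 : AllRanks)} := by
  refine Submodule.span_induction (p := fun T _ => evAll T ∈ Submodule.span ℂ {(1 : AllRanks)})
    ?_ ?_ ?_ ?_ hT
  · rintro _ ⟨L, hL, hd, rfl⟩
    have := gaugeList_cons hL
    obtain rfl : L = [] := List.length_eq_zero_iff.1 (by omega)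
    simp
  · simp
  · intro a b _ _ ha hb
    rw [map_add]; exact Submodule.add_mem _ ha hb
  · intro c a _ ha
    rw [map_smul]; exact Submodule.smul_mem _ _ ha

theorem evAll_mem_of_formalOps {d : ℕ} {U : Submodule ℂ AllRanks}
    (h : ∀ L : List (List Letter), (∀ w ∈ L, GaugeWord w) → (L.map wordCharge2).sum = 2 * d →
      2 * L.length ≤ 2 * d → (L.map fun w => evAll (tr w)).prod ∈ U) {T : Formal}
    (hT : T ∈ formalOps d) : evAll T ∈ U := by
  refine Submodule.span_induction (p := fun T _ => evAll T ∈ U) ?_ ?_ ?_ ?_ hT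
  · rintro _ ⟨L, hL, hd, rfl⟩
    have h1 := h L hL hd (hd ▸ gaugeList_cons hL)
    rw [map_list_prod, List.map_map]
    exact h1
  · simp
  · intro a b _ _ ha hb
    rw [map_add]; exact Submodule.add_mem _ ha hb
  · intro c a _ ha
    rw [map_smul]; exact Submodule.smul_mem _ _ ha

theorem evAll_mem_of_formalOps_one {U : Submodule ℂ AllRanks} (h : ∀ X, Single1 X → X ∈ U)
    {T : Formal} (hT : T ∈ formalOps 1) : evAll T ∈ U := by
  refine evAll_mem_of_formalOps (fun L hL hd hl => ?_) hT
  match L with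
  | [] => simp at hd
  | [w] => simpa using h _ (single1_of_gaugeWord (hL w (by simp)) (by simpa using hd))
  | a :: b :: L => simp at hl

theorem evAll_mem_of_formalOps_two {U : Submodule ℂ AllRanks} (h : ∀ X, Single2 X → X ∈ U)
    (h' : ∀ X Y, Single1 X → Single1 Y → X * Y ∈ U) {T : Formal} (hT : T ∈ formalOps 2) :
    evAll T ∈ U := by
  refine evAll_mem_of_formalOps (fun L hL hd hl => ?_) hT
  match L with
  | [] => simp at hd
  | [w] => simpa using h _ (single2_of_gaugeWord (hL w (by simp)) (by simpa using hd))
  | [w, w'] =>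
    have h1 := two_le_wordCharge2 (hL w (by simp))
    have h2 := two_le_wordCharge2 (hL w' (by simp))
    simp at hd
    simpa using h' _ _ (single1_of_gaugeWord (hL w (by simp)) (by omega))
      (single1_of_gaugeWord (hL w' (by simp)) (by omega))
  | a :: b :: c :: L => simp at hl; omega

theorem evAll_mem_of_formalOps_three {U : Submodule ℂ AllRanks} (h : ∀ X, Single3 X → X ∈ U)
    (h' : ∀ X Y, Single2 X → Single1 Y → X * Y ∈ U)
    (h'' : ∀ X Y Z, Single1 X → Single1 Y → Single1 Z → X * Y * Z ∈ U) {T : Formal}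
    (hT : T ∈ formalOps 3) : evAll T ∈ U := by
  refine evAll_mem_of_formalOps (fun L hL hd hl => ?_) hT
  match L with
  | [] => simp at hd
  | [w] =>
    have h1 := single3_of_gaugeWord (hL w (by simp)) (by simpa using hd)
    simpa using Submodule.span_le.2 h h1
  | [w, w'] =>
    have h1 := two_le_wordCharge2 (hL w (by simp))
    have h2 := two_le_wordCharge2 (hL w' (by simp))
    simp at hd
    obtain ⟨h3, h4⟩ | ⟨h3, h4⟩ : (wordCharge2 w = 4 ∧ wordCharge2 w' = 2) ∨
      (wordCharge2 w = 2 ∧ wordCharge2 w' = 4) := by omega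
    · simpa using h' _ _ (single2_of_gaugeWord (hL w (by simp)) h3)
        (single1_of_gaugeWord (hL w' (by simp)) h4)
    · have h5 := h' _ _ (single2_of_gaugeWord (hL w' (by simp)) h4)
        (single1_of_gaugeWord (hL w (by simp)) h3)
      have h6 := single1_of_gaugeWord (hL w (by simp)) h3
      -- A single trace of order $x$ is an `allS2`, which is central, so the order of the two
      -- factors does not matter.
      generalize hX : evAll (tr w) = X at h5 h6
      obtain ⟨i, p⟩ := h6
      rw [allS2_mul_comm] at h5
      simpa [hX] using h5
  | [w, w', w''] =>
    have h1 := two_le_wordCharge2 (hL w (by simp))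
    have h2 := two_le_wordCharge2 (hL w' (by simp))
    have h3 := two_le_wordCharge2 (hL w'' (by simp))
    simp at hd
    have := h'' _ _ _ (single1_of_gaugeWord (hL w (by simp)) (by omega))
      (single1_of_gaugeWord (hL w' (by simp)) (by omega))
      (single1_of_gaugeWord (hL w'' (by simp)) (by omega))
    simpa [mul_assoc] using this
  | a :: b :: c :: d :: L => simp at hl; omega

/-! ### Spanning sets for the operators of order `x^3` -/

/-- A triple product of doublets is a quadruplet and two doublets. The symmetric part together with
the contractions of the first and of the last pair of indices recovers all eight components; the
weights 2/3 and 1/3 solve these linear equations. -/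
theorem mem_of_sym3_of_eps {M : Type*} [AddCommGroup M] [Module ℂ M] {U : Submodule ℂ M}
    {f : Fin 2 → Fin 2 → Fin 2 → M}
    (hs : ∀ l m n, f l m n + f m n l + f n l m + f l n m + f m l n + f n m l ∈ U)
    (h1 : ∀ k, f 0 1 k - f 1 0 k ∈ U) (h2 : ∀ i, f i 0 1 - f i 1 0 ∈ U) (i j k : Fin 2) :
    f i j k ∈ U := by
  have h000 : f 0 0 0 ∈ U := by
    convert U.smul_mem (1 / 6 : ℂ) (hs 0 0 0) using 1; module
  have h111 : f 1 1 1 ∈ U := by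
    convert U.smul_mem (1 / 6 : ℂ) (hs 1 1 1) using 1; module
  have h001 : f 0 0 1 ∈ U := by
    convert U.add_mem (U.smul_mem (1 / 6 : ℂ) (hs 0 0 1)) (U.add_mem
      (U.smul_mem (2 / 3 : ℂ) (h2 0)) (U.smul_mem (1 / 3 : ℂ) (h1 0))) using 1; module
  have h011 : f 0 1 1 ∈ U := by
    convert U.add_mem (U.smul_mem (1 / 6 : ℂ) (hs 0 1 1)) (U.add_mem
      (U.smul_mem (2 / 3 : ℂ) (h1 1)) (U.smul_mem (1 / 3 : ℂ) (h2 1))) using 1; module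
  have h010 : f 0 1 0 ∈ U := by
    convert U.sub_mem h001 (h2 0) using 1; module
  have h100 : f 1 0 0 ∈ U := by
    convert U.sub_mem h010 (h1 0) using 1; module
  have h101 : f 1 0 1 ∈ U := by
    convert U.sub_mem h011 (h1 1) using 1; module
  have h110 : f 1 1 0 ∈ U := by
    convert U.sub_mem h101 (h2 1) using 1; module
  fin_cases i <;> fin_cases j <;> fin_cases k <;> assumption

/-- A variant for tensors whose last two indices are contracted after symmetrising the first
two. -/
theorem mem_of_sym3_of_eps' {M : Type*} [AddCommGroup M] [Module ℂ M] {U : Submodule ℂ M}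
    {f : Fin 2 → Fin 2 → Fin 2 → M}
    (hs : ∀ l m n, f l m n + f m n l + f n l m + f l n m + f m l n + f n m l ∈ U)
    (h1 : ∀ k, f 0 1 k - f 1 0 k ∈ U)
    (h2 : ∀ m, ∑ i, ∑ j, ∑ l, ∑ k, (sym2 i j l m * eps l k) • f i j k ∈ U) (i j k : Fin 2) :
    f i j k ∈ U := by
  -- The contraction after symmetrising differs from the contraction of the last two indices by half
  -- of the contraction of the first two.
  refine mem_of_sym3_of_eps hs h1 (fun m => ?_) i j k
  have h3 := h2 m
  fin_cases m
  · convert U.add_mem h3 (U.smul_mem (-1 / 2 : ℂ) (h1 0)) using 1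
    simp [Fin.sum_univ_two, sym2, delta, eps]; module
  · convert U.add_mem h3 (U.smul_mem (-1 / 2 : ℂ) (h1 1)) using 1
    simp [Fin.sum_univ_two, sym2, delta, eps]; module

/-- The span of the representatives other than the fortuitous ones. -/
def gravSpan (d : ℕ) : Submodule ℂ Formal :=
  Submodule.span ℂ {T | ∃ m : Multiplet, m.order = d ∧ m ≠ .fortuitous ∧ T ∈ m.reps}

theorem mem_gravSpan (m : Multiplet) (hm : m ≠ .fortuitous) {T : Formal} (hT : T ∈ m.reps) :
    T ∈ gravSpan m.order := Submodule.subset_span ⟨m, rfl, hm, hT⟩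

/-! ### Elimination of traces with one fermion by multi-gravitons, exact operators and $\mathcal
O_f$ -/

section AllRanks

theorem evAll_AB (i p : Fin 2) : evAll (tr [lA i, lB p]) = allS2 i p := rfl
theorem evAll_BA (i p : Fin 2) : evAll (tr [lB p, lA i]) = allS2 i p := funext fun N => ev_BA N _ _
theorem evAll_psiAA (i j : Fin 2) : evAll (tr [lPsiA i, lA j]) = allF2 i j := rfl
theorem evAll_ApsiA (i j : Fin 2) : evAll (tr [lA j, lPsiA i]) = allF2 i j :=
  funext fun N => ev_ApsiA N _ _
theorem evAll_psiBB (i j : Fin 2) : evAll (tr [lPsiB i, lB j]) = allG2 i j := rfl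
theorem evAll_BpsiB (i j : Fin 2) : evAll (tr [lB j, lPsiB i]) = allG2 i j :=
  funext fun N => ev_BpsiB N _ _
theorem evAll_psiABA (i j p t : Fin 2) :
    evAll (tr [lPsiA i, lA j, lB p, lA t]) = allF4 i j p t := rfl
theorem evAll_psiBAB (i j p t : Fin 2) :
    evAll (tr [lPsiB i, lB j, lA p, lB t]) = allG4 i j p t := rfl
theorem evAll_DAB (i p : Fin 2) : evAll (tr [lDA i, lB p]) = allD1 i p := rfl
theorem evAll_BDA (i p : Fin 2) : evAll (tr [lB p, lDA i]) = allD1 i p :=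
  funext fun N => ev_BDA N _ _
theorem evAll_ADB (i p : Fin 2) : evAll (tr [lA i, lDB p]) = allD2 i p := rfl
theorem evAll_psiApsiB (i p : Fin 2) : evAll (tr [lPsiA i, lPsiB p]) = allP2 i p := rfl

/-- The traces with one fermion and three scalars whose indices are contracted. -/
def kap1 (a b : Fin 2) : AllRanks := (allF2 0 1 - allF2 1 0) * allS2 a b
def kap2 (a b : Fin 2) : AllRanks := allF4 0 1 b a - allF4 1 0 b a
def allE2 (i p : Fin 2) : AllRanks := fun N => E2 N i p

/-- The fortuitous representatives. -/
def fort (a b : Fin 2) : Formal := ∑ i, ∑ j, eps i j •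
      (tr [lPsiA i, lA j, lB b, lA a] + tr [lPsiB i, lB j, lA a, lB b] -
        (3 / 4 : ℂ) • (tr [lB b, lA a] * (tr [lPsiA i, lA j] + tr [lPsiB i, lB j])))

def evFort (p : Fin 2 × Fin 2) : AllRanks := evAll (fort p.1 p.2)

theorem evAll_fort (a b : Fin 2) : evAll (fort a b) = kap2 a b + (allG4 0 1 a b - allG4 1 0 a b)
    - (3 / 4 : ℂ) • (kap1 a b + (allG2 0 1 - allG2 1 0) * allS2 a b) := by
  simp only [fort, sum_eps, map_sub, map_add, map_smul, map_mul, evAll_psiABA, evAll_psiBAB,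
    evAll_BA, evAll_psiAA, evAll_psiBB, kap1, kap2, ← allS2_mul_comm, mul_add, sub_mul]
  module

/-- The graviton operators for all ranks. -/
def allGrav (d : ℕ) : Submodule ℂ AllRanks := (gravSpan d).map evAll.toLinearMap

theorem mem_allGrav (m : Multiplet) (hm : m ≠ .fortuitous) {T : Formal} (hT : T ∈ m.reps)
    {X : AllRanks} (hX : evAll T = X) : X ∈ allGrav m.order :=
  ⟨T, mem_gravSpan m hm hT, hX⟩

theorem sym_F4_mem (l m n p : Fin 2) : allF4 l m p n + allF4 m n p l + allF4 n l p m +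
    allF4 l n p m + allF4 m l p n + allF4 n m p l ∈ allGrav 3 := by
  have h := mem_allGrav .psiABA_42 (by simp) ⟨l, m, n, p, rfl⟩ rfl
  rw [sum_sym3 (fun i j k => tr [lPsiA i, lA j, lB p, lA k]), map_smul] at h
  simpa only [map_add, evAll_psiABA] using ((allGrav 3).smul_mem_iff (by norm_num)).1 h

theorem sym_G4_mem (l m n p : Fin 2) : allG4 l m p n + allG4 m n p l + allG4 n l p m +
    allG4 l n p m + allG4 m l p n + allG4 n m p l ∈ allGrav 3 := by
  have h := mem_allGrav .psiBAB_24 (by simp) ⟨l, m, n, p, rfl⟩ rfl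
  rw [sum_sym3 (fun i j k => tr [lPsiB i, lB j, lA p, lB k]), map_smul] at h
  simpa only [map_add, evAll_psiBAB] using ((allGrav 3).smul_mem_iff (by norm_num)).1 h

theorem sym_F2S2_mem (l m n p : Fin 2) : allF2 l m * allS2 n p + allF2 m n * allS2 l p +
    allF2 n l * allS2 m p + allF2 l n * allS2 m p + allF2 m l * allS2 n p + allF2 n m * allS2 l p
      ∈ allGrav 3 := by
  have h := mem_allGrav .psiAA_AB_42 (by simp) ⟨l, m, n, p, rfl⟩ rfl
  rw [sum_sym3 (fun i j k => tr [lPsiA i, lA j] * tr [lB p, lA k]), map_smul] at h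
  simpa only [map_add, map_mul, evAll_psiAA, evAll_BA] using
    ((allGrav 3).smul_mem_iff (by norm_num)).1 h

theorem sym_G2S2_mem (l m n p : Fin 2) : allG2 l m * allS2 p n + allG2 m n * allS2 p l +
    allG2 n l * allS2 p m + allG2 l n * allS2 p m + allG2 m l * allS2 p n + allG2 n m * allS2 p l
      ∈ allGrav 3 := by
  have h := mem_allGrav .psiBB_AB_24 (by simp) ⟨l, m, n, p, rfl⟩ rfl
  rw [sum_sym3 (fun i j k => tr [lPsiB i, lB j] * tr [lA p, lB k]), map_smul] at h
  simpa only [map_add, map_mul, evAll_psiBB, evAll_AB] using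
    ((allGrav 3).smul_mem_iff (by norm_num)).1 h

theorem eps_F2S2_mem (m p : Fin 2) :
    ∑ i, ∑ j, ∑ l, ∑ k, (sym2 i j l m * eps l k) • (allF2 i j * allS2 k p) ∈ allGrav 3 := by
  refine mem_allGrav .psiAA_AB_22 (by simp) ⟨m, p, rfl⟩ ?_
  simp only [map_sum, map_smul, map_mul, evAll_psiAA, evAll_AB]

theorem eps_G2S2_mem (m p : Fin 2) :
    ∑ i, ∑ j, ∑ l, ∑ k, (sym2 i j l m * eps l k) • (allG2 i j * allS2 p k) ∈ allGrav 3 := by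
  refine mem_allGrav .psiBB_AB_22 (by simp) ⟨m, p, rfl⟩ ?_
  simp only [map_sum, map_smul, map_mul, evAll_psiBB, evAll_BA]

theorem current_mem (a b : Fin 2) :
    (allG2 0 1 - allG2 1 0) * allS2 a b - kap1 a b ∈ allGrav 3 := by
  refine mem_allGrav .current_AB_22 (by simp) ⟨a, b, rfl⟩ ?_
  simp only [sum_eps, map_sub, map_mul, evAll_ApsiA, evAll_BpsiB, evAll_AB, kap1]
  noncomm_ring

theorem psiYYY_mem (a b : Fin 2) : kap2 a b - (allG4 0 1 a b - allG4 1 0 a b) +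
    (allF4 a 0 b 1 - allF4 a 1 b 0) ∈ allGrav 3 := by
  refine mem_allGrav .psiYYY_22 (by simp) ⟨a, b, rfl⟩ ?_
  simp only [sum_eps, map_sub, map_add, evAll_psiABA, evAll_psiBAB, kap2]
  noncomm_ring

theorem allE2_eq (a b : Fin 2) : allE2 a b = -((allG4 b 0 a 1 - allG4 b 1 a 0) +
    (allF4 a 0 b 1 - allF4 a 1 b 0)) := by
  funext N
  simp only [allE2, E2, sum_eps]
  simp only [Pi.neg_apply, Pi.add_apply, Pi.sub_apply, allG4, allF4]
  abel

/-- The span of the operators with one fermion, up to gravitons. -/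
def allFermi : Submodule ℂ AllRanks := allGrav 3 ⊔
  Submodule.span ℂ (Set.range fun p : Fin 2 × Fin 2 => allE2 p.1 p.2) ⊔
  Submodule.span ℂ (Set.range fun p : Fin 2 × Fin 2 => kap1 p.1 p.2) ⊔
  Submodule.span ℂ (Set.range fun p : Fin 2 × Fin 2 => kap2 p.1 p.2) ⊔
  Submodule.span ℂ (Set.range evFort)

theorem allGrav_le_allFermi : allGrav 3 ≤ allFermi :=
  le_sup_left.trans (le_sup_left.trans (le_sup_left.trans le_sup_left))

theorem allE2_mem (a b : Fin 2) : allE2 a b ∈ allFermi :=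
  (le_sup_right.trans (le_sup_left.trans (le_sup_left.trans le_sup_left)) : _ ≤ allFermi)
    (Submodule.subset_span ⟨(a, b), rfl⟩)

theorem kap1_mem (a b : Fin 2) : kap1 a b ∈ allFermi :=
  (le_sup_right.trans (le_sup_left.trans le_sup_left) : _ ≤ allFermi)
    (Submodule.subset_span ⟨(a, b), rfl⟩)

theorem kap2_mem (a b : Fin 2) : kap2 a b ∈ allFermi :=
  (le_sup_right.trans le_sup_left : _ ≤ allFermi) (Submodule.subset_span ⟨(a, b), rfl⟩)

theorem fort_mem (a b : Fin 2) : evAll (fort a b) ∈ allFermi :=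
  (le_sup_right : _ ≤ allFermi) (Submodule.subset_span ⟨(a, b), rfl⟩)

/-- From here on the relations are solved in triangular order. The current expresses the contraction
of `allG2` by `kap1`, the definition of $\mathcal O_f$ yields the first contraction of `allG4`,
`psiYYY_22` yields the second one of `allF4`, and `allE2` the second one of `allG4`. -/
theorem g_mem (a b : Fin 2) : (allG2 0 1 - allG2 1 0) * allS2 a b ∈ allFermi := by
  have := allFermi.add_mem (allGrav_le_allFermi (current_mem a b)) (kap1_mem a b)
  simpa using this

theorem v1_mem (a b : Fin 2) : allG4 0 1 a b - allG4 1 0 a b ∈ allFermi := by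
  have := allFermi.add_mem (allFermi.sub_mem (fort_mem a b) (kap2_mem a b))
    (allFermi.smul_mem (3 / 4 : ℂ) (allFermi.add_mem (kap1_mem a b) (g_mem a b)))
  rw [evAll_fort] at this
  convert this using 1
  module

theorem u2_mem (a b : Fin 2) : allF4 a 0 b 1 - allF4 a 1 b 0 ∈ allFermi := by
  have := allFermi.add_mem (allFermi.sub_mem (allGrav_le_allFermi (psiYYY_mem a b)) (kap2_mem a b))
    (v1_mem a b)
  convert this using 1
  module

theorem v2_mem (a b : Fin 2) : allG4 b 0 a 1 - allG4 b 1 a 0 ∈ allFermi := by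
  have := allFermi.neg_mem (allFermi.add_mem (allE2_mem a b) (u2_mem a b))
  rw [allE2_eq] at this
  convert this using 1
  module

theorem allF4_mem (i j p t : Fin 2) : allF4 i j p t ∈ allFermi :=
  mem_of_sym3_of_eps (f := fun i j k => allF4 i j p k)
    (fun l m n => allGrav_le_allFermi (sym_F4_mem l m n p)) (fun k => kap2_mem k p)
    (fun i => u2_mem i p) i j t

theorem allG4_mem (i j p t : Fin 2) : allG4 i j p t ∈ allFermi :=
  mem_of_sym3_of_eps (f := fun i j k => allG4 i j p k)
    (fun l m n => allGrav_le_allFermi (sym_G4_mem l m n p)) (fun k => v1_mem p k)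
    (fun i => v2_mem p i) i j t

theorem allF2S2_mem (i j k p : Fin 2) : allF2 i j * allS2 k p ∈ allFermi :=
  mem_of_sym3_of_eps' (f := fun i j k => allF2 i j * allS2 k p)
    (fun l m n => allGrav_le_allFermi (sym_F2S2_mem l m n p))
    (fun k => by rw [← sub_mul]; exact kap1_mem k p)
    (fun i => allGrav_le_allFermi (eps_F2S2_mem i p)) i j k

theorem allG2S2_mem (i j k p : Fin 2) : allG2 i j * allS2 p k ∈ allFermi :=
  mem_of_sym3_of_eps' (f := fun i j k => allG2 i j * allS2 p k)
    (fun l m n => allGrav_le_allFermi (sym_G2S2_mem l m n p))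
    (fun k => by rw [← sub_mul]; exact g_mem p k)
    (fun i => allGrav_le_allFermi (eps_G2S2_mem i p)) i j k

/-- The scalar operators of order `x^3`. -/
inductive Scalar3 : AllRanks → Prop
  | S6 (i p j q t r : Fin 2) : Scalar3 (allS6 i p j q t r)
  | S4S2 (i p j q t r : Fin 2) : Scalar3 (allS4 i p j q * allS2 t r)
  | S2S2S2 (i p j q t r : Fin 2) : Scalar3 (allS2 i p * allS2 j q * allS2 t r)

/-- All operators of order `x^3`, up to gravitons. -/
def allOps3 : Submodule ℂ AllRanks := Submodule.span ℂ {X | Scalar3 X} ⊔ allFermi ⊔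
  Submodule.span ℂ (Set.range fun p : Fin 2 × Fin 2 => allP2 p.1 p.2)

theorem evAll_mem_allOps3 {T : Formal} (hT : T ∈ formalOps 3) : evAll T ∈ allOps3 := by
  have hs : ∀ X, Scalar3 X → X ∈ allOps3 := fun X hX =>
    (le_sup_left.trans le_sup_left : _ ≤ allOps3) (Submodule.subset_span hX)
  have hf : allFermi ≤ allOps3 := le_sup_right.trans le_sup_left
  have hg := allGrav_le_allFermi.trans hf
  have hp : ∀ a b, allP2 a b ∈ allOps3 := fun a b =>
    (le_sup_right : _ ≤ allOps3) (Submodule.subset_span ⟨(a, b), rfl⟩)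
  have hd1 : ∀ a b, allD1 a b ∈ allOps3 := fun a b => by
    have h := hg (mem_allGrav .ADB_22 (by simp) ⟨a, b, rfl⟩ rfl)
    rw [map_add, map_smul, evAll_BDA, evAll_psiApsiB] at h
    exact (allOps3.smul_mem_iff Complex.I_ne_zero).1 ((allOps3.add_mem_iff_left (hp a b)).1 h)
  have hd2 : ∀ a b, allD2 a b ∈ allOps3 := fun a b => by
    have h := hg (mem_allGrav .DAB_22 (by simp) ⟨a, b, rfl⟩ rfl)
    rw [map_add, evAll_DAB, evAll_ADB] at h
    exact (allOps3.add_mem_iff_right (hd1 a b)).1 h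
  refine evAll_mem_of_formalOps_three ?_ ?_ ?_ hT
  · rintro _ ⟨⟩
    · exact hs _ (.S6 _ _ _ _ _ _)
    · exact hf (allF4_mem _ _ _ _)
    · exact hf (allG4_mem _ _ _ _)
    · exact hd1 _ _
    · exact hd2 _ _
    · exact hp _ _
  · rintro _ _ ⟨⟩ ⟨⟩
    · exact hs _ (.S4S2 _ _ _ _ _ _)
    · exact hf (allF2S2_mem _ _ _ _)
    · exact hf (allG2S2_mem _ _ _ _)
  · rintro _ _ _ ⟨⟩ ⟨⟩ ⟨⟩
    exact hs _ (.S2S2S2 _ _ _ _ _ _)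

/-- The general form of an operator of order `x^3`. -/
theorem exists_decomposition {T : Formal} (hT : T ∈ formalOps 3) :
    ∃ s ∈ Submodule.span ℂ {X | Scalar3 X}, ∃ G ∈ gravSpan 3,
      ∃ e a b c d : Fin 2 × Fin 2 → ℂ, evAll T = s + evAll G + ∑ p, e p • allE2 p.1 p.2 +
        ∑ p, a p • kap1 p.1 p.2 + ∑ p, b p • kap2 p.1 p.2 + ∑ p, c p • evFort p +
        ∑ p, d p • allP2 p.1 p.2 := by
  have h := evAll_mem_allOps3 hT
  simp only [allOps3, allFermi, Submodule.mem_sup, Submodule.mem_span_range_iff_exists_fun] at h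
  obtain ⟨_, ⟨s, hs, _, ⟨_, ⟨_, ⟨_, ⟨_, ⟨G, hG, rfl⟩, _, ⟨e, rfl⟩, rfl⟩, _, ⟨a, rfl⟩, rfl⟩, _,
    ⟨b, rfl⟩, rfl⟩, _, ⟨c, rfl⟩, rfl⟩, rfl⟩, _, ⟨d, rfl⟩, hh⟩ := h
  refine ⟨s, hs, G, hG, e, a, b, c, d, ?_⟩
  rw [← hh]
  simp only [add_assoc]
  rfl

end AllRanks

/-! ### Trace identities of `2 × 2` matrices -/

/-- The center is a commutative ring, where trace identities can be proved by ring arithmetic. -/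
theorem HasParity.mem_center {N : ℕ} {X : Alg N} (h : HasParity false X) :
    X ∈ Subalgebra.center ℂ (Alg N) := Subalgebra.mem_center_iff.2 h.commute

section Central

variable (N : ℕ)

/-- The scalar traces as elements of the commutative center. -/
def zS2 (i p : Fin 2) : Subalgebra.center ℂ (Alg N) := ⟨S2 N i p, (S2_even i p).mem_center⟩
def zS4 (i p j q : Fin 2) : Subalgebra.center ℂ (Alg N) :=
  ⟨S4 N i p j q, (S4_even i p j q).mem_center⟩
def zS6 (i p j q t r : Fin 2) : Subalgebra.center ℂ (Alg N) :=
  ⟨S6 N i p j q t r, (S6_even i p j q t r).mem_center⟩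

theorem zS4_rotate (i p j q : Fin 2) : zS4 N i p j q = zS4 N j q i p :=
  Subtype.ext (S4_rotate i p j q)

theorem zS6_rotate (i p j q t r : Fin 2) : zS6 N i p j q t r = zS6 N j q t r i p :=
  Subtype.ext (S6_rotate i p j q t r)

end Central

/-- The trilinear polarisation of the Cayley-Hamilton theorem for 2 × 2 matrices; it is special to
rank two and is the source of $\mathcal O_f$. -/
theorem trace_identity_comm {R : Type*} [CommRing R] (X Y Z : Matrix (Fin 2) (Fin 2) R) :
    (X * Y * Z).trace + (X * Z * Y).trace = X.trace * (Y * Z).trace + Y.trace * (X * Z).trace +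
      Z.trace * (X * Y).trace - X.trace * Y.trace * Z.trace := by
  simp only [Matrix.trace_fin_two, Matrix.mul_apply, Fin.sum_univ_two]
  ring

theorem MatParity.exists_center {N : ℕ} {X : Matrix (Fin N) (Fin N) (Alg N)}
    (h : MatParity false X) : ∃ X' : Matrix (Fin N) (Fin N) (Subalgebra.center ℂ (Alg N)),
      X = (Subalgebra.center ℂ (Alg N)).val.mapMatrix X' :=
  ⟨Matrix.of fun a b => ⟨X a b, (h a b).mem_center⟩, by ext; rfl⟩

/-- Even matrices have central entries, so the commutative identity can be transported along the
inclusion of the center. -/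
theorem trace_identity {X Y Z : Matrix (Fin 2) (Fin 2) (Alg 2)} (hX : MatParity false X)
    (hY : MatParity false Y) (hZ : MatParity false Z) :
    (X * Y * Z).trace + (X * Z * Y).trace = X.trace * (Y * Z).trace + Y.trace * (X * Z).trace +
      Z.trace * (X * Y).trace - X.trace * Y.trace * Z.trace := by
  obtain ⟨X, rfl⟩ := hX.exists_center
  obtain ⟨Y, rfl⟩ := hY.exists_center
  obtain ⟨Z, rfl⟩ := hZ.exists_center
  have h := congrArg (Subalgebra.center ℂ (Alg 2)).val (trace_identity_comm X Y Z)
  have e : ∀ W : Matrix (Fin 2) (Fin 2) (Subalgebra.center ℂ (Alg 2)),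
      ((Subalgebra.center ℂ (Alg 2)).val.mapMatrix W).trace =
        (Subalgebra.center ℂ (Alg 2)).val W.trace := fun W => by
    simp [Matrix.trace]
  simp only [← map_mul, e]
  rw [← map_add, h]
  rfl

theorem zS6_identity (i p j q t r : Fin 2) : zS6 2 i p j q t r + zS6 2 i p t r j q =
    zS2 2 i p * zS4 2 j q t r + zS2 2 j q * zS4 2 i p t r + zS2 2 t r * zS4 2 i p j q -
      zS2 2 i p * zS2 2 j q * zS2 2 t r := by
  have h := trace_identity ((MatParity.mat (N := 2) (lA i)).mul (MatParity.mat (lB p)))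
    ((MatParity.mat (lA j)).mul (MatParity.mat (lB q)))
    ((MatParity.mat (lA t)).mul (MatParity.mat (lB r)))
  apply Subtype.ext
  simpa [zS6, zS4, zS2, S6, S4, S2, ev_tr, mul_assoc] using h

/-- The trace identity for blocks $BA$ instead of $AB$. After rotation to words beginning with $A$
the $B$ indices sit in other places than in `zS6_identity`, so this is a different relation. -/
theorem zS6_identity' (i p j q t r : Fin 2) : zS6 2 i q j r t p + zS6 2 i r t q j p =
    zS2 2 i p * zS4 2 j r t q + zS2 2 j q * zS4 2 i r t p + zS2 2 t r * zS4 2 i q j p -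
      zS2 2 i p * zS2 2 j q * zS2 2 t r := by
  have h := trace_identity ((MatParity.mat (N := 2) (lB p)).mul (MatParity.mat (lA i)))
    ((MatParity.mat (lB q)).mul (MatParity.mat (lA j)))
    ((MatParity.mat (lB r)).mul (MatParity.mat (lA t)))
  apply Subtype.ext
  have h2 := ev_BA 2
  have h4 := ev_BABA 2
  have h6 := ev_BABABA 2
  simp only [ev_tr, List.map_cons, List.map_nil, List.prod_cons, List.prod_nil, mul_one] at h2 h4 h6
  rw [mul_assoc (Matrix.trace _) (Matrix.trace _) (Matrix.trace _)] at h
  simp only [mul_assoc (mat 2 _)] at h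
  simp only [h2, h4, h6] at h
  rw [← mul_assoc] at h
  exact h

/-! ### Variations of the contracted fermionic traces, and closure of $\mathcal O_f$ at rank two -/

section Fermi

variable {N k : ℕ}

/-- The variations of the contracted traces with one fermion, without the coefficient. -/
def y1 (N : ℕ) (a b : Fin 2) : Subalgebra.center ℂ (Alg N) :=
  2 * ((zS4 N 0 1 1 0 - zS4 N 0 0 1 1) * zS2 N a b)
def y2 (N : ℕ) (a b : Fin 2) : Subalgebra.center ℂ (Alg N) :=
  (zS6 N 0 1 1 b a 0 - zS6 N 0 0 1 b a 1) - (zS6 N 1 1 0 b a 0 - zS6 N 1 0 0 b a 1)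
-- The coefficient 3 is 3/4 times the two equal contributions, each twice `S4'` times the scalar
-- trace, of the two double-trace terms of $\mathcal O_f$.
def y3 (N : ℕ) (a b : Fin 2) : Subalgebra.center ℂ (Alg N) :=
  y2 N a b - (zS6 N 0 0 1 1 a b - zS6 N 1 0 0 1 a b) + (zS6 N 0 1 1 0 a b - zS6 N 1 1 0 0 a b) -
    3 * ((zS4 N 0 1 1 0 - zS4 N 0 0 1 1) * zS2 N a b)

theorem Q_kap1 (a b : Fin 2) : Q N k (kap1 a b N) = cQ k • (y1 N a b : Alg N) := by
  change Q N k ((F2 N 0 1 - F2 N 1 0) * S2 N a b) = cQ k • (2 * ((S4 N 0 1 1 0 - S4 N 0 0 1 1) *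
    S2 N a b))
  rw [Q_mul_S2, map_sub, Q_F2_eps, Q_F2_eps, ← sub_smul]
  simp only [eps]
  simp only [S4', smul_mul_assoc]
  simp
  rw [two_mul]; module

theorem Q_kap2 (a b : Fin 2) : Q N k (kap2 a b N) = cQ k • (y2 N a b : Alg N) := by
  change Q N k (F4 N 0 1 b a - F4 N 1 0 b a) = cQ k • ((S6 N 0 1 1 b a 0 - S6 N 0 0 1 b a 1) -
    (S6 N 1 1 0 b a 0 - S6 N 1 0 0 b a 1))
  rw [map_sub, Q_F4', Q_F4']
  module

theorem Q_fort (a b : Fin 2) : Q N k (ev N (fort a b)) = cQ k • (y3 N a b : Alg N) := by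
  have h := congrFun (evAll_fort a b) N
  rw [evAll_apply] at h
  rw [h]
  change Q N k (kap2 a b N + (G4 N 0 1 a b - G4 N 1 0 a b) - (3 / 4 : ℂ) • (kap1 a b N +
    (G2 N 0 1 - G2 N 1 0) * S2 N a b)) = cQ k • ((y2 N a b : Alg N) -
    (S6 N 0 0 1 1 a b - S6 N 1 0 0 1 a b) + (S6 N 0 1 1 0 a b - S6 N 1 1 0 0 a b) -
    3 * ((S4 N 0 1 1 0 - S4 N 0 0 1 1) * S2 N a b))
  have h1 : (y1 N a b : Alg N) = 2 * ((S4 N 0 1 1 0 - S4 N 0 0 1 1) * S2 N a b) := rfl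
  have h3 : (3 : Alg N) = (3 : ℂ) • 1 := by rw [← map_ofNat (algebraMap ℂ (Alg N)) 3,
    Algebra.algebraMap_eq_smul_one]
  have h2 : (2 : Alg N) = (2 : ℂ) • 1 := by rw [← map_ofNat (algebraMap ℂ (Alg N)) 2,
    Algebra.algebraMap_eq_smul_one]
  simp only [map_sub, map_add, map_smul, Q_kap2, Q_kap1, Q_mul_S2, Q_G2_eps, Q_G4', h1, ← sub_smul]
  simp only [h2, h3, smul_mul_assoc, one_mul, eps, S4']
  simp
  module

/-- The variation of $\mathcal O_f$ is a multiple of the difference of two trace identities, one for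
blocks $AB$ and one for blocks $BA$; the multiple is 3/2 or 3, and the factor 2 keeps the
coefficients integral over any commutative ring. Beyond these two identities only cyclicity is used.
-/
theorem y3_two_aux {R : Type*} [CommRing R] (s2 : Fin 2 → Fin 2 → R)
    (s4 : Fin 2 → Fin 2 → Fin 2 → Fin 2 → R)
    (s6 : Fin 2 → Fin 2 → Fin 2 → Fin 2 → Fin 2 → Fin 2 → R)
    (h4 : ∀ i p j q, s4 i p j q = s4 j q i p)
    (h6 : ∀ i p j q t r, s6 i p j q t r = s6 j q t r i p) (a b : Fin 2)
    (hI : s6 0 0 a b 1 1 + s6 0 0 1 1 a b = s2 0 0 * s4 a b 1 1 + s2 a b * s4 0 0 1 1 +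
      s2 1 1 * s4 0 0 a b - s2 0 0 * s2 a b * s2 1 1)
    (hJ : s6 0 b a 1 1 0 + s6 0 1 1 b a 0 = s2 0 0 * s4 a 1 1 b + s2 a b * s4 0 1 1 0 +
      s2 1 1 * s4 0 b a 0 - s2 0 0 * s2 a b * s2 1 1) :
    2 * ((s6 0 1 1 b a 0 - s6 0 0 1 b a 1) - (s6 1 1 0 b a 0 - s6 1 0 0 b a 1) -
      (s6 0 0 1 1 a b - s6 1 0 0 1 a b) + (s6 0 1 1 0 a b - s6 1 1 0 0 a b) -
        3 * ((s4 0 1 1 0 - s4 0 0 1 1) * s2 a b)) = 0 := by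
  have r1 : ∀ i p j q t r : Fin 2,
      32 * j.1 + 16 * q.1 + 8 * t.1 + 4 * r.1 + 2 * i.1 + p.1 <
        32 * i.1 + 16 * p.1 + 8 * j.1 + 4 * q.1 + 2 * t.1 + r.1 →
      s6 i p j q t r = s6 j q t r i p := fun i p j q t r _ => h6 i p j q t r
  have r2 : ∀ i p j q t r : Fin 2,
      32 * t.1 + 16 * r.1 + 8 * i.1 + 4 * p.1 + 2 * j.1 + q.1 <
        32 * i.1 + 16 * p.1 + 8 * j.1 + 4 * q.1 + 2 * t.1 + r.1 →
      s6 i p j q t r = s6 t r i p j q := fun i p j q t r _ => (h6 t r i p j q).symm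
  have r3 : ∀ i p j q : Fin 2, 8 * j.1 + 4 * q.1 + 2 * i.1 + p.1 <
      8 * i.1 + 4 * p.1 + 2 * j.1 + q.1 → s4 i p j q = s4 j q i p := fun i p j q _ => h4 i p j q
  fin_cases a <;> fin_cases b <;> simp only [Fin.zero_eta, Fin.mk_one] at hI hJ ⊢ <;>
    simp [r1, r2, r3, -mul_eq_zero] at hI hJ ⊢
  · linear_combination (-3) * hI + 3 * hJ
  · linear_combination (-6) * hI + 6 * hJ
  · linear_combination (-6) * hI + 6 * hJ
  · linear_combination (-3) * hI + 3 * hJ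

theorem y3_two (a b : Fin 2) : y3 2 a b = 0 := by
  have h0 : (2 : ℂ) • y3 2 a b = 0 → y3 2 a b = 0 := fun h => by simpa using h
  have h2 : (2 : ℂ) • y3 2 a b = 2 * y3 2 a b := by rw [two_smul, two_mul]
  exact h0 (h2.trans (y3_two_aux (zS2 2) (zS4 2) (zS6 2) (zS4_rotate 2) (zS6_rotate 2) a b
    (zS6_identity 0 0 a b 1 1) (zS6_identity' 0 0 a b 1 1)))

theorem Q_fort_two (a b : Fin 2) : Q 2 k (ev 2 (fort a b)) = 0 := by
  rw [Q_fort, y3_two, ZeroMemClass.coe_zero, smul_zero]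

end Fermi

/-! ### Numerical evaluation -/

section Evaluation

variable {R : Type*} [CommRing R] {n N : ℕ} (h : n ≤ N)

/-- The inclusion of `n × n` matrices into `N × N` matrices. -/
def pad (M : Matrix (Fin n) (Fin n) R) : Matrix (Fin N) (Fin N) R :=
  (1 : Matrix (Fin N) (Fin N) R).submatrix id (Fin.castLE h) * M *
    (1 : Matrix (Fin N) (Fin N) R).submatrix (Fin.castLE h) id

/-- The columns of the inclusion are orthonormal. Hence padding by zeros respects products and
traces, and a test point with small matrices serves all larger ranks. -/
theorem pad_aux : (1 : Matrix (Fin N) (Fin N) R).submatrix (Fin.castLE h) id *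
    (1 : Matrix (Fin N) (Fin N) R).submatrix id (Fin.castLE h) = 1 := by
  ext a b
  simp [Matrix.mul_apply, Matrix.one_apply]

theorem pad_mul_pad (M M' : Matrix (Fin n) (Fin n) R) : pad h M * pad h M' = pad h (M * M') := by
  have e := pad_aux (R := R) h
  simp only [pad, Matrix.mul_assoc]
  rw [← Matrix.mul_assoc (Matrix.submatrix 1 (Fin.castLE h) id), e, Matrix.one_mul]

theorem trace_pad (M : Matrix (Fin n) (Fin n) R) : (pad h M).trace = M.trace := by
  rw [pad, Matrix.trace_mul_comm, ← Matrix.mul_assoc, pad_aux, Matrix.one_mul]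

variable [Algebra ℂ R]

/-- Evaluation at given matrices, such that the entries of the fermions have vanishing products. -/
def evalHom (M : Letter → Matrix (Fin n) (Fin n) R) (hM : ∀ l l' : Letter, l.kind.odd →
    l'.kind.odd → ∀ a b c d, pad h (M l) a b * pad h (M l') c d = 0) : Alg N →ₐ[ℂ] R :=
  lift (fun x => pad h (M x.1) x.2.1 x.2.2) fun x y => by
    cases hx : x.1.kind.odd <;> cases hy : y.1.kind.odd
    · simp [sgn, mul_comm]
    · simp [sgn, mul_comm]
    · simp [sgn, mul_comm]
    · rw [hM _ _ hx hy, hM _ _ hy hx, smul_zero]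

theorem evalHom_ev_tr (M : Letter → Matrix (Fin n) (Fin n) R) (hM) (l : Letter) (w : List Letter) :
    evalHom h M hM (ev N (tr (l :: w))) = (((l :: w).map M).prod).trace := by
  have e1 : ∀ l, (evalHom h M hM).mapMatrix (mat N l) = pad h (M l) := fun l => by
    ext a b
    simp [mat, evalHom]
  have e2 : ∀ w l, (evalHom h M hM).mapMatrix (((l :: w).map (mat N)).prod) =
      pad h (((l :: w).map M).prod) := fun w => by
    induction w with
    | nil => intro l; simpa using e1 l
    | cons l' w ih =>
      intro l
      rw [List.map_cons, List.prod_cons, map_mul, ih, e1, pad_mul_pad]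
      rfl
  rw [ev_tr, ← trace_pad h, ← e2]
  simp only [Matrix.trace, Matrix.diag, map_sum]
  rfl

/-- Weights of the flavour components. -/
def wt (s : ℂ) (i : Fin 2) : ℂ := if i = 0 then 1 else s

/-- Numerical values of the letters. -/
def numLetter (A B : Fin 2 → Matrix (Fin n) (Fin n) ℤ) (s t : ℂ) : Letter →
    Matrix (Fin n) (Fin n) ℂ
  | ⟨.A, 0, i⟩ => wt s i • (Int.castRingHom ℂ).mapMatrix (A i)
  | ⟨.B, 0, p⟩ => wt t p • (Int.castRingHom ℂ).mapMatrix (B p)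
  | _ => 0

theorem numLetter_odd (A B : Fin 2 → Matrix (Fin n) (Fin n) ℤ) (s t : ℂ) (l : Letter)
    (hl : l.kind.odd) : numLetter A B s t l = 0 := by
  obtain ⟨κ, d, i⟩ := l
  cases κ <;> simp_all [numLetter, Kind.odd]

/-- Evaluation at integer matrices, with weights for the flavour components. -/
def numEval (A B : Fin 2 → Matrix (Fin n) (Fin n) ℤ) (s t : ℂ) : Alg N →ₐ[ℂ] ℂ :=
  evalHom h (numLetter A B s t) fun l l' hl _ a b c d => by
    rw [numLetter_odd A B s t l hl]; simp [pad]

variable (A B : Fin 2 → Matrix (Fin n) (Fin n) ℤ) (s t : ℂ)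

def v2 (i p : Fin 2) : ℤ := (A i * B p).trace
def v4 (i p j q : Fin 2) : ℤ := (A i * B p * A j * B q).trace
def v6 (i p j q k r : Fin 2) : ℤ := (A i * B p * A j * B q * A k * B r).trace

theorem trace_intCast (M : Matrix (Fin n) (Fin n) ℤ) :
    ((Int.castRingHom ℂ).mapMatrix M).trace = (M.trace : ℂ) := by
  simp [Matrix.trace]

theorem numEval_S2 (i p : Fin 2) : numEval h A B s t (S2 N i p) = wt s i * wt t p * v2 A B i p := by
  rw [S2, numEval, evalHom_ev_tr, v2, ← trace_intCast]
  simp only [List.map_cons, List.map_nil, List.prod_cons, List.prod_nil, mul_one, lA, lB, numLetter,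
    Matrix.smul_mul, Matrix.mul_smul, Matrix.trace_smul, smul_eq_mul, ← map_mul]
  ring

theorem numEval_S4 (i p j q : Fin 2) : numEval h A B s t (S4 N i p j q) =
    wt s i * wt s j * (wt t p * wt t q) * v4 A B i p j q := by
  rw [S4, numEval, evalHom_ev_tr, v4, ← trace_intCast]
  simp only [List.map_cons, List.map_nil, List.prod_cons, List.prod_nil, mul_one, lA, lB, numLetter,
    Matrix.smul_mul, Matrix.mul_smul, Matrix.trace_smul, smul_eq_mul, ← map_mul, ← mul_assoc]
  ring

theorem numEval_S6 (i p j q k r : Fin 2) : numEval h A B s t (S6 N i p j q k r) =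
    wt s i * wt s j * wt s k * (wt t p * wt t q * wt t r) * v6 A B i p j q k r := by
  rw [S6, numEval, evalHom_ev_tr, v6, ← trace_intCast]
  simp only [List.map_cons, List.map_nil, List.prod_cons, List.prod_nil, mul_one, lA, lB, numLetter,
    Matrix.smul_mul, Matrix.mul_smul, Matrix.trace_smul, smul_eq_mul, ← map_mul, ← mul_assoc]
  ring

def u1 (a b : Fin 2) : ℤ := 2 * ((v4 A B 0 1 1 0 - v4 A B 0 0 1 1) * v2 A B a b)
def u2 (a b : Fin 2) : ℤ := (v6 A B 0 1 1 b a 0 - v6 A B 0 0 1 b a 1) -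
  (v6 A B 1 1 0 b a 0 - v6 A B 1 0 0 b a 1)
def u3 (a b : Fin 2) : ℤ := u2 A B a b - (v6 A B 0 0 1 1 a b - v6 A B 1 0 0 1 a b) +
  (v6 A B 0 1 1 0 a b - v6 A B 1 1 0 0 a b) - 3 * ((v4 A B 0 1 1 0 - v4 A B 0 0 1 1) * v2 A B a b)

theorem wt_zero : wt s 0 = 1 := rfl
theorem wt_one : wt s 1 = s := rfl

theorem numEval_y1 (a b : Fin 2) : numEval h A B s t (y1 N a b : Alg N) =
    s * wt s a * (t * wt t b) * u1 A B a b := by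
  change numEval h A B s t (2 * ((S4 N 0 1 1 0 - S4 N 0 0 1 1) * S2 N a b)) = _
  rw [u1, map_mul, map_mul, map_sub, map_ofNat, numEval_S4, numEval_S4, numEval_S2]
  simp only [wt_zero, wt_one]
  push_cast
  ring

theorem numEval_y2 (a b : Fin 2) : numEval h A B s t (y2 N a b : Alg N) =
    s * wt s a * (t * wt t b) * u2 A B a b := by
  change numEval h A B s t ((S6 N 0 1 1 b a 0 - S6 N 0 0 1 b a 1) -
    (S6 N 1 1 0 b a 0 - S6 N 1 0 0 b a 1)) = _
  rw [u2, map_sub, map_sub, map_sub, numEval_S6, numEval_S6, numEval_S6, numEval_S6]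
  simp only [wt_zero, wt_one]
  push_cast
  ring

theorem numEval_y3 (a b : Fin 2) : numEval h A B s t (y3 N a b : Alg N) =
    s * wt s a * (t * wt t b) * u3 A B a b := by
  change numEval h A B s t ((y2 N a b : Alg N) -
    (S6 N 0 0 1 1 a b - S6 N 1 0 0 1 a b) + (S6 N 0 1 1 0 a b - S6 N 1 1 0 0 a b) -
    3 * ((S4 N 0 1 1 0 - S4 N 0 0 1 1) * S2 N a b)) = _
  simp only [u3, map_sub, map_add, map_mul, map_ofNat, numEval_y2, numEval_S6, numEval_S4,
    numEval_S2, wt_zero, wt_one]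
  push_cast
  ring

/-- For `s, t = ±1` the four weights are the characters of a group of order four, and the
coefficients 1/4 are the inverse of its character table. -/
theorem eq_zero_of_weights {X : Fin 2 × Fin 2 → ℂ}
    (hX : ∀ s t : ℂ, ∑ p, s * wt s p.1 * (t * wt t p.2) * X p = 0) (p : Fin 2 × Fin 2) :
    X p = 0 := by
  have h1 := hX 1 1
  have h2 := hX 1 (-1)
  have h3 := hX (-1) 1
  have h4 := hX (-1) (-1)
  simp only [Fintype.sum_prod_type, Fin.sum_univ_two, wt_zero, wt_one] at h1 h2 h3 h4
  obtain ⟨a, b⟩ := p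
  fin_cases a <;> fin_cases b <;> simp only [Fin.zero_eta, Fin.mk_one]
  · linear_combination (1 / 4) * h1 - (1 / 4) * h2 - (1 / 4) * h3 + (1 / 4) * h4
  · linear_combination (1 / 4) * h1 + (1 / 4) * h2 - (1 / 4) * h3 - (1 / 4) * h4
  · linear_combination (1 / 4) * h1 - (1 / 4) * h2 + (1 / 4) * h3 - (1 / 4) * h4
  · linear_combination (1 / 4) * h1 + (1 / 4) * h2 + (1 / 4) * h3 + (1 / 4) * h4

/-- Rescaling one member of each doublet separates the four flavour components, so a relation among
the variations becomes one scalar relation per component at each pair of integer test matrices. -/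
theorem relation_of_variation (h : n ≤ N) {x y z : Fin 2 × Fin 2 → ℂ}
    (H : ∑ p, x p • (y1 N p.1 p.2 : Alg N) + ∑ p, y p • (y2 N p.1 p.2 : Alg N) +
      ∑ p, z p • (y3 N p.1 p.2 : Alg N) = 0) (p : Fin 2 × Fin 2) :
    x p * u1 A B p.1 p.2 + y p * u2 A B p.1 p.2 + z p * u3 A B p.1 p.2 = 0 := by
  refine eq_zero_of_weights (X := fun p => x p * u1 A B p.1 p.2 + y p * u2 A B p.1 p.2 +
    z p * u3 A B p.1 p.2) (fun s t => ?_) p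
  have := congrArg (numEval h A B s t) H
  simp only [map_add, map_sum, map_smul, numEval_y1, numEval_y2, numEval_y3, map_zero,
    smul_eq_mul] at this
  rw [← this, ← Finset.sum_add_distrib, ← Finset.sum_add_distrib]
  exact Finset.sum_congr rfl fun p _ => by ring

end Evaluation

theorem coefficients_eq_zero_two {x y : Fin 2 × Fin 2 → ℂ}
    (H : ∑ p, x p • (y1 2 p.1 p.2 : Alg 2) + ∑ p, y p • (y2 2 p.1 p.2 : Alg 2) = 0) :
    x = 0 ∧ y = 0 := by
  have H' : ∑ p, x p • (y1 2 p.1 p.2 : Alg 2) + ∑ p, y p • (y2 2 p.1 p.2 : Alg 2) +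
      ∑ p, (0 : Fin 2 × Fin 2 → ℂ) p • (y3 2 p.1 p.2 : Alg 2) = 0 := by simpa using H
  -- At this point `u1` vanishes and `u2` is one for all components, which isolates `y`; at the next
  -- one `u1` never vanishes, which then gives `x`.
  have e1 := relation_of_variation (n := 2)
    ![!![1, 1; 1, 0], !![1, 0; 0, 0]] ![!![1, 1; 1, 1], !![1, 0; 0, 1]] le_rfl H'
  have e2 := relation_of_variation (n := 2)
    ![!![1, 1; 0, 0], !![1, 0; 0, 0]] ![!![1, 0; 1, 1], !![1, 0; 0, 0]] le_rfl H'
  have f1 : ∀ a b, u1 ![!![1, 1; 1, 0], !![1, 0; 0, 0]] ![!![1, 1; 1, 1], !![1, 0; 0, 1]] a b = 0 ∧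
    u2 ![!![1, 1; 1, 0], !![1, 0; 0, 0]] ![!![1, 1; 1, 1], !![1, 0; 0, 1]] a b = 1 := by decide
  have f2 : ∀ a b, u1 ![!![1, 1; 0, 0], !![1, 0; 0, 0]] ![!![1, 0; 1, 1], !![1, 0; 0, 0]] a b =
      (if a = 0 ∧ b = 0 then -4 else -2) := by decide
  have hy : y = 0 := by
    funext p
    have := e1 p
    rw [(f1 _ _).1, (f1 _ _).2] at this
    simpa using this
  refine ⟨?_, hy⟩
  funext p
  have := e2 p
  rw [f2, hy] at this
  split_ifs at this <;> simpa using this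

/-- For each flavour component, three test points with 3 × 3 matrices give three equations for the
three coefficients, with nonzero integer determinant; padding covers all ranks from three on. -/
theorem coefficients_eq_zero_of_le {N : ℕ} (hN : 3 ≤ N) {x y z : Fin 2 × Fin 2 → ℂ}
    (H : ∑ p, x p • (y1 N p.1 p.2 : Alg N) + ∑ p, y p • (y2 N p.1 p.2 : Alg N) +
      ∑ p, z p • (y3 N p.1 p.2 : Alg N) = 0) : x = 0 ∧ y = 0 ∧ z = 0 := by
  have e1 := relation_of_variation
    ![!![0, 0, 0; 0, 0, 1; 0, 1, 1], !![0, 0, 0; 0, 1, 1; 1, 0, 1]]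
    ![!![0, 0, 0; 0, 0, 0; 0, 1, 0], !![1, 1, 0; 0, 0, 1; 0, 1, 0]] hN H
  have e2 := relation_of_variation
    ![!![1, 1, 1; 0, 1, 1; 0, 1, 1], !![0, 0, 0; 0, 0, 0; 1, 0, 0]]
    ![!![0, 0, 1; 1, 0, 1; 1, 0, 0], !![0, 1, 1; 0, 0, 1; 0, 1, 0]] hN H
  have e3 := relation_of_variation
    ![!![0, 0, 1; 0, 0, 0; 1, 0, 0], !![0, 1, 1; 0, 0, 0; 1, 0, 1]]
    ![!![1, 0, 0; 0, 0, 1; 1, 1, 0], !![1, 0, 0; 0, 1, 1; 0, 0, 0]] hN H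
  -- The matrices are hidden behind names, so that only the integer determinants below have to
  -- unfold them.
  generalize hA1 : (![!![0, 0, 0; 0, 0, 1; 0, 1, 1], !![0, 0, 0; 0, 1, 1; 1, 0, 1]] :
    Fin 2 → Matrix (Fin 3) (Fin 3) ℤ) = A1 at e1
  generalize hB1 : (![!![0, 0, 0; 0, 0, 0; 0, 1, 0], !![1, 1, 0; 0, 0, 1; 0, 1, 0]] :
    Fin 2 → Matrix (Fin 3) (Fin 3) ℤ) = B1 at e1
  generalize hA2 : (![!![1, 1, 1; 0, 1, 1; 0, 1, 1], !![0, 0, 0; 0, 0, 0; 1, 0, 0]] :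
    Fin 2 → Matrix (Fin 3) (Fin 3) ℤ) = A2 at e2
  generalize hB2 : (![!![0, 0, 1; 1, 0, 1; 1, 0, 0], !![0, 1, 1; 0, 0, 1; 0, 1, 0]] :
    Fin 2 → Matrix (Fin 3) (Fin 3) ℤ) = B2 at e2
  generalize hA3 : (![!![0, 0, 1; 0, 0, 0; 1, 0, 0], !![0, 1, 1; 0, 0, 0; 1, 0, 1]] :
    Fin 2 → Matrix (Fin 3) (Fin 3) ℤ) = A3 at e3
  generalize hB3 : (![!![1, 0, 0; 0, 0, 1; 1, 1, 0], !![1, 0, 0; 0, 1, 1; 0, 0, 0]] :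
    Fin 2 → Matrix (Fin 3) (Fin 3) ℤ) = B3 at e3
  have d : ∀ p : Fin 2 × Fin 2, !![u1 A1 B1 p.1 p.2, u2 A1 B1 p.1 p.2, u3 A1 B1 p.1 p.2;
      u1 A2 B2 p.1 p.2, u2 A2 B2 p.1 p.2, u3 A2 B2 p.1 p.2;
      u1 A3 B3 p.1 p.2, u2 A3 B3 p.1 p.2, u3 A3 B3 p.1 p.2].det ≠ 0 := by
    subst hA1 hB1 hA2 hB2 hA3 hB3
    simp only [Matrix.det_fin_three]
    decide +kernel
  have key : ∀ p, x p = 0 ∧ y p = 0 ∧ z p = 0 := fun p => by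
    have hd := d p
    have hm : (!![u1 A1 B1 p.1 p.2, u2 A1 B1 p.1 p.2, u3 A1 B1 p.1 p.2;
      u1 A2 B2 p.1 p.2, u2 A2 B2 p.1 p.2, u3 A2 B2 p.1 p.2;
      u1 A3 B3 p.1 p.2, u2 A3 B3 p.1 p.2, u3 A3 B3 p.1 p.2].map (Int.cast : ℤ → ℂ)).mulVec
        ![x p, y p, z p] = 0 := by
      ext i
      fin_cases i <;> simp [Matrix.mulVec, dotProduct, Fin.sum_univ_three]
      · linear_combination e1 p
      · linear_combination e2 p
      · linear_combination e3 p
    have h0 := Matrix.eq_zero_of_mulVec_eq_zero (by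
      rw [← Int.cast_det]
      exact_mod_cast hd) hm
    exact ⟨congrFun h0 0, congrFun h0 1, congrFun h0 2⟩
  exact ⟨funext fun p => (key p).1, funext fun p => (key p).2.1, funext fun p => (key p).2.2⟩

/-! ### Scalar operators of order `x^3` in the rank two theory -/

/-- The sum over all permutations of three indices. -/
def perm3 {M : Type*} [Add M] (f : Fin 2 → Fin 2 → Fin 2 → M) (l m n : Fin 2) : M :=
  f l m n + f m n l + f n l m + f l n m + f m l n + f n m l

theorem sum_sym3_eq_perm3 {M : Type*} [AddCommGroup M] [Module ℂ M]
    (f : Fin 2 → Fin 2 → Fin 2 → M) (l m n : Fin 2) :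
    ∑ i, ∑ j, ∑ k, sym3 i j k l m n • f i j k = (1 / 6 : ℂ) • perm3 f l m n := sum_sym3 f l m n

theorem perm3_smul {M : Type*} [AddCommGroup M] [Module ℂ M] (c : ℂ)
    (f : Fin 2 → Fin 2 → Fin 2 → M) (l m n : Fin 2) :
    perm3 (fun i j k => c • f i j k) l m n = c • perm3 f l m n := by
  simp only [perm3, smul_add]

theorem perm3_mem {M : Type*} [AddCommGroup M] [Module ℂ M] {U : Submodule ℂ M}
    {f : Fin 2 → Fin 2 → Fin 2 → M} (h : ∀ i j k, f i j k ∈ U) (l m n : Fin 2) :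
    perm3 f l m n ∈ U :=
  U.add_mem (U.add_mem (U.add_mem (U.add_mem (U.add_mem (h _ _ _) (h _ _ _)) (h _ _ _))
    (h _ _ _)) (h _ _ _)) (h _ _ _)

theorem cQ_ne_zero {k : ℕ} (hk : 0 < k) : cQ k ≠ 0 := by
  have : (k : ℂ) ≠ 0 := by exact_mod_cast hk.ne'
  have := Real.pi_ne_zero
  simp_all [cQ]

theorem cD_ne_zero {k : ℕ} (hk : 0 < k) : cD k ≠ 0 := by
  have : (k : ℂ) ≠ 0 := by exact_mod_cast hk.ne'
  have := Real.pi_ne_zero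
  simp_all [cD]

theorem Q_ev_mem_exact {N k d : ℕ} {T : Formal} (hT : T ∈ formalOps d) :
    Q N k (ev N T) ∈ exact N k d := ⟨_, ⟨T, hT, rfl⟩, rfl⟩

theorem gaugeWord_AB (i p : Fin 2) : GaugeWord [lA i, lB p] := gaugeWord_two Bool.false_ne_true
theorem gaugeWord_psiAA (i j : Fin 2) : GaugeWord [lPsiA i, lA j] :=
  gaugeWord_two Bool.false_ne_true.symm
theorem gaugeWord_psiABA (i j p t : Fin 2) : GaugeWord [lPsiA i, lA j, lB p, lA t] :=
  gaugeWord_four Bool.false_ne_true.symm Bool.false_ne_true Bool.false_ne_true.symm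
theorem gaugeWord_psiBAB (i j p t : Fin 2) : GaugeWord [lPsiB i, lB j, lA p, lB t] :=
  gaugeWord_four Bool.false_ne_true Bool.false_ne_true.symm Bool.false_ne_true
theorem gaugeWord_DAB (i p : Fin 2) : GaugeWord [lDA i, lB p] := gaugeWord_two Bool.false_ne_true

theorem E2_mem_exact {N k : ℕ} (hk : 0 < k) (i p : Fin 2) : E2 N i p ∈ exact N k 3 := by
  have h := Q_ev_mem_exact (N := N) (k := k) (d := 3) (tr_mem_formalOps (gaugeWord_DAB i p) rfl)
  rw [ev_DAB, Q_D1] at h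
  exact ((exact N k 3).smul_mem_iff (cD_ne_zero hk)).1 h

/-- The `F4` and `G4` parts cancel after rotation; nilpotency of the supercharge in general is not
needed. -/
theorem Q_E2 {N k : ℕ} (a b : Fin 2) : Q N k (E2 N a b) = 0 := by
  have h := congrFun (allE2_eq a b) N
  have r := S6_rotate (N := N)
  change E2 N a b = -((G4 N b 0 a 1 - G4 N b 1 a 0) + (F4 N a 0 b 1 - F4 N a 1 b 0)) at h
  rw [h]
  simp only [map_neg, map_add, map_sub, Q_F4', Q_G4']
  rw [r a 1 0 b 1 0, r a 0 0 b 1 1, r a 1 1 b 0 0, r a 0 1 b 0 1]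
  module

/-- Exact operators and gravitons of the rank two theory at order `x^3`. -/
def trivial3 (k : ℕ) : Submodule ℂ (Alg 2) :=
  exact 2 k 3 ⊔ (gravSpan 3).map (ev 2).toLinearMap

section Scalars

variable {k : ℕ}

theorem exact_mem_trivial3 {T : Formal} (hT : T ∈ formalOps 3) :
    Q 2 k (ev 2 T) ∈ trivial3 k := (le_sup_left : _ ≤ trivial3 k) (Q_ev_mem_exact hT)

theorem grav_mem_trivial3 (m : Multiplet) (ho : m.order = 3) (hm : m ≠ .fortuitous) {T : Formal}
    (hT : T ∈ m.reps) : ev 2 T ∈ trivial3 k :=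
  (le_sup_right : _ ≤ trivial3 k) ⟨T, ho ▸ mem_gravSpan m hm hT, rfl⟩

/-- The scalar trace is closed, so the product is a multiple of the variation of a double trace with
one fermion. -/
theorem S4'_mul_S2_mem (hk : 0 < k) (a b : Fin 2) : S4' 2 * S2 2 a b ∈ trivial3 k := by
  have h := exact_mem_trivial3 (k := k) (tr_mul_tr_mem_formalOps (d := 3) (gaugeWord_psiAA 0 1)
    (gaugeWord_AB a b) rfl)
  rw [map_mul, ev_psiAA, ev_AB, Q_mul_S2, Q_F2_eps, smul_mul_assoc] at h
  refine ((trivial3 k).smul_mem_iff ?_).1 h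
  simpa [eps] using cQ_ne_zero hk

theorem S4_eps (N : ℕ) (p q : Fin 2) : ∃ c : ℂ, S4 N 0 p 1 q - S4 N 1 p 0 q = c • S4' N := by
  have r := S4_rotate (N := N)
  rw [r 1 p 0 q]
  fin_cases p <;> fin_cases q
  · exact ⟨0, by simp⟩
  · exact ⟨-1, by simp [S4']⟩
  · exact ⟨1, by simp [S4']⟩
  · exact ⟨0, by simp⟩

theorem S4_eps' (N : ℕ) (i j : Fin 2) : ∃ c : ℂ, S4 N i 0 j 1 - S4 N i 1 j 0 = c • S4' N := by
  have r := S4_rotate (N := N)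
  fin_cases i <;> fin_cases j
  · exact ⟨0, by simp [r 0 0 0 1]⟩
  · exact ⟨-1, by simp [S4']⟩
  · exact ⟨1, by simp [S4', r 1 0 0 1, r 1 1 0 0]⟩
  · exact ⟨0, by simp [r 1 0 1 1]⟩

theorem S4_eps_mul_S2_mem (hk : 0 < k) (p q a b : Fin 2) :
    S4 2 0 p 1 q * S2 2 a b - S4 2 1 p 0 q * S2 2 a b ∈ trivial3 k := by
  obtain ⟨c, hc⟩ := S4_eps 2 p q
  rw [← sub_mul, hc, smul_mul_assoc]
  exact Submodule.smul_mem _ _ (S4'_mul_S2_mem hk a b)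

theorem S4_eps'_mul_S2_mem (hk : 0 < k) (i j a b : Fin 2) :
    S4 2 i 0 j 1 * S2 2 a b - S4 2 i 1 j 0 * S2 2 a b ∈ trivial3 k := by
  obtain ⟨c, hc⟩ := S4_eps' 2 i j
  rw [← sub_mul, hc, smul_mul_assoc]
  exact Submodule.smul_mem _ _ (S4'_mul_S2_mem hk a b)

theorem sub_swap_mem {M : Type*} [AddCommGroup M] [Module ℂ M] {U : Submodule ℂ M}
    {f : Fin 2 → Fin 2 → M} (h : f 0 1 - f 1 0 ∈ U) (p q : Fin 2) : f p q - f q p ∈ U := by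
  fin_cases p <;> fin_cases q
  · simp
  · exact h
  · exact sub_mem_comm_iff.1 h
  · simp

/-- The variation of `F4` is antisymmetric in two neighbouring $B$ indices, so modulo exact
operators they may be exchanged; `G4` does the same for $A$ indices. -/
theorem S6_swap_B_mem (hk : 0 < k) (i p j q t r : Fin 2) :
    S6 2 i p j q t r - S6 2 i p j r t q ∈ trivial3 k := by
  have h := exact_mem_trivial3 (k := k) (tr_mem_formalOps (d := 3) (gaugeWord_psiABA t i p j) rfl)
  rw [ev_psiABA, Q_F4'] at h
  replace h := ((trivial3 k).smul_mem_iff (cQ_ne_zero hk)).1 h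
  have h2 := sub_swap_mem (f := fun r q => S6 2 t r i p j q) (U := trivial3 k)
    (sub_mem_comm_iff.1 h) r q
  rwa [S6_rotate t r, S6_rotate t q] at h2

theorem S6_swap_A_mem (hk : 0 < k) (i p j q t r : Fin 2) :
    S6 2 i p j q t r - S6 2 i p t q j r ∈ trivial3 k := by
  have h := exact_mem_trivial3 (k := k) (tr_mem_formalOps (d := 3) (gaugeWord_psiBAB q r i p) rfl)
  rw [ev_psiBAB, Q_G4'] at h
  replace h := ((trivial3 k).smul_mem_iff (neg_ne_zero.2 (cQ_ne_zero hk))).1 h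
  have h2 := sub_swap_mem (f := fun j t => S6 2 j q t r i p) (U := trivial3 k) h j t
  rwa [← S6_rotate i p j q t r, ← S6_rotate i p t q j r] at h2

/-- Since the factors commute, permuting the $A$ indices already permutes the pairs; symmetrising
the $B$ indices as well only repeats each term six times. -/
theorem perm3_comm_aux {R : Type*} [CommRing R] (s2 : Fin 2 → Fin 2 → R) (l m n s t u : Fin 2) :
    perm3 (fun i j k => perm3 (fun p q r => s2 i p * s2 j q * s2 k r) s t u) l m n =
      6 * perm3 (fun i j k => s2 i s * s2 j t * s2 k u) l m n := by
  simp only [perm3]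
  ring

theorem perm3_comm (N : ℕ) (l m n s t u : Fin 2) :
    perm3 (fun i j k => perm3 (fun p q r => S2 N i p * S2 N j q * S2 N k r) s t u) l m n =
      (6 : ℂ) • perm3 (fun i j k => S2 N i s * S2 N j t * S2 N k u) l m n := by
  have h := congrArg (Subalgebra.center ℂ (Alg N)).val (perm3_comm_aux (zS2 N) l m n s t u)
  have h6 : (6 : ℂ) • perm3 (fun i j k => S2 N i s * S2 N j t * S2 N k u) l m n =
      6 * perm3 (fun i j k => S2 N i s * S2 N j t * S2 N k u) l m n := by
    rw [← map_ofNat (algebraMap ℂ (Alg N)) 6, ← Algebra.smul_def]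
  rw [h6]
  exact h

theorem AB_AB_AB_44_mem (l m n p q r : Fin 2) :
    perm3 (fun i j k => S2 2 i p * S2 2 j q * S2 2 k r) l m n ∈ trivial3 k := by
  have h := grav_mem_trivial3 (k := k) .AB_AB_AB_44 rfl (by simp) ⟨l, m, n, p, q, r, rfl⟩
  simp only [map_sum, map_smul, map_mul, ev_AB, mul_smul, ← Finset.smul_sum] at h
  have e : ∀ i j k, ∑ a, ∑ b, ∑ c, sym3 a b c p q r • (S2 2 i a * S2 2 j b * S2 2 k c) =
      (1 / 6 : ℂ) • perm3 (fun a b c => S2 2 i a * S2 2 j b * S2 2 k c) p q r :=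
    fun i j k => sum_sym3_eq_perm3 _ p q r
  simp only [e] at h
  rw [sum_sym3_eq_perm3 (fun i j k => (1 / 6 : ℂ) • perm3 (fun a b c => S2 2 i a * S2 2 j b *
    S2 2 k c) p q r), perm3_smul, perm3_comm, smul_smul, smul_smul] at h
  exact ((trivial3 k).smul_mem_iff (by norm_num)).1 h

theorem AB_AB_AB_22_mem (i p : Fin 2) :
    (S2 2 0 0 * S2 2 1 1 - S2 2 1 0 * S2 2 0 1) * S2 2 i p ∈ trivial3 k := by
  have h := grav_mem_trivial3 (k := k) .AB_AB_AB_22 rfl (by simp) ⟨i, p, rfl⟩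
  simp only [map_sum, map_smul, map_mul, ev_AB, mul_smul, ← Finset.smul_sum] at h
  simp only [sum_eps] at h
  refine ((trivial3 k).smul_mem_iff (two_ne_zero : (2 : ℂ) ≠ 0)).1 ?_
  convert h using 1
  rw [S2_mul_comm 0 1 (S2 2 1 0), S2_mul_comm 0 0 (S2 2 1 1), sub_mul, two_smul]
  abel

theorem S2S2_eps_mem (p q i r : Fin 2) :
    (S2 2 0 p * S2 2 1 q - S2 2 1 p * S2 2 0 q) * S2 2 i r ∈ trivial3 k := by
  have h := AB_AB_AB_22_mem (k := k) i r
  fin_cases p <;> fin_cases q <;> simp only [Fin.zero_eta, Fin.mk_one]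
  · rw [S2_mul_comm 0 0 (S2 2 1 0), sub_self, zero_mul]; exact Submodule.zero_mem _
  · exact h
  · rw [S2_mul_comm 1 0, S2_mul_comm 0 0, ← neg_sub, neg_mul]; exact Submodule.neg_mem _ h
  · rw [S2_mul_comm 0 1 (S2 2 1 1), sub_self, zero_mul]; exact Submodule.zero_mem _

theorem S2S2S2_mem (i p j q t r : Fin 2) : S2 2 i p * S2 2 j q * S2 2 t r ∈ trivial3 k := by
  refine mem_of_sym3_of_eps (f := fun i j t => S2 2 i p * S2 2 j q * S2 2 t r)
    (fun l m n => AB_AB_AB_44_mem l m n p q r) (fun t => ?_) (fun i => ?_) i j t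
  · rw [← sub_mul]; exact S2S2_eps_mem p q t r
  · rw [mul_assoc, mul_assoc, ← mul_sub, ← S2_mul_comm]; exact S2S2_eps_mem q r i p

theorem AB_ABAB_44_mem (l m n s t u : Fin 2) :
    perm3 (fun p q r => perm3 (fun i j k => S4 2 i p j q * S2 2 k r) l m n) s t u ∈
      trivial3 k := by
  have h := grav_mem_trivial3 (k := k) .AB_ABAB_44 rfl (by simp) ⟨l, m, n, s, t, u, rfl⟩
  simp only [map_sum, map_smul, map_mul, ev_AB, ev_ABAB, mul_smul, ← Finset.smul_sum] at h
  have e : ∀ i j k, ∑ a, ∑ b, ∑ c, sym3 a b c s t u • (S2 2 i a * S4 2 j b k c) =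
      (1 / 6 : ℂ) • perm3 (fun a b c => S2 2 i a * S4 2 j b k c) s t u :=
    fun i j k => sum_sym3_eq_perm3 _ s t u
  simp only [e] at h
  rw [sum_sym3_eq_perm3 (fun i j k => (1 / 6 : ℂ) • perm3 (fun a b c => S2 2 i a * S4 2 j b k c)
    s t u), perm3_smul, smul_smul] at h
  replace h := ((trivial3 k).smul_mem_iff (by norm_num)).1 h
  convert h using 1
  simp only [perm3, S2_mul_comm]
  abel

theorem AB_ABAB_42_mem (l m n p : Fin 2) :
    perm3 (fun i j k => S4 2 i p j 0 * S2 2 k 1 - S4 2 i p j 1 * S2 2 k 0) l m n ∈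
      trivial3 k := by
  have h := grav_mem_trivial3 (k := k) .AB_ABAB_42 rfl (by simp) ⟨l, m, n, p, rfl⟩
  simp only [map_sum, map_smul, map_mul, ev_AB, ev_ABAB, mul_smul, ← Finset.smul_sum] at h
  simp only [sum_eps] at h
  rw [sum_sym3 (fun i j k => S4 2 i p j 0 * S2 2 k 1 - S4 2 i p j 1 * S2 2 k 0)] at h
  exact ((trivial3 k).smul_mem_iff (by norm_num)).1 h

theorem AB_ABAB_24_mem (s t u i : Fin 2) :
    perm3 (fun p q r => S4 2 i p 0 q * S2 2 1 r - S4 2 i p 1 q * S2 2 0 r) s t u ∈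
      trivial3 k := by
  have h := grav_mem_trivial3 (k := k) .AB_ABAB_24 rfl (by simp) ⟨s, t, u, i, rfl⟩
  have e : ∀ p q r : Fin 2, ∑ j, ∑ k, eps j k • (S4 2 i p j q * S2 2 k r) =
      S4 2 i p 0 q * S2 2 1 r - S4 2 i p 1 q * S2 2 0 r := fun p q r => sum_eps _
  have e2 : ∑ p, ∑ q, ∑ r, sym3 p q r s t u • ∑ j, ∑ k, eps j k • (S4 2 i p j q * S2 2 k r) ∈
      trivial3 k := by
    convert h using 1
    simp only [map_sum, map_smul, map_mul, ev_AB, ev_ABAB]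
    rw [Fin.sum_univ_two (f := fun j => _)]
    simp only [Fin.sum_univ_two, eps]
    simp
    module
  simp only [e] at e2
  rw [sum_sym3 (fun p q r => S4 2 i p 0 q * S2 2 1 r - S4 2 i p 1 q * S2 2 0 r)] at e2
  exact ((trivial3 k).smul_mem_iff (by norm_num)).1 e2

/-- This component, contracted in $A$ and in $B$, is not covered by the scalar multi-gravitons of
type `AB_ABAB`. At rank two, subtracting two instances of the trace identity expresses it by
exchanges in `S6`, by `S4'` times a trace, and by triple products. -/
theorem S4S2_eps_eps_mem (hk : 0 < k) (i p : Fin 2) :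
    (S4 2 i p 0 0 * S2 2 1 1 - S4 2 i p 1 0 * S2 2 0 1) -
      (S4 2 i p 0 1 * S2 2 1 0 - S4 2 i p 1 1 * S2 2 0 0) ∈ trivial3 k := by
  have h1 : (S6 2 i p 0 0 1 1 + S6 2 i p 1 1 0 0 : Alg 2) = S2 2 i p * S4 2 0 0 1 1 +
      S2 2 0 0 * S4 2 i p 1 1 + S2 2 1 1 * S4 2 i p 0 0 - S2 2 i p * S2 2 0 0 * S2 2 1 1 :=
    congrArg Subtype.val (zS6_identity i p 0 0 1 1)
  have h2 : (S6 2 i p 0 1 1 0 + S6 2 i p 1 0 0 1 : Alg 2) = S2 2 i p * S4 2 0 1 1 0 +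
      S2 2 0 1 * S4 2 i p 1 0 + S2 2 1 0 * S4 2 i p 0 1 - S2 2 i p * S2 2 0 1 * S2 2 1 0 :=
    congrArg Subtype.val (zS6_identity i p 0 1 1 0)
  have m1 := S6_swap_B_mem hk i p 0 0 1 1
  have m2 := S6_swap_B_mem hk i p 1 1 0 0
  have m3 := S4'_mul_S2_mem hk i p
  have m4 := S2S2S2_mem (k := k) i p 0 0 1 1
  have m5 := S2S2S2_mem (k := k) i p 0 1 1 0
  convert (trivial3 k).sub_mem ((trivial3 k).add_mem ((trivial3 k).add_mem
    ((trivial3 k).add_mem m1 m2) m3) m4) m5 using 1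
  have e1 := S2_mul_comm (N := 2) 1 1 (S4 2 i p 0 0)
  have e2 := S2_mul_comm (N := 2) 0 1 (S4 2 i p 1 0)
  have e3 := S2_mul_comm (N := 2) 1 0 (S4 2 i p 0 1)
  have e4 := S2_mul_comm (N := 2) 0 0 (S4 2 i p 1 1)
  have e5 := S2_mul_comm (N := 2) i p (S4' 2)
  rw [e1, e2, e3, e4, e5, S4', mul_sub]
  linear_combination (norm := skip) (-1 : ℂ) • h1 + (1 : ℂ) • h2
  module

/-- Decomposition into symmetric and contracted parts, in the $A$ and in the $B$ indices. The doubly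
symmetric part and the mixed contractions are multi-gravitons, contractions within the four-letter
trace are exact, and the last component is `S4S2_eps_eps_mem`. -/
theorem S4S2_mem (hk : 0 < k) (i p j q t r : Fin 2) : S4 2 i p j q * S2 2 t r ∈ trivial3 k := by
  refine mem_of_sym3_of_eps (f := fun i j t => S4 2 i p j q * S2 2 t r)
    (fun l m n => ?_) (fun t => S4_eps_mul_S2_mem hk p q t r) (fun i => ?_) i j t
  · refine mem_of_sym3_of_eps
      (f := fun p q r => perm3 (fun i j t => S4 2 i p j q * S2 2 t r) l m n)
      (fun s t u => AB_ABAB_44_mem l m n s t u) (fun r => ?_) (fun p => ?_) p q r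
    · have := perm3_mem (fun i j t => S4_eps'_mul_S2_mem hk i j t r) l m n
      convert this using 1
      simp only [perm3]; abel
    · convert AB_ABAB_42_mem (k := k) l m n p using 1
      simp only [perm3]; abel
  · refine mem_of_sym3_of_eps
      (f := fun p q r => S4 2 i p 0 q * S2 2 1 r - S4 2 i p 1 q * S2 2 0 r)
      (fun s t u => AB_ABAB_24_mem s t u i) (fun r => ?_) (fun p => S4S2_eps_eps_mem hk i p) p q r
    convert (trivial3 k).sub_mem (S4_eps'_mul_S2_mem hk i 0 1 r) (S4_eps'_mul_S2_mem hk i 1 0 r)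
      using 1
    abel

/-- Modulo exact operators the last two $AB$ blocks may be exchanged, first their $B$'s and then
their $A$'s. The two terms on the left of the trace identity then agree, so twice the trace is a
combination of products. -/
theorem S6_mem (hk : 0 < k) (i p j q t r : Fin 2) : S6 2 i p j q t r ∈ trivial3 k := by
  have h1 : (S6 2 i p j q t r + S6 2 i p t r j q : Alg 2) = S2 2 i p * S4 2 j q t r +
      S2 2 j q * S4 2 i p t r + S2 2 t r * S4 2 i p j q - S2 2 i p * S2 2 j q * S2 2 t r :=
    congrArg Subtype.val (zS6_identity i p j q t r)
  simp only [← S2_mul_comm _ _ (S4 2 _ _ _ _)] at h1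
  have m1 := S6_swap_B_mem hk i p j q t r
  have m2 := S6_swap_A_mem hk i p j r t q
  have m3 := (trivial3 k).sub_mem ((trivial3 k).add_mem ((trivial3 k).add_mem
    (S4S2_mem hk j q t r i p) (S4S2_mem hk i p t r j q)) (S4S2_mem hk i p j q t r))
    (S2S2S2_mem (k := k) i p j q t r)
  rw [← h1] at m3
  refine ((trivial3 k).smul_mem_iff (two_ne_zero : (2 : ℂ) ≠ 0)).1 ?_
  convert (trivial3 k).add_mem ((trivial3 k).add_mem m1 m2) m3 using 1
  module

theorem scalar3_mem (hk : 0 < k) {X : AllRanks}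
    (hX : X ∈ Submodule.span ℂ {X | Scalar3 X}) : X 2 ∈ trivial3 k := by
  have : Submodule.span ℂ {X | Scalar3 X} ≤
      (trivial3 k).comap (LinearMap.proj 2 : AllRanks →ₗ[ℂ] Alg 2) := by
    refine Submodule.span_le.2 ?_
    rintro _ ⟨⟩
    · exact S6_mem hk _ _ _ _ _ _
    · exact S4S2_mem hk _ _ _ _ _ _
    · exact S2S2S2_mem _ _ _ _ _ _
  exact this hX

end Scalars

theorem scalar3_closed {X : AllRanks} (hX : X ∈ Submodule.span ℂ {X | Scalar3 X}) (N k : ℕ) :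
    Q N k (X N) = 0 := by
  have : Submodule.span ℂ {X | Scalar3 X} ≤
      LinearMap.ker (Q N k ∘ₗ (LinearMap.proj N : AllRanks →ₗ[ℂ] Alg N)) := by
    refine Submodule.span_le.2 ?_
    rintro _ ⟨⟩
    · exact Q_S6 _ _ _ _ _ _
    · change Q N k (S4 N _ _ _ _ * S2 N _ _) = 0
      rw [Q_mul_S2, Q_S4, zero_mul]
    · change Q N k (S2 N _ _ * S2 N _ _ * S2 N _ _) = 0
      rw [Q_mul_S2, Q_mul_S2, Q_S2, zero_mul, zero_mul]
  exact this hX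

theorem gravSpan_closed {d : ℕ} {T : Formal} (hT : T ∈ gravSpan d) (N k : ℕ) :
    Q N k (ev N T) = 0 := by
  have : gravSpan d ≤ LinearMap.ker (Q N k ∘ₗ (ev N).toLinearMap) := by
    refine Submodule.span_le.2 ?_
    rintro T ⟨m, -, hm, hT⟩
    exact m.Q_reps hm hT
  exact this hT

/-! ### Evaluation in the dual numbers -/

theorem map_ev_tr {N : ℕ} {R : Type*} [CommRing R] [Algebra ℂ R] (f : Alg N →ₐ[ℂ] R)
    (w : List Letter) :
    f (ev N (tr w)) = ((w.map fun l => f.mapMatrix (mat N l)).prod).trace := by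
  have : ((w.map fun l => f.mapMatrix (mat N l)).prod) = f.mapMatrix (w.map (mat N)).prod := by
    rw [map_list_prod, List.map_map]; rfl
  rw [ev_tr, this]
  simp [Matrix.trace]

/-- Evaluation at matrices of dual numbers whose fermionic entries are nilpotent. -/
def dualEval {N : ℕ} (a b : Letter → Matrix (Fin N) (Fin N) ℂ) : Alg N →ₐ[ℂ] DualNumber ℂ :=
  lift (fun x => (if x.1.kind.odd then 0 else TrivSqZeroExt.inl (a x.1 x.2.1 x.2.2)) +
    TrivSqZeroExt.inr (b x.1 x.2.1 x.2.2)) fun x y => by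
    cases hx : x.1.kind.odd <;> cases hy : y.1.kind.odd
    · simp [sgn, mul_comm]
    · simp [sgn, mul_comm]
    · simp [sgn, mul_comm]
    · simp

theorem dualEval_mat {N : ℕ} (a b : Letter → Matrix (Fin N) (Fin N) ℂ) (l : Letter) :
    (dualEval a b).mapMatrix (mat N l) = Matrix.of fun i j =>
      (if l.kind.odd then 0 else TrivSqZeroExt.inl (a l i j)) + TrivSqZeroExt.inr (b l i j) := by
  ext i j <;> simp [mat, dualEval]

theorem dualEval_mat_apply {N : ℕ} (a b : Letter → Matrix (Fin N) (Fin N) ℂ) (l : Letter)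
    (i j : Fin N) : dualEval a b (mat N l i j) =
      (if l.kind.odd then 0 else TrivSqZeroExt.inl (a l i j)) + TrivSqZeroExt.inr (b l i j) :=
  congrFun (congrFun (dualEval_mat a b l) i) j

/-- Matrices that detect the operators proportional to `𝒬 Tr(DA_i B_p)`. -/
def testA (w : Fin 2 → ℂ) : Letter → Matrix (Fin 2) (Fin 2) ℂ
  | ⟨.A, 0, i⟩ => if i = 0 then 1 else !![0, 0; 1, 0]
  | ⟨.B, 0, p⟩ => w p • !![0, 1; 0, 0]
  | _ => 0

def testB (u : Fin 2 → ℂ) : Letter → Matrix (Fin 2) (Fin 2) ℂ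
  | ⟨.psiA, 0, i⟩ => u i • !![1, 0; 0, 0]
  | _ => 0

theorem dualEval_F4 (u w : Fin 2 → ℂ) (i p : Fin 2) :
    (dualEval (testA w) (testB u) (F4 2 i 0 p 1 - F4 2 i 1 p 0)).snd = u i * w p := by
  rw [map_sub, F4, F4, map_ev_tr, map_ev_tr]
  simp [dualEval_mat_apply, lPsiA, lA, lB, Kind.odd, testA, testB, Matrix.trace_fin_two,
    Matrix.mul_apply, Fin.sum_univ_two]

theorem dualEval_G4 (u w : Fin 2 → ℂ) (p q i r : Fin 2) :
    dualEval (testA w) (testB u) (G4 2 p q i r) = 0 := by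
  rw [G4, map_ev_tr]
  have : (dualEval (testA w) (testB u)).mapMatrix (mat 2 (lPsiB p)) = 0 := by
    rw [dualEval_mat]
    ext <;> simp [lPsiB, Kind.odd, testB]
  rw [List.map_cons, List.prod_cons, this, zero_mul, Matrix.trace_zero]

/-- The test matrices have $\psi^B = 0$, which removes the `G4` part; with unit vectors for `u` and
`w` the `F4` part picks out one component, up to sign. -/
theorem E2_coefficients_eq_zero {d : Fin 2 × Fin 2 → ℂ}
    (H : ∑ p, d p • E2 2 p.1 p.2 = 0) : d = 0 := by
  have e : ∀ (u w : Fin 2 → ℂ) (p : Fin 2 × Fin 2),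
      (dualEval (testA w) (testB u) (E2 2 p.1 p.2)).snd = -(u p.1 * w p.2) := fun u w p => by
    have h : E2 2 p.1 p.2 = -((G4 2 p.2 0 p.1 1 - G4 2 p.2 1 p.1 0) +
      (F4 2 p.1 0 p.2 1 - F4 2 p.1 1 p.2 0)) := congrFun (allE2_eq p.1 p.2) 2
    rw [h, map_neg, map_add, map_sub, dualEval_G4, dualEval_G4, TrivSqZeroExt.snd_neg,
      TrivSqZeroExt.snd_add, dualEval_F4]
    simp
  funext p
  have h := congrArg (fun X => (dualEval (testA (Pi.single p.2 1)) (testB (Pi.single p.1 1)) X).snd) H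
  simp only [map_sum, map_smul, TrivSqZeroExt.snd_sum, TrivSqZeroExt.snd_smul, e, map_zero,
    TrivSqZeroExt.snd_zero] at h
  rw [Finset.sum_eq_single p] at h
  · simpa using h
  · rintro ⟨a, b⟩ - hq
    by_cases ha : a = p.1
    · have hb : b ≠ p.2 := fun hb => hq (Prod.ext ha hb)
      simp [Pi.single_apply, hb]
    · simp [Pi.single_apply, ha]
  · simp

/-! ### Closed operators of order `x^3` -/

theorem ofNat_mul_eq_smul {N : ℕ} (n : ℕ) [n.AtLeastTwo] (X : Alg N) :
    (OfNat.ofNat n : Alg N) * X = (OfNat.ofNat n : ℂ) • X := by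
  rw [Algebra.smul_def, map_ofNat]

section Parities

variable {N : ℕ}

theorem y1_even (a b : Fin 2) : HasParity false (y1 N a b : Alg N) := by
  change HasParity false (2 * ((S4 N 0 1 1 0 - S4 N 0 0 1 1) * S2 N a b))
  rw [ofNat_mul_eq_smul]
  exact (((S4_even _ _ _ _).sub (S4_even _ _ _ _)).mul (S2_even _ _)).smul _

theorem y2_even (a b : Fin 2) : HasParity false (y2 N a b : Alg N) :=
  ((S6_even 0 1 1 b a 0).sub (S6_even 0 0 1 b a 1)).sub
    ((S6_even 1 1 0 b a 0).sub (S6_even 1 0 0 b a 1))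

theorem y3_even (a b : Fin 2) : HasParity false (y3 N a b : Alg N) := by
  change HasParity false ((y2 N a b : Alg N) -
    (S6 N 0 0 1 1 a b - S6 N 1 0 0 1 a b) + (S6 N 0 1 1 0 a b - S6 N 1 1 0 0 a b) -
    3 * ((S4 N 0 1 1 0 - S4 N 0 0 1 1) * S2 N a b))
  rw [ofNat_mul_eq_smul]
  exact (((y2_even a b).sub ((S6_even _ _ _ _ _ _).sub (S6_even _ _ _ _ _ _))).add
    ((S6_even _ _ _ _ _ _).sub (S6_even _ _ _ _ _ _))).sub
      ((((S4_even _ _ _ _).sub (S4_even _ _ _ _)).mul (S2_even _ _)).smul _)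

theorem E2_odd (a b : Fin 2) : HasParity true (E2 N a b) := by
  have h : E2 N a b = (-1 : ℂ) • ((G4 N b 0 a 1 - G4 N b 1 a 0) +
      (F4 N a 0 b 1 - F4 N a 1 b 0)) := by
    rw [neg_one_smul]
    exact congrFun (allE2_eq a b) N
  rw [h]
  exact (((G4_odd _ _ _ _).sub (G4_odd _ _ _ _)).add ((F4_odd _ _ _ _).sub (F4_odd _ _ _ _))).smul _

/-- Applying $(-1)^F$ and adding gives twice the even part. -/
theorem HasParity.eq_zero_of_add {X Y : Alg N} (hX : HasParity false X) (hY : HasParity true Y)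
    (h : X + Y = 0) : X = 0 ∧ Y = 0 := by
  have h2 := congrArg (parity N) h
  rw [map_add, hX.2, hY.2, map_zero] at h2
  simp only [Bool.false_eq_true, if_false, if_true, one_smul] at h2
  have h3 : (2 : ℂ) • X = 0 := by
    have := congrArg₂ (· + ·) h h2
    simp only [add_zero] at this
    rw [← this]; module
  have h4 : X = 0 := by simpa using h3
  refine ⟨h4, ?_⟩
  rwa [h4, zero_add] at h

end Parities

/-- Scalars, multi-gravitons and `E2` have no variation, so only the coefficients `a`, `b`, `c`, `d`
are constrained by closure. -/
theorem Q_decomposition {N k : ℕ} {T : Formal} {s : AllRanks} {G : Formal}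
    {e a b c d : Fin 2 × Fin 2 → ℂ} (hs : s ∈ Submodule.span ℂ {X | Scalar3 X})
    (hG : G ∈ gravSpan 3)
    (h : evAll T = s + evAll G + ∑ p, e p • allE2 p.1 p.2 +
        ∑ p, a p • kap1 p.1 p.2 + ∑ p, b p • kap2 p.1 p.2 + ∑ p, c p • evFort p +
        ∑ p, d p • allP2 p.1 p.2) :
    Q N k (ev N T) = cQ k • (∑ p, a p • (y1 N p.1 p.2 : Alg N) +
      ∑ p, b p • (y2 N p.1 p.2 : Alg N) + ∑ p, c p • (y3 N p.1 p.2 : Alg N)) +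
      (-cQ k) • ∑ p, d p • E2 N p.1 p.2 := by
  have h1 := congrArg (Q N k) (congrFun h N)
  simp only [Pi.add_apply, Finset.sum_apply, Pi.smul_apply, map_add, map_sum, map_smul, Q_kap1,
    Q_kap2, evAll_apply, evFort, Q_fort, scalar3_closed hs, gravSpan_closed hG, zero_add] at h1
  rw [h1]
  have h2 : ∀ p : Fin 2 × Fin 2, Q N k (allE2 p.1 p.2 N) = 0 := fun p => Q_E2 _ _
  have h3 : ∀ p : Fin 2 × Fin 2, Q N k (allP2 p.1 p.2 N) = (-cQ k) • E2 N p.1 p.2 :=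
    fun p => Q_P2 _ _
  simp only [h2, h3, smul_zero, Finset.sum_const_zero, zero_add, smul_add, Finset.smul_sum,
    smul_comm (cQ k), smul_comm (-cQ k)]

theorem closed_conditions {N k : ℕ} (hk : 0 < k) {a b c d : Fin 2 × Fin 2 → ℂ}
    (h : cQ k • (∑ p, a p • (y1 N p.1 p.2 : Alg N) + ∑ p, b p • (y2 N p.1 p.2 : Alg N) +
      ∑ p, c p • (y3 N p.1 p.2 : Alg N)) + (-cQ k) • ∑ p, d p • E2 N p.1 p.2 = 0) :
    ∑ p, a p • (y1 N p.1 p.2 : Alg N) + ∑ p, b p • (y2 N p.1 p.2 : Alg N) +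
      ∑ p, c p • (y3 N p.1 p.2 : Alg N) = 0 ∧ ∑ p, d p • E2 N p.1 p.2 = 0 := by
  have hc := cQ_ne_zero hk
  have h1 := HasParity.eq_zero_of_add (HasParity.smul _ (HasParity.add (HasParity.add
    (HasParity.sum _ _ fun p _ => (y1_even p.1 p.2).smul (a p))
    (HasParity.sum _ _ fun p _ => (y2_even p.1 p.2).smul (b p)))
    (HasParity.sum _ _ fun p _ => (y3_even p.1 p.2).smul (c p))))
    (HasParity.smul _ (HasParity.sum _ _ fun p _ => (E2_odd p.1 p.2).smul (d p))) h
  exact ⟨(smul_eq_zero.1 h1.1).resolve_left hc,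
    (smul_eq_zero.1 h1.2).resolve_left (neg_ne_zero.2 hc)⟩

theorem mem_of_decomposition {k : ℕ} (hk : 0 < k) {T : Formal} {s : AllRanks} {G : Formal}
    {e c : Fin 2 × Fin 2 → ℂ} (hs : s ∈ Submodule.span ℂ {X | Scalar3 X})
    (hG : G ∈ gravSpan 3) (h : evAll T = s + evAll G + ∑ p, e p • allE2 p.1 p.2 +
      ∑ p, c p • evFort p) : ev 2 T - ∑ p, c p • ev 2 (fort p.1 p.2) ∈ trivial3 k := by
  have h1 := congrFun h 2
  simp only [Pi.add_apply, Finset.sum_apply, Pi.smul_apply, evAll_apply, evFort] at h1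
  rw [h1, add_sub_cancel_right]
  refine Submodule.add_mem _ (Submodule.add_mem _ (scalar3_mem hk hs) ?_)
    (Submodule.sum_mem _ fun p _ => Submodule.smul_mem _ _ ?_)
  · exact (le_sup_right : _ ≤ trivial3 k) ⟨G, hG, rfl⟩
  · exact (le_sup_left : _ ≤ trivial3 k) (E2_mem_exact hk _ _)

/-- At rank two `y3` is zero, which leaves `c` free, while `a`, `b` and `d` vanish by independence.
-/
theorem closed3_decomposition {k : ℕ} (hk : 0 < k) {X : Alg 2} (hX : X ∈ closed 2 k 3) :
    ∃ c : Fin 2 × Fin 2 → ℂ, X - ∑ p, c p • ev 2 (fort p.1 p.2) ∈ trivial3 k := by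
  obtain ⟨⟨T, hT, rfl⟩, hQ⟩ := hX
  obtain ⟨s, hs, G, hG, e, a, b, c, d, h⟩ := exists_decomposition hT
  have hQ' : Q 2 k (ev 2 T) = 0 := hQ
  rw [Q_decomposition hs hG h] at hQ'
  obtain ⟨h1, h2⟩ := closed_conditions hk hQ'
  have h3 : ∑ p, c p • (y3 2 p.1 p.2 : Alg 2) = 0 := by simp [y3_two]
  rw [h3, add_zero] at h1
  obtain ⟨rfl, rfl⟩ := coefficients_eq_zero_two h1
  obtain rfl := E2_coefficients_eq_zero h2
  refine ⟨c, mem_of_decomposition hk hs hG (e := e) ?_⟩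
  simpa using h

/-- The coefficients are the same at all ranks: closure at rank three removes `a`, `b`, `c`, and
closure at rank two removes `d`. -/
theorem monotone3_mem {k : ℕ} (hk : 0 < k) {T : Formal} (hT : T ∈ monotone k 3) :
    ev 2 T ∈ trivial3 k := by
  obtain ⟨hT, hQ⟩ := hT
  have hQ' : ∀ N, Q N k (ev N T) = 0 := fun N => (Submodule.mem_iInf _).1 hQ N
  obtain ⟨s, hs, G, hG, e, a, b, c, d, h⟩ := exists_decomposition hT
  have h2 := hQ' 2
  have h3 := hQ' 3
  rw [Q_decomposition hs hG h] at h2 h3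
  obtain ⟨rfl, rfl, rfl⟩ := coefficients_eq_zero_of_le le_rfl (closed_conditions hk h3).1
  obtain rfl := E2_coefficients_eq_zero (closed_conditions hk h2).2
  have := mem_of_decomposition hk hs hG (e := e) (c := 0) (T := T) (by simpa using h)
  simpa using this

theorem Q_fort_ne_zero {k N : ℕ} (hk : 0 < k) (hN : 3 ≤ N) (a b : Fin 2) :
    Q N k (ev N (fort a b)) ≠ 0 := by
  intro h
  rw [Q_fort] at h
  replace h := (smul_eq_zero.1 h).resolve_left (cQ_ne_zero hk)
  have := (coefficients_eq_zero_of_le hN (x := 0) (y := 0) (z := Pi.single (a, b) 1) (by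
    rw [Finset.sum_eq_single (a, b) (f := fun p : Fin 2 × Fin 2 =>
      (Pi.single (a, b) (1 : ℂ) : Fin 2 × Fin 2 → ℂ) p • (y3 N p.1 p.2 : Alg N))]
    · simp [h]
    · intro p _ hp; simp [hp]
    · simp)).2.2
  simpa using congrFun this (a, b)

/-! ### Closed operators of lower order -/

/-- Exact operators and gravitons of the rank two theory. -/
def trivialOps (k d : ℕ) : Submodule ℂ (Alg 2) :=
  exact 2 k d ⊔ (gravSpan d).map (ev 2).toLinearMap

theorem grav_mem_trivialOps {k : ℕ} (m : Multiplet) (hm : m ≠ .fortuitous) {T : Formal}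
    (hT : T ∈ m.reps) : ev 2 T ∈ trivialOps k m.order :=
  (le_sup_right : _ ≤ trivialOps k m.order) ⟨T, mem_gravSpan m hm hT, rfl⟩

theorem mem_trivialOps_zero {k : ℕ} {T : Formal} (hT : T ∈ formalOps 0) :
    ev 2 T ∈ trivialOps k 0 := by
  obtain ⟨c, hc⟩ := Submodule.mem_span_singleton.1 (evAll_mem_of_formalOps_zero hT)
  have h : ev 2 T = c • 1 := (congrFun hc 2).symm
  rw [h]
  refine Submodule.smul_mem _ _ ?_
  have := grav_mem_trivialOps (k := k) .unit (by simp) (T := 1) rfl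
  rwa [map_one] at this

theorem mem_trivialOps_one {k : ℕ} {T : Formal} (hT : T ∈ formalOps 1) :
    ev 2 T ∈ trivialOps k 1 := by
  refine evAll_mem_of_formalOps_one
    (U := (trivialOps k 1).comap (LinearMap.proj 2 : AllRanks →ₗ[ℂ] Alg 2)) ?_ hT
  rintro _ ⟨i, p⟩
  exact grav_mem_trivialOps (k := k) .AB (by simp) ⟨i, p, rfl⟩

section OrderTwo

variable {k : ℕ}

theorem S4'_mem (hk : 0 < k) : S4' 2 ∈ trivialOps k 2 := by
  have h := (le_sup_left : _ ≤ trivialOps k 2) (Q_ev_mem_exact (N := 2) (k := k)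
    (tr_mem_formalOps (d := 2) (gaugeWord_psiAA 0 1) rfl))
  rw [ev_psiAA, Q_F2_eps] at h
  refine ((trivialOps k 2).smul_mem_iff ?_).1 h
  simpa [eps] using cQ_ne_zero hk

theorem mem_of_sym2_of_eps {M : Type*} [AddCommGroup M] [Module ℂ M] {U : Submodule ℂ M}
    {f : Fin 2 → Fin 2 → M} (hs : ∀ l m, f l m + f m l ∈ U) (h : f 0 1 - f 1 0 ∈ U)
    (i j : Fin 2) : f i j ∈ U := by
  have h1 : f i j - f j i ∈ U := sub_swap_mem h i j
  convert U.smul_mem (1 / 2 : ℂ) (U.add_mem (hs i j) h1) using 1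
  module

theorem ABAB_33_mem (l m r s : Fin 2) :
    (S4 2 l r m s + S4 2 l s m r) + (S4 2 m r l s + S4 2 m s l r) ∈ trivialOps k 2 := by
  have h := grav_mem_trivialOps (k := k) .ABAB_33 (by simp) ⟨l, m, r, s, rfl⟩
  simp only [map_sum, map_smul, ev_ABAB, mul_smul, ← Finset.smul_sum] at h
  simp only [sum_sym2 (fun p q => S4 2 _ p _ q)] at h
  rw [sum_sym2 (fun i j => (1 / 2 : ℂ) • (S4 2 i r j s + S4 2 i s j r)), ← smul_add,
    smul_smul] at h
  exact ((trivialOps k 2).smul_mem_iff (by norm_num)).1 h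

theorem AB_AB_33_mem (l m r s : Fin 2) : (S2 2 l r * S2 2 m s + S2 2 l s * S2 2 m r) +
    (S2 2 m r * S2 2 l s + S2 2 m s * S2 2 l r) ∈ trivialOps k 2 := by
  have h := grav_mem_trivialOps (k := k) .AB_AB_33 (by simp) ⟨l, m, r, s, rfl⟩
  simp only [map_sum, map_smul, map_mul, ev_AB, mul_smul, ← Finset.smul_sum] at h
  simp only [sum_sym2 (fun p q => S2 2 _ p * S2 2 _ q)] at h
  rw [sum_sym2 (fun i j => (1 / 2 : ℂ) • (S2 2 i r * S2 2 j s + S2 2 i s * S2 2 j r)), ← smul_add,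
    smul_smul] at h
  exact ((trivialOps k 2).smul_mem_iff (by norm_num)).1 h

theorem AB_AB_11_mem : S2 2 0 0 * S2 2 1 1 - S2 2 1 0 * S2 2 0 1 ∈ trivialOps k 2 := by
  have h := grav_mem_trivialOps (k := k) .AB_AB_11 (by simp) rfl
  simp only [map_sum, map_smul, map_mul, ev_AB, mul_smul, ← Finset.smul_sum] at h
  simp only [sum_eps] at h
  replace h : _ ∈ trivialOps k 2 := h
  refine ((trivialOps k 2).smul_mem_iff (two_ne_zero : (2 : ℂ) ≠ 0)).1 ?_
  convert h using 1
  rw [S2_mul_comm 0 1 (S2 2 1 0), S2_mul_comm 0 0 (S2 2 1 1), two_smul]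
  abel

theorem S4_mem (hk : 0 < k) (i p j q : Fin 2) : S4 2 i p j q ∈ trivialOps k 2 := by
  refine mem_of_sym2_of_eps (f := fun i j => S4 2 i p j q) (fun l m => ?_) ?_ i j
  · refine mem_of_sym2_of_eps (f := fun p q => S4 2 l p m q + S4 2 m p l q) (fun r s => ?_) ?_ p q
    · convert ABAB_33_mem l m r s using 1
      abel
    · obtain ⟨c, hc⟩ := S4_eps' 2 l m
      obtain ⟨c', hc'⟩ := S4_eps' 2 m l
      rw [add_sub_add_comm, hc, hc']
      exact Submodule.add_mem _ (Submodule.smul_mem _ _ (S4'_mem hk))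
        (Submodule.smul_mem _ _ (S4'_mem hk))
  · obtain ⟨c, hc⟩ := S4_eps 2 p q
    rw [hc]
    exact Submodule.smul_mem _ _ (S4'_mem hk)

theorem S2S2_mem (i p j q : Fin 2) : S2 2 i p * S2 2 j q ∈ trivialOps k 2 := by
  refine mem_of_sym2_of_eps (f := fun i j => S2 2 i p * S2 2 j q) (fun l m => ?_) ?_ i j
  · have h := AB_AB_33_mem (k := k) l m p q
    rw [S2_mul_comm m p, S2_mul_comm l p] at h
    refine ((trivialOps k 2).smul_mem_iff (two_ne_zero : (2 : ℂ) ≠ 0)).1 ?_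
    convert h using 1
    module
  · have h := AB_AB_11_mem (k := k)
    fin_cases p <;> fin_cases q <;> simp only [Fin.zero_eta, Fin.mk_one]
    · rw [S2_mul_comm 0 0 (S2 2 1 0), sub_self]; exact Submodule.zero_mem _
    · exact h
    · rw [S2_mul_comm 1 0, S2_mul_comm 0 0, ← neg_sub]; exact Submodule.neg_mem _ h
    · rw [S2_mul_comm 0 1 (S2 2 1 1), sub_self]; exact Submodule.zero_mem _

theorem F2_mem {U : Submodule ℂ (Alg 2)} (hU : trivialOps k 2 ≤ U)
    (h : F2 2 0 1 - F2 2 1 0 ∈ U) (i j : Fin 2) : F2 2 i j ∈ U := by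
  refine mem_of_sym2_of_eps (fun l m => hU ?_) h i j
  have h := grav_mem_trivialOps (k := k) .psiAA_31 (by simp) ⟨l, m, rfl⟩
  simp only [map_sum, map_smul, ev_ApsiA] at h
  rw [sum_sym2 (fun i j => F2 2 j i), add_comm] at h
  exact ((trivialOps k 2).smul_mem_iff (by norm_num)).1 h

theorem G2_mem {U : Submodule ℂ (Alg 2)} (hU : trivialOps k 2 ≤ U)
    (h : F2 2 0 1 - F2 2 1 0 ∈ U) (i j : Fin 2) : G2 2 i j ∈ U := by
  refine mem_of_sym2_of_eps (fun l m => hU ?_) ?_ i j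
  · have h := grav_mem_trivialOps (k := k) .psiBB_13 (by simp) ⟨l, m, rfl⟩
    simp only [map_sum, map_smul, ev_BpsiB] at h
    rw [sum_sym2 (fun i j => G2 2 j i), add_comm] at h
    exact ((trivialOps k 2).smul_mem_iff (by norm_num)).1 h
  · have h2 := hU (grav_mem_trivialOps (k := k) .current_11 (by simp) rfl)
    simp only [map_sum, map_smul, map_sub, ev_BpsiB, ev_ApsiA] at h2
    rw [sum_eps (fun i j => F2 2 j i - G2 2 j i)] at h2
    convert U.add_mem h h2 using 1
    abel

theorem S4'_ne_zero : S4' 2 ≠ 0 := by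
  intro h
  have h2 := congrArg (numEval (N := 2) le_rfl ![!![1, 1; 0, 0], !![1, 0; 0, 0]]
    ![!![1, 0; 1, 1], !![1, 0; 0, 0]] 1 1) h
  rw [S4', map_sub, numEval_S4, numEval_S4, map_zero] at h2
  have e1 : v4 ![!![1, 1; 0, 0], !![1, 0; 0, 0]] ![!![1, 0; 1, 1], !![1, 0; 0, 0]] 0 1 1 0 -
    v4 ![!![1, 1; 0, 0], !![1, 0; 0, 0]] ![!![1, 0; 1, 1], !![1, 0; 0, 0]] 0 0 1 1 = -1 := by
    decide
  have e2 : ((v4 ![!![1, 1; 0, 0], !![1, 0; 0, 0]] ![!![1, 0; 1, 1], !![1, 0; 0, 0]] 0 1 1 0 : ℂ) -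
    v4 ![!![1, 1; 0, 0], !![1, 0; 0, 0]] ![!![1, 0; 1, 1], !![1, 0; 0, 0]] 0 0 1 1) = -1 := by
    exact_mod_cast congrArg (Int.cast : ℤ → ℂ) e1
  simp only [wt_zero, wt_one, one_mul] at h2
  rw [e2] at h2
  norm_num at h2

/-- Modulo exact operators and multi-gravitons one direction remains, the contracted `F2`; its
variation is a nonzero multiple of `S4'`, so a closed operator has no component along it. -/
theorem mem_trivialOps_two (hk : 0 < k) {T : Formal} (hT : T ∈ formalOps 2)
    (hQ : Q 2 k (ev 2 T) = 0) : ev 2 T ∈ trivialOps k 2 := by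
  let U := trivialOps k 2 ⊔ Submodule.span ℂ {F2 2 0 1 - F2 2 1 0}
  have hU : trivialOps k 2 ≤ U := le_sup_left
  have hf : F2 2 0 1 - F2 2 1 0 ∈ U :=
    (le_sup_right : _ ≤ U) (Submodule.mem_span_singleton_self _)
  have h : ev 2 T ∈ U := by
    refine evAll_mem_of_formalOps_two
      (U := U.comap (LinearMap.proj 2 : AllRanks →ₗ[ℂ] Alg 2)) ?_ ?_ hT
    · rintro _ ⟨⟩
      · exact hU (S4_mem hk _ _ _ _)
      · exact F2_mem hU hf _ _
      · exact G2_mem hU hf _ _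
    · rintro _ _ ⟨⟩ ⟨⟩
      exact hU (S2S2_mem _ _ _ _)
  obtain ⟨X, hX, Y, hY, hXY⟩ := Submodule.mem_sup.1 h
  obtain ⟨c, rfl⟩ := Submodule.mem_span_singleton.1 hY
  have hQX : Q 2 k X = 0 := by
    have hX' := hX
    obtain ⟨X1, ⟨Z, ⟨Z', hZ', rfl⟩, rfl⟩, X2, ⟨G, hG, rfl⟩, rfl⟩ := Submodule.mem_sup.1 hX'
    rw [map_add]
    -- At this order all variations are built from scalars, so the second variation vanishes case by
    -- case.
    have hQQ : Q 2 k (Q 2 k (ev 2 Z')) = 0 := by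
      have : evAll Z' ∈ (LinearMap.ker (Q 2 k ∘ₗ Q 2 k)).comap
          (LinearMap.proj 2 : AllRanks →ₗ[ℂ] Alg 2) := by
        refine evAll_mem_of_formalOps_two ?_ ?_ hZ'
        · rintro _ ⟨⟩
          · change Q 2 k (Q 2 k (S4 2 _ _ _ _)) = 0
            rw [Q_S4, map_zero]
          · change Q 2 k (Q 2 k (F2 2 _ _)) = 0
            rw [Q_F2_eps, map_smul, S4', map_sub, Q_S4, Q_S4, sub_zero, smul_zero]
          · change Q 2 k (Q 2 k (G2 2 _ _)) = 0
            rw [Q_G2_eps, map_smul, S4', map_sub, Q_S4, Q_S4, sub_zero, smul_zero]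
        · rintro _ _ ⟨⟩ ⟨⟩
          change Q 2 k (Q 2 k (S2 2 _ _ * S2 2 _ _)) = 0
          rw [Q_mul_S2, Q_S2, zero_mul, map_zero]
      exact this
    change Q 2 k (Q 2 k (ev 2 Z')) + Q 2 k (ev 2 G) = 0
    rw [hQQ, gravSpan_closed hG, add_zero]
  rw [← hXY, map_add, hQX, zero_add, map_smul, map_sub, Q_F2_eps, Q_F2_eps, ← sub_smul,
    smul_smul, smul_eq_zero] at hQ
  have hc : c = 0 := by
    have := hQ.resolve_right S4'_ne_zero
    have h2 : cQ k * eps 0 1 - cQ k * eps 1 0 = 2 * cQ k := by simp [eps]; ring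
    rw [h2] at this
    simpa [cQ_ne_zero hk] using this
  rw [← hXY, hc, zero_smul, add_zero]
  exact hX

end OrderTwo

/-! ### Polarisation -/

section Polarisation

variable {M : Type*} [AddCommGroup M] [Module ℂ M]

/-- The index sequence that starts with `a` ones and continues with zeros. -/
def idx (a t : ℕ) : Fin 2 := if t < a then 1 else 0

theorem sum_powCoeff_two (f : Fin 2 → M) (x : Fin 2 → ℂ) :
    ∑ a ∈ Finset.range 2, powCoeff 2 a x • f (idx a 0) = ∑ i, x i • f i := by
  simp [Finset.sum_range_succ, powCoeff, idx]

/-- The binomial coefficient in `powCoeff` counts the index strings with a given number of ones, so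
the symmetrised components sum up to the full polynomial in `x`. -/
theorem sum_powCoeff_three (f : Fin 2 → Fin 2 → M) (x : Fin 2 → ℂ) :
    ∑ a ∈ Finset.range 3, powCoeff 3 a x • ∑ i, ∑ j, sym2 i j (idx a 0) (idx a 1) • f i j =
      ∑ i, ∑ j, (x i * x j) • f i j := by
  simp only [sum_sym2, Finset.sum_range_succ, powCoeff, idx, Finset.sum_range_zero]
  simp
  module

theorem sum_powCoeff_four (f : Fin 2 → Fin 2 → Fin 2 → M) (x : Fin 2 → ℂ) :
    ∑ a ∈ Finset.range 4, powCoeff 4 a x • ∑ i, ∑ j, ∑ k,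
      sym3 i j k (idx a 0) (idx a 1) (idx a 2) • f i j k =
      ∑ i, ∑ j, ∑ k, (x i * x j * x k) • f i j k := by
  simp only [sum_sym3, Finset.sum_range_succ, powCoeff, idx, Finset.sum_range_zero]
  simp [Nat.choose_succ_succ]
  module

theorem genFun_eq (m n : ℕ) (φ : ℕ → ℕ → M) (x y : Fin 2 → ℂ) :
    genFun m n φ x y = ∑ a ∈ Finset.range m, powCoeff m a x •
      ∑ b ∈ Finset.range n, powCoeff n b y • φ a b := by
  simp only [genFun, Finset.smul_sum, mul_smul]

theorem genFun_eq' (m n : ℕ) (φ : ℕ → ℕ → M) (x y : Fin 2 → ℂ) :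
    genFun m n φ x y = ∑ b ∈ Finset.range n, powCoeff n b y •
      ∑ a ∈ Finset.range m, powCoeff m a x • φ a b := by
  simp only [genFun, Finset.smul_sum, smul_smul]
  rw [Finset.sum_comm]
  simp only [mul_comm]

theorem genFun_one_one (X : M) (x y : Fin 2 → ℂ) : genFun 1 1 (fun _ _ => X) x y = X := by
  simp [genFun, powCoeff]

theorem genFun_two_two (f : Fin 2 → Fin 2 → M) (x y : Fin 2 → ℂ) :
    genFun 2 2 (fun a b => f (idx a 0) (idx b 0)) x y = ∑ i, ∑ p, (x i * y p) • f i p := by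
  rw [genFun_eq]
  simp only [sum_powCoeff_two (f _)]
  rw [sum_powCoeff_two (fun i => ∑ p, y p • f i p)]
  simp only [Finset.smul_sum, mul_smul]

theorem genFun_three_one (f : Fin 2 → Fin 2 → M) (x y : Fin 2 → ℂ) :
    genFun 3 1 (fun a _ => ∑ i, ∑ j, sym2 i j (idx a 0) (idx a 1) • f i j) x y =
      ∑ i, ∑ j, (x i * x j) • f i j := by
  rw [genFun_eq']
  simp only [sum_powCoeff_three f]
  simp [powCoeff]

theorem genFun_one_three (f : Fin 2 → Fin 2 → M) (x y : Fin 2 → ℂ) :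
    genFun 1 3 (fun _ b => ∑ i, ∑ j, sym2 i j (idx b 0) (idx b 1) • f i j) x y =
      ∑ i, ∑ j, (y i * y j) • f i j := by
  rw [genFun_eq]
  simp only [sum_powCoeff_three f]
  simp [powCoeff]

theorem sum_smul_sum_two (s : ℕ) (c : ℕ → ℂ) (w : Fin 2 → Fin 2 → ℂ)
    (h : ℕ → Fin 2 → Fin 2 → M) : ∑ b ∈ Finset.range s, c b • ∑ i, ∑ j, w i j • h b i j =
      ∑ i, ∑ j, w i j • ∑ b ∈ Finset.range s, c b • h b i j := by
  simp only [Fin.sum_univ_two, smul_add, Finset.sum_add_distrib, Finset.smul_sum, smul_smul,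
    mul_comm]

theorem sum_smul_sum_three (s : ℕ) (c : ℕ → ℂ) (w : Fin 2 → Fin 2 → Fin 2 → ℂ)
    (h : ℕ → Fin 2 → Fin 2 → Fin 2 → M) : ∑ b ∈ Finset.range s, c b • ∑ i, ∑ j, ∑ k, w i j k • h b i j k =
      ∑ i, ∑ j, ∑ k, w i j k • ∑ b ∈ Finset.range s, c b • h b i j k := by
  simp only [Fin.sum_univ_two, smul_add, Finset.sum_add_distrib, Finset.smul_sum, smul_smul,
    mul_comm]

theorem genFun_three_three (f : Fin 2 → Fin 2 → Fin 2 → Fin 2 → M) (x y : Fin 2 → ℂ) :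
    genFun 3 3 (fun a b => ∑ i, ∑ j, ∑ p, ∑ q,
      (sym2 i j (idx a 0) (idx a 1) * sym2 p q (idx b 0) (idx b 1)) • f i j p q) x y =
      ∑ i, ∑ j, (x i * x j) • ∑ p, ∑ q, (y p * y q) • f i j p q := by
  rw [genFun_eq]
  simp only [mul_smul _ (sym2 _ _ _ _), ← Finset.smul_sum, sum_smul_sum_two]
  simp only [sum_powCoeff_three (f _ _)]
  exact sum_powCoeff_three (fun i j => ∑ p, ∑ q, (y p * y q) • f i j p q) x

theorem genFun_four_four (f : Fin 2 → Fin 2 → Fin 2 → Fin 2 → Fin 2 → Fin 2 → M)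
    (x y : Fin 2 → ℂ) :
    genFun 4 4 (fun a b => ∑ i, ∑ j, ∑ k, ∑ p, ∑ q, ∑ r,
      (sym3 i j k (idx a 0) (idx a 1) (idx a 2) * sym3 p q r (idx b 0) (idx b 1) (idx b 2)) •
        f i j k p q r) x y =
      ∑ i, ∑ j, ∑ k, (x i * x j * x k) • ∑ p, ∑ q, ∑ r, (y p * y q * y r) • f i j k p q r := by
  rw [genFun_eq]
  simp only [mul_smul _ (sym3 _ _ _ _ _ _), ← Finset.smul_sum, sum_smul_sum_three]
  simp only [sum_powCoeff_four (f _ _ _)]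
  exact sum_powCoeff_four (fun i j k => ∑ p, ∑ q, ∑ r, (y p * y q * y r) • f i j k p q r) x

theorem genFun_four_two (f : Fin 2 → Fin 2 → Fin 2 → Fin 2 → M) (x y : Fin 2 → ℂ) :
    genFun 4 2 (fun a b => ∑ i, ∑ j, ∑ k,
      sym3 i j k (idx a 0) (idx a 1) (idx a 2) • f i j k (idx b 0)) x y =
      ∑ i, ∑ j, ∑ k, (x i * x j * x k) • ∑ p, y p • f i j k p := by
  rw [genFun_eq]
  simp only [sum_smul_sum_three]
  simp only [sum_powCoeff_two (f _ _ _)]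
  exact sum_powCoeff_four (fun i j k => ∑ p, y p • f i j k p) x

theorem genFun_two_four (f : Fin 2 → Fin 2 → Fin 2 → Fin 2 → M) (x y : Fin 2 → ℂ) :
    genFun 2 4 (fun a b => ∑ i, ∑ j, ∑ k,
      sym3 i j k (idx b 0) (idx b 1) (idx b 2) • f i j k (idx a 0)) x y =
      ∑ i, ∑ j, ∑ k, (y i * y j * y k) • ∑ p, x p • f i j k p := by
  rw [genFun_eq']
  simp only [sum_smul_sum_three]
  simp only [sum_powCoeff_two (f _ _ _)]
  exact sum_powCoeff_four (fun i j k => ∑ p, x p • f i j k p) y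

end Polarisation

/-! ### Traces of linear combinations of letters -/

section LinearCombinations

variable (N : ℕ)

/-- The linear combination of the members of a doublet of letters. -/
def comb (t : Kind) (n : ℕ) (x : Fin 2 → ℂ) : Matrix (Fin N) (Fin N) (Alg N) :=
  ∑ i, x i • mat N ⟨t, n, i⟩

/-- The `i`-th unit vector. -/
def uvec (i : Fin 2) : Fin 2 → ℂ := Pi.single i 1

theorem comb_uvec (t : Kind) (n : ℕ) (i : Fin 2) : comb N t n (uvec i) = mat N ⟨t, n, i⟩ := by
  fin_cases i <;> simp [comb, uvec]

theorem comb_eq (t : Kind) (n : ℕ) (x : Fin 2 → ℂ) :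
    comb N t n x = x 0 • comb N t n (uvec 0) + x 1 • comb N t n (uvec 1) := by
  rw [comb_uvec, comb_uvec, comb, Fin.sum_univ_two]

/-- The group action moves onto the auxiliary vector, so covariance of traces of such combinations
can be read off their arguments. -/
theorem flavorMap_comb (g : Flavor) (t : Kind) (n : ℕ) (x : Fin 2 → ℂ) :
    flavorMap N g (comb N t n x) = comb N t n ((g.on t).mulVec x) := by
  simp only [comb, map_add, map_smul, flavorMap_mat, Fin.sum_univ_two, Matrix.mulVec, dotProduct]
  module

theorem flavorHom_trace (g : Flavor) (M : Matrix (Fin N) (Fin N) (Alg N)) :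
    flavorHom N g M.trace = (flavorMap N g M).trace := by
  simp [Matrix.trace]

def vS2 (x y : Fin 2 → ℂ) : Alg N := (comb N .A 0 x * comb N .B 0 y).trace
def vS4 (x y x' y' : Fin 2 → ℂ) : Alg N :=
  (comb N .A 0 x * (comb N .B 0 y * (comb N .A 0 x' * comb N .B 0 y'))).trace
def vF2 (x x' : Fin 2 → ℂ) : Alg N := (comb N .psiA 0 x * comb N .A 0 x').trace
def vG2 (y y' : Fin 2 → ℂ) : Alg N := (comb N .psiB 0 y * comb N .B 0 y').trace
def vF4 (x x' y x'' : Fin 2 → ℂ) : Alg N :=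
  (comb N .psiA 0 x * (comb N .A 0 x' * (comb N .B 0 y * comb N .A 0 x''))).trace
def vG4 (y y' x y'' : Fin 2 → ℂ) : Alg N :=
  (comb N .psiB 0 y * (comb N .B 0 y' * (comb N .A 0 x * comb N .B 0 y''))).trace
def vD1 (x y : Fin 2 → ℂ) : Alg N := (comb N .A 1 x * comb N .B 0 y).trace
def vD2 (x y : Fin 2 → ℂ) : Alg N := (comb N .A 0 x * comb N .B 1 y).trace
def vP2 (x y : Fin 2 → ℂ) : Alg N := (comb N .psiA 0 x * comb N .psiB 0 y).trace

variable {N}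

theorem S2_eq_vS2 (i p : Fin 2) : S2 N i p = vS2 N (uvec i) (uvec p) := by
  simp [S2, vS2, ev_tr, comb_uvec, lA, lB]
theorem S4_eq_vS4 (i p j q : Fin 2) :
    S4 N i p j q = vS4 N (uvec i) (uvec p) (uvec j) (uvec q) := by
  simp [S4, vS4, ev_tr, comb_uvec, lA, lB]
theorem F2_eq_vF2 (i j : Fin 2) : F2 N i j = vF2 N (uvec i) (uvec j) := by
  simp [F2, vF2, ev_tr, comb_uvec, lA, lPsiA]
theorem G2_eq_vG2 (i j : Fin 2) : G2 N i j = vG2 N (uvec i) (uvec j) := by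
  simp [G2, vG2, ev_tr, comb_uvec, lB, lPsiB]
theorem F4_eq_vF4 (i j p k : Fin 2) :
    F4 N i j p k = vF4 N (uvec i) (uvec j) (uvec p) (uvec k) := by
  simp [F4, vF4, ev_tr, comb_uvec, lA, lB, lPsiA]
theorem G4_eq_vG4 (i j p k : Fin 2) :
    G4 N i j p k = vG4 N (uvec i) (uvec j) (uvec p) (uvec k) := by
  simp [G4, vG4, ev_tr, comb_uvec, lA, lB, lPsiB]
theorem D1_eq_vD1 (i p : Fin 2) : D1 N i p = vD1 N (uvec i) (uvec p) := by
  simp [D1, vD1, ev_tr, comb_uvec, lDA, lA, lB, Letter.D]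
theorem D2_eq_vD2 (i p : Fin 2) : D2 N i p = vD2 N (uvec i) (uvec p) := by
  simp [D2, vD2, ev_tr, comb_uvec, lDB, lA, lB, Letter.D]
theorem P2_eq_vP2 (i p : Fin 2) : P2 N i p = vP2 N (uvec i) (uvec p) := by
  simp [P2, vP2, ev_tr, comb_uvec, lPsiA, lPsiB]

theorem vS2_eq (x y : Fin 2 → ℂ) : vS2 N x y = ∑ i, ∑ p, (x i * y p) • S2 N i p := by
  simp only [S2_eq_vS2, vS2, comb_eq N _ _ x, comb_eq N _ _ y, add_mul, mul_add, smul_mul_smul_comm,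
    Matrix.trace_add, Matrix.trace_smul, Fin.sum_univ_two]
  abel
theorem vF2_eq (x y : Fin 2 → ℂ) : vF2 N x y = ∑ i, ∑ p, (x i * y p) • F2 N i p := by
  simp only [F2_eq_vF2, vF2, comb_eq N _ _ x, comb_eq N _ _ y, add_mul, mul_add, smul_mul_smul_comm,
    Matrix.trace_add, Matrix.trace_smul, Fin.sum_univ_two]
  abel
theorem vG2_eq (x y : Fin 2 → ℂ) : vG2 N x y = ∑ i, ∑ p, (x i * y p) • G2 N i p := by
  simp only [G2_eq_vG2, vG2, comb_eq N _ _ x, comb_eq N _ _ y, add_mul, mul_add, smul_mul_smul_comm,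
    Matrix.trace_add, Matrix.trace_smul, Fin.sum_univ_two]
  abel
theorem vD1_eq (x y : Fin 2 → ℂ) : vD1 N x y = ∑ i, ∑ p, (x i * y p) • D1 N i p := by
  simp only [D1_eq_vD1, vD1, comb_eq N _ _ x, comb_eq N _ _ y, add_mul, mul_add, smul_mul_smul_comm,
    Matrix.trace_add, Matrix.trace_smul, Fin.sum_univ_two]
  abel
theorem vD2_eq (x y : Fin 2 → ℂ) : vD2 N x y = ∑ i, ∑ p, (x i * y p) • D2 N i p := by
  simp only [D2_eq_vD2, vD2, comb_eq N _ _ x, comb_eq N _ _ y, add_mul, mul_add, smul_mul_smul_comm,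
    Matrix.trace_add, Matrix.trace_smul, Fin.sum_univ_two]
  abel
theorem vP2_eq (x y : Fin 2 → ℂ) : vP2 N x y = ∑ i, ∑ p, (x i * y p) • P2 N i p := by
  simp only [P2_eq_vP2, vP2, comb_eq N _ _ x, comb_eq N _ _ y, add_mul, mul_add, smul_mul_smul_comm,
    Matrix.trace_add, Matrix.trace_smul, Fin.sum_univ_two]
  abel
theorem vS4_eq (x y x' y' : Fin 2 → ℂ) : vS4 N x y x' y' =
    ∑ i, ∑ p, ∑ j, ∑ q, (x i * (y p * (x' j * y' q))) • S4 N i p j q := by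
  simp only [S4_eq_vS4, vS4, comb_eq N _ _ x, comb_eq N _ _ y, comb_eq N _ _ x', comb_eq N _ _ y',
    add_mul, mul_add, smul_mul_smul_comm, Matrix.trace_add, Matrix.trace_smul, Fin.sum_univ_two]
  abel
theorem vF4_eq (x x' y x'' : Fin 2 → ℂ) : vF4 N x x' y x'' =
    ∑ i, ∑ j, ∑ p, ∑ k, (x i * (x' j * (y p * x'' k))) • F4 N i j p k := by
  simp only [F4_eq_vF4, vF4, comb_eq N _ _ x, comb_eq N _ _ y, comb_eq N _ _ x', comb_eq N _ _ x'',
    add_mul, mul_add, smul_mul_smul_comm, Matrix.trace_add, Matrix.trace_smul, Fin.sum_univ_two]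
  abel
theorem vG4_eq (x x' y x'' : Fin 2 → ℂ) : vG4 N x x' y x'' =
    ∑ i, ∑ j, ∑ p, ∑ k, (x i * (x' j * (y p * x'' k))) • G4 N i j p k := by
  simp only [G4_eq_vG4, vG4, comb_eq N _ _ x, comb_eq N _ _ y, comb_eq N _ _ x', comb_eq N _ _ x'',
    add_mul, mul_add, smul_mul_smul_comm, Matrix.trace_add, Matrix.trace_smul, Fin.sum_univ_two]
  abel

end LinearCombinations

/-! ### The multiplets as tensors -/

/-- The components of a multiplet. -/
def Multiplet.rep : Multiplet → ℕ → ℕ → Formal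
  | unit, _, _ => 1
  | AB, a, b => tr [lA (idx a 0), lB (idx b 0)]
  | ABAB_33, a, b => ∑ i, ∑ j, ∑ p, ∑ q,
      (sym2 i j (idx a 0) (idx a 1) * sym2 p q (idx b 0) (idx b 1)) • tr [lA i, lB p, lA j, lB q]
  | AB_AB_33, a, b => ∑ i, ∑ j, ∑ p, ∑ q,
      (sym2 i j (idx a 0) (idx a 1) * sym2 p q (idx b 0) (idx b 1)) •
        (tr [lA i, lB p] * tr [lA j, lB q])
  | AB_AB_11, _, _ => ∑ i, ∑ j, ∑ p, ∑ q,
      (eps i j * eps p q) • (tr [lA i, lB p] * tr [lA j, lB q])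
  | psiAA_31, a, _ => ∑ i, ∑ j, sym2 i j (idx a 0) (idx a 1) • tr [lA i, lPsiA j]
  | psiBB_13, _, b => ∑ p, ∑ q, sym2 p q (idx b 0) (idx b 1) • tr [lB p, lPsiB q]
  | current_11, _, _ => ∑ i, ∑ j, eps i j • (tr [lA i, lPsiA j] - tr [lB i, lPsiB j])
  | AB_ABAB_44, a, b => ∑ i, ∑ j, ∑ k, ∑ p, ∑ q, ∑ r,
      (sym3 i j k (idx a 0) (idx a 1) (idx a 2) * sym3 p q r (idx b 0) (idx b 1) (idx b 2)) •
        (tr [lA i, lB p] * tr [lA j, lB q, lA k, lB r])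
  | AB_ABAB_42, a, b => ∑ i, ∑ j, ∑ k, ∑ q, ∑ r,
      (sym3 i j k (idx a 0) (idx a 1) (idx a 2) * eps q r) •
        (tr [lA i, lB (idx b 0), lA j, lB q] * tr [lA k, lB r])
  | AB_ABAB_24, a, b => ∑ j, ∑ k, ∑ p, ∑ q, ∑ r,
      (sym3 p q r (idx b 0) (idx b 1) (idx b 2) * eps j k) •
        (tr [lA (idx a 0), lB p, lA j, lB q] * tr [lA k, lB r])
  | AB_AB_AB_44, a, b => ∑ i, ∑ j, ∑ k, ∑ p, ∑ q, ∑ r,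
      (sym3 i j k (idx a 0) (idx a 1) (idx a 2) * sym3 p q r (idx b 0) (idx b 1) (idx b 2)) •
        (tr [lA i, lB p] * tr [lA j, lB q] * tr [lA k, lB r])
  | AB_AB_AB_22, a, b => ∑ i, ∑ j, ∑ p, ∑ q,
      (eps i j * eps p q) •
        (tr [lA i, lB p] * tr [lA j, lB q] * tr [lA (idx a 0), lB (idx b 0)])
  | DAB_22, a, b => tr [lDA (idx a 0), lB (idx b 0)] + tr [lA (idx a 0), lDB (idx b 0)]
  | ADB_22, a, b => Complex.I • tr [lB (idx b 0), lDA (idx a 0)] +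
      tr [lPsiA (idx a 0), lPsiB (idx b 0)]
  | psiABA_42, a, b => ∑ i, ∑ j, ∑ k,
      sym3 i j k (idx a 0) (idx a 1) (idx a 2) • tr [lPsiA i, lA j, lB (idx b 0), lA k]
  | psiBAB_24, a, b => ∑ p, ∑ q, ∑ r,
      sym3 p q r (idx b 0) (idx b 1) (idx b 2) • tr [lPsiB p, lB q, lA (idx a 0), lB r]
  | psiYYY_22, a, b => ∑ i, ∑ j, eps i j • (tr [lPsiA i, lA j, lB (idx b 0), lA (idx a 0)] -
      tr [lPsiB i, lB j, lA (idx a 0), lB (idx b 0)] +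
      tr [lPsiA (idx a 0), lA i, lB (idx b 0), lA j])
  | current_AB_22, a, b => ∑ i, ∑ j,
      eps i j • ((tr [lA i, lPsiA j] - tr [lB i, lPsiB j]) * tr [lA (idx a 0), lB (idx b 0)])
  | psiAA_AB_42, a, b => ∑ i, ∑ j, ∑ k,
      sym3 i j k (idx a 0) (idx a 1) (idx a 2) • (tr [lPsiA i, lA j] * tr [lB (idx b 0), lA k])
  | psiBB_AB_24, a, b => ∑ p, ∑ q, ∑ r,
      sym3 p q r (idx b 0) (idx b 1) (idx b 2) • (tr [lPsiB p, lB q] * tr [lA (idx a 0), lB r])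
  | psiAA_AB_22, a, b => ∑ i, ∑ j, ∑ l, ∑ k,
      (sym2 i j l (idx a 0) * eps l k) • (tr [lPsiA i, lA j] * tr [lA k, lB (idx b 0)])
  | psiBB_AB_22, a, b => ∑ p, ∑ q, ∑ t, ∑ r,
      (sym2 p q t (idx b 0) * eps t r) • (tr [lPsiB p, lB q] * tr [lB r, lA (idx a 0)])
  | fortuitous, a, b => fort (idx a 0) (idx b 0)

theorem exists_idx_one (i : Fin 2) : ∃ a < 2, i = idx a 0 := by
  fin_cases i
  · exact ⟨0, by simp, rfl⟩
  · exact ⟨1, by simp, rfl⟩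

theorem exists_idx_two (k l : Fin 2) : ∃ a < 3, ∀ i j, sym2 i j k l = sym2 i j (idx a 0) (idx a 1) := by
  have h : ∀ i j, sym2 i j 1 0 = sym2 i j 0 1 := fun i j => by simp [sym2]; ring
  fin_cases k <;> fin_cases l
  · exact ⟨0, by simp, fun i j => rfl⟩
  · exact ⟨1, by simp, fun i j => (h i j).symm⟩
  · exact ⟨1, by simp, fun i j => rfl⟩
  · exact ⟨2, by simp, fun i j => rfl⟩

theorem exists_idx_three (l m n : Fin 2) :
    ∃ a < 4, ∀ i j k, sym3 i j k l m n = sym3 i j k (idx a 0) (idx a 1) (idx a 2) := by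
  have h1 : ∀ i j k l m n, sym3 i j k l m n = sym3 i j k m l n := fun i j k l m n => by
    simp only [sym3]; ring
  have h2 : ∀ i j k l m n, sym3 i j k l m n = sym3 i j k l n m := fun i j k l m n => by
    simp only [sym3]; ring
  have h3 : ∀ i j k l m n, sym3 i j k l m n = sym3 i j k n m l := fun i j k l m n => by
    simp only [sym3]; ring
  fin_cases l <;> fin_cases m <;> fin_cases n
  · exact ⟨0, by simp, fun _ _ _ => rfl⟩
  · exact ⟨1, by simp, fun _ _ _ => h3 _ _ _ _ _ _⟩
  · exact ⟨1, by simp, fun _ _ _ => h1 _ _ _ _ _ _⟩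
  · exact ⟨2, by simp, fun _ _ _ => h3 _ _ _ _ _ _⟩
  · exact ⟨1, by simp, fun _ _ _ => rfl⟩
  · exact ⟨2, by simp, fun _ _ _ => h2 _ _ _ _ _ _⟩
  · exact ⟨2, by simp, fun _ _ _ => rfl⟩
  · exact ⟨3, by simp, fun _ _ _ => rfl⟩

/-- A symmetriser depends only on how many of its free indices are one; `idx` is the representative
string with the ones first, so the components are labelled by two numbers. -/
theorem Multiplet.reps_eq (m : Multiplet) :
    m.reps = {T | ∃ a < m.dimU, ∃ b < m.dimV, T = m.rep a b} := by
  ext T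
  rw [Set.mem_ofPred_eq]
  cases m <;> simp only [reps, Set.mem_ofPred_eq, Set.mem_singleton_iff, dimU, dimV, rep,
    Nat.lt_one_iff, exists_eq_left]
  case AB =>
    refine ⟨?_, fun ⟨a, _, b, _, h⟩ => ⟨_, _, h⟩⟩
    rintro ⟨i, p, rfl⟩
    obtain ⟨a, ha, rfl⟩ := exists_idx_one i
    obtain ⟨b, hb, rfl⟩ := exists_idx_one p
    exact ⟨a, ha, b, hb, rfl⟩
  case ABAB_33 =>
    refine ⟨?_, fun ⟨a, _, b, _, h⟩ => ⟨_, _, _, _, h⟩⟩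
    rintro ⟨k, l, r, s, rfl⟩
    obtain ⟨a, ha, h⟩ := exists_idx_two k l
    obtain ⟨b, hb, h'⟩ := exists_idx_two r s
    exact ⟨a, ha, b, hb, by simp only [h, h']⟩
  case AB_AB_33 =>
    refine ⟨?_, fun ⟨a, _, b, _, h⟩ => ⟨_, _, _, _, h⟩⟩
    rintro ⟨k, l, r, s, rfl⟩
    obtain ⟨a, ha, h⟩ := exists_idx_two k l
    obtain ⟨b, hb, h'⟩ := exists_idx_two r s
    exact ⟨a, ha, b, hb, by simp only [h, h']⟩
  case psiAA_31 =>
    refine ⟨?_, fun ⟨a, _, h⟩ => ⟨_, _, h⟩⟩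
    rintro ⟨k, l, rfl⟩
    obtain ⟨a, ha, h⟩ := exists_idx_two k l
    exact ⟨a, ha, by simp only [h]⟩
  case psiBB_13 =>
    refine ⟨?_, fun ⟨a, _, h⟩ => ⟨_, _, h⟩⟩
    rintro ⟨k, l, rfl⟩
    obtain ⟨a, ha, h⟩ := exists_idx_two k l
    exact ⟨a, ha, by simp only [h]⟩
  case AB_ABAB_44 =>
    refine ⟨?_, fun ⟨a, _, b, _, h⟩ => ⟨_, _, _, _, _, _, h⟩⟩
    rintro ⟨l, m, n, s, t, u, rfl⟩
    obtain ⟨a, ha, h⟩ := exists_idx_three l m n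
    obtain ⟨b, hb, h'⟩ := exists_idx_three s t u
    exact ⟨a, ha, b, hb, by simp only [h, h']⟩
  case AB_AB_AB_44 =>
    refine ⟨?_, fun ⟨a, _, b, _, h⟩ => ⟨_, _, _, _, _, _, h⟩⟩
    rintro ⟨l, m, n, s, t, u, rfl⟩
    obtain ⟨a, ha, h⟩ := exists_idx_three l m n
    obtain ⟨b, hb, h'⟩ := exists_idx_three s t u
    exact ⟨a, ha, b, hb, by simp only [h, h']⟩
  case psiAA_AB_22 =>
    refine ⟨?_, fun ⟨a, _, b, _, h⟩ => ⟨_, _, h⟩⟩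
    rintro ⟨i, p, rfl⟩
    obtain ⟨a, ha, rfl⟩ := exists_idx_one i
    obtain ⟨b, hb, rfl⟩ := exists_idx_one p
    exact ⟨a, ha, b, hb, rfl⟩
  case psiBB_AB_22 =>
    refine ⟨?_, fun ⟨a, _, b, _, h⟩ => ⟨_, _, h⟩⟩
    rintro ⟨p, i, rfl⟩
    obtain ⟨a, ha, rfl⟩ := exists_idx_one i
    obtain ⟨b, hb, rfl⟩ := exists_idx_one p
    exact ⟨a, ha, b, hb, rfl⟩
  case fortuitous =>
    refine ⟨?_, fun ⟨a, _, b, _, h⟩ => ⟨_, _, h⟩⟩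
    rintro ⟨p, i, rfl⟩
    obtain ⟨a, ha, rfl⟩ := exists_idx_one i
    obtain ⟨b, hb, rfl⟩ := exists_idx_one p
    exact ⟨a, ha, b, hb, rfl⟩
  case' AB_ABAB_42 | psiABA_42 | psiAA_AB_42 =>
    refine ⟨?_, fun ⟨a, _, b, _, h⟩ => ⟨_, _, _, _, h⟩⟩
    rintro ⟨l, m, n, p, rfl⟩
    obtain ⟨a, ha, h⟩ := exists_idx_three l m n
    obtain ⟨b, hb, rfl⟩ := exists_idx_one p
    exact ⟨a, ha, b, hb, by simp only [h]⟩
  case' AB_ABAB_24 | psiBAB_24 | psiBB_AB_24 =>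
    refine ⟨?_, fun ⟨a, _, b, _, h⟩ => ⟨_, _, _, _, h⟩⟩
    rintro ⟨l, m, n, p, rfl⟩
    obtain ⟨b, hb, h⟩ := exists_idx_three l m n
    obtain ⟨a, ha, rfl⟩ := exists_idx_one p
    exact ⟨a, ha, b, hb, by simp only [h]⟩
  all_goals
    refine ⟨?_, fun ⟨a, _, b, _, h⟩ => ⟨_, _, h⟩⟩
    rintro ⟨i, p, rfl⟩
    obtain ⟨a, ha, rfl⟩ := exists_idx_one i
    obtain ⟨b, hb, rfl⟩ := exists_idx_one p
    exact ⟨a, ha, b, hb, rfl⟩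

/-! ### Covariance of the generating polynomials -/

section Covariance

/-- Bilinearity, in coordinates. -/
def IsBilin {M : Type*} [AddCommGroup M] [Module ℂ M] (B : (Fin 2 → ℂ) → (Fin 2 → ℂ) → M) : Prop :=
  ∀ x x', B x x' = ∑ i, ∑ j, (x i * x' j) • B (uvec i) (uvec j)

/-- The contraction of a bilinear form with the antisymmetric tensor. -/
def contr {M : Type*} [AddCommGroup M] (B : (Fin 2 → ℂ) → (Fin 2 → ℂ) → M) : M :=
  B (uvec 0) (uvec 1) - B (uvec 1) (uvec 0)

/-- Contraction of a bilinear form with ε scales by the determinant, which is one. -/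
theorem IsBilin.contr_mulVec {M : Type*} [AddCommGroup M] [Module ℂ M]
    {B : (Fin 2 → ℂ) → (Fin 2 → ℂ) → M} (h : IsBilin B) (g : SL2) :
    contr (fun x x' => B (g.1.mulVec x) (g.1.mulVec x')) = contr B := by
  have hd : g.1 0 0 * g.1 1 1 - g.1 0 1 * g.1 1 0 = 1 := SL2.det_eq g
  simp only [contr, h (g.1.mulVec _)]
  simp only [Fin.sum_univ_two, uvec, Matrix.mulVec_single_one, Matrix.col_apply]
  match_scalars <;> first
    | ring1
    | linear_combination hd
    | linear_combination -hd

variable {N : ℕ} (g : Flavor)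

theorem flavorHom_vS2 (x y : Fin 2 → ℂ) :
    flavorHom N g (vS2 N x y) = vS2 N (g.1.1.mulVec x) (g.2.1.mulVec y) := by
  simp only [vS2, flavorHom_trace, map_mul, flavorMap_comb]; rfl
theorem flavorHom_vS4 (x y x' y' : Fin 2 → ℂ) : flavorHom N g (vS4 N x y x' y') =
    vS4 N (g.1.1.mulVec x) (g.2.1.mulVec y) (g.1.1.mulVec x') (g.2.1.mulVec y') := by
  simp only [vS4, flavorHom_trace, map_mul, flavorMap_comb]; rfl
theorem flavorHom_vF2 (x y : Fin 2 → ℂ) :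
    flavorHom N g (vF2 N x y) = vF2 N (g.1.1.mulVec x) (g.1.1.mulVec y) := by
  simp only [vF2, flavorHom_trace, map_mul, flavorMap_comb]; rfl
theorem flavorHom_vG2 (x y : Fin 2 → ℂ) :
    flavorHom N g (vG2 N x y) = vG2 N (g.2.1.mulVec x) (g.2.1.mulVec y) := by
  simp only [vG2, flavorHom_trace, map_mul, flavorMap_comb]; rfl
theorem flavorHom_vF4 (x x' y x'' : Fin 2 → ℂ) : flavorHom N g (vF4 N x x' y x'') =
    vF4 N (g.1.1.mulVec x) (g.1.1.mulVec x') (g.2.1.mulVec y) (g.1.1.mulVec x'') := by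
  simp only [vF4, flavorHom_trace, map_mul, flavorMap_comb]; rfl
theorem flavorHom_vG4 (y y' x y'' : Fin 2 → ℂ) : flavorHom N g (vG4 N y y' x y'') =
    vG4 N (g.2.1.mulVec y) (g.2.1.mulVec y') (g.1.1.mulVec x) (g.2.1.mulVec y'') := by
  simp only [vG4, flavorHom_trace, map_mul, flavorMap_comb]; rfl
theorem flavorHom_vD1 (x y : Fin 2 → ℂ) :
    flavorHom N g (vD1 N x y) = vD1 N (g.1.1.mulVec x) (g.2.1.mulVec y) := by
  simp only [vD1, flavorHom_trace, map_mul, flavorMap_comb]; rfl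
theorem flavorHom_vD2 (x y : Fin 2 → ℂ) :
    flavorHom N g (vD2 N x y) = vD2 N (g.1.1.mulVec x) (g.2.1.mulVec y) := by
  simp only [vD2, flavorHom_trace, map_mul, flavorMap_comb]; rfl
theorem flavorHom_vP2 (x y : Fin 2 → ℂ) :
    flavorHom N g (vP2 N x y) = vP2 N (g.1.1.mulVec x) (g.2.1.mulVec y) := by
  simp only [vP2, flavorHom_trace, map_mul, flavorMap_comb]; rfl

/-- The generating polynomial of a multiplet. -/
def Multiplet.poly (N : ℕ) (x y : Fin 2 → ℂ) : Multiplet → Alg N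
  | unit => 1
  | AB => vS2 N x y
  | ABAB_33 => vS4 N x y x y
  | AB_AB_33 => vS2 N x y * vS2 N x y
  | AB_AB_11 => contr fun a a' => contr fun b b' => vS2 N a b * vS2 N a' b'
  | psiAA_31 => vF2 N x x
  | psiBB_13 => vG2 N y y
  | current_11 => contr (fun a a' => vF2 N a' a) - contr (fun b b' => vG2 N b' b)
  | AB_ABAB_44 => vS2 N x y * vS4 N x y x y
  | AB_ABAB_42 => contr fun b b' => vS4 N x y x b * vS2 N x b'
  | AB_ABAB_24 => contr fun a a' => vS4 N x y a y * vS2 N a' y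
  | AB_AB_AB_44 => vS2 N x y * vS2 N x y * vS2 N x y
  | AB_AB_AB_22 => (contr fun a a' => contr fun b b' => vS2 N a b * vS2 N a' b') * vS2 N x y
  | DAB_22 => vD1 N x y + vD2 N x y
  | ADB_22 => Complex.I • vD1 N x y + vP2 N x y
  | psiABA_42 => vF4 N x x y x
  | psiBAB_24 => vG4 N y y x y
  | psiYYY_22 => contr (fun a a' => vF4 N a a' y x) - contr (fun b b' => vG4 N b b' x y) +
      contr (fun a a' => vF4 N x a y a')
  | current_AB_22 => (contr (fun a a' => vF2 N a' a) - contr (fun b b' => vG2 N b' b)) * vS2 N x y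
  | psiAA_AB_42 => vF2 N x x * vS2 N x y
  | psiBB_AB_24 => vG2 N y y * vS2 N x y
  | psiAA_AB_22 => (1 / 2 : ℂ) • contr fun a a' => (vF2 N a x + vF2 N x a) * vS2 N a' y
  | psiBB_AB_22 => (1 / 2 : ℂ) • contr fun b b' => (vG2 N b y + vG2 N y b) * vS2 N x b'
  | fortuitous => contr (fun a a' => vF4 N a a' y x) + contr (fun b b' => vG4 N b b' x y) -
      (3 / 4 : ℂ) • (vS2 N x y * (contr (fun a a' => vF2 N a a') + contr (fun b b' => vG2 N b b')))

theorem isBilin_vF2 : IsBilin fun a a' => vF2 N a a' := fun x x' => by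
  simp only [vF2, comb_eq N _ _ x, comb_eq N _ _ x', Fin.sum_univ_two, add_mul, mul_add,
    smul_mul_smul_comm, Matrix.trace_add, Matrix.trace_smul]; abel
theorem isBilin_vF2' : IsBilin fun a a' => vF2 N a' a := fun x x' => by
  simp only [vF2, comb_eq N _ _ x, comb_eq N _ _ x', Fin.sum_univ_two, add_mul, mul_add,
    smul_mul_smul_comm, Matrix.trace_add, Matrix.trace_smul]; module
theorem isBilin_vG2 : IsBilin fun a a' => vG2 N a a' := fun x x' => by
  simp only [vG2, comb_eq N _ _ x, comb_eq N _ _ x', Fin.sum_univ_two, add_mul, mul_add,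
    smul_mul_smul_comm, Matrix.trace_add, Matrix.trace_smul]; abel
theorem isBilin_vG2' : IsBilin fun a a' => vG2 N a' a := fun x x' => by
  simp only [vG2, comb_eq N _ _ x, comb_eq N _ _ x', Fin.sum_univ_two, add_mul, mul_add,
    smul_mul_smul_comm, Matrix.trace_add, Matrix.trace_smul]; module
theorem isBilin_vF4 (y z : Fin 2 → ℂ) : IsBilin fun a a' => vF4 N a a' y z := fun x x' => by
  simp only [vF4, comb_eq N _ _ x, comb_eq N _ _ x', Fin.sum_univ_two, add_mul, mul_add,
    smul_mul_assoc, mul_smul_comm, Matrix.trace_add, Matrix.trace_smul]; module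
theorem isBilin_vF4' (y z : Fin 2 → ℂ) : IsBilin fun a a' => vF4 N z a y a' := fun x x' => by
  simp only [vF4, comb_eq N _ _ x, comb_eq N _ _ x', Fin.sum_univ_two, add_mul, mul_add,
    smul_mul_assoc, mul_smul_comm, Matrix.trace_add, Matrix.trace_smul]; module
theorem isBilin_vG4 (y z : Fin 2 → ℂ) : IsBilin fun a a' => vG4 N a a' y z := fun x x' => by
  simp only [vG4, comb_eq N _ _ x, comb_eq N _ _ x', Fin.sum_univ_two, add_mul, mul_add,
    smul_mul_assoc, mul_smul_comm, Matrix.trace_add, Matrix.trace_smul]; module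
theorem isBilin_vS4_vS2 (z y : Fin 2 → ℂ) : IsBilin fun b b' => vS4 N z y z b * vS2 N z b' :=
  fun x x' => by
    simp only [vS4, vS2, comb_eq N _ _ x, comb_eq N _ _ x', Fin.sum_univ_two, add_mul, mul_add,
      smul_mul_assoc, mul_smul_comm, Matrix.trace_add, Matrix.trace_smul]; module
theorem isBilin_vS4_vS2' (z y : Fin 2 → ℂ) : IsBilin fun a a' => vS4 N z y a y * vS2 N a' y :=
  fun x x' => by
    simp only [vS4, vS2, comb_eq N _ _ x, comb_eq N _ _ x', Fin.sum_univ_two, add_mul, mul_add,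
      smul_mul_assoc, mul_smul_comm, Matrix.trace_add, Matrix.trace_smul]; module
theorem isBilin_vS2_vS2 (a a' : Fin 2 → ℂ) : IsBilin fun b b' => vS2 N a b * vS2 N a' b' :=
  fun x x' => by
    simp only [vS2, comb_eq N _ _ x, comb_eq N _ _ x', Fin.sum_univ_two, add_mul, mul_add,
      smul_mul_assoc, mul_smul_comm, Matrix.trace_add, Matrix.trace_smul]; module
theorem isBilin_contr_vS2_vS2 :
    IsBilin fun a a' => contr fun b b' => vS2 N a b * vS2 N a' b' :=
  fun x x' => by
    simp only [contr, vS2, comb_eq N _ _ x, comb_eq N _ _ x', Fin.sum_univ_two, add_mul, mul_add,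
      smul_mul_assoc, mul_smul_comm, Matrix.trace_add, Matrix.trace_smul]; module
theorem isBilin_vF2_vS2 (z y : Fin 2 → ℂ) :
    IsBilin fun a a' => (vF2 N a z + vF2 N z a) * vS2 N a' y :=
  fun x x' => by
    simp only [vF2, vS2, comb_eq N _ _ x, comb_eq N _ _ x', Fin.sum_univ_two, add_mul, mul_add,
      smul_mul_assoc, mul_smul_comm, Matrix.trace_add, Matrix.trace_smul]; module
theorem isBilin_vG2_vS2 (z y : Fin 2 → ℂ) :
    IsBilin fun b b' => (vG2 N b y + vG2 N y b) * vS2 N z b' :=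
  fun x x' => by
    simp only [vG2, vS2, comb_eq N _ _ x, comb_eq N _ _ x', Fin.sum_univ_two, add_mul, mul_add,
      smul_mul_assoc, mul_smul_comm, Matrix.trace_add, Matrix.trace_smul]; module

theorem flavorHom_contr (B : (Fin 2 → ℂ) → (Fin 2 → ℂ) → Alg N) :
    flavorHom N g (contr B) = contr fun x x' => flavorHom N g (B x x') := map_sub _ _ _

theorem Multiplet.flavorHom_poly (m : Multiplet) (x y : Fin 2 → ℂ) :
    flavorHom N g (m.poly N x y) = m.poly N (g.1.1.mulVec x) (g.2.1.mulVec y) := by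
  -- The double contraction is invariant under one group factor at a time, the inner contraction
  -- first.
  have h1 : (contr fun a a' => contr fun b b' => vS2 N (g.1.1.mulVec a) (g.2.1.mulVec b) *
      vS2 N (g.1.1.mulVec a') (g.2.1.mulVec b')) =
      contr fun a a' => contr fun b b' => vS2 N a b * vS2 N a' b' := by
    simp only [(isBilin_vS2_vS2 _ _).contr_mulVec]
    exact isBilin_contr_vS2_vS2.contr_mulVec _
  cases m <;> simp only [poly, map_one, map_mul, map_add, map_sub, map_smul, flavorHom_contr,
    flavorHom_vS2, flavorHom_vS4, flavorHom_vF2, flavorHom_vG2, flavorHom_vF4, flavorHom_vG4,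
    flavorHom_vD1, flavorHom_vD2, flavorHom_vP2, h1, (isBilin_vF2 (N := N)).contr_mulVec,
    (isBilin_vF2' (N := N)).contr_mulVec, (isBilin_vG2 (N := N)).contr_mulVec,
    (isBilin_vG2' (N := N)).contr_mulVec, (isBilin_vF4 (N := N) _ _).contr_mulVec,
    (isBilin_vF4' (N := N) _ _).contr_mulVec, (isBilin_vG4 (N := N) _ _).contr_mulVec,
    (isBilin_vS4_vS2 (N := N) _ _).contr_mulVec, (isBilin_vS4_vS2' (N := N) _ _).contr_mulVec,
    (isBilin_vF2_vS2 (N := N) _ _).contr_mulVec, (isBilin_vG2_vS2 (N := N) _ _).contr_mulVec]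

end Covariance

/-! ### The generating functions of the multiplets -/

section

variable {N : ℕ}

theorem sum_sum_eps {M : Type*} [AddCommGroup M] [Module ℂ M]
    (f : Fin 2 → Fin 2 → Fin 2 → Fin 2 → M) :
    ∑ i, ∑ j, ∑ p, ∑ q, (eps i j * eps p q) • f i j p q =
      (f 0 1 0 1 - f 0 1 1 0) - (f 1 0 0 1 - f 1 0 1 0) := by
  simp only [mul_smul, ← Finset.smul_sum, sum_eps]

theorem uvec_zero_zero : uvec 0 0 = 1 := by simp [uvec]
theorem uvec_zero_one : uvec 0 1 = 0 := by simp [uvec]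
theorem uvec_one_zero : uvec 1 0 = 0 := by simp [uvec]
theorem uvec_one_one : uvec 1 1 = 1 := by simp [uvec]

/-- The link between the components indexed by numbers and the covariant polynomials: with it the
transformation law of each multiplet is that of `Multiplet.poly`. -/
theorem Multiplet.genFun_ev_rep (m : Multiplet) (x y : Fin 2 → ℂ) :
    genFun m.dimU m.dimV (fun a b => ev N (m.rep a b)) x y = m.poly N x y := by
  cases m <;> simp only [rep, dimU, dimV, poly, map_sum, map_smul, map_mul, map_sub, map_add, map_one,
    sum_sum_eps, ev_AB, ev_BA, ev_ABAB, ev_psiAA, ev_ApsiA, ev_psiBB, ev_BpsiB, ev_psiABA, ev_psiBAB,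
    ev_DAB, ev_BDA, ev_ADB, ev_psiApsiB, contr, ← S2_eq_vS2, ← F2_eq_vF2, ← G2_eq_vG2]
  case unit => exact genFun_one_one _ x y
  case AB => exact (genFun_two_two (S2 N) x y).trans (vS2_eq x y).symm
  case ABAB_33 =>
    refine (genFun_three_three (fun i j p q => S4 N i p j q) x y).trans ?_
    simp only [vS4_eq, Fin.sum_univ_two]; module
  case AB_AB_33 =>
    refine (genFun_three_three (fun i j p q => S2 N i p * S2 N j q) x y).trans ?_
    simp only [vS2_eq, Fin.sum_univ_two, add_mul, mul_add, smul_mul_smul_comm]; module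
  case AB_AB_11 => exact genFun_one_one _ x y
  case psiAA_31 =>
    refine (genFun_three_one (fun i j => F2 N j i) x y).trans ?_
    simp only [vF2_eq, Fin.sum_univ_two]; module
  case psiBB_13 =>
    refine (genFun_one_three (fun i j => G2 N j i) x y).trans ?_
    simp only [vG2_eq, Fin.sum_univ_two]; module
  case current_11 =>
    refine (genFun_one_one _ x y).trans ?_
    simp only [sum_eps]; abel
  case AB_ABAB_44 =>
    refine (genFun_four_four (fun i j k p q r => S2 N i p * S4 N j q k r) x y).trans ?_
    simp only [vS4_eq, vS2_eq, Fin.sum_univ_two, add_mul, mul_add, smul_mul_smul_comm]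
    module
  case AB_AB_AB_44 =>
    refine (genFun_four_four (fun i j k p q r => S2 N i p * S2 N j q * S2 N k r) x y).trans ?_
    simp only [vS2_eq, Fin.sum_univ_two, add_mul, mul_add, smul_mul_smul_comm]
    module
  case AB_ABAB_42 =>
    simp only [mul_smul, ← Finset.smul_sum, sum_eps]
    refine (genFun_four_two (fun i j k p => S4 N i p j 0 * S2 N k 1 - S4 N i p j 1 * S2 N k 0)
      x y).trans ?_
    simp only [vS4_eq, vS2_eq, Fin.sum_univ_two, uvec_zero_zero, uvec_zero_one, uvec_one_zero,
      uvec_one_one, mul_zero, mul_one, zero_smul, add_zero, zero_add, add_mul,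
      mul_add, smul_mul_smul_comm]
    module
  case AB_ABAB_24 =>
    simp only [mul_smul]
    have h : ∀ (c : Fin 2 → Fin 2 → Fin 2 → ℂ) (i : Fin 2), ∑ j, ∑ k, ∑ p, ∑ q, ∑ r,
        c p q r • eps j k • (S4 N i p j q * S2 N k r) = ∑ p, ∑ q, ∑ r, c p q r •
          (S4 N i p 0 q * S2 N 1 r - S4 N i p 1 q * S2 N 0 r) := fun c i => by
      simp [Fin.sum_univ_two, eps]; module
    simp only [h]
    refine (genFun_two_four (fun p q r i => S4 N i p 0 q * S2 N 1 r - S4 N i p 1 q * S2 N 0 r)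
      x y).trans ?_
    simp only [vS4_eq, vS2_eq, Fin.sum_univ_two, uvec_zero_zero, uvec_zero_one, uvec_one_zero,
      uvec_one_one, mul_zero, zero_mul, one_mul, zero_smul, add_zero, zero_add, add_mul,
      mul_add, smul_mul_smul_comm]
    module
  case AB_AB_AB_22 =>
    refine (genFun_two_two (fun i p => ((S2 N 0 0 * S2 N 1 1 * S2 N i p -
      S2 N 0 1 * S2 N 1 0 * S2 N i p) - (S2 N 1 0 * S2 N 0 1 * S2 N i p -
      S2 N 1 1 * S2 N 0 0 * S2 N i p))) x y).trans ?_
    simp only [vS2_eq x y, Fin.sum_univ_two, mul_add, sub_mul, mul_smul_comm]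
  case DAB_22 =>
    refine (genFun_two_two (fun i p => D1 N i p + D2 N i p) x y).trans ?_
    simp only [vD1_eq x y, vD2_eq x y, Fin.sum_univ_two]
    module
  case ADB_22 =>
    refine (genFun_two_two (fun i p => Complex.I • D1 N i p + P2 N i p) x y).trans ?_
    simp only [vD1_eq x y, vP2_eq x y, Fin.sum_univ_two]
    module
  case psiABA_42 =>
    refine (genFun_four_two (fun i j k p => F4 N i j p k) x y).trans ?_
    simp only [vF4_eq, Fin.sum_univ_two]; module
  case psiBAB_24 =>
    refine (genFun_two_four (fun i j k p => G4 N i j p k) x y).trans ?_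
    simp only [vG4_eq, Fin.sum_univ_two]; module
  case psiYYY_22 =>
    simp only [sum_eps]
    refine (genFun_two_two (fun i p => (F4 N 0 1 p i - G4 N 0 1 i p + F4 N i 0 p 1) -
      (F4 N 1 0 p i - G4 N 1 0 i p + F4 N i 1 p 0)) x y).trans ?_
    simp only [vF4_eq, vG4_eq, Fin.sum_univ_two, uvec_zero_zero, uvec_zero_one, uvec_one_zero,
      uvec_one_one, mul_zero, zero_mul, mul_one, one_mul, zero_smul, add_zero, zero_add]
    module
  case current_AB_22 =>
    simp only [sum_eps]
    refine (genFun_two_two (fun i p => (F2 N 1 0 - G2 N 1 0) * S2 N i p -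
      (F2 N 0 1 - G2 N 0 1) * S2 N i p) x y).trans ?_
    simp only [vS2_eq x y, Fin.sum_univ_two, mul_add, sub_mul, mul_smul_comm]
    module
  case psiAA_AB_42 =>
    refine (genFun_four_two (fun i j k p => F2 N i j * S2 N k p) x y).trans ?_
    simp only [vF2_eq, vS2_eq, Fin.sum_univ_two, add_mul, mul_add, smul_mul_smul_comm]
    module
  case psiBB_AB_24 =>
    refine (genFun_two_four (fun i j k p => G2 N i j * S2 N p k) x y).trans ?_
    simp only [vG2_eq, vS2_eq, Fin.sum_univ_two, add_mul, mul_add, smul_mul_smul_comm]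
    module
  case psiAA_AB_22 =>
    have h : ∀ (n p : Fin 2), ∑ i, ∑ j, ∑ l, ∑ k, (sym2 i j l n * eps l k) •
        (F2 N i j * S2 N k p) = (1 / 2 : ℂ) • ((F2 N 0 n + F2 N n 0) * S2 N 1 p -
          (F2 N 1 n + F2 N n 1) * S2 N 0 p) := fun n p => by
      fin_cases n <;> simp [Fin.sum_univ_two, eps, sym2, delta, add_mul] <;> module
    simp only [h]
    refine (genFun_two_two (fun n p => (1 / 2 : ℂ) • ((F2 N 0 n + F2 N n 0) * S2 N 1 p -
          (F2 N 1 n + F2 N n 1) * S2 N 0 p)) x y).trans ?_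
    simp only [vF2_eq, vS2_eq, Fin.sum_univ_two, uvec_zero_zero, uvec_zero_one, uvec_one_zero,
      uvec_one_one, mul_zero, zero_mul, mul_one, one_mul, zero_smul, add_zero, zero_add, add_mul,
      mul_add, smul_mul_smul_comm]
    module
  case psiBB_AB_22 =>
    have h : ∀ (n p : Fin 2), ∑ i, ∑ j, ∑ l, ∑ k, (sym2 i j l n * eps l k) •
        (G2 N i j * S2 N p k) = (1 / 2 : ℂ) • ((G2 N 0 n + G2 N n 0) * S2 N p 1 -
          (G2 N 1 n + G2 N n 1) * S2 N p 0) := fun n p => by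
      fin_cases n <;> simp [Fin.sum_univ_two, eps, sym2, delta, add_mul] <;> module
    simp only [h]
    refine (genFun_two_two (fun p n => (1 / 2 : ℂ) • ((G2 N 0 n + G2 N n 0) * S2 N p 1 -
          (G2 N 1 n + G2 N n 1) * S2 N p 0)) x y).trans ?_
    simp only [vG2_eq, vS2_eq, Fin.sum_univ_two, uvec_zero_zero, uvec_zero_one, uvec_one_zero,
      uvec_one_one, mul_zero, zero_mul, mul_one, one_mul, zero_smul, add_zero, zero_add, add_mul,
      mul_add, smul_mul_smul_comm]
    module
  case fortuitous =>
    simp only [fort, sum_eps, map_sub, map_add, map_smul, map_mul, ev_BA, ev_psiAA, ev_psiBB,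
      ev_psiABA, ev_psiBAB]
    refine (genFun_two_two (fun a b => F4 N 0 1 b a + G4 N 0 1 a b - (3 / 4 : ℂ) •
      (S2 N a b * (F2 N 0 1 + G2 N 0 1)) - (F4 N 1 0 b a + G4 N 1 0 a b - (3 / 4 : ℂ) •
      (S2 N a b * (F2 N 1 0 + G2 N 1 0)))) x y).trans ?_
    simp only [vF4_eq, vG4_eq, vS2_eq, Fin.sum_univ_two, uvec_zero_zero, uvec_zero_one,
      uvec_one_zero, uvec_one_one, mul_zero, zero_mul, one_mul, zero_smul, add_zero,
      zero_add, add_mul, mul_add, mul_sub, smul_mul_assoc]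
    module

end

/-! ### The classes of the multiplets -/

section Classes

theorem Multiplet.rep_mem (m : Multiplet) (a b : ℕ) : m.rep a b ∈ m.reps := by
  cases m
  case unit | AB_AB_11 | current_11 => rfl
  case AB_ABAB_44 | AB_AB_AB_44 => exact ⟨_, _, _, _, _, _, rfl⟩
  case ABAB_33 | AB_AB_33 | AB_ABAB_42 | AB_ABAB_24 | psiABA_42 | psiBAB_24 | psiAA_AB_42 |
    psiBB_AB_24 => exact ⟨_, _, _, _, rfl⟩
  all_goals exact ⟨_, _, rfl⟩

theorem Multiplet.Q_two_reps (k : ℕ) (m : Multiplet) {T : Formal} (hT : T ∈ m.reps) :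
    Q 2 k (ev 2 T) = 0 := by
  by_cases hm : m = .fortuitous
  · subst hm
    obtain ⟨p, i, rfl⟩ := hT
    exact Q_fort_two i p
  · exact m.Q_reps hm hT

theorem Multiplet.ev_mem_closed (k : ℕ) (m : Multiplet) {T : Formal} (hT : T ∈ m.reps) :
    ev 2 T ∈ closed 2 k m.order :=
  ⟨Submodule.mem_map_of_mem (m.reps_subset_formalOps hT), m.Q_two_reps k hT⟩

/-- The components of a multiplet, as closed operators. -/
def Multiplet.closedRep (k : ℕ) (m : Multiplet) (a b : ℕ) : closed 2 k m.order :=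
  ⟨ev 2 (m.rep a b), m.ev_mem_closed k (m.rep_mem a b)⟩

/-- The classes of the components of a multiplet. -/
def Multiplet.cls (k : ℕ) (m : Multiplet) (a b : ℕ) : Coh 2 k m.order :=
  Submodule.mkQ _ (m.closedRep k a b)

/-- `classes` first intersects with the closed operators, which is harmless only when the spanning
family is itself closed. -/
theorem classes_span {N k d : ℕ} (s : Set (closed N k d)) :
    classes k d (Submodule.span ℂ (Subtype.val '' s)) =
      Submodule.span ℂ (Submodule.mkQ ((exact N k d).submoduleOf (closed N k d)) '' s) := by
  change ((Submodule.span ℂ ((closed N k d).subtype '' s)).comap (closed N k d).subtype).map _ = _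
  rw [← Submodule.map_span, Submodule.comap_map_eq_of_injective (Submodule.subtype_injective _), Submodule.map_span]

theorem Multiplet.space_eq (k : ℕ) (m : Multiplet) :
    m.space k m.order = tensorSpan m.dimU m.dimV (m.cls k) := by
  have h : (Submodule.span ℂ m.reps).map (ev 2).toLinearMap = Submodule.span ℂ
      (Subtype.val '' {X : closed 2 k m.order | ∃ a < m.dimU, ∃ b < m.dimV,
        X = m.closedRep k a b}) := by
    rw [Submodule.map_span, m.reps_eq]
    congr 1
    ext X
    constructor
    · rintro ⟨_, ⟨a, ha, b, hb, rfl⟩, rfl⟩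
      exact ⟨_, ⟨a, ha, b, hb, rfl⟩, rfl⟩
    · rintro ⟨_, ⟨a, ha, b, hb, rfl⟩, rfl⟩
      exact ⟨_, ⟨a, ha, b, hb, rfl⟩, rfl⟩
  rw [space, h, classes_span, tensorSpan]
  congr 1
  ext X
  constructor
  · rintro ⟨_, ⟨a, ha, b, hb, rfl⟩, rfl⟩
    exact ⟨a, ha, b, hb, rfl⟩
  · rintro ⟨a, ha, b, hb, rfl⟩
    exact ⟨_, ⟨a, ha, b, hb, rfl⟩, rfl⟩

theorem map_genFun {M M' : Type*} [AddCommGroup M] [Module ℂ M] [AddCommGroup M'] [Module ℂ M']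
    (L : M →ₗ[ℂ] M') (m n : ℕ) (φ : ℕ → ℕ → M) (x y : Fin 2 → ℂ) :
    L (genFun m n φ x y) = genFun m n (fun a b => L (φ a b)) x y := by
  simp only [genFun, map_sum, map_smul]

/-- Generating functions commute with linear maps, so the law for classes follows from that for the
representatives in the algebra. -/
theorem Multiplet.isTensor_cls (k : ℕ) (m : Multiplet) :
    IsTensor (flavorRep 2 k m.order) m.dimU m.dimV (m.cls k) := by
  have hc : ∀ x y, genFun m.dimU m.dimV (m.cls k) x y =
      Submodule.mkQ _ (genFun m.dimU m.dimV (m.closedRep k) x y) := fun x y =>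
    (map_genFun _ _ _ _ x y).symm
  have hp : ∀ x y, ((genFun m.dimU m.dimV (m.closedRep k) x y : closed 2 k m.order) : Alg 2) =
      m.poly 2 x y := fun x y => (map_genFun (Submodule.subtype _) _ _ _ x y).trans (m.genFun_ev_rep x y)
  intro g x y
  rw [hc, hc]
  refine congrArg (Submodule.mkQ ((exact 2 k m.order).submoduleOf (closed 2 k m.order)))
    (Subtype.ext ?_)
  change flavorHom 2 g ((genFun m.dimU m.dimV (m.closedRep k) x y : closed 2 k m.order) : Alg 2) = _
  rw [hp, hp]
  exact m.flavorHom_poly g x y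

theorem Multiplet.parity_rep (N : ℕ) (m : Multiplet) (a b : ℕ) :
    HasParity m.odd (ev N (m.rep a b)) := by
  have h2 : ∀ (p q : Bool) (w w' : List Letter), wordOdd w = p → wordOdd w' = q →
      HasParity (xor p q) (ev N (tr w * tr w')) := by
    rintro p q w w' rfl rfl
    rw [map_mul]
    exact (hasParity_ev_tr N w).mul (hasParity_ev_tr N w')
  have hs : ∀ (p : Bool) (s : Finset (Fin 2)) (f : Fin 2 → Formal),
      (∀ i, HasParity p (ev N (f i))) → HasParity p (ev N (∑ i ∈ s, f i)) := fun p s f h => by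
    rw [map_sum]; exact HasParity.sum _ _ fun i _ => h i
  have hc : ∀ (p : Bool) (c : ℂ) (T : Formal), HasParity p (ev N T) →
      HasParity p (ev N (c • T)) := fun p c T h => by
    rw [map_smul]; exact h.smul c
  have ha : ∀ (p : Bool) (T T' : Formal), HasParity p (ev N T) → HasParity p (ev N T') →
      HasParity p (ev N (T + T')) := fun p T T' h h' => by
    rw [map_add]; exact h.add h'
  have hb : ∀ (p : Bool) (T T' : Formal), HasParity p (ev N T) → HasParity p (ev N T') →
      HasParity p (ev N (T - T')) := fun p T T' h h' => by
    rw [map_sub]; exact h.sub h'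
  have ht : ∀ (p : Bool) (w : List Letter), wordOdd w = p → HasParity p (ev N (tr w)) := by
    rintro p w rfl
    exact hasParity_ev_tr N w
  have hm : ∀ (p q r : Bool) (T T' : Formal), HasParity p (ev N T) → HasParity q (ev N T') →
      xor p q = r → HasParity r (ev N (T * T')) := by
    rintro p q _ T T' h h' rfl
    rw [map_mul]; exact h.mul h'
  cases m <;> simp only [rep, odd, fort]
  case unit => exact ⟨fun x => by simp [sgn], by simp⟩
  case AB_AB_AB_44 | AB_AB_AB_22 =>
    repeat' first
      | exact ht _ _ rfl
      | apply hs
      | intro _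
      | apply hc
      | exact hm _ false _ _ _ (h2 _ _ _ _ rfl rfl) (ht _ _ rfl) rfl
  case current_AB_22 | fortuitous =>
    repeat' first
      | exact ht _ _ rfl
      | apply hs
      | intro _
      | apply hc
      | apply ha
      | apply hb
      | exact h2 _ _ _ _ rfl rfl
      | exact hm true false _ _ _ (hb _ _ _ (ht _ _ rfl) (ht _ _ rfl)) (ht _ _ rfl) rfl
      | exact hm false true _ _ _ (ht _ _ rfl) (ha _ _ _ (ht _ _ rfl) (ht _ _ rfl)) rfl
  all_goals
    repeat' first
      | exact ht _ _ rfl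
      | apply hs
      | intro _
      | apply hc
      | apply ha
      | apply hb
      | exact h2 _ _ _ _ rfl rfl

theorem Multiplet.parityCoh_space (k : ℕ) (m : Multiplet) {X : Coh 2 k m.order}
    (hX : X ∈ m.space k m.order) :
    parityCoh 2 k m.order X = (if m.odd then (-1 : ℂ) else 1) • X := by
  rw [space_eq] at hX
  have h : tensorSpan m.dimU m.dimV (m.cls k) ≤ LinearMap.ker (parityCoh 2 k m.order -
      (if m.odd then (-1 : ℂ) else 1) • LinearMap.id) := by
    refine Submodule.span_le.2 ?_
    rintro _ ⟨a, -, b, -, rfl⟩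
    rw [SetLike.mem_coe, LinearMap.mem_ker, LinearMap.sub_apply, sub_eq_zero]
    refine congrArg (Submodule.mkQ ((exact 2 k m.order).submoduleOf (closed 2 k m.order)))
      (Subtype.ext ?_)
    exact (m.parity_rep 2 a b).2
  have h' := h hX
  rwa [LinearMap.mem_ker, LinearMap.sub_apply, sub_eq_zero] at h'

end Classes

/-! ### Evaluation on diagonal matrices -/

section Diagonal

/-- The truncation to diagonal matrices. -/
def diag (N : ℕ) : Alg N →ₐ[ℂ] Alg N :=
  lift (fun x => if x.2.1 = x.2.2 then gen x else 0) fun x y => by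
    by_cases hx : x.2.1 = x.2.2 <;> by_cases hy : y.2.1 = y.2.2 <;> simp [hx, hy, gen_mul_gen x y]

theorem diag_gen {N : ℕ} (x : Gen N) :
    diag N (gen x) = if x.2.1 = x.2.2 then gen x else 0 := by
  simp [diag]

theorem diag_der {N : ℕ} (X : Alg N) : diag N (der N X) = der N (diag N X) := by
  have h : (diag N).mapMatrix.comp (derHom N) = (derHom N).comp (diag N) := by
    apply algHom_ext
    rintro ⟨l, a, b⟩
    by_cases hx : a = b <;> ext i j <;> fin_cases i <;> fin_cases j <;>
      simp [derHom, diag_gen, hx]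
  exact congrFun (congrFun (DFunLike.congr_fun h X) 0) 1

/-- The truncation to diagonal matrices, entrywise. -/
abbrev diagMap (N : ℕ) : Matrix (Fin N) (Fin N) (Alg N) →ₐ[ℂ] Matrix (Fin N) (Fin N) (Alg N) :=
  (diag N).mapMatrix

theorem diagMap_mat {N : ℕ} (l : Letter) :
    diagMap N (mat N l) = Matrix.diagonal fun a => gen (l, a, a) := by
  ext a b
  by_cases h : a = b
  · subst h; simp [mat, diag_gen]
  · simp [mat, diag_gen, h]

theorem diagMap_der {N : ℕ} (M : Matrix (Fin N) (Fin N) (Alg N)) :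
    diagMap N (M.map (der N)) = (diagMap N M).map (der N) := by
  ext a b
  simp [diag_der]

theorem gen_comm {N : ℕ} {l l' : Letter} (a b : Fin N) (h : (l.kind.odd && l'.kind.odd) = false) :
    gen (l, a, a) * gen (l', b, b) = gen (l', b, b) * gen (l, a, a) := by
  rw [gen_mul_gen]; simp [sgn, h]

/-- Diagonal entries of a fermion and of a scalar commute, so after truncation the two connections
have the same variation. -/
theorem diagMap_conn (N : ℕ) : diagMap N (conn N) = diagMap N (connHat N) := by
  simp only [conn, connHat, map_add, map_sub, map_mul, diagMap_mat, Matrix.diagonal_mul_diagonal]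
  simp only [gen_comm (l := ⟨.A, 0, _⟩) (l' := ⟨.psiA, 0, _⟩) _ _ rfl,
    gen_comm (l := ⟨.psiB, 0, _⟩) (l' := ⟨.B, 0, _⟩) _ _ rfl]

theorem diagMap_connHat_mul {N : ℕ} (l : Letter) :
    diagMap N (connHat N) * diagMap N (mat N l) =
      (if l.kind.odd then (-1 : ℂ) else 1) • (diagMap N (mat N l) * diagMap N (connHat N)) := by
  obtain ⟨v, hv⟩ : ∃ v : Fin N → Alg N, diagMap N (connHat N) = Matrix.diagonal v := by
    simp only [connHat, map_add, map_sub, map_mul, diagMap_mat, Matrix.diagonal_mul_diagonal,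
      Matrix.diagonal_sub, Matrix.diagonal_add]
    exact ⟨_, rfl⟩
  have hp : ∀ a, HasParity true (connHat N a a) := fun a => connHat_parity N a a
  have hd : ∀ a, v a * gen (l, a, a) =
      (if l.kind.odd then (-1 : ℂ) else 1) • (gen (l, a, a) * v a) := fun a => by
    have h1 : diag N (connHat N a a) = v a := by
      simpa using congrFun (congrFun hv a) a
    have h2 := congrArg (diag N) ((hp a).1 (l, a, a))
    rw [map_smul, map_mul, map_mul, diag_gen, if_pos rfl, h1] at h2
    rw [h2, smul_smul]
    cases l.kind.odd <;> simp [sgn]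
  rw [hv, diagMap_mat, Matrix.diagonal_mul_diagonal, Matrix.diagonal_mul_diagonal,
    ← Matrix.diagonal_smul]
  congr 1
  funext a
  exact hd a

/-- On diagonal matrices the products of three scalars commute and their ε-contraction vanishes; the
connections agree and supercommute with each letter, so their contribution to derivatives vanishes
too. -/
theorem diagMap_Qmat (N k : ℕ) (t : Kind) (n : ℕ) (i : Fin 2) : diagMap N (Qmat N k t n i) = 0 := by
  have h0 : (0 : Matrix (Fin N) (Fin N) (Alg N)).map (der N) = 0 := by ext; simp
  induction n with
  | zero =>
    have hc : ∀ (l l' l'' : Letter), l.kind.odd = false → l'.kind.odd = false →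
        l''.kind.odd = false → diagMap N (mat N l) * diagMap N (mat N l') * diagMap N (mat N l'') =
        diagMap N (mat N l'') * diagMap N (mat N l') * diagMap N (mat N l) := fun l l' l'' h h' h'' => by
      simp only [diagMap_mat, Matrix.diagonal_mul_diagonal]
      congr 1
      funext a
      rw [gen_comm (l := l) (l' := l') a a (by simp [h]), mul_assoc,
        gen_comm (l := l) (l' := l'') a a (by simp [h]), ← mul_assoc,
        gen_comm (l := l') (l' := l'') a a (by simp [h'])]
    cases t
    · exact map_zero _
    · exact map_zero _
    · simp only [Qmat, sum_eps, map_smul, map_sub, map_mul]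
      rw [hc _ _ _ rfl rfl rfl, sub_self, smul_zero]
    · simp only [Qmat, sum_eps, map_smul, map_sub, map_mul]
      rw [hc _ _ _ rfl rfl rfl, sub_self, smul_zero]
  | succ n ih =>
    cases t <;> simp only [Qmat, map_add, map_sub, map_smul, map_mul, diagMap_der, ih, h0,
      diagMap_conn, diagMap_connHat_mul] <;> simp [Kind.odd]

/-- Exact operators are invisible on diagonal matrices. Any evaluation there is therefore well
defined on cohomology, which is how independence of classes is detected. -/
theorem diag_Q {N k : ℕ} (X : Alg N) : diag N (Q N k X) = 0 := by
  obtain ⟨Y, rfl⟩ := proj_surjective N X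
  induction Y using FreeAlgebra.induction with
  | grade0 r => simp [Q_algebraMap]
  | grade1 x =>
    change diag N (Q N k (gen x)) = 0
    rw [Q_gen]
    exact congrFun (congrFun (diagMap_Qmat N k x.1.kind x.1.der x.1.idx) x.2.1) x.2.2
  | mul a b ha hb => rw [map_mul, Q_mul, map_add, map_mul, map_mul, ha, hb]; simp
  | add a b ha hb => rw [map_add, map_add, map_add, ha, hb, add_zero]

/-- The evaluation on diagonal matrices of dual numbers. -/
def diagEval {N : ℕ} (f : Letter → Fin N → DualNumber ℂ)
    (hf : ∀ l a, l.kind.odd = true → (f l a).fst = 0) : Alg N →ₐ[ℂ] DualNumber ℂ :=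
  lift (fun x => if x.2.1 = x.2.2 then f x.1 x.2.1 else 0) fun x y => by
    by_cases hx : x.1.kind.odd = true ∧ y.1.kind.odd = true
    · have h : ∀ u v : DualNumber ℂ, u.fst = 0 → v.fst = 0 → u * v = 0 := fun u v hu hv => by
        ext <;> simp [hu, hv]
      have h1 : ∀ x : Gen N, x.1.kind.odd = true →
          (if x.2.1 = x.2.2 then f x.1 x.2.1 else 0).fst = 0 := fun x hx => by
        split_ifs
        · exact hf _ _ hx
        · rfl
      rw [h _ _ (h1 x hx.1) (h1 y hx.2), h _ _ (h1 y hx.2) (h1 x hx.1), smul_zero]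
    · have : (x.1.kind.odd && y.1.kind.odd) = false := by
        rw [← Bool.not_eq_true, Bool.and_eq_true]; exact hx
      rw [sgn, this, mul_comm]; simp

variable {N : ℕ} (f : Letter → Fin N → DualNumber ℂ)
    (hf : ∀ l a, l.kind.odd = true → (f l a).fst = 0)

theorem diagEval_diag (X : Alg N) : diagEval f hf (diag N X) = diagEval f hf X := by
  have h : (diagEval f hf).comp (diag N) = diagEval f hf := by
    apply algHom_ext
    rintro ⟨l, a, b⟩
    by_cases h : a = b <;> simp [diag_gen, diagEval, h]
  exact DFunLike.congr_fun h X

theorem diagEval_eq_zero_of_mem_exact {k d : ℕ} {X : Alg N} (hX : X ∈ exact N k d) :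
    diagEval f hf X = 0 := by
  obtain ⟨Y, -, rfl⟩ := hX
  rw [← diagEval_diag, diag_Q, map_zero]

theorem diagEval_ev_tr (w : List Letter) :
    diagEval f hf (ev N (tr w)) = ∑ a, (w.map fun l => f l a).prod := by
  rw [map_ev_tr]
  have h : ∀ l, (diagEval f hf).mapMatrix (mat N l) = Matrix.diagonal (f l) := fun l => by
    ext a b : 1
    by_cases h : a = b
    · subst h; simp [mat, diagEval]
    · simp [mat, diagEval, h]
  have h' : ((w.map fun l => (diagEval f hf).mapMatrix (mat N l)).prod) =
      Matrix.diagonal fun a => (w.map fun l => f l a).prod := by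
    simp only [h]
    induction w with
    | nil => simp
    | cons l w ih => simp [ih, Matrix.diagonal_mul_diagonal]
  rw [h', Matrix.trace_diagonal]

end Diagonal

/-! ### Independence of the highest weight classes -/

section HighestWeight

instance : Fintype Multiplet where
  elems := ⟨([.unit, .AB, .ABAB_33, .AB_AB_33, .AB_AB_11, .psiAA_31, .psiBB_13, .current_11,
    .AB_ABAB_44, .AB_ABAB_42, .AB_ABAB_24, .AB_AB_AB_44, .AB_AB_AB_22, .DAB_22, .ADB_22, .psiABA_42,
    .psiBAB_24, .psiYYY_22, .current_AB_22, .psiAA_AB_42, .psiBB_AB_24, .psiAA_AB_22, .psiBB_AB_22,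
    .fortuitous] : List Multiplet), by simp⟩
  complete m := by cases m <;> simp

theorem sum_multiplet {M : Type*} [AddCommMonoid M] (F : Multiplet → M) :
    ∑ m, F m = F .unit + F .AB + F .ABAB_33 + F .AB_AB_33 + F .AB_AB_11 + F .psiAA_31 +
      F .psiBB_13 + F .current_11 + F .AB_ABAB_44 + F .AB_ABAB_42 + F .AB_ABAB_24 +
      F .AB_AB_AB_44 + F .AB_AB_AB_22 + F .DAB_22 + F .ADB_22 + F .psiABA_42 + F .psiBAB_24 +
      F .psiYYY_22 + F .current_AB_22 + F .psiAA_AB_42 + F .psiBB_AB_24 + F .psiAA_AB_22 +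
      F .psiBB_AB_22 + F .fortuitous := by
  have h : ∑ m, F m = (List.map F [.unit, .AB, .ABAB_33, .AB_AB_33, .AB_AB_11, .psiAA_31,
    .psiBB_13, .current_11, .AB_ABAB_44, .AB_ABAB_42, .AB_ABAB_24, .AB_AB_AB_44, .AB_AB_AB_22,
    .DAB_22, .ADB_22, .psiABA_42, .psiBAB_24, .psiYYY_22, .current_AB_22, .psiAA_AB_42,
    .psiBB_AB_24, .psiAA_AB_22, .psiBB_AB_22, .fortuitous]).sum := rfl
  rw [h]
  simp only [List.map_cons, List.map_nil, List.sum_cons, List.sum_nil, add_zero, add_assoc]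

theorem genFun_uvec_zero {M : Type*} [AddCommGroup M] [Module ℂ M] {m n : ℕ} (hm : 0 < m)
    (hn : 0 < n) (φ : ℕ → ℕ → M) : genFun m n φ (uvec 0) (uvec 0) = φ 0 0 := by
  have h : ∀ n a, powCoeff n a (uvec 0) = if a = 0 then 1 else 0 := fun n a => by
    rw [powCoeff, uvec_zero_zero, uvec_zero_one]
    by_cases h : a = 0 <;> simp [h]
  simp [genFun, h, hm, hn]

theorem Multiplet.dimU_pos (m : Multiplet) : 0 < m.dimU := by cases m <;> simp [dimU]
theorem Multiplet.dimV_pos (m : Multiplet) : 0 < m.dimV := by cases m <;> simp [dimV]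

theorem Multiplet.ev_rep_zero (N : ℕ) (m : Multiplet) :
    ev N (m.rep 0 0) = m.poly N (uvec 0) (uvec 0) := by
  rw [← m.genFun_ev_rep, genFun_uvec_zero m.dimU_pos m.dimV_pos]

/-- Diagonal matrices of dual numbers: numbers for the scalars, infinitesimals for the fermions and
for the derivatives. -/
def letterVal (A B ψ φ δ η : Fin 2 → Fin 2 → ℂ) : Letter → Fin 2 → DualNumber ℂ
  | ⟨.A, 0, i⟩, r => TrivSqZeroExt.inl (A i r)
  | ⟨.B, 0, i⟩, r => TrivSqZeroExt.inl (B i r)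
  | ⟨.psiA, 0, i⟩, r => TrivSqZeroExt.inr (ψ i r)
  | ⟨.psiB, 0, i⟩, r => TrivSqZeroExt.inr (φ i r)
  | ⟨.A, 1, i⟩, r => TrivSqZeroExt.inr (δ i r)
  | ⟨.B, 1, i⟩, r => TrivSqZeroExt.inr (η i r)
  | _, _ => 0

variable (A B ψ φ δ η : Fin 2 → Fin 2 → ℂ)

theorem letterVal_odd (l : Letter) (r : Fin 2) (h : l.kind.odd = true) :
    (letterVal A B ψ φ δ η l r).fst = 0 := by
  obtain ⟨t, n, i⟩ := l
  cases t <;> simp only [Kind.odd, Bool.false_eq_true] at h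
  all_goals rcases n with _ | _ | n <;> simp [letterVal]

/-- The evaluation of operators that corresponds to `letterVal`. -/
def hwEval : Alg 2 →ₐ[ℂ] DualNumber ℂ :=
  diagEval (letterVal A B ψ φ δ η) (letterVal_odd A B ψ φ δ η)

theorem hwEval_S2 (i p : Fin 2) : hwEval A B ψ φ δ η (S2 2 i p) =
    TrivSqZeroExt.inl (A i 0 * B p 0 + A i 1 * B p 1) := by
  rw [hwEval, S2, diagEval_ev_tr]
  ext <;> simp [letterVal, lA, lB, Fin.sum_univ_two]
theorem hwEval_S4 (i p j q : Fin 2) : hwEval A B ψ φ δ η (S4 2 i p j q) =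
    TrivSqZeroExt.inl (A i 0 * B p 0 * A j 0 * B q 0 + A i 1 * B p 1 * A j 1 * B q 1) := by
  rw [hwEval, S4, diagEval_ev_tr]
  ext <;> simp [letterVal, lA, lB, Fin.sum_univ_two]; ring
theorem hwEval_F2 (i j : Fin 2) : hwEval A B ψ φ δ η (F2 2 i j) =
    TrivSqZeroExt.inr (ψ i 0 * A j 0 + ψ i 1 * A j 1) := by
  rw [hwEval, F2, diagEval_ev_tr]
  ext <;> simp [letterVal, lA, lPsiA, Fin.sum_univ_two]
theorem hwEval_G2 (i j : Fin 2) : hwEval A B ψ φ δ η (G2 2 i j) =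
    TrivSqZeroExt.inr (φ i 0 * B j 0 + φ i 1 * B j 1) := by
  rw [hwEval, G2, diagEval_ev_tr]
  ext <;> simp [letterVal, lB, lPsiB, Fin.sum_univ_two]
theorem hwEval_F4 (i j p k : Fin 2) : hwEval A B ψ φ δ η (F4 2 i j p k) =
    TrivSqZeroExt.inr (ψ i 0 * A j 0 * B p 0 * A k 0 + ψ i 1 * A j 1 * B p 1 * A k 1) := by
  rw [hwEval, F4, diagEval_ev_tr]
  ext <;> simp [letterVal, lA, lB, lPsiA, Fin.sum_univ_two]; ring
theorem hwEval_G4 (i j p k : Fin 2) : hwEval A B ψ φ δ η (G4 2 i j p k) =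
    TrivSqZeroExt.inr (φ i 0 * B j 0 * A p 0 * B k 0 + φ i 1 * B j 1 * A p 1 * B k 1) := by
  rw [hwEval, G4, diagEval_ev_tr]
  ext <;> simp [letterVal, lA, lB, lPsiB, Fin.sum_univ_two]; ring
theorem hwEval_D1 (i p : Fin 2) : hwEval A B ψ φ δ η (D1 2 i p) =
    TrivSqZeroExt.inr (δ i 0 * B p 0 + δ i 1 * B p 1) := by
  rw [hwEval, D1, diagEval_ev_tr]
  ext <;> simp [letterVal, lDA, lA, lB, Letter.D, Fin.sum_univ_two]
theorem hwEval_D2 (i p : Fin 2) : hwEval A B ψ φ δ η (D2 2 i p) =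
    TrivSqZeroExt.inr (A i 0 * η p 0 + A i 1 * η p 1) := by
  rw [hwEval, D2, diagEval_ev_tr]
  ext <;> simp [letterVal, lDB, lA, lB, Letter.D, Fin.sum_univ_two]; ring
theorem hwEval_P2 (i p : Fin 2) : hwEval A B ψ φ δ η (P2 2 i p) = 0 := by
  rw [hwEval, P2, diagEval_ev_tr]
  ext <;> simp [letterVal, lPsiA, lPsiB]

/-- The values of the traces of two scalars and of the contraction of two of them. -/
def sv (i p : Fin 2) : ℂ := A i 0 * B p 0 + A i 1 * B p 1

/-- The numerical part of the evaluation sees the pure scalars, the infinitesimal part the fermions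
and derivatives. A product of two fermions is a product of two infinitesimals and drops out, so
`ADB_22` is seen through its derivative term. -/
theorem hwEval_equations {k d : ℕ} {c : Multiplet → ℂ}
    (h : ∑ m, c m • ev 2 (m.rep 0 0) ∈ exact 2 k d) :
    (c .unit + c .AB * sv A B 0 0 +
      c .ABAB_33 * (A 0 0 * B 0 0 * A 0 0 * B 0 0 + A 0 1 * B 0 1 * A 0 1 * B 0 1) +
      c .AB_AB_33 * sv A B 0 0 ^ 2 +
      c .AB_AB_11 * (2 * (sv A B 0 0 * sv A B 1 1 - sv A B 0 1 * sv A B 1 0)) +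
      c .AB_ABAB_44 * (sv A B 0 0 * (A 0 0 * B 0 0 * A 0 0 * B 0 0 + A 0 1 * B 0 1 * A 0 1 * B 0 1)) +
      c .AB_ABAB_42 *
        ((A 0 0 * B 0 0 * A 0 0 * B 0 0 + A 0 1 * B 0 1 * A 0 1 * B 0 1) * sv A B 0 1 -
          (A 0 0 * B 0 0 * A 0 0 * B 1 0 + A 0 1 * B 0 1 * A 0 1 * B 1 1) * sv A B 0 0) +
      c .AB_ABAB_24 *
        ((A 0 0 * B 0 0 * A 0 0 * B 0 0 + A 0 1 * B 0 1 * A 0 1 * B 0 1) * sv A B 1 0 -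
          (A 0 0 * B 0 0 * A 1 0 * B 0 0 + A 0 1 * B 0 1 * A 1 1 * B 0 1) * sv A B 0 0) +
      c .AB_AB_AB_44 * sv A B 0 0 ^ 3 +
      c .AB_AB_AB_22 * (2 * (sv A B 0 0 * sv A B 1 1 - sv A B 0 1 * sv A B 1 0) * sv A B 0 0) = 0) ∧
    (c .psiAA_31 * sv ψ A 0 0 + c .psiBB_13 * sv φ B 0 0 +
      c .current_11 * (sv ψ A 1 0 - sv ψ A 0 1 - (sv φ B 1 0 - sv φ B 0 1)) +
      c .DAB_22 * (sv δ B 0 0 + sv A η 0 0) + c .ADB_22 * (Complex.I * sv δ B 0 0) +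
      c .psiABA_42 * (ψ 0 0 * A 0 0 * B 0 0 * A 0 0 + ψ 0 1 * A 0 1 * B 0 1 * A 0 1) +
      c .psiBAB_24 * (φ 0 0 * B 0 0 * A 0 0 * B 0 0 + φ 0 1 * B 0 1 * A 0 1 * B 0 1) +
      c .psiYYY_22 * ((ψ 0 0 * A 1 0 * B 0 0 * A 0 0 + ψ 0 1 * A 1 1 * B 0 1 * A 0 1) -
        (ψ 1 0 * A 0 0 * B 0 0 * A 0 0 + ψ 1 1 * A 0 1 * B 0 1 * A 0 1) -
        ((φ 0 0 * B 1 0 * A 0 0 * B 0 0 + φ 0 1 * B 1 1 * A 0 1 * B 0 1) -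
        (φ 1 0 * B 0 0 * A 0 0 * B 0 0 + φ 1 1 * B 0 1 * A 0 1 * B 0 1))) +
      c .current_AB_22 * ((sv ψ A 1 0 - sv ψ A 0 1 - (sv φ B 1 0 - sv φ B 0 1)) * sv A B 0 0) +
      c .psiAA_AB_42 * (sv ψ A 0 0 * sv A B 0 0) + c .psiBB_AB_24 * (sv φ B 0 0 * sv A B 0 0) +
      c .psiAA_AB_22 * (sv ψ A 0 0 * sv A B 1 0 - (sv ψ A 0 1 + sv ψ A 1 0) * sv A B 0 0 / 2) +
      c .psiBB_AB_22 * (sv φ B 0 0 * sv A B 0 1 - (sv φ B 0 1 + sv φ B 1 0) * sv A B 0 0 / 2) +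
      c .fortuitous * ((ψ 0 0 * A 1 0 * B 0 0 * A 0 0 + ψ 0 1 * A 1 1 * B 0 1 * A 0 1) -
        (ψ 1 0 * A 0 0 * B 0 0 * A 0 0 + ψ 1 1 * A 0 1 * B 0 1 * A 0 1) +
        ((φ 0 0 * B 1 0 * A 0 0 * B 0 0 + φ 0 1 * B 1 1 * A 0 1 * B 0 1) -
        (φ 1 0 * B 0 0 * A 0 0 * B 0 0 + φ 1 1 * B 0 1 * A 0 1 * B 0 1)) -
        3 / 4 * (sv A B 0 0 * (sv ψ A 0 1 - sv ψ A 1 0 + (sv φ B 0 1 - sv φ B 1 0)))) = 0) := by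
  have h0 := diagEval_eq_zero_of_mem_exact (letterVal A B ψ φ δ η) (letterVal_odd A B ψ φ δ η) h
  change hwEval A B ψ φ δ η _ = 0 at h0
  simp only [Multiplet.ev_rep_zero, sum_multiplet, map_add, map_smul, Multiplet.poly, contr,
    ← S2_eq_vS2, ← S4_eq_vS4, ← F2_eq_vF2, ← G2_eq_vG2, ← F4_eq_vF4, ← G4_eq_vG4, ← D1_eq_vD1,
    ← D2_eq_vD2, ← P2_eq_vP2, map_sub, map_mul, map_one, hwEval_S2, hwEval_S4, hwEval_F2, hwEval_G2,
    hwEval_F4, hwEval_G4, hwEval_D1, hwEval_D2, hwEval_P2, add_zero] at h0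
  constructor
  · have h1 := congrArg TrivSqZeroExt.fst h0
    simp at h1
    simp only [sv]
    linear_combination h1
  · have h1 := congrArg TrivSqZeroExt.snd h0
    simp at h1
    simp only [sv]
    linear_combination h1

/-- Each choice of diagonal matrices gives a linear equation for the coefficients. Supports on
different eigenvalues switch single traces off and leave products of traces, so that the equations
can be solved one after the other. -/
theorem coefficients_eq_zero {k d : ℕ} {c : Multiplet → ℂ}
    (hc : ∀ m : Multiplet, m.order ≠ d → c m = 0)
    (h : ∑ m, c m • ev 2 (m.rep 0 0) ∈ exact 2 k d) (m : Multiplet) : c m = 0 := by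
  have hs := fun A B => (hwEval_equations A B 0 0 0 0 h).1
  have hf := fun A B ψ φ δ η => (hwEval_equations A B ψ φ δ η h).2
  have h0 : d ≠ 0 → c .unit = 0 := fun h => hc _ (Ne.symm h)
  have h1 : d ≠ 1 → c .AB = 0 := fun h => hc _ (Ne.symm h)
  have h2 : d ≠ 2 → c .ABAB_33 = 0 ∧ c .AB_AB_33 = 0 ∧ c .AB_AB_11 = 0 ∧ c .psiAA_31 = 0 ∧
      c .psiBB_13 = 0 ∧ c .current_11 = 0 := fun h =>
    ⟨hc _ (Ne.symm h), hc _ (Ne.symm h), hc _ (Ne.symm h), hc _ (Ne.symm h), hc _ (Ne.symm h),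
      hc _ (Ne.symm h)⟩
  have h3 : d ≠ 3 → (c .AB_ABAB_44 = 0 ∧ c .AB_ABAB_42 = 0 ∧ c .AB_ABAB_24 = 0 ∧
      c .AB_AB_AB_44 = 0 ∧ c .AB_AB_AB_22 = 0) ∧ (c .DAB_22 = 0 ∧ c .ADB_22 = 0 ∧
      c .psiABA_42 = 0 ∧ c .psiBAB_24 = 0 ∧ c .psiYYY_22 = 0 ∧ c .current_AB_22 = 0 ∧
      c .psiAA_AB_42 = 0 ∧ c .psiBB_AB_24 = 0 ∧ c .psiAA_AB_22 = 0 ∧ c .psiBB_AB_22 = 0 ∧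
      c .fortuitous = 0) := fun h =>
    ⟨⟨hc _ (Ne.symm h), hc _ (Ne.symm h), hc _ (Ne.symm h), hc _ (Ne.symm h), hc _ (Ne.symm h)⟩,
      hc _ (Ne.symm h), hc _ (Ne.symm h), hc _ (Ne.symm h), hc _ (Ne.symm h), hc _ (Ne.symm h),
      hc _ (Ne.symm h), hc _ (Ne.symm h), hc _ (Ne.symm h), hc _ (Ne.symm h), hc _ (Ne.symm h),
      hc _ (Ne.symm h)⟩
  have e0 : c .unit = 0 := by
    by_contra hne
    have hd0 : d = 0 := by_contra fun h => hne (h0 h)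
    subst hd0
    have := hs 0 0
    simp [sv] at this
    exact hne this
  have e1 : c .AB = 0 := by
    by_contra hne
    have hd0 : d = 1 := by_contra fun h => hne (h1 h)
    subst hd0
    have := hs ![![1, 0], 0] ![![1, 0], 0]
    simp [sv, h0, h2, h3] at this
    exact hne this
  have e2 : c .ABAB_33 = 0 ∧ c .AB_AB_33 = 0 ∧ c .AB_AB_11 = 0 ∧ c .psiAA_31 = 0 ∧
      c .psiBB_13 = 0 ∧ c .current_11 = 0 := by
    by_contra hne
    have hd0 : d = 2 := by_contra fun h => hne (h2 h)
    subst hd0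
    obtain ⟨⟨z1, z2, z3, z4, z5⟩, z6, z7, z8, z9, z10, z11, z12, z13, z14, z15, z16⟩ := h3 (by simp)
    -- One eigenvalue, two equal eigenvalues, and complementary supports: the second choice
    -- distinguishes a trace of four letters (value 2) from a product of two traces (value 4), the
    -- third sees the determinant.
    have a1 := hs ![![1, 0], 0] ![![1, 0], 0]
    have a2 := hs ![![1, 1], 0] ![![1, 1], 0]
    have a3 := hs ![![1, 0], ![0, 1]] ![![1, 0], ![0, 1]]
    have a4 := hf ![![1, 0], 0] 0 ![![1, 0], 0] 0 0 0
    have a5 := hf 0 ![![1, 0], 0] 0 ![![1, 0], 0] 0 0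
    have a6 := hf ![![1, 0], 0] 0 ![0, ![1, 0]] 0 0 0
    simp [sv, e0, e1, z1, z2, z3, z4, z5] at a1 a2 a3
    simp [sv, z6, z7, z8, z9, z10, z11, z12, z13, z14, z15, z16] at a4 a5 a6
    apply hne
    refine ⟨?_, ?_, ?_, a4, a5, a6⟩
    · linear_combination 2 * a1 - a2 / 2
    · linear_combination -a1 + a2 / 2
    · linear_combination a3 / 2 - a1 / 2
  obtain ⟨y1, y2, y3, y4, y5, y6⟩ := e2
  have e3 : (c .AB_ABAB_44 = 0 ∧ c .AB_ABAB_42 = 0 ∧ c .AB_ABAB_24 = 0 ∧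
      c .AB_AB_AB_44 = 0 ∧ c .AB_AB_AB_22 = 0) := by
    have a1 := hs ![![1, 0], 0] ![![1, 0], 0]
    have a2 := hs ![![1, 1], 0] ![![1, 1], 0]
    have a3 := hs ![![1, 0], ![0, 1]] ![![1, 0], ![0, 1]]
    have a4 := hs ![![1, 1], 0] ![![1, 0], ![0, 1]]
    have a5 := hs ![![1, 0], ![0, 1]] ![![1, 1], 0]
    simp [sv, e0, e1, y1, y2, y3] at a1 a2 a3 a4 a5
    have b1 : c .AB_AB_AB_44 = 0 := by linear_combination a2 / 4 - a1
    have b2 : c .AB_ABAB_44 = 0 := by linear_combination a1 - b1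
    refine ⟨b2, ?_, ?_, b1, ?_⟩
    · linear_combination a4 - b1 - b2
    · linear_combination a5 - b1 - b2
    · linear_combination a3 / 2 - b1 / 2 - b2 / 2
  obtain ⟨x1, x2, x3, x4, x5⟩ := e3
  -- An infinitesimal in $DB$ alone isolates `DAB_22`; one in $DA$ then gives `ADB_22`.
  have d1 := hf ![![1, 0], 0] 0 0 0 0 ![![1, 0], 0]
  have d2 := hf 0 ![![1, 0], 0] 0 0 ![![1, 0], 0] 0
  -- The fermion sits at the first eigenvalue. In `p2`, `p3`, `p4` the letter $B$ sits at the
  -- second, so single traces vanish and double traces remain; in `p1` and `p5` all letters meet.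
  -- The equations `q1` to `q5` are the mirror images for $\psi^B$.
  have p1 := hf ![![1, 0], 0] ![![1, 0], 0] ![![1, 0], 0] 0 0 0
  have p2 := hf ![![1, 1], 0] ![![0, 1], 0] ![![1, 0], 0] 0 0 0
  have p3 := hf ![![1, 0], ![0, 1]] ![![0, 1], 0] ![![1, 0], 0] 0 0 0
  have p4 := hf ![![0, 1], ![1, 0]] ![![0, 1], 0] ![![1, 0], 0] 0 0 0
  have p5 := hf ![![1, 0], ![1, 0]] ![![1, 0], 0] ![![1, 0], 0] 0 0 0
  have q1 := hf ![![1, 0], 0] ![![1, 0], 0] 0 ![![1, 0], 0] 0 0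
  have q2 := hf ![![0, 1], 0] ![![1, 1], 0] 0 ![![1, 0], 0] 0 0
  have q3 := hf ![![0, 1], 0] ![![1, 0], ![0, 1]] 0 ![![1, 0], 0] 0 0
  have q4 := hf ![![0, 1], 0] ![![0, 1], ![1, 0]] 0 ![![1, 0], 0] 0 0
  have q5 := hf ![![1, 0], 0] ![![1, 0], ![1, 0]] 0 ![![1, 0], 0] 0 0
  simp [sv, y4, y5, y6] at d1 d2 p1 p2 p3 p4 p5 q1 q2 q3 q4 q5
  have w2 : c .ADB_22 = 0 := by simpa [d1] using d2
  have w3 : c .psiABA_42 = 0 := by linear_combination p1 - p2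
  have w4 : c .psiBAB_24 = 0 := by linear_combination q1 - q2
  -- The double-trace terms of $\mathcal O_f$ have equal signs in the $A$ and $B$ halves, those of
  -- the current opposite signs. The sum of `p4` and `q4` thus removes the current and leaves -3/2
  -- times the coefficient, once `p3` and `q3` have removed the other doublets.
  have w9 : c .fortuitous = 0 := by
    linear_combination -2 / 3 * (p4 + q4 + p3 / 2 + q3 / 2)
  have w10 : c .current_AB_22 = 0 := by
    linear_combination -p4 - 3 / 4 * w9 - p3 / 2
  have w11 : c .psiYYY_22 = 0 := by
    linear_combination p5 + w10 - w3 - p2 - p3 / 2 - w9 / 4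
  cases m
  all_goals first
    | assumption

end HighestWeight

/-! ### The cohomology up to order `x^3` -/

section Cohomology

theorem rep_mem_closed (k : ℕ) {d : ℕ} (i : {m : Multiplet // m.order = d}) (a b : ℕ) :
    ev 2 (i.1.rep a b) ∈ closed 2 k d := by
  obtain ⟨m, rfl⟩ := i
  exact m.ev_mem_closed k (m.rep_mem a b)

/-- The classes of the components of a multiplet of a given order. -/
def clsAt (k d : ℕ) (i : {m : Multiplet // m.order = d}) (a b : ℕ) : Coh 2 k d :=
  Submodule.mkQ _ ⟨ev 2 (i.1.rep a b), rep_mem_closed k i a b⟩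

variable {k d : ℕ}

theorem space_eq_tensorSpan (i : {m : Multiplet // m.order = d}) :
    i.1.space k d = tensorSpan i.1.dimU i.1.dimV (clsAt k d i) := by
  obtain ⟨m, rfl⟩ := i
  exact m.space_eq k

theorem isTensor_clsAt (i : {m : Multiplet // m.order = d}) :
    IsTensor (flavorRep 2 k d) i.1.dimU i.1.dimV (clsAt k d i) := by
  obtain ⟨m, rfl⟩ := i
  exact m.isTensor_cls k

/-- A relation among classes means that the combination of representatives is exact; extended by
zero to all multiplets it falls under `coefficients_eq_zero`. -/
theorem linearIndependent_clsAt_zero : LinearIndependent ℂ fun i => clsAt k d i 0 0 := by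
  rw [Fintype.linearIndependent_iff]
  intro g hg i
  let c : Multiplet → ℂ := fun m => if h : m.order = d then g ⟨m, h⟩ else 0
  have hsum : ∑ m, c m • ev 2 (m.rep 0 0) =
      ∑ i : {m : Multiplet // m.order = d}, g i • ev 2 (i.1.rep 0 0) := by
    have h1 : ∑ i : {m : Multiplet // m.order = d}, g i • ev 2 (i.1.rep 0 0) =
        ∑ i : {m : Multiplet // m.order = d}, c i.1 • ev 2 (i.1.rep 0 0) :=
      Finset.sum_congr rfl fun i _ => by simp only [c, dif_pos i.2]
    rw [h1, ← Finset.sum_subtype (Finset.univ.filter fun m : Multiplet => m.order = d) (by simp)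
      fun m => c m • ev 2 (m.rep 0 0), Finset.sum_filter]
    refine Finset.sum_congr rfl fun m _ => ?_
    split_ifs with h
    · rfl
    · simp only [c, dif_neg h, zero_smul]
  have hmem : ∑ m, c m • ev 2 (m.rep 0 0) ∈ exact 2 k d := by
    rw [hsum]
    let x : closed 2 k d := ∑ i : {m : Multiplet // m.order = d}, g i •
          (⟨ev 2 (i.1.rep 0 0), rep_mem_closed k i 0 0⟩ : closed 2 k d)
    have hx : Submodule.mkQ ((exact 2 k d).submoduleOf (closed 2 k d)) x = 0 := by
      rw [map_sum, ← hg]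
      exact Finset.sum_congr rfl fun i _ => map_smul _ _ _
    rw [Submodule.mkQ_apply, Submodule.Quotient.mk_eq_zero] at hx
    have hx' : (x : Alg 2) ∈ exact 2 k d := hx
    simpa [x] using hx'
  have := coefficients_eq_zero (fun m hm => dif_neg hm) hmem i.1
  simpa only [c, dif_pos i.2] using this

theorem linearIndependent_clsAt : LinearIndependent ℂ
    fun p : Σ i : {m : Multiplet // m.order = d}, Fin i.1.dimU × Fin i.1.dimV =>
      clsAt k d p.1 p.2.1 p.2.2 := by
  have h := linearIndependent_of_highestWeight (flavorRep 2 k d)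
    (fun i : {m : Multiplet // m.order = d} => i.1.dimU) (fun i => i.1.dimV)
    (fun i => i.1.dimU_pos) (fun i => i.1.dimV_pos) (clsAt k d) (fun i => isTensor_clsAt i)
    linearIndependent_clsAt_zero
  exact h

theorem iSupIndep_space :
    iSupIndep fun i : {m : Multiplet // m.order = d} => i.1.space k d := by
  have h := iSupIndep_span_of_linearIndependent _ (linearIndependent_clsAt (k := k) (d := d))
  simpa only [space_eq_tensorSpan, tensorSpan_eq_range] using h

theorem Multiplet.exists_subrepresentation (k : ℕ) (m : Multiplet) :
    ∃ W : Subrepresentation (flavorRep 2 k m.order), W.toSubmodule = m.space k m.order ∧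
      Nonempty ((irrepTensor m.dimU m.dimV).Equiv W.toRepresentation) := by
  rw [m.space_eq]
  refine (m.isTensor_cls k).exists_subrepresentation m.dimU_pos m.dimV_pos ?_
  refine (linearIndependent_clsAt (k := k) (d := m.order)).comp
    (fun p => (⟨⟨m, rfl⟩, p⟩ : Σ i : {m' : Multiplet // m'.order = m.order},
      Fin i.1.dimU × Fin i.1.dimV)) fun p q h => ?_
  simpa using h

theorem classes_mono {N : ℕ} {W W' : Submodule ℂ (Alg N)} (h : W ≤ W') :
    classes k d W ≤ classes k d W' :=
  Submodule.map_mono (Submodule.comap_mono h)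

theorem Multiplet.span_reps_le_monotone (k : ℕ) {m : Multiplet} (hm : m ≠ .fortuitous) :
    Submodule.span ℂ m.reps ≤ monotone k m.order := by
  refine Submodule.span_le.2 fun T hT => ⟨m.reps_subset_formalOps hT, ?_⟩
  rw [SetLike.mem_coe, Submodule.mem_iInf]
  exact fun N => m.Q_reps hm hT

theorem mem_space {m : Multiplet} {X : Alg 2} (hX : X ∈ closed 2 k d)
    (h : X ∈ (Submodule.span ℂ m.reps).map (ev 2).toLinearMap) :
    Submodule.mkQ ((exact 2 k d).submoduleOf (closed 2 k d)) ⟨X, hX⟩ ∈ m.space k d :=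
  ⟨⟨X, hX⟩, h, rfl⟩

theorem mkQ_mem_iSup_of_mem_gravSpan {T : Formal} (hT : T ∈ gravSpan d) :
    ∃ h : ev 2 T ∈ closed 2 k d,
      Submodule.mkQ ((exact 2 k d).submoduleOf (closed 2 k d)) ⟨ev 2 T, h⟩ ∈
        ⨆ m : {m : Multiplet // m.order = d ∧ m ≠ .fortuitous}, m.1.space k d := by
  induction hT using Submodule.span_induction with
  | mem T hT =>
    obtain ⟨m, rfl, hm, hT⟩ := hT
    exact ⟨m.ev_mem_closed k hT, Submodule.mem_iSup_of_mem ⟨m, rfl, hm⟩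
      (mem_space _ (Submodule.mem_map_of_mem (Submodule.subset_span hT)))⟩
  | zero =>
    refine ⟨by rw [map_zero]; exact Submodule.zero_mem _, ?_⟩
    convert Submodule.zero_mem _
    rw [Submodule.mkQ_apply, Submodule.Quotient.mk_eq_zero]
    convert Submodule.zero_mem _
    exact map_zero _
  | add T T' _ _ h h' =>
    obtain ⟨h1, h2⟩ := h
    obtain ⟨h1', h2'⟩ := h'
    have e : ev 2 (T + T') = ev 2 T + ev 2 T' := map_add _ _ _
    have h3 : ev 2 (T + T') ∈ closed 2 k d := by rw [e]; exact Submodule.add_mem _ h1 h1'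
    refine ⟨h3, ?_⟩
    have h4 := congrArg (Submodule.mkQ ((exact 2 k d).submoduleOf (closed 2 k d)))
      (Subtype.ext e : (⟨_, h3⟩ : closed 2 k d) = ⟨_, h1⟩ + ⟨_, h1'⟩)
    rw [h4, map_add]
    exact Submodule.add_mem _ h2 h2'
  | smul c T _ h =>
    obtain ⟨h1, h2⟩ := h
    have e : ev 2 (c • T) = c • ev 2 T := map_smul _ _ _
    have h3 : ev 2 (c • T) ∈ closed 2 k d := by rw [e]; exact Submodule.smul_mem _ _ h1
    refine ⟨h3, ?_⟩
    have h4 := congrArg (Submodule.mkQ ((exact 2 k d).submoduleOf (closed 2 k d)))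
      (Subtype.ext e : (⟨_, h3⟩ : closed 2 k d) = c • ⟨_, h1⟩)
    rw [h4, map_smul]
    exact Submodule.smul_mem _ c h2

theorem mkQ_mem_iSup_of_mem_trivialOps {X : Alg 2} (hX : X ∈ closed 2 k d)
    (h : X ∈ trivialOps k d) : Submodule.mkQ ((exact 2 k d).submoduleOf (closed 2 k d)) ⟨X, hX⟩ ∈
      ⨆ m : {m : Multiplet // m.order = d ∧ m ≠ .fortuitous}, m.1.space k d := by
  obtain ⟨E, hE, _, ⟨T, hT, rfl⟩, rfl⟩ := Submodule.mem_sup.1 h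
  obtain ⟨h1, h2⟩ := mkQ_mem_iSup_of_mem_gravSpan (k := k) hT
  convert h2 using 1
  refine (Submodule.Quotient.eq _).2 ?_
  change E + ev 2 T - ev 2 T ∈ exact 2 k d
  rwa [add_sub_cancel_right]

/-- In orders zero and one every operator is of the listed form, in order two closure at rank two
suffices, and only in order three is closure at rank three needed as well, to exclude $\mathcal
O_f$. -/
theorem gravitons_eq (hk : 0 < k) (hd : d ≤ 3) : gravitons 2 k d =
    ⨆ m : {m : Multiplet // m.order = d ∧ m ≠ .fortuitous}, m.1.space k d := by
  apply le_antisymm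
  · rintro _ ⟨⟨X, hX⟩, ⟨T, hT, hTX⟩, rfl⟩
    have hTX : ev 2 T = X := hTX
    subst hTX
    refine mkQ_mem_iSup_of_mem_trivialOps hX ?_
    interval_cases d
    · exact mem_trivialOps_zero hT.1
    · exact mem_trivialOps_one hT.1
    · exact mem_trivialOps_two hk hT.1 hX.2
    · exact monotone3_mem hk hT
  · refine iSup_le ?_
    rintro ⟨m, rfl, hm⟩
    exact classes_mono (Submodule.map_mono (m.span_reps_le_monotone k hm))

theorem iSup_space (hk : 0 < k) (hd : d ≤ 3) :
    (⨆ m : {m : Multiplet // m.order = d}, m.1.space k d) = ⊤ := by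
  have hle : (⨆ m : {m : Multiplet // m.order = d ∧ m ≠ .fortuitous}, m.1.space k d) ≤
      ⨆ m : {m : Multiplet // m.order = d}, m.1.space k d :=
    iSup_le fun m => le_iSup (fun m : {m : Multiplet // m.order = d} => m.1.space k d) ⟨m.1, m.2.1⟩
  rw [eq_top_iff]
  rintro X -
  obtain ⟨⟨X, hX⟩, rfl⟩ := Submodule.mkQ_surjective _ X
  have h012 : ∀ T, ev 2 T = X → ev 2 T ∈ trivialOps k d → Submodule.mkQ
      ((exact 2 k d).submoduleOf (closed 2 k d)) ⟨X, hX⟩ ∈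
      ⨆ m : {m : Multiplet // m.order = d}, m.1.space k d := by
    rintro T rfl h
    exact hle (mkQ_mem_iSup_of_mem_trivialOps hX h)
  obtain ⟨T, hT, hTX⟩ := hX.1
  have hTX : ev 2 T = X := hTX
  interval_cases d
  · exact h012 T hTX (mem_trivialOps_zero hT)
  · exact h012 T hTX (mem_trivialOps_one hT)
  · exact h012 T hTX (mem_trivialOps_two hk hT (hTX ▸ hX.2))
  · obtain ⟨c, hc⟩ := closed3_decomposition hk hX
    -- The indices of `fort` are ordered as $(A, B)$, the free indices in `reps` as $(B, A)$; hence
    -- the exchange of components.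
    have hF : ∀ p : Fin 2 × Fin 2, ev 2 (fort p.1 p.2) ∈ closed 2 k 3 := fun p =>
      Multiplet.ev_mem_closed k .fortuitous ⟨p.2, p.1, rfl⟩
    have hF' : ∀ p : Fin 2 × Fin 2, Submodule.mkQ ((exact 2 k 3).submoduleOf (closed 2 k 3))
        ⟨_, hF p⟩ ∈ ⨆ m : {m : Multiplet // m.order = 3}, m.1.space k 3 := fun p =>
      Submodule.mem_iSup_of_mem ⟨.fortuitous, rfl⟩ (mem_space _ (Submodule.mem_map_of_mem
        (Submodule.subset_span ⟨p.2, p.1, rfl⟩)))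
    have hR : X - ∑ p, c p • ev 2 (fort p.1 p.2) ∈ closed 2 k 3 :=
      Submodule.sub_mem _ hX (Submodule.sum_mem _ fun p _ => Submodule.smul_mem _ _ (hF p))
    have h1 := hle (mkQ_mem_iSup_of_mem_trivialOps hR hc)
    have h2 := Submodule.add_mem _ h1 (Submodule.sum_mem _ fun p (_ : p ∈ Finset.univ) =>
      Submodule.smul_mem _ (c p) (hF' p))
    convert h2 using 1
    simp only [← map_smul, ← map_sum, ← map_add]
    exact congrArg _ (Subtype.ext (by simp))

end Cohomology

/-! ### Graded characters -/

section Characters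

theorem trace_restrict_span {ι W : Type*} [Fintype ι] [AddCommGroup W] [Module ℂ W] {v : ι → W}
    (hv : LinearIndependent ℂ v) (T : W →ₗ[ℂ] W) (c : ι → ℂ) (hT : ∀ i, T (v i) = c i • v i)
    {S : Submodule ℂ W} (hS : S = Submodule.span ℂ (Set.range v)) :
    ∃ h : ∀ X ∈ S, T X ∈ S, LinearMap.trace ℂ S (T.restrict h) = ∑ i, c i := by
  classical
  subst hS
  have h : ∀ X ∈ Submodule.span ℂ (Set.range v), T X ∈ Submodule.span ℂ (Set.range v) := by
    intro X hX
    refine (Submodule.span_le (p := (Submodule.span ℂ (Set.range v)).comap T)).2 ?_ hX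
    rintro _ ⟨i, rfl⟩
    rw [SetLike.mem_coe, Submodule.mem_comap, hT]
    exact Submodule.smul_mem _ _ (Submodule.subset_span ⟨i, rfl⟩)
  refine ⟨h, ?_⟩
  have hb : ∀ i, (T.restrict h) (Module.Basis.span hv i) = c i • Module.Basis.span hv i := fun i => by
    apply Subtype.ext
    rw [LinearMap.coe_restrict_apply, Submodule.coe_smul, Module.Basis.span_apply]
    exact hT i
  rw [LinearMap.trace_eq_matrix_trace ℂ (Module.Basis.span hv), Matrix.trace]
  refine Finset.sum_congr rfl fun i _ => ?_
  rw [Matrix.diag_apply, LinearMap.toMatrix_apply, hb, map_smul, Module.Basis.repr_self]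
  simp

theorem sum_weights (n : ℕ) (w : ℂˣ) :
    ∑ a : Fin n, (w : ℂ) ^ (2 * ((a : ℕ) : ℤ) - (n - 1)) = chi n w := by
  rw [chi, ← Finset.sum_range_reflect, Finset.sum_range]
  refine Finset.sum_congr rfl fun a _ => ?_
  congr 1
  have := a.2
  omega

theorem IsTensor.cartan {W : Type*} [AddCommGroup W] [Module ℂ W] {ρ : Representation ℂ Flavor W}
    {m n : ℕ} {φ : ℕ → ℕ → W} (h : IsTensor ρ m n φ) (hm : 0 < m) (hn : 0 < n) (u v : ℂˣ)
    (a : Fin m) (b : Fin n) : ρ (ABJM.cartan u, ABJM.cartan v) (φ a b) =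
      ((u : ℂ) ^ (2 * ((a : ℕ) : ℤ) - (m - 1)) * (v : ℂ) ^ (2 * ((b : ℕ) : ℤ) - (n - 1))) •
        φ a b := by
  have := h.tensorMap hm hn (ABJM.cartan u, ABJM.cartan v) (vmon m a ⊗ₜ vmon n b)
  rw [tensorMap_vmon] at this
  rw [← this, irrepTensor, Representation.tprod_apply, TensorProduct.map_tmul]
  simp only [MonoidHom.comp_apply, MonoidHom.coe_fst, MonoidHom.coe_snd]
  rw [irrep_cartan, irrep_cartan, TensorProduct.smul_tmul_smul, map_smul, tensorMap_vmon]

/-- The contribution of a multiplet to the graded character. -/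
def Multiplet.character (m : Multiplet) (u v : ℂˣ) : ℂ :=
  (if m.odd then (-1 : ℂ) else 1) * (chi m.dimU u * chi m.dimV v)

theorem indexOp_clsAt {k d : ℕ} (i : {m : Multiplet // m.order = d}) (u v : ℂˣ)
    (a : Fin i.1.dimU) (b : Fin i.1.dimV) : indexOp 2 k d u v (clsAt k d i a b) =
      ((if i.1.odd then (-1 : ℂ) else 1) * ((u : ℂ) ^ (2 * ((a : ℕ) : ℤ) - (i.1.dimU - 1)) *
        (v : ℂ) ^ (2 * ((b : ℕ) : ℤ) - (i.1.dimV - 1)))) • clsAt k d i a b := by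
  have h := (isTensor_clsAt (k := k) i).cartan i.1.dimU_pos i.1.dimV_pos u v a b
  have hp : parityCoh 2 k d (clsAt k d i a b) =
      (if i.1.odd then (-1 : ℂ) else 1) • clsAt k d i a b := by
    obtain ⟨m, rfl⟩ := i
    refine m.parityCoh_space k ?_
    rw [m.space_eq]
    exact Submodule.subset_span ⟨a, a.2, b, b.2, rfl⟩
  rw [indexOp, LinearMap.comp_apply, h, map_smul, hp, smul_smul, mul_comm]

/-- The components of the selected multiplets form a basis of eigenvectors of the index operator, so
the trace is the sum of their weights, and this factorises into the two characters. -/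
theorem superTrace_iSup {k d : ℕ} (P : Multiplet → Prop) [DecidablePred P] (u v : ℂˣ) :
    superTrace (⨆ m : {m : Multiplet // m.order = d ∧ P m}, m.1.space k d) u v =
      ∑ m : Multiplet, if m.order = d ∧ P m then m.character u v else 0 := by
  let ι := {m : Multiplet // m.order = d ∧ P m}
  let f : (Σ i : ι, Fin i.1.dimU × Fin i.1.dimV) →
      Σ i : {m : Multiplet // m.order = d}, Fin i.1.dimU × Fin i.1.dimV :=
    fun p => ⟨⟨p.1.1, p.1.2.1⟩, p.2⟩
  have hf : Function.Injective f := by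
    rintro ⟨⟨m, hm⟩, p⟩ ⟨⟨m', hm'⟩, p'⟩ h
    simp only [f, Sigma.mk.injEq, Subtype.mk.injEq] at h
    obtain ⟨rfl, h⟩ := h
    simpa using h
  have hli := (linearIndependent_clsAt (k := k) (d := d)).comp f hf
  have hS : (⨆ m : ι, m.1.space k d) = Submodule.span ℂ (Set.range
      ((fun p : Σ i : {m : Multiplet // m.order = d}, Fin i.1.dimU × Fin i.1.dimV =>
      clsAt k d p.1 p.2.1 p.2.2) ∘ f)) := by
    rw [Set.range_sigma_eq_iUnion_range, Submodule.span_iUnion]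
    refine iSup_congr fun m => ?_
    exact (space_eq_tensorSpan (⟨m.1, m.2.1⟩ : {m : Multiplet // m.order = d})).trans
      (tensorSpan_eq_range _ _ _)
  obtain ⟨h, htr⟩ := trace_restrict_span hli (indexOp 2 k d u v)
    (fun p => (if p.1.1.odd then (-1 : ℂ) else 1) *
      ((u : ℂ) ^ (2 * ((p.2.1 : ℕ) : ℤ) - (p.1.1.dimU - 1)) *
        (v : ℂ) ^ (2 * ((p.2.2 : ℕ) : ℤ) - (p.1.1.dimV - 1))))
    (fun p => indexOp_clsAt (⟨p.1.1, p.1.2.1⟩ : {m : Multiplet // m.order = d}) u v p.2.1 p.2.2) hS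
  rw [superTrace, dif_pos h, htr, Fintype.sum_sigma]
  have h1 : ∀ i : ι, ∑ p : Fin i.1.dimU × Fin i.1.dimV, (if i.1.odd then (-1 : ℂ) else 1) *
      ((u : ℂ) ^ (2 * ((p.1 : ℕ) : ℤ) - (i.1.dimU - 1)) *
        (v : ℂ) ^ (2 * ((p.2 : ℕ) : ℤ) - (i.1.dimV - 1))) = i.1.character u v := fun i => by
    rw [Multiplet.character, ← sum_weights, ← sum_weights, Finset.sum_mul_sum, ← Finset.mul_sum,
      Fintype.sum_prod_type]
  refine (Finset.sum_congr rfl fun i _ => h1 i).trans ?_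
  rw [← Finset.sum_filter]
  exact (Finset.sum_subtype (Finset.univ.filter fun m : Multiplet => m.order = d ∧ P m) (by simp)
      fun m => m.character u v).symm

variable {k : ℕ}

theorem superTrace_top (hk : 0 < k) {d : ℕ} (hd : d ≤ 3) (u v : ℂˣ) :
    superTrace (⊤ : Submodule ℂ (Coh 2 k d)) u v =
      ∑ m : Multiplet, if m.order = d then m.character u v else 0 := by
  have h : (⨆ m : {m : Multiplet // m.order = d ∧ True}, m.1.space k d) = ⊤ := by
    rw [← iSup_space hk hd]
    refine le_antisymm (iSup_le fun m => ?_) (iSup_le fun m => ?_)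
    · exact le_iSup (fun m : {m : Multiplet // m.order = d} => m.1.space k d) ⟨m.1, m.2.1⟩
    · exact le_iSup (fun m : {m : Multiplet // m.order = d ∧ True} => m.1.space k d)
        ⟨m.1, m.2, trivial⟩
  rw [← h, superTrace_iSup]
  simp only [and_true]

open scoped Classical in
theorem superTrace_gravitons (hk : 0 < k) {d : ℕ} (hd : d ≤ 3) (u v : ℂˣ) :
    superTrace (gravitons 2 k d) u v =
      ∑ m : Multiplet, if m.order = d then (if m = .fortuitous then 0 else m.character u v)
        else 0 := by
  rw [gravitons_eq hk hd, superTrace_iSup]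
  refine Finset.sum_congr rfl fun m _ => ?_
  by_cases h : m = .fortuitous <;> simp [h]

theorem chi_one (w : ℂˣ) : chi 1 w = 1 := by simp [chi]

theorem superTrace_top_zero (hk : 0 < k) (u v : ℂˣ) :
    superTrace (⊤ : Submodule ℂ (Coh 2 k 0)) u v = 1 := by
  rw [superTrace_top hk (by simp), sum_multiplet]
  simp [Multiplet.order, Multiplet.character, Multiplet.odd, Multiplet.dimU, Multiplet.dimV, chi_one]

theorem superTrace_top_one (hk : 0 < k) (u v : ℂˣ) :
    superTrace (⊤ : Submodule ℂ (Coh 2 k 1)) u v = chi 2 u * chi 2 v := by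
  rw [superTrace_top hk (by simp), sum_multiplet]
  simp [Multiplet.order, Multiplet.character, Multiplet.odd, Multiplet.dimU, Multiplet.dimV]

theorem superTrace_top_two (hk : 0 < k) (u v : ℂˣ) :
    superTrace (⊤ : Submodule ℂ (Coh 2 k 2)) u v =
      2 * chi 3 u * chi 3 v - chi 3 u - chi 3 v := by
  rw [superTrace_top hk (by simp), sum_multiplet]
  simp [Multiplet.order, Multiplet.character, Multiplet.odd, Multiplet.dimU, Multiplet.dimV, chi_one]
  ring

theorem superTrace_top_three (hk : 0 < k) (u v : ℂˣ) :
    superTrace (⊤ : Submodule ℂ (Coh 2 k 3)) u v = 2 * chi 4 u * chi 4 v - chi 4 u * chi 2 v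
      - chi 2 u * chi 4 v - 2 * chi 2 u * chi 2 v := by
  rw [superTrace_top hk (by simp), sum_multiplet]
  simp [Multiplet.order, Multiplet.character, Multiplet.odd, Multiplet.dimU, Multiplet.dimV]
  ring

theorem superTrace_gravitons_of_lt (hk : 0 < k) {d : ℕ} (hd : d < 3) (u v : ℂˣ) :
    superTrace (gravitons 2 k d) u v = superTrace (⊤ : Submodule ℂ (Coh 2 k d)) u v := by
  rw [superTrace_gravitons hk hd.le, superTrace_top hk hd.le]
  refine Finset.sum_congr rfl fun m _ => ?_
  by_cases h : m = .fortuitous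
  · subst h
    simp [Multiplet.order, hd.ne']
  · simp [h]

theorem superTrace_gravitons_three (hk : 0 < k) (u v : ℂˣ) :
    superTrace (gravitons 2 k 3) u v = 2 * chi 4 u * chi 4 v - chi 4 u * chi 2 v
      - chi 2 u * chi 4 v - chi 2 u * chi 2 v := by
  rw [superTrace_gravitons hk (by simp), sum_multiplet]
  simp [Multiplet.order, Multiplet.character, Multiplet.odd, Multiplet.dimU, Multiplet.dimV]
  ring

end Characters

/-! ### Asymptotics of the chiral factor -/

section Chiral

open Filter Topology Asymptotics

/-- Agreement up to an error of order `g` of two functions, the second of which is bounded. -/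
structure Approx {α : Type*} (l : Filter α) (g f f' : α → ℂ) : Prop where
  sub : (fun a => f a - f' a) =O[l] g
  bdd : f' =O[l] fun _ => (1 : ℂ)

namespace Approx

variable {α β : Type*} {l : Filter α} {g f f' e e' : α → ℂ}

theorem refl (h : f =O[l] fun _ => (1 : ℂ)) : Approx l g f f :=
  ⟨by simpa using isBigO_zero g l, h⟩

theorem mul (hg : g =O[l] fun _ => (1 : ℂ)) (hf : Approx l g f f') (he : Approx l g e e') :
    Approx l g (fun a => f a * e a) fun a => f' a * e' a := by
  refine ⟨?_, by simpa using hf.bdd.mul he.bdd⟩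
  have h1 : e =O[l] fun _ => (1 : ℂ) := by
    simpa using (he.sub.trans hg).add he.bdd
  have h2 : (fun a => (f a - f' a) * e a + f' a * (e a - e' a)) =O[l] g :=
    IsBigO.add (by simpa using hf.sub.mul h1) (by simpa using hf.bdd.mul he.sub)
  refine h2.congr_left fun a => by ring

theorem prod (hg : g =O[l] fun _ => (1 : ℂ)) {ι : Type*} (s : Finset ι) {f f' : ι → α → ℂ}
    (h : ∀ i ∈ s, Approx l g (f i) (f' i)) :
    Approx l g (fun a => ∏ i ∈ s, f i a) fun a => ∏ i ∈ s, f' i a := by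
  classical
  induction s using Finset.induction_on with
  | empty => simpa using refl (isBigO_refl _ _)
  | insert i s hi ih =>
    simp only [Finset.prod_insert hi]
    exact mul hg (h i (Finset.mem_insert_self _ _))
      (ih fun j hj => h j (Finset.mem_insert_of_mem hj))

theorem comp (h : Approx l g f f') {l' : Filter β} {k : β → α} (hk : Tendsto k l' l) :
    Approx l' (g ∘ k) (f ∘ k) (f' ∘ k) :=
  ⟨h.sub.comp_tendsto hk, h.bdd.comp_tendsto hk⟩

theorem trans (h : (fun a => e a - f a) =O[l] g)
    (hf : Approx l g f f') : Approx l g e f' :=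
  ⟨(h.add hf.sub).congr_left fun a => by ring, hf.bdd⟩

end Approx

/-- The factors of the infinite product defining `chiral`. -/
def chiralFactor (s x : ℂ) (n : ℕ) : ℂ :=
  (1 - s ^ (3 + 4 * n) * x⁻¹) / (1 - s ^ (1 + 4 * n) * x)

/-- A polynomial truncation of `chiral` in `s * x`. -/
def chiralTrunc (s x : ℂ) : ℂ :=
  (1 - s ^ 3 * x⁻¹) * (1 - s ^ 7 * x⁻¹) *
    ((∑ a ∈ Finset.range 8, (s * x) ^ a) * (1 + s ^ 5 * x))

variable {R : ℝ}

theorem one_half_le_norm {y : ℂ} (h : ‖y‖ ≤ 1 / 2) : 1 / 2 ≤ ‖1 - y‖ := by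
  have := norm_sub_norm_le (1 : ℂ) y
  rw [norm_one] at this
  linarith

theorem norm_pow_mul_le {s x : ℂ} (hR : 1 ≤ R) (hs : 4 * R * ‖s‖ ≤ 1) (hx : ‖x‖ ≤ R) (n m : ℕ) :
    ‖s ^ (1 + n + m) * x‖ ≤ ‖s‖ ^ n / 4 := by
  have h0 := norm_nonneg s
  have h1 : ‖s‖ ≤ 1 := by nlinarith
  rw [norm_mul, norm_pow, pow_add, pow_add, pow_one]
  calc ‖s‖ * ‖s‖ ^ n * ‖s‖ ^ m * ‖x‖ ≤ ‖s‖ * ‖s‖ ^ n * 1 * R := by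
        gcongr
        exact pow_le_one₀ h0 h1
    _ = (4 * R * ‖s‖) * (‖s‖ ^ n / 4) := by ring
    _ ≤ 1 * (‖s‖ ^ n / 4) := by gcongr
    _ = _ := one_mul _

/-- Numerator and denominator differ by at most $|s|^{4n}/2$ and the denominator is at least one
half in norm. -/
theorem norm_chiralFactor_sub_one_le {s x : ℂ} (hR : 1 ≤ R) (hs : 4 * R * ‖s‖ ≤ 1) (hx : ‖x‖ ≤ R)
    (hx' : ‖x⁻¹‖ ≤ R) (n : ℕ) : ‖chiralFactor s x n - 1‖ ≤ ‖s‖ ^ (4 * n) := by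
  have h0 := norm_nonneg s
  have h1 : ‖s‖ ≤ 1 := by nlinarith
  have ha := norm_pow_mul_le hR hs hx (4 * n) 0
  have hb := norm_pow_mul_le hR hs hx' (4 * n) 2
  rw [show 1 + 4 * n + 0 = 1 + 4 * n by ring] at ha
  rw [show 1 + 4 * n + 2 = 3 + 4 * n by ring] at hb
  have hp : ‖s‖ ^ (4 * n) ≤ 1 := pow_le_one₀ h0 h1
  have hd := one_half_le_norm (ha.trans (by linarith))
  have hne : 1 - s ^ (1 + 4 * n) * x ≠ 0 := norm_pos_iff.1 (by linarith)
  have : chiralFactor s x n - 1 =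
      (s ^ (1 + 4 * n) * x - s ^ (3 + 4 * n) * x⁻¹) / (1 - s ^ (1 + 4 * n) * x) := by
    rw [chiralFactor, div_sub_one hne]
    congr 1
    ring
  rw [this, norm_div, div_le_iff₀ (by linarith)]
  have h2 := norm_sub_le (s ^ (1 + 4 * n) * x) (s ^ (3 + 4 * n) * x⁻¹)
  have h3 : 0 ≤ ‖s‖ ^ (4 * n) := by positivity
  nlinarith

theorem summable_pow_four_mul {r : ℝ} (h0 : 0 ≤ r) (h1 : r < 1) : Summable fun n : ℕ => r ^ (4 * n) := by
  simp_rw [pow_mul]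
  exact summable_geometric_of_lt_one (by positivity) (pow_lt_one₀ h0 h1 (by norm_num))

theorem tendsto_prod_chiralFactor {s x : ℂ} (hR : 1 ≤ R) (hs : 4 * R * ‖s‖ ≤ 1) (hx : ‖x‖ ≤ R)
    (hx' : ‖x⁻¹‖ ≤ R) :
    Tendsto (fun n => ∏ i ∈ Finset.range n, chiralFactor s x i) atTop (𝓝 (chiral s x)) := by
  have h1 : ‖s‖ < 1 := by nlinarith [norm_nonneg s]
  have hsum : Summable fun n => ‖chiralFactor s x n - 1‖ :=
    Summable.of_nonneg_of_le (fun _ => norm_nonneg _)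
      (norm_chiralFactor_sub_one_le hR hs hx hx') (summable_pow_four_mul (norm_nonneg s) h1)
  have := (multipliable_one_add_of_summable hsum).tendsto_prod_tprod_nat
  simp only [add_sub_cancel] at this
  exact this

/-- The factors from the third on differ from one by amounts whose sum is at most $2|s|^8$, so their
product differs from one by at most $4|s|^8$; the first two factors are bounded by 2 each. -/
theorem norm_chiral_sub_le {s x : ℂ} (hR : 1 ≤ R) (hs : 4 * R * ‖s‖ ≤ 1) (hx : ‖x‖ ≤ R)
    (hx' : ‖x⁻¹‖ ≤ R) :
    ‖chiral s x - chiralFactor s x 0 * chiralFactor s x 1‖ ≤ 16 * ‖s‖ ^ 8 := by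
  have h0 := norm_nonneg s
  have hq : ‖s‖ ≤ 1 / 4 := by nlinarith
  have h8 : ‖s‖ ^ 8 ≤ (1 / 4 : ℝ) ^ 8 := by gcongr
  have hF := norm_chiralFactor_sub_one_le hR hs hx hx'
  have hF2 : ∀ n, ‖chiralFactor s x n‖ ≤ 2 := fun n => by
    have h2 := norm_le_norm_add_norm_sub' (chiralFactor s x n) 1
    have h3 : ‖s‖ ^ (4 * n) ≤ 1 := pow_le_one₀ h0 (by linarith)
    rw [norm_one] at h2
    linarith [hF n]
  refine le_of_tendsto (((tendsto_prod_chiralFactor hR hs hx hx').comp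
    (tendsto_add_atTop_nat 2)).sub_const _).norm (Eventually.of_forall fun n => ?_)
  have hprod : ∏ i ∈ Finset.range (n + 2), chiralFactor s x i =
      chiralFactor s x 0 * chiralFactor s x 1 *
        ∏ i ∈ Finset.range n, (1 + (chiralFactor s x (i + 2) - 1)) := by
    simp only [add_sub_cancel]
    rw [Finset.prod_range_succ', Finset.prod_range_succ']
    ring
  have hsum : ∑ i ∈ Finset.range n, ‖chiralFactor s x (i + 2) - 1‖ ≤ 2 * ‖s‖ ^ 8 := by
    calc ∑ i ∈ Finset.range n, ‖chiralFactor s x (i + 2) - 1‖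
        ≤ ∑ i ∈ Finset.range n, ‖s‖ ^ 8 * (1 / 2 : ℝ) ^ i := by
          refine Finset.sum_le_sum fun i _ => (hF _).trans ?_
          rw [show 4 * (i + 2) = 8 + 4 * i by ring, pow_add, pow_mul ‖s‖ 4 i]
          gcongr
          calc ‖s‖ ^ 4 ≤ (1 / 4 : ℝ) ^ 4 := by gcongr
            _ ≤ 1 / 2 := by norm_num
      _ = ‖s‖ ^ 8 * ∑ i ∈ Finset.range n, (1 / 2 : ℝ) ^ i := by rw [Finset.mul_sum]
      _ ≤ ‖s‖ ^ 8 * 2 := by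
          gcongr
          exact sum_geometric_two_le n
      _ = _ := mul_comm _ _
  have hexp := (Finset.norm_prod_one_add_sub_one_le (Finset.range n)
    fun i => chiralFactor s x (i + 2) - 1).trans
      (sub_le_sub_right (Real.exp_le_exp.2 hsum) 1)
  have hexp2 := (le_abs_self _).trans (Real.abs_exp_sub_one_le
    (show |2 * ‖s‖ ^ 8| ≤ 1 by rw [abs_of_nonneg (by positivity)]; norm_num at h8 ⊢; linarith))
  rw [abs_of_nonneg (by positivity)] at hexp2
  simp only [Function.comp_apply]
  rw [hprod, ← mul_sub_one, norm_mul, norm_mul]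
  calc _ ≤ 2 * 2 * (2 * (2 * ‖s‖ ^ 8)) := by
        gcongr
        · exact hF2 0
        · exact hF2 1
        · exact hexp.trans hexp2
    _ = _ := by ring

/-- The filter of small `s` and of `x` bounded above and below. -/
def annulus (R : ℝ) : Filter (ℂ × ℂ) := 𝓝 0 ×ˢ 𝓟 {x | ‖x‖ ≤ R ∧ ‖x⁻¹‖ ≤ R}

theorem eventually_annulus (R : ℝ) :
    ∀ᶠ p in annulus R, 4 * R * ‖p.1‖ ≤ 1 ∧ ‖p.2‖ ≤ R ∧ ‖p.2⁻¹‖ ≤ R := by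
  have h1 : ∀ᶠ s : ℂ in 𝓝 0, 4 * R * ‖s‖ ≤ 1 := by
    have : Tendsto (fun s : ℂ => 4 * R * ‖s‖) (𝓝 0) (𝓝 (4 * R * ‖(0 : ℂ)‖)) :=
      (continuous_const.mul continuous_norm).tendsto 0
    rw [norm_zero, mul_zero] at this
    exact (this.eventually (gt_mem_nhds one_pos)).mono fun _ h => le_of_lt h
  exact h1.prod_mk (eventually_principal.2 fun x hx => hx)

/-- The remainder of a finite geometric series, with denominator at least one half in norm. -/
theorem approx_inv {α : Type*} {l : Filter α} {g y : α → ℂ} {n : ℕ}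
    (hy : ∀ᶠ a in l, ‖y a‖ ≤ 1 / 2) (hg : (fun a => y a ^ n) =O[l] g) :
    Approx l g (fun a => (1 - y a)⁻¹) fun a => ∑ i ∈ Finset.range n, y a ^ i := by
  constructor
  · refine IsBigO.trans (IsBigO.of_bound 2 ?_) hg
    filter_upwards [hy] with a ha
    have hd := one_half_le_norm ha
    have hne : 1 - y a ≠ 0 := norm_pos_iff.1 (by linarith)
    have : (1 - y a)⁻¹ - ∑ i ∈ Finset.range n, y a ^ i = y a ^ n / (1 - y a) := by
      rw [eq_div_iff hne, sub_mul, inv_mul_cancel₀ hne, geom_sum_mul_neg]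
      ring
    rw [this, norm_div, div_le_iff₀ (by linarith)]
    nlinarith [norm_nonneg (y a ^ n)]
  · have : ∀ i, (fun a => y a ^ i) =O[l] fun _ => (1 : ℂ) := fun i => by
      refine IsBigO.of_bound 1 ?_
      filter_upwards [hy] with a ha
      rw [norm_pow, norm_one, mul_one]
      exact pow_le_one₀ (norm_nonneg _) (by linarith)
    exact IsBigO.fun_sum fun i _ => this i

theorem approx_chiral (hR : 1 ≤ R) :
    Approx (annulus R) (fun p => p.1 ^ 8) (fun p => chiral p.1 p.2)
      fun p => chiralTrunc p.1 p.2 := by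
  have hev := eventually_annulus R
  have hb : ∀ n m : ℕ, ∀ᶠ p in annulus R, ‖p.1 ^ (1 + n + m) * p.2‖ ≤ 1 / 2 := fun n m => by
    filter_upwards [hev] with p hp
    refine (norm_pow_mul_le hR hp.1 hp.2.1 n m).trans ?_
    have : ‖p.1‖ ^ n ≤ 1 := pow_le_one₀ (norm_nonneg _) (by nlinarith [norm_nonneg p.1])
    linarith
  have hb' : ∀ n : ℕ, ∀ᶠ p in annulus R, ‖p.1 ^ (1 + n) * p.2⁻¹‖ ≤ 1 / 2 := fun n => by
    filter_upwards [hev] with p hp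
    refine (norm_pow_mul_le hR hp.1 hp.2.2 n 0).trans ?_
    have : ‖p.1‖ ^ n ≤ 1 := pow_le_one₀ (norm_nonneg _) (by nlinarith [norm_nonneg p.1])
    linarith
  have hg : (fun p : ℂ × ℂ => p.1 ^ 8) =O[annulus R] fun _ => (1 : ℂ) := by
    refine IsBigO.of_bound 1 ?_
    filter_upwards [hev] with p hp
    rw [norm_pow, norm_one, mul_one]
    exact pow_le_one₀ (norm_nonneg _) (by nlinarith [norm_nonneg p.1])
  have hnum : ∀ n : ℕ, Approx (annulus R) (fun p => p.1 ^ 8) (fun p => 1 - p.1 ^ (1 + n) * p.2⁻¹)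
      fun p => 1 - p.1 ^ (1 + n) * p.2⁻¹ := fun n => by
    refine Approx.refl ((isBigO_refl _ _).sub (IsBigO.of_bound 1 ?_))
    filter_upwards [hb' n] with p hp
    rw [norm_one]
    linarith
  have hpow : ∀ k n : ℕ, (fun p : ℂ × ℂ => (p.1 ^ (k + 1) * p.2) ^ n) =O[annulus R]
      fun p => (p.1 ^ (k + 1)) ^ n := fun k n => by
    refine IsBigO.pow (IsBigO.of_bound R ?_) n
    filter_upwards [hev] with p hp
    rw [norm_mul, mul_comm]
    gcongr
    exact hp.2.1
  -- Error $(sx)^8$ after eight terms; two terms suffice for the next denominator, where the error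
  -- $s^{10}$ is already below $s^8$. The numerators $s^3$ and $s^7$ are kept exactly.
  have hden : Approx (annulus R) (fun p => p.1 ^ 8) (fun p => (1 - p.1 ^ 1 * p.2)⁻¹)
      fun p => ∑ i ∈ Finset.range 8, (p.1 ^ 1 * p.2) ^ i :=
    approx_inv (hb 0 0) (by simpa using hpow 0 8)
  have hden' : Approx (annulus R) (fun p => p.1 ^ 8) (fun p => (1 - p.1 ^ 5 * p.2)⁻¹)
      fun p => ∑ i ∈ Finset.range 2, (p.1 ^ 5 * p.2) ^ i := by
    refine approx_inv (hb 4 0) ((hpow 4 2).trans ?_)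
    refine IsBigO.of_bound 1 ?_
    filter_upwards [hev] with p hp
    rw [← pow_mul, norm_pow, norm_pow, one_mul]
    exact pow_le_pow_of_le_one (norm_nonneg _) (by nlinarith [norm_nonneg p.1]) (by norm_num)
  have h := ((hnum 2).mul hg (hnum 6)).mul hg (hden.mul hg hden')
  have key : Approx (annulus R) (fun p => p.1 ^ 8)
      (fun p => chiralFactor p.1 p.2 0 * chiralFactor p.1 p.2 1)
      fun p => chiralTrunc p.1 p.2 := by
    convert h using 2 with p p
    · simp only [chiralFactor, div_eq_mul_inv, mul_zero, mul_one, add_zero, Nat.reduceAdd]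
      ring
    · rw [chiralTrunc, Finset.sum_range_succ _ 1, Finset.sum_range_one]
      simp only [pow_one, pow_zero, Nat.reduceAdd]
  refine Approx.trans (IsBigO.of_bound 16 ?_) key
  filter_upwards [hev] with p hp
  rw [norm_pow]
  exact norm_chiral_sub_le hR hp.1 hp.2.1 hp.2.2

end Chiral

/-! ### Charge expansions

A charged family is a polynomial in a counting variable whose `n`-th coefficient is a combination of
monomials of degree `n` in given elements, with coefficients depending continuously on a parameter. -/

section Charge

open Polynomial

variable {B ι : Type*} [CommRing B] [Fintype ι]

/-- A monomial in a family. -/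
def monom (Y : ι → B) (α : ι → ℕ) : B := ∏ i, Y i ^ α i

theorem monom_add (Y : ι → B) (α β : ι → ℕ) : monom Y (α + β) = monom Y α * monom Y β := by
  simp only [monom, Pi.add_apply, pow_add, Finset.prod_mul_distrib]

variable [Algebra ℂ B]

/-- Combinations of monomials of degree `n`, depending continuously on a parameter. -/
def chargeSpan (Y : ι → B) (n : ℕ) : Submodule ℂ (ℂ → B) :=
  Submodule.span ℂ {f | ∃ (c : ℂ → ℂ) (α : ι → ℕ), Continuous c ∧ ∑ i, α i = n ∧
    f = fun s => c s • monom Y α}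

theorem chargeSpan_mul {Y : ι → B} {n m : ℕ} {f g : ℂ → B} (hf : f ∈ chargeSpan Y n)
    (hg : g ∈ chargeSpan Y m) : f * g ∈ chargeSpan Y (n + m) := by
  refine Submodule.span_induction₂ (p := fun f g _ _ => f * g ∈ chargeSpan Y (n + m))
    ?_ ?_ ?_ ?_ ?_ ?_ ?_ hf hg
  · rintro _ _ ⟨c, α, hc, hα, rfl⟩ ⟨d, β, hd, hβ, rfl⟩
    refine Submodule.subset_span ⟨fun s => c s * d s, α + β, hc.mul hd, ?_, ?_⟩
    · simp only [Pi.add_apply, Finset.sum_add_distrib, hα, hβ]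
    · funext s
      rw [Pi.mul_apply, monom_add, smul_mul_smul_comm]
  · intro g _
    simp only [zero_mul, zero_mem]
  · intro f _
    simp only [mul_zero, zero_mem]
  · intro f f' g _ _ _ h h'
    rw [add_mul]
    exact add_mem h h'
  · intro f g g' _ _ _ h h'
    rw [mul_add]
    exact add_mem h h'
  · intro r f g _ _ h
    rw [smul_mul_assoc]
    exact Submodule.smul_mem _ _ h
  · intro r f g _ _ h
    rw [mul_smul_comm]
    exact Submodule.smul_mem _ _ h

/-- Polynomials whose coefficients are combinations of monomials of the same degree. -/
def charged (Y : ι → B) : Subring (ℂ → B)[X] where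
  carrier := {P | ∀ n, P.coeff n ∈ chargeSpan Y n}
  mul_mem' := fun {P P'} hP hP' n => by
    rw [coeff_mul]
    refine sum_mem fun p hp => ?_
    rw [← Finset.HasAntidiagonal.mem_antidiagonal.1 hp]
    exact chargeSpan_mul (hP _) (hP' _)
  one_mem' := fun n => by
    rw [coeff_one]
    split_ifs with h
    · refine Submodule.subset_span ⟨fun _ => 1, 0, continuous_const, by simp [h], ?_⟩
      funext s
      simp [monom]
    · exact zero_mem _
  add_mem' := fun {P P'} hP hP' n => by
    rw [coeff_add]
    exact add_mem (hP n) (hP' n)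
  zero_mem' := fun n => by
    rw [coeff_zero]
    exact zero_mem _
  neg_mem' := fun {P} hP n => by
    rw [coeff_neg]
    exact neg_mem (hP n)

/-- A continuous function of the parameter, as a constant polynomial. -/
def scalarPoly (B : Type*) [CommRing B] [Algebra ℂ B] (c : ℂ → ℂ) : (ℂ → B)[X] :=
  C fun s => algebraMap ℂ B (c s)

theorem scalarPoly_mem (Y : ι → B) {c : ℂ → ℂ} (hc : Continuous c) :
    scalarPoly B c ∈ charged Y := by
  intro n
  rw [scalarPoly, coeff_C]
  split_ifs with h
  · refine Submodule.subset_span ⟨c, 0, hc, by simp [h], ?_⟩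
    funext s
    simp [monom, Algebra.algebraMap_eq_smul_one]
  · exact zero_mem _

/-- A member of the family, with the counting variable. -/
def letterPoly (Y : ι → B) (i : ι) : (ℂ → B)[X] := C (fun _ => Y i) * X

theorem letterPoly_mem (Y : ι → B) (i : ι) : letterPoly Y i ∈ charged Y := by
  classical
  intro n
  rw [letterPoly, coeff_C_mul, coeff_X]
  split_ifs with h
  · refine Submodule.subset_span ⟨fun _ => 1, Pi.single i 1, continuous_const, ?_, ?_⟩
    · rw [Finset.sum_pi_single', if_pos (Finset.mem_univ _), h]
    · funext s
      rw [mul_one, one_smul, monom, Finset.prod_eq_single i]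
      · rw [Pi.single_eq_same, pow_one]
      · intro j _ hj
        rw [Pi.single_eq_of_ne hj, pow_zero]
      · intro h
        exact absurd (Finset.mem_univ _) h
  · rw [mul_zero]
    exact zero_mem _

/-- The value at the parameter `s`, with the counting variable equal to `s`. -/
def evalAt (s : ℂ) : (ℂ → B)[X] →+* B :=
  (Pi.evalRingHom (fun _ : ℂ => B) s).comp (evalRingHom fun s => algebraMap ℂ B s)

theorem evalAt_scalarPoly (s : ℂ) (c : ℂ → ℂ) :
    evalAt s (scalarPoly B c) = algebraMap ℂ B (c s) := by
  simp [evalAt, scalarPoly]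

theorem evalAt_letterPoly {ι : Type*} (s : ℂ) (Y : ι → B) (i : ι) : evalAt s (letterPoly Y i) = s • Y i := by
  rw [evalAt, letterPoly, RingHom.comp_apply, coe_evalRingHom, eval_C_mul, eval_X, mul_comm,
    Algebra.smul_def]
  rfl

theorem evalAt_eq_sum (s : ℂ) {P : (ℂ → B)[X]} {N : ℕ} (hN : P.natDegree < N) :
    evalAt s P = ∑ n ∈ Finset.range N, s ^ n • P.coeff n s := by
  simp only [evalAt, RingHom.comp_apply, coe_evalRingHom, eval_eq_sum_range' hN, map_sum, map_mul,
    map_pow, Pi.evalRingHom_apply, Algebra.smul_def]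
  exact Finset.sum_congr rfl fun n _ => mul_comm _ _

variable {L : B →ₗ[ℂ] ℂ} {Y Z : ι → B}

/-- Continuity in the parameter is what bounds the remainder of the expansion near zero. -/
theorem continuous_pairing {n m : ℕ} {f g : ℂ → B} (hf : f ∈ chargeSpan Y n)
    (hg : g ∈ chargeSpan Z m) : Continuous fun s => L (f s * g s) := by
  refine Submodule.span_induction₂ (p := fun f g _ _ => Continuous fun s => L (f s * g s))
    ?_ ?_ ?_ ?_ ?_ ?_ ?_ hf hg
  · rintro _ _ ⟨c, α, hc, -, rfl⟩ ⟨d, β, hd, -, rfl⟩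
    simp only [smul_mul_smul_comm, map_smul, smul_eq_mul]
    exact (hc.mul hd).mul continuous_const
  · intro g _
    simpa using continuous_const
  · intro f _
    simpa using continuous_const
  · intro f f' g _ _ _ h h'
    simpa only [Pi.add_apply, add_mul, map_add] using Continuous.fun_add h h'
  · intro f g g' _ _ _ h h'
    simpa only [Pi.add_apply, mul_add, map_add] using Continuous.fun_add h h'
  · intro r f g _ _ h
    simpa only [Pi.smul_apply, smul_mul_assoc, map_smul, smul_eq_mul] using Continuous.fun_mul continuous_const h
  · intro r f g _ _ h
    simpa only [Pi.smul_apply, mul_smul_comm, map_smul, smul_eq_mul] using Continuous.fun_mul continuous_const h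

theorem pairing_eq_zero
    (hL : ∀ α β : ι → ℕ, ∑ i, α i ≠ ∑ i, β i → L (monom Y α * monom Z β) = 0)
    {n m : ℕ} (hnm : n ≠ m) {f g : ℂ → B} (hf : f ∈ chargeSpan Y n)
    (hg : g ∈ chargeSpan Z m) (s : ℂ) : L (f s * g s) = 0 := by
  refine Submodule.span_induction₂ (p := fun f g _ _ => L (f s * g s) = 0)
    ?_ ?_ ?_ ?_ ?_ ?_ ?_ hf hg
  · rintro _ _ ⟨c, α, -, hα, rfl⟩ ⟨d, β, -, hβ, rfl⟩
    rw [smul_mul_smul_comm, map_smul, hL α β (by rwa [hα, hβ]), smul_zero]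
  · intro g _
    rw [Pi.zero_apply, zero_mul, map_zero]
  · intro f _
    rw [Pi.zero_apply, mul_zero, map_zero]
  · intro f f' g _ _ _ h h'
    rw [Pi.add_apply, add_mul, map_add, h, h', add_zero]
  · intro f g g' _ _ _ h h'
    rw [Pi.add_apply, mul_add, map_add, h, h', add_zero]
  · intro r f g _ _ h
    rw [Pi.smul_apply, smul_mul_assoc, map_smul, h, smul_zero]
  · intro r f g _ _ h
    rw [Pi.smul_apply, mul_smul_comm, map_smul, h, smul_zero]

/-- The expectation value of a product of two charged families of opposite charge, to fourth order
in the square of the parameter. -/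
theorem exists_pairing_evalAt
    (hL : ∀ α β : ι → ℕ, ∑ i, α i ≠ ∑ i, β i → L (monom Y α * monom Z β) = 0)
    {P P' : (ℂ → B)[X]} (hP : P ∈ charged Y) (hP' : P' ∈ charged Z) :
    ∃ r : ℂ → ℂ, Continuous r ∧ ∀ s, L (evalAt s P * evalAt s P') =
      ∑ n ∈ Finset.range 4, (s ^ 2) ^ n * L (P.coeff n s * P'.coeff n s) + (s ^ 2) ^ 4 * r s := by
  set N := max P.natDegree P'.natDegree + 1
  -- The remainder collects the degrees from four on, with the common factor $s^8$ taken out.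
  refine ⟨fun s => ∑ n ∈ Finset.range N,
    (s ^ 2) ^ n * L (P.coeff (n + 4) s * P'.coeff (n + 4) s), ?_, fun s => ?_⟩
  · refine continuous_finsetSum _ fun n _ => ?_
    exact ((continuous_id.pow 2).pow n).mul (continuous_pairing (hP _) (hP' _))
  · rw [evalAt_eq_sum s (N := 4 + N) (by omega), evalAt_eq_sum s (N := 4 + N) (by omega),
      Finset.sum_mul_sum, map_sum, Finset.mul_sum]
    have : ∀ n ∈ Finset.range (4 + N), L (∑ m ∈ Finset.range (4 + N),
        s ^ n • P.coeff n s * s ^ m • P'.coeff m s) =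
          (s ^ 2) ^ n * L (P.coeff n s * P'.coeff n s) := fun n hn => by
      rw [map_sum, Finset.sum_eq_single n]
      · rw [smul_mul_smul_comm, map_smul, smul_eq_mul]
        ring
      · intro m _ hm
        rw [smul_mul_smul_comm, map_smul, pairing_eq_zero hL hm.symm (hP n) (hP' m), smul_zero]
      · exact fun h => absurd hn h
    rw [Finset.sum_congr rfl this, Finset.sum_range_add]
    congr 1
    refine Finset.sum_congr rfl fun n _ => ?_
    rw [add_comm 4 n, pow_add]
    ring

end Charge

/-! ### Algebra of the index integrand -/

section Cubic

variable {R : Type*} [CommRing R]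

/-- Agreement of `f` with a cubic polynomial in `t` with constant term one, up to third order. -/
def IsCubic (t f a₁ a₂ a₃ : R) : Prop := t ^ 4 ∣ f - (1 + a₁ * t + a₂ * t ^ 2 + a₃ * t ^ 3)

theorem IsCubic.mul {t f g a₁ a₂ a₃ b₁ b₂ b₃ : R} (hf : IsCubic t f a₁ a₂ a₃)
    (hg : IsCubic t g b₁ b₂ b₃) :
    IsCubic t (f * g) (a₁ + b₁) (a₂ + a₁ * b₁ + b₂) (a₃ + a₂ * b₁ + a₁ * b₂ + b₃) := by
  obtain ⟨x, hx⟩ := hf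
  obtain ⟨y, hy⟩ := hg
  rw [sub_eq_iff_eq_add] at hx hy
  subst hx hy
  refine ⟨x * (1 + b₁ * t + b₂ * t ^ 2 + b₃ * t ^ 3) + y * (1 + a₁ * t + a₂ * t ^ 2 + a₃ * t ^ 3) +
    t ^ 4 * x * y + (a₁ * b₃ + a₂ * b₂ + a₃ * b₁) + (a₂ * b₃ + a₃ * b₂) * t + a₃ * b₃ * t ^ 2, ?_⟩
  ring

theorem isCubic_geom (t x : R) : IsCubic t (∑ a ∈ Finset.range 8, (x * t) ^ a) x (x ^ 2) (x ^ 3) := by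
  refine ⟨x ^ 4 + x ^ 5 * t + x ^ 6 * t ^ 2 + x ^ 7 * t ^ 3, ?_⟩
  simp only [Finset.sum_range_succ, Finset.sum_range_zero]
  ring

theorem isCubic_quadratic (t a b : R) : IsCubic t (1 + a * t + b * t ^ 2) a b 0 :=
  ⟨0, by ring⟩

/-- The part of the matter contribution of one pair of eigenvalues that depends on `τ`. -/
def matter (q u u' v v' τ : R) : R :=
  (∑ a ∈ Finset.range 8, (u * τ) ^ a) * (1 + q ^ 2 * (u * τ)) *
    ((∑ a ∈ Finset.range 8, (u' * τ) ^ a) * (1 + q ^ 2 * (u' * τ))) *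
    ((1 - q * (v * τ)) * (1 - q ^ 3 * (v * τ))) * ((1 - q * (v' * τ)) * (1 - q ^ 3 * (v' * τ)))

/-- The first three coefficients of `matter`, in terms of the characters of the doublets. -/
def matterOne (q U V : R) : R := U - q * V + q ^ 2 * U - q ^ 3 * V

def matterTwo (q U V : R) : R :=
  U ^ 2 - 1 + U * (q ^ 2 * U - q * V - q ^ 3 * V) +
    (q ^ 4 + q ^ 2 + q ^ 6 - q ^ 3 * U * V - q ^ 5 * U * V + q ^ 4 * V ^ 2)

def matterThree (q U V : R) : R :=
  U ^ 3 - 2 * U + (U ^ 2 - 1) * (q ^ 2 * U - q * V - q ^ 3 * V) +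
    U * (q ^ 4 + q ^ 2 + q ^ 6 - q ^ 3 * U * V - q ^ 5 * U * V + q ^ 4 * V ^ 2) +
    (q ^ 6 * U * V ^ 2 + q ^ 4 * U + q ^ 8 * U - 2 * q ^ 5 * V - 2 * q ^ 7 * V)

/-- The two geometric series contribute the complete symmetric functions of `u` and `u'`, which are
$U$, $U^2-1$, $U^3-2U$ because `u * u' = 1`. The other factors combine in pairs into quadratic
polynomials in the characters. -/
theorem isCubic_matter {u u' v v' : R} (hu : u * u' = 1) (hv : v * v' = 1) (q y t : R) :
    IsCubic t (matter q u u' v v' (y * t)) (matterOne q (u + u') (v + v') * y)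
      (matterTwo q (u + u') (v + v') * y ^ 2) (matterThree q (u + u') (v + v') * y ^ 3) := by
  have h := ((((isCubic_geom t (u * y)).mul (isCubic_geom t (u' * y))).mul
    (isCubic_quadratic t (q ^ 2 * (u + u') * y) (q ^ 4 * y ^ 2))).mul
    (isCubic_quadratic t (-(q * (v + v') * y)) (q ^ 2 * y ^ 2))).mul
    (isCubic_quadratic t (-(q ^ 3 * (v + v') * y)) (q ^ 6 * y ^ 2))
  obtain ⟨r, hr⟩ := h
  refine ⟨r, ?_⟩
  have e1 : (1 + q ^ 2 * (u * (y * t))) * (1 + q ^ 2 * (u' * (y * t))) =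
      1 + q ^ 2 * (u + u') * y * t + q ^ 4 * y ^ 2 * t ^ 2 := by
    linear_combination q ^ 4 * y ^ 2 * t ^ 2 * hu
  have e2 : (1 - q * (v * (y * t))) * (1 - q * (v' * (y * t))) =
      1 + -(q * (v + v') * y) * t + q ^ 2 * y ^ 2 * t ^ 2 := by
    linear_combination q ^ 2 * y ^ 2 * t ^ 2 * hv
  have e3 : (1 - q ^ 3 * (v * (y * t))) * (1 - q ^ 3 * (v' * (y * t))) =
      1 + -(q ^ 3 * (v + v') * y) * t + q ^ 6 * y ^ 2 * t ^ 2 := by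
    linear_combination q ^ 6 * y ^ 2 * t ^ 2 * hv
  have e4 : matter q u u' v v' (y * t) =
      (∑ a ∈ Finset.range 8, (u * y * t) ^ a) * (∑ a ∈ Finset.range 8, (u' * y * t) ^ a) *
        ((1 + q ^ 2 * (u * (y * t))) * (1 + q ^ 2 * (u' * (y * t)))) *
        ((1 - q * (v * (y * t))) * (1 - q * (v' * (y * t)))) *
        ((1 - q ^ 3 * (v * (y * t))) * (1 - q ^ 3 * (v' * (y * t)))) := by
    simp only [matter, mul_assoc]
    ring
  rw [← hr, e4, e1, e2, e3, matterOne, matterTwo, matterThree]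
  linear_combination -(y ^ 2 * t ^ 2 + y ^ 3 * t ^ 3 * (2 * (u + u') + q ^ 2 * (u + u')
    - q * (v + v') - q ^ 3 * (v + v'))) * hu

theorem dvd_sub_iff_mk {m a b : R} :
    m ∣ a - b ↔ Ideal.Quotient.mk (Ideal.span {m}) a = Ideal.Quotient.mk (Ideal.span {m}) b := by
  rw [Ideal.Quotient.eq, Ideal.mem_span_singleton]

/-- The contributions of degree one, two and three. -/
def chargeOne (k₁ l₁ : R) : R := k₁ * l₁

/-- The coefficients here and in `chargeThree` come from the scalar products of power sums, one for
each gauge group, divided by the value in degree zero. -/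
def chargeTwo (k₁ k₂ l₁ l₂ : R) : R :=
  k₁ ^ 2 * l₁ ^ 2 + (2 * k₂ - k₁ ^ 2) * (2 * l₂ - l₁ ^ 2)

def chargeThree (k₁ k₂ k₃ l₁ l₂ l₃ : R) : R :=
  k₁ ^ 3 * l₁ ^ 3 - (k₁ ^ 3 * (l₁ * l₂) + k₁ * k₂ * l₁ ^ 3) + (k₁ ^ 3 * l₃ + k₃ * l₁ ^ 3) +
    3 * (k₁ * k₂ * (l₁ * l₂)) - 3 * (k₁ * k₂ * l₃ + k₃ * (l₁ * l₂)) + 4 * (k₃ * l₃)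

/-- Degree `n` already carries $q^n$, so `chargeOne`, `chargeTwo` and `chargeThree` are needed only
modulo $q^3$, $q^2$ and $q$. -/
theorem index_expansion (q U V : R) :
    q ^ 4 ∣ 1 + q * chargeOne (matterOne q U V) (matterOne q V U) +
      q ^ 2 * chargeTwo (matterOne q U V) (matterTwo q U V) (matterOne q V U) (matterTwo q V U) +
      q ^ 3 * chargeThree (matterOne q U V) (matterTwo q U V) (matterThree q U V)
        (matterOne q V U) (matterTwo q V U) (matterThree q V U) -
      (1 + U * V * q + (2 * (U ^ 2 - 1) * (V ^ 2 - 1) - (U ^ 2 - 1) - (V ^ 2 - 1)) * q ^ 2 +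
        (2 * (U ^ 3 - 2 * U) * (V ^ 3 - 2 * V) - (U ^ 3 - 2 * U) * V - U * (V ^ 3 - 2 * V)
          - 2 * U * V) * q ^ 3) := by
  have h1 : q ^ 3 ∣ chargeOne (matterOne q U V) (matterOne q V U) -
      (U * V - q * (U ^ 2 + V ^ 2) + 3 * q ^ 2 * (U * V)) := by
    refine ⟨-(2 * U ^ 2 + 2 * V ^ 2) + q * (3 * U * V) - q ^ 2 * (U ^ 2 + V ^ 2)
      + q ^ 3 * (U * V), ?_⟩
    rw [chargeOne, matterOne, matterOne]
    ring
  have a1 : ∀ U V : R, q ^ 2 ∣ matterOne q U V - (U - q * V) := fun U V =>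
    ⟨U - q * V, by rw [matterOne]; ring⟩
  have a2 : ∀ U V : R, q ^ 2 ∣ matterTwo q U V - (U ^ 2 - 1 - q * (U * V)) := fun U V =>
    ⟨U * (U - q * V) + (q ^ 2 + 1 + q ^ 4 - q * U * V - q ^ 3 * U * V + q ^ 2 * V ^ 2), by
      rw [matterTwo]; ring⟩
  have h2 : q ^ 2 ∣ chargeTwo (matterOne q U V) (matterTwo q U V) (matterOne q V U)
      (matterTwo q V U) - (2 * U ^ 2 * V ^ 2 - 2 * U ^ 2 - 2 * V ^ 2 + 4
        - q * (2 * U * V * (U ^ 2 + V ^ 2))) := by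
    have h : q ^ 2 ∣ chargeTwo (U - q * V) (U ^ 2 - 1 - q * (U * V)) (V - q * U)
        (V ^ 2 - 1 - q * (V * U)) - (2 * U ^ 2 * V ^ 2 - 2 * U ^ 2 - 2 * V ^ 2 + 4
          - q * (2 * U * V * (U ^ 2 + V ^ 2))) := by
      refine ⟨U ^ 4 + 4 * U ^ 2 * V ^ 2 + V ^ 4 - q * (2 * U * V * (U ^ 2 + V ^ 2)) +
        2 * q ^ 2 * U ^ 2 * V ^ 2 - U ^ 2 * (U ^ 2 - 2) - V ^ 2 * (V ^ 2 - 2), ?_⟩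
      rw [chargeTwo]
      ring
    rw [dvd_sub_iff_mk] at h ⊢
    rw [← h]
    simp only [chargeTwo, map_add, map_sub, map_mul, map_pow, dvd_sub_iff_mk.1 (a1 U V),
      dvd_sub_iff_mk.1 (a1 V U), dvd_sub_iff_mk.1 (a2 U V), dvd_sub_iff_mk.1 (a2 V U)]
  have b1 : ∀ U V : R, q ∣ matterOne q U V - U := fun U V =>
    ⟨-V + q * U - q ^ 2 * V, by rw [matterOne]; ring⟩
  have b2 : ∀ U V : R, q ∣ matterTwo q U V - (U ^ 2 - 1) := fun U V =>
    ⟨U * (q * U - V - q ^ 2 * V) + (q ^ 3 + q + q ^ 5 - q ^ 2 * U * V - q ^ 4 * U * V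
      + q ^ 3 * V ^ 2), by rw [matterTwo]; ring⟩
  have b3 : ∀ U V : R, q ∣ matterThree q U V - (U ^ 3 - 2 * U) := fun U V =>
    ⟨(U ^ 2 - 1) * (q * U - V - q ^ 2 * V) +
      U * (q ^ 3 + q + q ^ 5 - q ^ 2 * U * V - q ^ 4 * U * V + q ^ 3 * V ^ 2) +
      (q ^ 5 * U * V ^ 2 + q ^ 3 * U + q ^ 7 * U - 2 * q ^ 4 * V - 2 * q ^ 6 * V), by
      rw [matterThree]; ring⟩
  have h3 : q ∣ chargeThree (matterOne q U V) (matterTwo q U V) (matterThree q U V)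
      (matterOne q V U) (matterTwo q V U) (matterThree q V U) -
        chargeThree U (U ^ 2 - 1) (U ^ 3 - 2 * U) V (V ^ 2 - 1) (V ^ 3 - 2 * V) := by
    rw [dvd_sub_iff_mk]
    simp only [chargeThree, map_add, map_sub, map_mul, map_pow, dvd_sub_iff_mk.1 (b1 U V),
      dvd_sub_iff_mk.1 (b1 V U), dvd_sub_iff_mk.1 (b2 U V), dvd_sub_iff_mk.1 (b2 V U),
      dvd_sub_iff_mk.1 (b3 U V), dvd_sub_iff_mk.1 (b3 V U)]
  obtain ⟨r1, h1⟩ := h1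
  obtain ⟨r2, h2⟩ := h2
  obtain ⟨r3, h3⟩ := h3
  refine ⟨r1 + r2 + r3, ?_⟩
  rw [sub_eq_iff_eq_add] at h1 h2 h3
  rw [h1, h2, h3, chargeThree]
  ring

end Cubic

/-! ### Averages over the tori -/

section Torus

open MeasureTheory Complex

/-- The angles of the eigenvalues of one gauge group. -/
abbrev Angles := Fin 2 → ℝ

def angleMeasure : Measure Angles := volume.restrict (Set.Icc 0 fun _ => 2 * Real.pi)

instance : IsFiniteMeasure angleMeasure := by
  rw [angleMeasure]
  exact ⟨by simpa using isCompact_Icc.measure_lt_top⟩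

def eigenvalue (θ : Angles) (i : Fin 2) : ℂ := exp (θ i * I)

theorem eigenvalue_ne_zero (θ : Angles) (i : Fin 2) : eigenvalue θ i ≠ 0 := exp_ne_zero _

theorem norm_eigenvalue (θ : Angles) (i : Fin 2) : ‖eigenvalue θ i‖ = 1 :=
  norm_exp_ofReal_mul_I _

theorem continuous_eigenvalue (i : Fin 2) : Continuous fun θ => eigenvalue θ i := by
  unfold eigenvalue
  fun_prop

theorem vec_two (z : Fin 2 → ℂ) : vec z = (1 - z 0 / z 1) * (1 - z 1 / z 0) := by
  rw [vec, Fin.prod_univ_two, show Finset.Ioi (0 : Fin 2) = {1} by decide,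
    show Finset.Ioi (1 : Fin 2) = ∅ by decide]
  simp

theorem continuous_vec_eigenvalue : Continuous fun θ => vec (eigenvalue θ) := by
  simp only [vec_two]
  have h0 := continuous_eigenvalue 0
  have h1 := continuous_eigenvalue 1
  exact (continuous_const.sub (h0.div₀ h1 fun θ => eigenvalue_ne_zero θ 1)).mul
    (continuous_const.sub (h1.div₀ h0 fun θ => eigenvalue_ne_zero θ 0))

theorem integrable_of_continuous {f : Angles → ℂ} (hf : Continuous f) :
    Integrable f angleMeasure :=
  hf.continuousOn.integrableOn_compact isCompact_Icc

theorem integrable_prod_of_continuous {f : Angles × Angles → ℂ} (hf : Continuous f) :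
    Integrable f (angleMeasure.prod angleMeasure) := by
  rw [angleMeasure, Measure.prod_restrict]
  exact hf.continuousOn.integrableOn_compact (isCompact_Icc.prod isCompact_Icc)

theorem integral_exp_int (n : ℤ) :
    ∫ t in Set.Icc 0 (2 * Real.pi), exp (n * t * I) = if n = 0 then (2 * Real.pi : ℂ) else 0 := by
  rw [integral_Icc_eq_integral_Ioc, ← intervalIntegral.integral_of_le Real.two_pi_pos.le]
  split_ifs with h
  · simp [h]
  · have hc : (n : ℂ) * I ≠ 0 := mul_ne_zero (Int.cast_ne_zero.2 h) I_ne_zero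
    have := integral_exp_mul_complex (a := 0) (b := 2 * Real.pi) hc
    simp only [mul_right_comm _ I] at this
    rw [this]
    have h2 : exp ((n : ℂ) * ((2 * Real.pi : ℝ) : ℂ) * I) = 1 :=
      exp_eq_one_iff.2 ⟨n, by push_cast; ring⟩
    rw [h2]
    simp

/-- The integral of a monomial in the eigenvalues. -/
theorem integral_eigenvalue_zpow (n : Fin 2 → ℤ) :
    ∫ θ, ∏ i, eigenvalue θ i ^ n i ∂angleMeasure = ∏ i, if n i = 0 then (2 * Real.pi : ℂ) else 0 := by
  have hm : angleMeasure =
      Measure.pi fun _ : Fin 2 => volume.restrict (Set.Icc (0 : ℝ) (2 * Real.pi)) := by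
    rw [angleMeasure, volume_pi, ← Measure.restrict_pi_pi, Set.pi_univ_Icc]
    rfl
  simp only [eigenvalue]
  rw [hm, integral_fintype_prod_eq_prod (fun i t => exp ((t : ℝ) * I) ^ n i)]
  refine Finset.prod_congr rfl fun i _ => ?_
  rw [← integral_exp_int]
  refine integral_congr_ae (Filter.Eventually.of_forall fun t => ?_)
  simp only
  rw [← exp_int_mul, mul_assoc]

/-- The measure factor is homogeneous of degree zero. Each monomial in the product keeps a nonzero
total degree, hence a nonzero exponent in some angle, and integrates to zero. -/
theorem integral_vec_mul_zpow {n : Fin 2 → ℤ} (hn : ∑ i, n i ≠ 0) :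
    ∫ θ, vec (eigenvalue θ) * ∏ i, eigenvalue θ i ^ n i ∂angleMeasure = 0 := by
  have h : ∀ θ, vec (eigenvalue θ) * ∏ i, eigenvalue θ i ^ n i =
      2 * ∏ i, eigenvalue θ i ^ n i - ∏ i, eigenvalue θ i ^ (n + ![1, -1] : Fin 2 → ℤ) i
        - ∏ i, eigenvalue θ i ^ (n + ![-1, 1] : Fin 2 → ℤ) i := fun θ => by
    have h0 := eigenvalue_ne_zero θ 0
    have h1 := eigenvalue_ne_zero θ 1
    simp only [vec_two, Fin.prod_univ_two, Pi.add_apply, Matrix.cons_val_zero, Matrix.cons_val_one,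
      zpow_add₀ h0, zpow_add₀ h1, zpow_one, zpow_neg]
    field_simp
    ring
  have hi : ∀ m : Fin 2 → ℤ, Integrable (fun θ => ∏ i, eigenvalue θ i ^ m i) angleMeasure :=
    fun m => integrable_of_continuous (continuous_finsetProd _ fun i _ =>
      (continuous_eigenvalue i).zpow₀ _ fun θ => Or.inl (eigenvalue_ne_zero θ i))
  have hz : ∀ m : Fin 2 → ℤ, ∑ i, m i ≠ 0 → ∫ θ, ∏ i, eigenvalue θ i ^ m i ∂angleMeasure = 0 := by
    intro m hm
    obtain ⟨i, -, hi⟩ := Finset.exists_ne_zero_of_sum_ne_zero hm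
    rw [integral_eigenvalue_zpow]
    exact Finset.prod_eq_zero (Finset.mem_univ i) (if_neg hi)
  have h2 : Integrable (fun θ => 2 * ∏ i, eigenvalue θ i ^ n i -
      ∏ i, eigenvalue θ i ^ (n + ![1, -1] : Fin 2 → ℤ) i) angleMeasure :=
    ((hi _).const_mul 2).sub (hi _)
  simp only [h]
  rw [integral_sub h2 (hi _), integral_sub ((hi _).const_mul 2) (hi _),
    integral_const_mul, hz n hn, hz, hz]
  · simp
  · simpa [Finset.sum_add_distrib] using hn
  · simpa [Finset.sum_add_distrib] using hn

/-- The integral of a function of the eigenvalues that is, after multiplication by the measure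
factor, a symmetric Laurent polynomial in their ratio. -/
theorem integral_vec_mul {g : ℂ → ℂ → ℂ} (c : ℂ) (d : ℕ → ℂ)
    (hg : ∀ a b : ℂ, a ≠ 0 → b ≠ 0 → (1 - a / b) * (1 - b / a) * g a b =
      c + ∑ m ∈ Finset.range 4, d m * ((a / b) ^ (m + 1) + (b / a) ^ (m + 1))) :
    ∫ θ, vec (eigenvalue θ) * g (eigenvalue θ 0) (eigenvalue θ 1) ∂angleMeasure =
      (2 * Real.pi) ^ 2 * c := by
  have hi : ∀ m : Fin 2 → ℤ, Integrable (fun θ => ∏ i, eigenvalue θ i ^ m i) angleMeasure :=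
    fun m => integrable_of_continuous (continuous_finsetProd _ fun i _ =>
      (continuous_eigenvalue i).zpow₀ _ fun θ => Or.inl (eigenvalue_ne_zero θ i))
  have h : ∀ θ, vec (eigenvalue θ) * g (eigenvalue θ 0) (eigenvalue θ 1) =
      c * ∏ i, eigenvalue θ i ^ (0 : Fin 2 → ℤ) i + ∑ m ∈ Finset.range 4, d m *
        (∏ i, eigenvalue θ i ^ (![(m + 1 : ℕ), -(m + 1 : ℕ)] : Fin 2 → ℤ) i +
          ∏ i, eigenvalue θ i ^ (![-(m + 1 : ℕ), (m + 1 : ℕ)] : Fin 2 → ℤ) i) := fun θ => by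
    rw [vec_two, hg _ _ (eigenvalue_ne_zero θ 0) (eigenvalue_ne_zero θ 1)]
    simp only [Pi.zero_apply, zpow_zero, Finset.prod_const_one, mul_one]
    congr 1
    refine Finset.sum_congr rfl fun m _ => ?_
    simp only [Fin.prod_univ_two, Matrix.cons_val_zero, Matrix.cons_val_one, zpow_neg, zpow_natCast,
      div_eq_mul_inv]
    ring
  have h0 : ∀ m : ℕ, ((m + 1 : ℕ) : ℤ) ≠ 0 := fun m => Int.natCast_ne_zero.2 m.succ_ne_zero
  have hs : ∀ m : ℕ, Integrable (fun θ => d m *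
        (∏ i, eigenvalue θ i ^ (![(m + 1 : ℕ), -(m + 1 : ℕ)] : Fin 2 → ℤ) i +
          ∏ i, eigenvalue θ i ^ (![-(m + 1 : ℕ), (m + 1 : ℕ)] : Fin 2 → ℤ) i)) angleMeasure :=
    fun m => ((hi _).fun_add (hi _)).const_mul _
  simp only [h]
  rw [integral_add ((hi _).const_mul c) (integrable_finsetSum _ fun m _ => hs m),
    integral_const_mul, integral_eigenvalue_zpow, integral_finsetSum _ fun m _ => hs m,
    Finset.sum_eq_zero]
  · simp only [Pi.zero_apply, if_true, Fin.prod_univ_two]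
    ring
  · intro m _
    rw [integral_const_mul, integral_add (hi _) (hi _), integral_eigenvalue_zpow,
      integral_eigenvalue_zpow]
    simp only [Fin.prod_univ_two, Matrix.cons_val_zero, Matrix.cons_val_one, if_neg (h0 m), zero_mul,
      neg_eq_zero, add_zero, mul_zero]

/-- A monomial in the power sums of two variables, of degrees one, two and three. -/
def powerSum (e : ℕ × ℕ × ℕ) (a b : ℂ) : ℂ :=
  (a + b) ^ e.1 * (a ^ 2 + b ^ 2) ^ e.2.1 * (a ^ 3 + b ^ 3) ^ e.2.2

/-- The scalar product of monomials in the power sums. -/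
def gram (e e' : ℕ × ℕ × ℕ) : ℂ :=
  ∫ θ, vec (eigenvalue θ) * (powerSum e (eigenvalue θ 0) (eigenvalue θ 1) *
    powerSum e' (eigenvalue θ 0)⁻¹ (eigenvalue θ 1)⁻¹) ∂angleMeasure

/-- Inverting both variables only divides by a power of `a * b`; the integrand becomes a Laurent
polynomial in `a / b` when the degrees agree. -/
theorem powerSum_inv (e : ℕ × ℕ × ℕ) {a b : ℂ} (ha : a ≠ 0) (hb : b ≠ 0) :
    powerSum e a⁻¹ b⁻¹ = powerSum e a b / (a * b) ^ (e.1 + 2 * e.2.1 + 3 * e.2.2) := by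
  have h1 : a⁻¹ + b⁻¹ = (a + b) / (a * b) := by field_simp; ring
  have h2 : a⁻¹ ^ 2 + b⁻¹ ^ 2 = (a ^ 2 + b ^ 2) / (a * b) ^ 2 := by field_simp; ring
  have h3 : a⁻¹ ^ 3 + b⁻¹ ^ 3 = (a ^ 3 + b ^ 3) / (a * b) ^ 3 := by field_simp; ring
  rw [powerSum, h1, h2, h3, div_pow, div_pow, div_pow, ← pow_mul, ← pow_mul, div_mul_div_comm,
    div_mul_div_comm, ← pow_add, ← pow_add, powerSum]

theorem gram_comm {e e' : ℕ × ℕ × ℕ}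
    (h : e.1 + 2 * e.2.1 + 3 * e.2.2 = e'.1 + 2 * e'.2.1 + 3 * e'.2.2) : gram e e' = gram e' e := by
  refine integral_congr_ae (Filter.Eventually.of_forall fun θ => ?_)
  simp only [powerSum_inv _ (eigenvalue_ne_zero θ 0) (eigenvalue_ne_zero θ 1), h]
  ring

/-- Only the constant term `c` survives the integration; `d₁` to `d₄` are the remaining Laurent
coefficients. -/
theorem gram_eq {e e' : ℕ × ℕ × ℕ} (c d₁ d₂ d₃ d₄ : ℂ)
    (h : ∀ a b : ℂ, a ≠ 0 → b ≠ 0 → (1 - a / b) * (1 - b / a) * (powerSum e a b *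
      (powerSum e' a b / (a * b) ^ (e'.1 + 2 * e'.2.1 + 3 * e'.2.2))) =
        c + d₁ * (a / b + b / a) + d₂ * ((a / b) ^ 2 + (b / a) ^ 2) +
          d₃ * ((a / b) ^ 3 + (b / a) ^ 3) + d₄ * ((a / b) ^ 4 + (b / a) ^ 4)) :
    gram e e' = (2 * Real.pi) ^ 2 * c := by
  refine integral_vec_mul (g := fun a b => powerSum e a b * powerSum e' a⁻¹ b⁻¹) c
    (fun m => if m = 0 then d₁ else if m = 1 then d₂ else if m = 2 then d₃ else d₄)
    fun a b ha hb => ?_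
  rw [powerSum_inv e' ha hb, h a b ha hb]
  simp only [Finset.sum_range_succ, Finset.sum_range_zero]
  norm_num
  ring

/-- Apart from the volume $(2\pi)^2$ and the order 2 of the Weyl group, these values are sums of
products of symmetric-group characters over Young diagrams with at most two rows. In degree three
the single column is missing, which is the effect of rank two. -/
theorem gram_000_000 : gram (0, 0, 0) (0, 0, 0) = (2 * Real.pi) ^ 2 * 2 := by
  refine gram_eq _ (-1) 0 0 0 fun a b ha hb => ?_
  simp only [powerSum]
  field_simp
  ring

theorem gram_100_100 : gram (1, 0, 0) (1, 0, 0) = (2 * Real.pi) ^ 2 * 2 := by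
  refine gram_eq _ 0 (-1) 0 0 fun a b ha hb => ?_
  simp only [powerSum]
  field_simp
  ring

theorem gram_200_200 : gram (2, 0, 0) (2, 0, 0) = (2 * Real.pi) ^ 2 * 4 := by
  refine gram_eq _ 1 (-2) (-1) 0 fun a b ha hb => ?_
  simp only [powerSum]
  field_simp
  ring

theorem gram_200_010 : gram (2, 0, 0) (0, 1, 0) = (2 * Real.pi) ^ 2 * 0 := by
  refine gram_eq _ 1 0 (-1) 0 fun a b ha hb => ?_
  simp only [powerSum]
  field_simp
  ring

theorem gram_010_010 : gram (0, 1, 0) (0, 1, 0) = (2 * Real.pi) ^ 2 * 4 := by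
  refine gram_eq _ (-3) 2 (-1) 0 fun a b ha hb => ?_
  simp only [powerSum]
  field_simp
  ring

theorem gram_300_300 : gram (3, 0, 0) (3, 0, 0) = (2 * Real.pi) ^ 2 * 10 := by
  refine gram_eq _ 4 (-4) (-4) (-1) fun a b ha hb => ?_
  simp only [powerSum]
  field_simp
  ring

theorem gram_300_110 : gram (3, 0, 0) (1, 1, 0) = (2 * Real.pi) ^ 2 * 2 := by
  refine gram_eq _ 2 0 (-2) (-1) fun a b ha hb => ?_
  simp only [powerSum]
  field_simp
  ring

theorem gram_300_001 : gram (3, 0, 0) (0, 0, 1) = (2 * Real.pi) ^ 2 * (-2) := by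
  refine gram_eq _ 1 2 (-1) (-1) fun a b ha hb => ?_
  simp only [powerSum]
  field_simp
  ring

theorem gram_110_110 : gram (1, 1, 0) (1, 1, 0) = (2 * Real.pi) ^ 2 * 2 := by
  refine gram_eq _ 0 0 0 (-1) fun a b ha hb => ?_
  simp only [powerSum]
  field_simp
  ring

theorem gram_110_001 : gram (1, 1, 0) (0, 0, 1) = (2 * Real.pi) ^ 2 * 2 := by
  refine gram_eq _ (-1) 0 1 (-1) fun a b ha hb => ?_
  simp only [powerSum]
  field_simp
  ring

theorem gram_001_001 : gram (0, 0, 1) (0, 0, 1) = (2 * Real.pi) ^ 2 * 4 := by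
  refine gram_eq _ (-2) (-1) 2 (-1) fun a b ha hb => ?_
  simp only [powerSum]
  field_simp
  ring

end Torus

/-! ### The average over both gauge groups -/

section Average

open MeasureTheory Complex

/-- The angles of both gauge groups. -/
abbrev Torus := Angles × Angles

def torusMeasure : Measure Torus := angleMeasure.prod angleMeasure

instance : IsFiniteMeasure torusMeasure := by
  rw [torusMeasure]
  infer_instance

/-- The integration measure of the gauge groups. -/
def haarFactor (ω : Torus) : ℂ := vec (eigenvalue ω.1) * vec (eigenvalue ω.2)

theorem continuous_haarFactor : Continuous haarFactor :=
  (continuous_vec_eigenvalue.comp continuous_fst).mul (continuous_vec_eigenvalue.comp continuous_snd)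

/-- The average with the integration measure of the gauge groups. -/
def average : C(Torus, ℂ) →ₗ[ℂ] ℂ where
  toFun f := ∫ ω, haarFactor ω * f ω ∂torusMeasure
  map_add' f g := by
    simp only [ContinuousMap.add_apply, mul_add]
    exact integral_add (integrable_prod_of_continuous (continuous_haarFactor.mul f.continuous))
      (integrable_prod_of_continuous (continuous_haarFactor.mul g.continuous))
  map_smul' c f := by
    simp only [ContinuousMap.smul_apply, RingHom.id_apply, smul_eq_mul, mul_left_comm _ c]
    exact integral_const_mul c _

theorem average_apply (f : C(Torus, ℂ)) :
    average f = ∫ ω, haarFactor ω * f ω ∂torusMeasure := rfl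

/-- The average factorises. -/
theorem average_of_factor {f : C(Torus, ℂ)} (g h : Angles → ℂ) (hf : ∀ ω, f ω = g ω.1 * h ω.2) :
    average f = (∫ θ, vec (eigenvalue θ) * g θ ∂angleMeasure) *
      ∫ θ, vec (eigenvalue θ) * h θ ∂angleMeasure := by
  rw [average_apply, torusMeasure, ← integral_prod_mul]
  refine integral_congr_ae (Filter.Eventually.of_forall fun ω => ?_)
  simp only [haarFactor, hf]
  ring

/-- The fugacities of the anti-bifundamentals. -/
def ratio (i : Fin 2 × Fin 2) : C(Torus, ℂ) :=
  ⟨fun ω => eigenvalue ω.1 i.1 / eigenvalue ω.2 i.2,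
    ((continuous_eigenvalue i.1).comp continuous_fst).div₀
      ((continuous_eigenvalue i.2).comp continuous_snd) fun _ => eigenvalue_ne_zero _ _⟩

/-- The fugacities of the bifundamentals. -/
def ratioInv (i : Fin 2 × Fin 2) : C(Torus, ℂ) :=
  ⟨fun ω => eigenvalue ω.2 i.2 / eigenvalue ω.1 i.1,
    ((continuous_eigenvalue i.2).comp continuous_snd).div₀
      ((continuous_eigenvalue i.1).comp continuous_fst) fun _ => eigenvalue_ne_zero _ _⟩

theorem ratio_apply (i : Fin 2 × Fin 2) (ω : Torus) :
    ratio i ω = eigenvalue ω.1 i.1 / eigenvalue ω.2 i.2 := rfl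

theorem ratioInv_apply (i : Fin 2 × Fin 2) (ω : Torus) :
    ratioInv i ω = eigenvalue ω.2 i.2 / eigenvalue ω.1 i.1 := rfl

theorem norm_ratio (i : Fin 2 × Fin 2) (ω : Torus) : ‖ratio i ω‖ = 1 := by
  rw [ratio_apply, norm_div, norm_eigenvalue, norm_eigenvalue, div_one]

theorem norm_ratioInv (i : Fin 2 × Fin 2) (ω : Torus) : ‖ratioInv i ω‖ = 1 := by
  rw [ratioInv_apply, norm_div, norm_eigenvalue, norm_eigenvalue, div_one]

theorem inv_ratio_apply (i : Fin 2 × Fin 2) (ω : Torus) : (ratio i ω)⁻¹ = ratioInv i ω := by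
  rw [ratio_apply, ratioInv_apply, inv_div]

/-- Only neutral monomials have a nonzero average. -/
theorem average_monom_eq_zero (α β : Fin 2 × Fin 2 → ℕ) (h : ∑ i, α i ≠ ∑ i, β i) :
    average (monom ratio α * monom ratioInv β) = 0 := by
  have hd : ∀ (i : Fin 2 × Fin 2) (ω : Torus), ratio i ω ^ α i * ratioInv i ω ^ β i =
      eigenvalue ω.1 i.1 ^ ((α i : ℤ) - β i) * eigenvalue ω.2 i.2 ^ ((β i : ℤ) - α i) := by
    intro i ω
    rw [ratio_apply, ratioInv_apply, zpow_sub₀ (eigenvalue_ne_zero _ _),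
      zpow_sub₀ (eigenvalue_ne_zero _ _), div_pow, div_pow]
    simp only [zpow_natCast]
    ring
  rw [average_of_factor
    (fun θ => ∏ i, eigenvalue θ i ^ (∑ j, ((α (i, j) : ℤ) - β (i, j))))
    (fun θ => ∏ j, eigenvalue θ j ^ (∑ i, ((β (i, j) : ℤ) - α (i, j))))]
  · rw [integral_vec_mul_zpow (n := fun i => ∑ j, ((α (i, j) : ℤ) - β (i, j))), zero_mul]
    rw [← Fintype.sum_prod_type' (f := fun i j => (α (i, j) : ℤ) - β (i, j)),
      Finset.sum_sub_distrib, sub_ne_zero]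
    exact_mod_cast h
  · intro ω
    have : (monom ratio α * monom ratioInv β) ω = ∏ i, ratio i ω ^ α i * ratioInv i ω ^ β i := by
      simp only [monom, ContinuousMap.mul_apply, ContinuousMap.prod_apply, ContinuousMap.pow_apply,
        Finset.prod_mul_distrib]
    rw [this]
    simp only [hd, Fintype.prod_prod_type, Fin.prod_univ_two, Fin.sum_univ_two,
      zpow_add₀ (eigenvalue_ne_zero _ _)]
    ring

/-- The monomials in the power sums of the fugacities. -/
def powerSumMap (Y : Fin 2 × Fin 2 → C(Torus, ℂ)) (e : ℕ × ℕ × ℕ) : C(Torus, ℂ) :=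
  (∑ i, Y i) ^ e.1 * (∑ i, Y i ^ 2) ^ e.2.1 * (∑ i, Y i ^ 3) ^ e.2.2

theorem powerSumMap_apply (Y : Fin 2 × Fin 2 → C(Torus, ℂ)) (e : ℕ × ℕ × ℕ) (ω : Torus) :
    powerSumMap Y e ω =
      (∑ i, Y i ω) ^ e.1 * (∑ i, Y i ω ^ 2) ^ e.2.1 * (∑ i, Y i ω ^ 3) ^ e.2.2 := by
  simp only [powerSumMap, ContinuousMap.mul_apply, ContinuousMap.pow_apply, ContinuousMap.sum_apply]

theorem sum_ratio_pow (n : ℕ) (ω : Torus) : ∑ i, ratio i ω ^ n =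
    (eigenvalue ω.1 0 ^ n + eigenvalue ω.1 1 ^ n) *
      ((eigenvalue ω.2 0)⁻¹ ^ n + (eigenvalue ω.2 1)⁻¹ ^ n) := by
  simp only [Fintype.sum_prod_type, Fin.sum_univ_two, ratio_apply, div_eq_mul_inv, mul_pow]
  ring

theorem sum_ratioInv_pow (n : ℕ) (ω : Torus) : ∑ i, ratioInv i ω ^ n =
    ((eigenvalue ω.1 0)⁻¹ ^ n + (eigenvalue ω.1 1)⁻¹ ^ n) *
      (eigenvalue ω.2 0 ^ n + eigenvalue ω.2 1 ^ n) := by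
  simp only [Fintype.sum_prod_type, Fin.sum_univ_two, ratioInv_apply, div_eq_mul_inv, mul_pow]
  ring

/-- A power sum of the ratios is a power sum of the first eigenvalues times one of the inverses of
the second, so the average is a product of two scalar products. -/
theorem average_powerSumMap (e e' : ℕ × ℕ × ℕ) :
    average (powerSumMap ratio e * powerSumMap ratioInv e') = gram e e' * gram e' e := by
  rw [average_of_factor
    (fun θ => powerSum e (eigenvalue θ 0) (eigenvalue θ 1) *
      powerSum e' (eigenvalue θ 0)⁻¹ (eigenvalue θ 1)⁻¹)
    (fun θ => powerSum e' (eigenvalue θ 0) (eigenvalue θ 1) *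
      powerSum e (eigenvalue θ 0)⁻¹ (eigenvalue θ 1)⁻¹)]
  · rfl
  · intro ω
    have h1 := sum_ratio_pow 1 ω
    have h2 := sum_ratioInv_pow 1 ω
    simp only [pow_one] at h1 h2
    rw [ContinuousMap.mul_apply, powerSumMap_apply, powerSumMap_apply, h1, h2, sum_ratio_pow,
      sum_ratio_pow, sum_ratioInv_pow, sum_ratioInv_pow]
    simp only [powerSum, mul_pow]
    ring

end Average

/-! ### The matter contribution as a charged polynomial -/

section ChargedMatter

open Polynomial

/-- The matter contribution of one family of fugacities, as a charged polynomial. -/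
def matterPoly (u v : ℂˣ) (Y : Fin 2 × Fin 2 → C(Torus, ℂ)) : (ℂ → C(Torus, ℂ))[X] :=
  ∏ i, matter (scalarPoly _ fun s => s ^ 2) (scalarPoly _ fun _ => (u : ℂ))
    (scalarPoly _ fun _ => (u : ℂ)⁻¹) (scalarPoly _ fun _ => (v : ℂ))
    (scalarPoly _ fun _ => (v : ℂ)⁻¹) (letterPoly Y i)

variable (u v : ℂˣ) (Y : Fin 2 × Fin 2 → C(Torus, ℂ))

theorem matter_mem {R : Type*} [CommRing R] (S : Subring R) {q u u' v v' τ : R} (hq : q ∈ S)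
    (hu : u ∈ S) (hu' : u' ∈ S) (hv : v ∈ S) (hv' : v' ∈ S) (hτ : τ ∈ S) :
    matter q u u' v v' τ ∈ S := by
  have h : ∀ {x c : R}, x ∈ S → c ∈ S → c * x ∈ S := fun hx hc => S.mul_mem hc hx
  refine S.mul_mem (S.mul_mem (S.mul_mem ?_ ?_) ?_) ?_
  · exact S.mul_mem (S.sum_mem fun a _ => S.pow_mem (h hτ hu) a)
      (S.add_mem S.one_mem (h (h hτ hu) (S.pow_mem hq 2)))
  · exact S.mul_mem (S.sum_mem fun a _ => S.pow_mem (h hτ hu') a)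
      (S.add_mem S.one_mem (h (h hτ hu') (S.pow_mem hq 2)))
  · exact S.mul_mem (S.sub_mem S.one_mem (h (h hτ hv) hq))
      (S.sub_mem S.one_mem (h (h hτ hv) (S.pow_mem hq 3)))
  · exact S.mul_mem (S.sub_mem S.one_mem (h (h hτ hv') hq))
      (S.sub_mem S.one_mem (h (h hτ hv') (S.pow_mem hq 3)))

theorem matterPoly_mem : matterPoly u v Y ∈ charged Y := by
  refine Subring.prod_mem _ fun i _ => matter_mem _ ?_ ?_ ?_ ?_ ?_ (letterPoly_mem Y i)
  · exact scalarPoly_mem Y (continuous_id.pow 2)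
  all_goals exact scalarPoly_mem Y continuous_const

theorem map_matter {R S : Type*} [CommRing R] [CommRing S] (f : R →+* S) (q u u' v v' τ : R) :
    f (matter q u u' v v' τ) = matter (f q) (f u) (f u') (f v) (f v') (f τ) := by
  simp only [matter, map_mul, map_add, map_sub, map_one, map_pow, map_sum]

/-- Evaluation at a point of the torus. -/
def evalPoint (ω : Torus) : C(Torus, ℂ) →+* ℂ :=
  (Pi.evalRingHom (fun _ : Torus => ℂ) ω).comp ContinuousMap.coeFnRingHom

theorem evalPoint_apply (ω : Torus) (f : C(Torus, ℂ)) : evalPoint ω f = f ω := rfl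

theorem evalPoint_algebraMap (ω : Torus) (c : ℂ) : evalPoint ω (algebraMap ℂ C(Torus, ℂ) c) = c :=
  rfl

theorem evalAt_matterPoly (s : ℂ) (ω : Torus) : evalAt s (matterPoly u v Y) ω =
    ∏ i, matter (s ^ 2) (u : ℂ) (u : ℂ)⁻¹ v (v : ℂ)⁻¹ (s * Y i ω) := by
  rw [← evalPoint_apply, matterPoly, map_prod, map_prod]
  refine Finset.prod_congr rfl fun i _ => ?_
  refine (congrArg (evalPoint ω) (map_matter (R := (ℂ → C(Torus, ℂ))[X]) (evalAt s) _ _ _ _ _ _)).trans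
    ((map_matter (evalPoint ω) _ _ _ _ _ _).trans ?_)
  simp only [evalAt_scalarPoly, evalAt_letterPoly, evalPoint_algebraMap]
  rfl

/-- The polynomial in the counting variable, at fixed parameter and point of the torus. -/
def specialize (s : ℂ) (ω : Torus) : (ℂ → C(Torus, ℂ))[X] →+* ℂ[X] :=
  mapRingHom ((evalPoint ω).comp (Pi.evalRingHom (fun _ : ℂ => C(Torus, ℂ)) s))

theorem coeff_specialize (s : ℂ) (ω : Torus) (P : (ℂ → C(Torus, ℂ))[X]) (n : ℕ) :
    (specialize s ω P).coeff n = P.coeff n s ω := by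
  rw [specialize, coe_mapRingHom, coeff_map]
  rfl

theorem specialize_scalarPoly (s : ℂ) (ω : Torus) (c : ℂ → ℂ) :
    specialize s ω (scalarPoly _ c) = C (c s) := by
  rw [specialize, coe_mapRingHom, scalarPoly, map_C]
  rfl

theorem specialize_letterPoly (s : ℂ) (ω : Torus) (i : Fin 2 × Fin 2) :
    specialize s ω (letterPoly Y i) = C (Y i ω) * X := by
  rw [specialize, coe_mapRingHom, letterPoly, Polynomial.map_mul, map_C, map_X]
  rfl

theorem IsCubic.coeff {f : ℂ[X]} {a₁ a₂ a₃ : ℂ} (h : IsCubic X f (C a₁) (C a₂) (C a₃)) :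
    f.coeff 0 = 1 ∧ f.coeff 1 = a₁ ∧ f.coeff 2 = a₂ ∧ f.coeff 3 = a₃ := by
  have h := X_pow_dvd_iff.1 h
  have h0 := h 0 (by norm_num)
  have h1 := h 1 (by norm_num)
  have h2 := h 2 (by norm_num)
  have h3 := h 3 (by norm_num)
  simp [coeff_X, coeff_one, coeff_C_mul, coeff_X_pow, sub_eq_zero] at h0 h1 h2 h3
  exact ⟨h0, h1, h2, h3⟩

/-- The coefficients of the matter contribution at a point of the torus. -/
theorem coeff_specialize_matterPoly (s : ℂ) (ω : Torus) (k₁ k₂ k₃ : ℂ)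
    (h₁ : k₁ = matterOne (s ^ 2) ((u : ℂ) + (u : ℂ)⁻¹) (v + (v : ℂ)⁻¹))
    (h₂ : k₂ = matterTwo (s ^ 2) ((u : ℂ) + (u : ℂ)⁻¹) (v + (v : ℂ)⁻¹))
    (h₃ : k₃ = matterThree (s ^ 2) ((u : ℂ) + (u : ℂ)⁻¹) (v + (v : ℂ)⁻¹)) :
    (matterPoly u v Y).coeff 0 s ω = 1 ∧
    (matterPoly u v Y).coeff 1 s ω = k₁ * ∑ i, Y i ω ∧
    (matterPoly u v Y).coeff 2 s ω =
      k₁ ^ 2 / 2 * (∑ i, Y i ω) ^ 2 + (k₂ - k₁ ^ 2 / 2) * ∑ i, Y i ω ^ 2 ∧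
    (matterPoly u v Y).coeff 3 s ω =
      k₁ ^ 3 / 6 * (∑ i, Y i ω) ^ 3 +
      (k₁ * k₂ - k₁ ^ 3 / 2) * ((∑ i, Y i ω) * ∑ i, Y i ω ^ 2) +
      (k₃ - k₁ * k₂ + k₁ ^ 3 / 3) * ∑ i, Y i ω ^ 3 := by
  have hi : ∀ i, IsCubic X (specialize s ω (matter (scalarPoly _ fun s => s ^ 2)
      (scalarPoly _ fun _ => (u : ℂ)) (scalarPoly _ fun _ => (u : ℂ)⁻¹)
      (scalarPoly _ fun _ => (v : ℂ)) (scalarPoly _ fun _ => (v : ℂ)⁻¹) (letterPoly Y i)))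
      (C (k₁ * Y i ω)) (C (k₂ * Y i ω ^ 2)) (C (k₃ * Y i ω ^ 3)) := fun i => by
    have hs : specialize s ω (matter (scalarPoly _ fun s => s ^ 2)
        (scalarPoly _ fun _ => (u : ℂ)) (scalarPoly _ fun _ => (u : ℂ)⁻¹)
        (scalarPoly _ fun _ => (v : ℂ)) (scalarPoly _ fun _ => (v : ℂ)⁻¹) (letterPoly Y i)) =
          matter (C (s ^ 2)) (C (u : ℂ)) (C (u : ℂ)⁻¹) (C (v : ℂ)) (C (v : ℂ)⁻¹)
            (C (Y i ω) * X) := by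
      refine (map_matter (R := (ℂ → C(Torus, ℂ))[X]) (S := ℂ[X]) (specialize s ω) _ _ _ _ _ _).trans ?_
      simp only [specialize_scalarPoly, specialize_letterPoly]
    rw [hs]
    have hc := isCubic_matter (u := C (u : ℂ)) (u' := C (u : ℂ)⁻¹) (v := C (v : ℂ))
      (v' := C (v : ℂ)⁻¹) (by rw [← C_mul, mul_inv_cancel₀ u.ne_zero, C_1])
      (by rw [← C_mul, mul_inv_cancel₀ v.ne_zero, C_1]) (C (s ^ 2)) (C (Y i ω)) X
    convert hc using 1
    · rw [h₁]
      simp only [matterOne, map_add, map_sub, map_mul, map_pow]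
    · rw [h₂]
      simp only [matterTwo, map_add, map_sub, map_mul, map_pow, map_one]
    · rw [h₃]
      simp only [matterThree, map_add, map_sub, map_mul, map_pow, map_one, map_ofNat]
  have hP : specialize s ω (matterPoly u v Y) = ∏ i, specialize s ω (matter
      (scalarPoly _ fun s => s ^ 2) (scalarPoly _ fun _ => (u : ℂ))
      (scalarPoly _ fun _ => (u : ℂ)⁻¹) (scalarPoly _ fun _ => (v : ℂ))
      (scalarPoly _ fun _ => (v : ℂ)⁻¹) (letterPoly Y i)) := map_prod _ _ _
  have h := ((hi (0, 0)).mul (hi (0, 1))).mul ((hi (1, 0)).mul (hi (1, 1)))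
  simp only [Fintype.prod_prod_type, Fin.prod_univ_two] at hP
  rw [← hP] at h
  simp only [← C_add, ← C_mul] at h
  obtain ⟨c0, c1, c2, c3⟩ := h.coeff
  rw [coeff_specialize] at c0 c1 c2 c3
  refine ⟨c0, ?_, ?_, ?_⟩
  · rw [c1]
    simp only [Fintype.sum_prod_type, Fin.sum_univ_two]
    ring
  · rw [c2]
    simp only [Fintype.sum_prod_type, Fin.sum_univ_two]
    ring
  · rw [c3]
    simp only [Fintype.sum_prod_type, Fin.sum_univ_two]
    ring

end ChargedMatter

/-! ### The expansion of the index -/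

section IndexExpansion

open MeasureTheory Complex Filter Topology Asymptotics

/-- The index up to third order, in terms of the characters of the doublets. -/
def indexPoly {R : Type*} [CommRing R] (U V q : R) : R :=
  1 + U * V * q + (2 * (U ^ 2 - 1) * (V ^ 2 - 1) - (U ^ 2 - 1) - (V ^ 2 - 1)) * q ^ 2 +
    (2 * (U ^ 3 - 2 * U) * (V ^ 3 - 2 * V) - (U ^ 3 - 2 * U) * V - U * (V ^ 3 - 2 * V)
      - 2 * U * V) * q ^ 3

variable (u v : ℂˣ)

theorem coeff_matterPoly (Y : Fin 2 × Fin 2 → C(Torus, ℂ)) (s : ℂ) (k₁ k₂ k₃ : ℂ)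
    (h₁ : k₁ = matterOne (s ^ 2) ((u : ℂ) + (u : ℂ)⁻¹) (v + (v : ℂ)⁻¹))
    (h₂ : k₂ = matterTwo (s ^ 2) ((u : ℂ) + (u : ℂ)⁻¹) (v + (v : ℂ)⁻¹))
    (h₃ : k₃ = matterThree (s ^ 2) ((u : ℂ) + (u : ℂ)⁻¹) (v + (v : ℂ)⁻¹)) :
    (matterPoly u v Y).coeff 0 s = powerSumMap Y (0, 0, 0) ∧
    (matterPoly u v Y).coeff 1 s = k₁ • powerSumMap Y (1, 0, 0) ∧
    (matterPoly u v Y).coeff 2 s =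
      (k₁ ^ 2 / 2) • powerSumMap Y (2, 0, 0) + (k₂ - k₁ ^ 2 / 2) • powerSumMap Y (0, 1, 0) ∧
    (matterPoly u v Y).coeff 3 s =
      (k₁ ^ 3 / 6) • powerSumMap Y (3, 0, 0) +
      (k₁ * k₂ - k₁ ^ 3 / 2) • powerSumMap Y (1, 1, 0) +
      (k₃ - k₁ * k₂ + k₁ ^ 3 / 3) • powerSumMap Y (0, 0, 1) := by
  have h := fun ω => coeff_specialize_matterPoly u v Y s ω k₁ k₂ k₃ h₁ h₂ h₃
  refine ⟨?_, ?_, ?_, ?_⟩ <;> ext ω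
  · rw [(h ω).1, powerSumMap_apply]
    simp
  · rw [(h ω).2.1, ContinuousMap.smul_apply, powerSumMap_apply]
    simp
  · rw [(h ω).2.2.1, ContinuousMap.add_apply, ContinuousMap.smul_apply, ContinuousMap.smul_apply,
      powerSumMap_apply, powerSumMap_apply]
    simp
  · rw [(h ω).2.2.2, ContinuousMap.add_apply, ContinuousMap.add_apply, ContinuousMap.smul_apply,
      ContinuousMap.smul_apply, ContinuousMap.smul_apply, powerSumMap_apply, powerSumMap_apply,
      powerSumMap_apply]
    simp

/-- The average of the truncated integrand. -/
theorem exists_average_matterPoly : ∃ r : ℂ → ℂ, Continuous r ∧ ∀ s,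
    average (evalAt s (matterPoly u v ratio) * evalAt s (matterPoly v u ratioInv)) =
      4 * (2 * Real.pi) ^ 4 * indexPoly ((u : ℂ) + (u : ℂ)⁻¹) (v + (v : ℂ)⁻¹) (s ^ 2) +
        (s ^ 2) ^ 4 * r s := by
  obtain ⟨r, hr, h⟩ := exists_pairing_evalAt (L := average) average_monom_eq_zero
    (matterPoly_mem u v ratio) (matterPoly_mem v u ratioInv)
  -- Working in the ring of continuous functions makes the quotient by $q^4$ a continuous function,
  -- hence bounded near zero.
  obtain ⟨r', h'⟩ := index_expansion (R := C(ℂ, ℂ)) ⟨fun s => s ^ 2, by fun_prop⟩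
    (algebraMap ℂ C(ℂ, ℂ) ((u : ℂ) + (u : ℂ)⁻¹)) (algebraMap ℂ C(ℂ, ℂ) (v + (v : ℂ)⁻¹))
  refine ⟨fun s => 4 * (2 * Real.pi) ^ 4 * r' s + r s,
    (continuous_const.mul r'.continuous).add hr, fun s => ?_⟩
  set U := (u : ℂ) + (u : ℂ)⁻¹ with hU
  set V := (v : ℂ) + (v : ℂ)⁻¹ with hV
  set k₁ := matterOne (s ^ 2) U V with hk₁
  set k₂ := matterTwo (s ^ 2) U V with hk₂
  set k₃ := matterThree (s ^ 2) U V with hk₃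
  set l₁ := matterOne (s ^ 2) V U with hl₁
  set l₂ := matterTwo (s ^ 2) V U with hl₂
  set l₃ := matterThree (s ^ 2) V U with hl₃
  have hs' : 1 + s ^ 2 * chargeOne k₁ l₁ + (s ^ 2) ^ 2 * chargeTwo k₁ k₂ l₁ l₂ +
      (s ^ 2) ^ 3 * chargeThree k₁ k₂ k₃ l₁ l₂ l₃ - indexPoly U V (s ^ 2) =
        (s ^ 2) ^ 4 * r' s := by
    set φ : C(ℂ, ℂ) →+* ℂ := (Pi.evalRingHom (fun _ : ℂ => ℂ) s).comp ContinuousMap.coeFnRingHom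
    have hq : φ ⟨fun s => s ^ 2, by fun_prop⟩ = s ^ 2 := rfl
    have hc : ∀ c : ℂ, φ (algebraMap ℂ C(ℂ, ℂ) c) = c := fun _ => rfl
    have hr : φ r' = r' s := rfl
    have hs := congrArg φ h'
    simp only [chargeOne, chargeTwo, chargeThree, matterOne, matterTwo, matterThree, map_sub,
      map_add φ, map_mul, map_pow, map_one, map_ofNat, hq, hc, hr] at hs
    simp only [hk₁, hk₂, hk₃, hl₁, hl₂, hl₃, chargeOne, chargeTwo, chargeThree, matterOne,
      matterTwo, matterThree, indexPoly]
    exact hs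
  rw [sub_eq_iff_eq_add] at hs'
  obtain ⟨a0, a1, a2, a3⟩ := coeff_matterPoly u v ratio s k₁ k₂ k₃ hk₁ hk₂ hk₃
  obtain ⟨b0, b1, b2, b3⟩ := coeff_matterPoly v u ratioInv s l₁ l₂ l₃ hl₁ hl₂ hl₃
  have g1 : gram (0, 1, 0) (2, 0, 0) = (2 * Real.pi) ^ 2 * 0 :=
    (gram_comm (e := (0, 1, 0)) (e' := (2, 0, 0)) rfl).trans gram_200_010
  have g2 : gram (1, 1, 0) (3, 0, 0) = (2 * Real.pi) ^ 2 * 2 :=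
    (gram_comm (e := (1, 1, 0)) (e' := (3, 0, 0)) rfl).trans gram_300_110
  have g3 : gram (0, 0, 1) (3, 0, 0) = (2 * Real.pi) ^ 2 * (-2) :=
    (gram_comm (e := (0, 0, 1)) (e' := (3, 0, 0)) rfl).trans gram_300_001
  have g4 : gram (0, 0, 1) (1, 1, 0) = (2 * Real.pi) ^ 2 * 2 :=
    (gram_comm (e := (0, 0, 1)) (e' := (1, 1, 0)) rfl).trans gram_110_001
  have e0 : average ((matterPoly u v ratio).coeff 0 s * (matterPoly v u ratioInv).coeff 0 s) =
      4 * (2 * Real.pi) ^ 4 := by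
    rw [a0, b0, average_powerSumMap, gram_000_000]
    ring
  have e1 : average ((matterPoly u v ratio).coeff 1 s * (matterPoly v u ratioInv).coeff 1 s) =
      4 * (2 * Real.pi) ^ 4 * chargeOne k₁ l₁ := by
    rw [a1, b1, smul_mul_smul_comm, map_smul, average_powerSumMap, gram_100_100, chargeOne,
      smul_eq_mul]
    ring
  have e2 : average ((matterPoly u v ratio).coeff 2 s * (matterPoly v u ratioInv).coeff 2 s) =
      4 * (2 * Real.pi) ^ 4 * chargeTwo k₁ k₂ l₁ l₂ := by
    rw [a2, b2]
    simp only [add_mul, mul_add, smul_mul_smul_comm, map_add, map_smul, average_powerSumMap,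
      gram_200_200, gram_200_010, g1, gram_010_010, chargeTwo, smul_eq_mul]
    ring
  have e3 : average ((matterPoly u v ratio).coeff 3 s * (matterPoly v u ratioInv).coeff 3 s) =
      4 * (2 * Real.pi) ^ 4 * chargeThree k₁ k₂ k₃ l₁ l₂ l₃ := by
    rw [a3, b3]
    simp only [add_mul, mul_add, smul_mul_smul_comm, map_add, map_smul, average_powerSumMap,
      gram_300_300, gram_300_110, gram_300_001, gram_110_110, gram_110_001, gram_001_001, g2, g3,
      g4, chargeThree, smul_eq_mul]
    ring
  rw [h s]
  simp only [Finset.sum_range_succ, Finset.sum_range_zero, e0, e1, e2, e3]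
  linear_combination 4 * (2 * (Real.pi : ℂ)) ^ 4 * hs'

/-- The matter contribution to the integrand. -/
def matterFull (s : ℂ) (ω : Torus) : ℂ :=
  ∏ i, (chiral s ((u : ℂ)⁻¹ * ratio i ω) * chiral s ((u : ℂ) * ratio i ω) *
    chiral s ((v : ℂ)⁻¹ * ratioInv i ω) * chiral s ((v : ℂ) * ratioInv i ω))

/-- Each truncated chiral factor splits into a part in $sy$ and a part in $s/y$, with $s^3 = s^2 s$,
$s^5 = s^4 s$ and $s^7 = s^6 s$. Regrouping collects the positive and the negative powers of the
ratio in separate factors, as the pairing by charge requires. -/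
theorem chiralTrunc_eq_matter (s x u v : ℂ) :
    chiralTrunc s (u⁻¹ * x) * chiralTrunc s (u * x) * chiralTrunc s (v⁻¹ * x⁻¹) *
      chiralTrunc s (v * x⁻¹) =
    matter (s ^ 2) u u⁻¹ v v⁻¹ (s * x) * matter (s ^ 2) v v⁻¹ u u⁻¹ (s * x⁻¹) := by
  obtain ⟨A, hA⟩ : ∃ A : ℂ → ℂ, ∀ t, (∑ a ∈ Finset.range 8, t ^ a) * (1 + (s ^ 2) ^ 2 * t) = A t :=
    ⟨_, fun _ => rfl⟩
  obtain ⟨B, hB⟩ : ∃ B : ℂ → ℂ, ∀ t, (1 - s ^ 2 * t) * (1 - (s ^ 2) ^ 3 * t) = B t :=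
    ⟨_, fun _ => rfl⟩
  have h : ∀ y, chiralTrunc s y = B (s * y⁻¹) * A (s * y) := fun y => by
    rw [chiralTrunc, ← hA, ← hB]
    congr 2 <;> ring
  simp only [h, matter, hA, hB, mul_inv, inv_inv, mul_left_comm s]
  ring

/-- A bound for the fugacities. -/
def fugacityBound : ℝ := 1 + ‖(u : ℂ)‖ + ‖(u : ℂ)⁻¹‖ + ‖(v : ℂ)‖ + ‖(v : ℂ)⁻¹‖

theorem one_le_fugacityBound : 1 ≤ fugacityBound u v := by
  rw [fugacityBound]
  linarith [norm_nonneg (u : ℂ), norm_nonneg (u : ℂ)⁻¹, norm_nonneg (v : ℂ),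
    norm_nonneg (v : ℂ)⁻¹]

/-- Multiples of the fugacities by phases are bounded above and below. -/
theorem norm_mul_le_fugacityBound {c x : ℂ} (hc : c = u ∨ c = (u : ℂ)⁻¹ ∨ c = v ∨ c = (v : ℂ)⁻¹)
    (hx : ‖x‖ = 1) : ‖c * x‖ ≤ fugacityBound u v ∧ ‖(c * x)⁻¹‖ ≤ fugacityBound u v := by
  rw [norm_inv, norm_mul, hx, mul_one, fugacityBound, ← norm_inv]
  have := norm_nonneg (u : ℂ)
  have := norm_nonneg (u : ℂ)⁻¹
  have := norm_nonneg (v : ℂ)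
  have := norm_nonneg (v : ℂ)⁻¹
  obtain rfl | rfl | rfl | rfl := hc <;> constructor <;> (try rw [inv_inv]) <;> linarith

/-- The filter of small `s`, uniformly on the torus. -/
def uniformFilter : Filter (ℂ × Torus) := 𝓝 0 ×ˢ 𝓟 Set.univ

theorem approx_chiral_mul {c : ℂ} (hc : c = u ∨ c = (u : ℂ)⁻¹ ∨ c = v ∨ c = (v : ℂ)⁻¹)
    {f : Torus → ℂ} (hf : ∀ ω, ‖f ω‖ = 1) :
    Approx uniformFilter (fun p => p.1 ^ 8) (fun p => chiral p.1 (c * f p.2))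
      fun p => chiralTrunc p.1 (c * f p.2) := by
  have ht : Tendsto (fun p : ℂ × Torus => (p.1, c * f p.2)) uniformFilter
      (annulus (fugacityBound u v)) := by
    exact Tendsto.prodMk tendsto_fst (tendsto_principal.2 (Eventually.of_forall fun p =>
      norm_mul_le_fugacityBound u v hc (hf p.2)))
  have h := (approx_chiral (one_le_fugacityBound u v)).comp ht
  simp only [Function.comp_def] at h
  exact h

theorem approx_matterFull : Approx uniformFilter (fun p => p.1 ^ 8)
    (fun p => matterFull u v p.1 p.2) fun p =>
      evalAt p.1 (matterPoly u v ratio) p.2 * evalAt p.1 (matterPoly v u ratioInv) p.2 := by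
  have hg : (fun p : ℂ × Torus => p.1 ^ 8) =O[uniformFilter] fun _ => (1 : ℂ) := by
    have : Tendsto (fun p : ℂ × Torus => p.1 ^ 8) uniformFilter (𝓝 (0 ^ 8)) :=
      (tendsto_fst (f := 𝓝 (0 : ℂ)) (g := 𝓟 (Set.univ : Set Torus))).pow 8
    exact this.isBigO_one ℂ
  have h := Approx.prod hg Finset.univ fun i _ =>
    (((approx_chiral_mul u v (Or.inr (Or.inl rfl)) (norm_ratio i)).mul hg
      (approx_chiral_mul u v (Or.inl rfl) (norm_ratio i))).mul hg
      (approx_chiral_mul u v (Or.inr (Or.inr (Or.inr rfl))) (norm_ratioInv i))).mul hg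
      (approx_chiral_mul u v (Or.inr (Or.inr (Or.inl rfl))) (norm_ratioInv i))
  have e : ∀ p : ℂ × Torus, evalAt p.1 (matterPoly u v ratio) p.2 *
      evalAt p.1 (matterPoly v u ratioInv) p.2 = ∏ i,
        (chiralTrunc p.1 ((u : ℂ)⁻¹ * ratio i p.2) * chiralTrunc p.1 ((u : ℂ) * ratio i p.2) *
          chiralTrunc p.1 ((v : ℂ)⁻¹ * ratioInv i p.2) *
          chiralTrunc p.1 ((v : ℂ) * ratioInv i p.2)) := fun p => by
    rw [evalAt_matterPoly, evalAt_matterPoly, ← Finset.prod_mul_distrib]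
    refine Finset.prod_congr rfl fun i _ => ?_
    rw [← inv_ratio_apply]
    exact (chiralTrunc_eq_matter _ _ _ _).symm
  simp only [e]
  exact h

theorem exists_matterFull_bound : ∃ C : ℝ, ∀ᶠ s in 𝓝 (0 : ℂ), ∀ ω, ‖matterFull u v s ω -
    evalAt s (matterPoly u v ratio) ω * evalAt s (matterPoly v u ratioInv) ω‖ ≤ C * ‖s‖ ^ 8 := by
  obtain ⟨C, hC⟩ := (approx_matterFull u v).sub.bound
  refine ⟨C, ?_⟩
  rw [uniformFilter, eventually_prod_principal_iff] at hC
  filter_upwards [hC] with s hs ω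
  simpa only [norm_pow] using hs ω (Set.mem_univ ω)

/-- A pointwise limit of measurable finite products. Measurability and the uniform bound are enough
for integrability, so continuity of the infinite product is not needed. -/
theorem measurable_chiral {c : ℂ} (hc : c = u ∨ c = (u : ℂ)⁻¹ ∨ c = v ∨ c = (v : ℂ)⁻¹)
    (f : C(Torus, ℂ)) (hf : ∀ ω, ‖f ω‖ = 1) {s : ℂ} (hs : 4 * fugacityBound u v * ‖s‖ ≤ 1) :
    Measurable fun ω => chiral s (c * f ω) := by
  refine measurable_of_tendsto_metrizable
    (f := fun n ω => ∏ i ∈ Finset.range n, chiralFactor s (c * f ω) i) (fun n => ?_)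
    (tendsto_pi_nhds.2 fun ω => tendsto_prod_chiralFactor (one_le_fugacityBound u v) hs
      (norm_mul_le_fugacityBound u v hc (hf ω)).1 (norm_mul_le_fugacityBound u v hc (hf ω)).2)
  have hm : Measurable fun ω => c * f ω := (f.continuous.measurable).const_mul c
  refine Finset.measurable_fun_prod _ fun i _ => ?_
  unfold chiralFactor
  exact (measurable_const.sub (measurable_const.mul hm.inv)).div
    (measurable_const.sub (measurable_const.mul hm))

theorem measurable_matterFull {s : ℂ} (hs : 4 * fugacityBound u v * ‖s‖ ≤ 1) :
    Measurable fun ω => matterFull u v s ω := by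
  refine Finset.measurable_fun_prod _ fun i _ => ?_
  exact (((measurable_chiral u v (Or.inr (Or.inl rfl)) _ (norm_ratio i) hs).mul
    (measurable_chiral u v (Or.inl rfl) _ (norm_ratio i) hs)).mul
    (measurable_chiral u v (Or.inr (Or.inr (Or.inr rfl))) _ (norm_ratioInv i) hs)).mul
    (measurable_chiral u v (Or.inr (Or.inr (Or.inl rfl))) _ (norm_ratioInv i) hs)

theorem norm_haarFactor_le (ω : Torus) : ‖haarFactor ω‖ ≤ 16 := by
  have h : ∀ θ : Angles, ‖vec (eigenvalue θ)‖ ≤ 4 := fun θ => by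
    have h1 : ∀ i j, ‖1 - eigenvalue θ i / eigenvalue θ j‖ ≤ 2 := fun i j => by
      refine (norm_sub_le _ _).trans ?_
      rw [norm_div, norm_eigenvalue, norm_eigenvalue, norm_one]
      norm_num
    rw [vec_two, norm_mul]
    nlinarith [h1 0 1, h1 1 0, norm_nonneg (1 - eigenvalue θ 0 / eigenvalue θ 1),
      norm_nonneg (1 - eigenvalue θ 1 / eigenvalue θ 0)]
  rw [haarFactor, norm_mul]
  nlinarith [h ω.1, h ω.2, norm_nonneg (vec (eigenvalue ω.1)), norm_nonneg (vec (eigenvalue ω.2))]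

/-- The index as an integral over the angles. -/
theorem zeroFluxIndex_two {s : ℂ}
    (hi : Integrable (fun ω => haarFactor ω * matterFull u v s ω) torusMeasure) :
    zeroFluxIndex 2 s u v =
      (4 * (2 * (Real.pi : ℂ)) ^ 4)⁻¹ * ∫ ω, haarFactor ω * matterFull u v s ω ∂torusMeasure := by
  have hmap : ∀ θ : Angles, torusMap 0 1 θ = eigenvalue θ := fun θ => by
    funext i
    simp [torusMap, eigenvalue]
  -- Each torus has Jacobian $i^2 = -1$ times the product of the eigenvalues; the two signs cancel
  -- and the eigenvalues cancel against the inverse factors of the integrand.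
  have hjac : ∀ θ : Angles, ∏ i, (((1 : Fin 2 → ℝ) i : ℂ) * exp (θ i * I) * I) =
      -(∏ i, eigenvalue θ i) := fun θ => by
    simp only [Fin.prod_univ_two, eigenvalue, Pi.one_apply, ofReal_one, one_mul]
    linear_combination exp (θ 0 * I) * exp (θ 1 * I) * I_mul_I
  have hprod : ∀ θ : Angles, ∏ i, eigenvalue θ i ≠ 0 := fun θ =>
    Finset.prod_ne_zero_iff.2 fun i _ => eigenvalue_ne_zero θ i
  rw [torusMeasure, integral_prod _ hi, zeroFluxIndex]
  simp only [torusIntegral, hmap, hjac, smul_eq_mul]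
  have hI : (((Nat.factorial 2 : ℕ) : ℂ) ^ 2)⁻¹ * ((2 * Real.pi * I) ^ 2)⁻¹ ^ 2 =
      (4 * (2 * (Real.pi : ℂ)) ^ 4)⁻¹ := by
    rw [mul_pow _ I, I_sq, inv_pow, ← mul_inv]
    congr 1
    norm_num [Nat.factorial]
    ring
  rw [hI]
  congr 1
  refine integral_congr_ae (Eventually.of_forall fun θ => ?_)
  simp only
  rw [← integral_const_mul]
  refine integral_congr_ae (Eventually.of_forall fun φ => ?_)
  simp only
  trans ((∏ i, eigenvalue θ i) * (∏ i, eigenvalue θ i)⁻¹) *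
    ((∏ i, eigenvalue φ i) * (∏ i, eigenvalue φ i)⁻¹) *
      (haarFactor (θ, φ) * matterFull u v s (θ, φ))
  · simp only [haarFactor, matterFull, Fintype.prod_prod_type, ratio_apply, ratioInv_apply,
      mul_div_assoc]
    ring
  · rw [mul_inv_cancel₀ (hprod θ), mul_inv_cancel₀ (hprod φ), one_mul, one_mul]

/-- The expansion of the zero-flux index to third order. -/
theorem zeroFluxIndex_sub_isBigO : (fun s : ℂ => zeroFluxIndex 2 s u v -
    indexPoly ((u : ℂ) + (u : ℂ)⁻¹) (v + (v : ℂ)⁻¹) (s ^ 2)) =O[𝓝 0] fun s => (s ^ 2) ^ 4 := by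
  obtain ⟨C, hC⟩ := exists_matterFull_bound u v
  obtain ⟨r, hr, hav⟩ := exists_average_matterPoly u v
  have hpi : (4 * (2 * (Real.pi : ℂ)) ^ 4) ≠ 0 := by
    have : (Real.pi : ℂ) ≠ 0 := ofReal_ne_zero.2 Real.pi_ne_zero
    exact mul_ne_zero (by norm_num) (pow_ne_zero _ (mul_ne_zero two_ne_zero this))
  set K : ℂ := 4 * (2 * (Real.pi : ℂ)) ^ 4 with hK
  have hsmall : ∀ᶠ s : ℂ in 𝓝 0, 4 * fugacityBound u v * ‖s‖ ≤ 1 := by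
    have : Tendsto (fun s : ℂ => 4 * fugacityBound u v * ‖s‖) (𝓝 0)
        (𝓝 (4 * fugacityBound u v * ‖(0 : ℂ)‖)) :=
      (continuous_const.mul continuous_norm).tendsto 0
    rw [norm_zero, mul_zero] at this
    exact (this.eventually (gt_mem_nhds one_pos)).mono fun _ h => le_of_lt h
  have key : ∀ᶠ s : ℂ in 𝓝 0, ‖zeroFluxIndex 2 s u v - K⁻¹ *
      average (evalAt s (matterPoly u v ratio) * evalAt s (matterPoly v u ratioInv))‖ ≤
        ‖K⁻¹‖ * (16 * C * torusMeasure.real Set.univ) * ‖(s ^ 2) ^ 4‖ := by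
    filter_upwards [hC, hsmall] with s hs hs'
    set F := evalAt s (matterPoly u v ratio) * evalAt s (matterPoly v u ratioInv) with hF
    have hb : ∀ ω, ‖haarFactor ω * (matterFull u v s ω - F ω)‖ ≤ 16 * (C * ‖s‖ ^ 8) := fun ω => by
      rw [norm_mul]
      exact mul_le_mul (norm_haarFactor_le ω) (hs ω) (norm_nonneg _) (by norm_num)
    have hm : Measurable fun ω => haarFactor ω * (matterFull u v s ω - F ω) :=
      continuous_haarFactor.measurable.mul
        ((measurable_matterFull u v hs').sub F.continuous.measurable)
    have hi1 : Integrable (fun ω => haarFactor ω * (matterFull u v s ω - F ω)) torusMeasure :=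
      Integrable.of_bound hm.aestronglyMeasurable _ (Eventually.of_forall hb)
    have hi2 : Integrable (fun ω => haarFactor ω * F ω) torusMeasure :=
      integrable_prod_of_continuous (continuous_haarFactor.mul F.continuous)
    -- The full integrand is the continuous truncated one plus a bounded measurable error.
    have hi : Integrable (fun ω => haarFactor ω * matterFull u v s ω) torusMeasure := by
      refine (hi1.add hi2).congr (Eventually.of_forall fun ω => ?_)
      simp only [Pi.add_apply]
      ring
    rw [zeroFluxIndex_two u v hi, ← hK, ← mul_sub, norm_mul, mul_assoc]
    gcongr
    rw [average_apply, ← integral_sub hi hi2]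
    simp only [← mul_sub]
    refine (norm_integral_le_of_norm_le_const (Eventually.of_forall hb)).trans (le_of_eq ?_)
    rw [← pow_mul, norm_pow]
    ring
  have h1 : (fun s : ℂ => zeroFluxIndex 2 s u v - K⁻¹ *
      average (evalAt s (matterPoly u v ratio) * evalAt s (matterPoly v u ratioInv)))
        =O[𝓝 0] fun s => (s ^ 2) ^ 4 := IsBigO.of_bound _ key
  have h3 : (fun s : ℂ => K⁻¹ * r s) =O[𝓝 0] fun _ => (1 : ℂ) :=
    ((continuous_const.mul hr).tendsto 0).isBigO_one ℂ
  have h2 : (fun s : ℂ => (s ^ 2) ^ 4 * (K⁻¹ * r s)) =O[𝓝 0] fun s => (s ^ 2) ^ 4 := by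
    simpa using (isBigO_refl (fun s : ℂ => (s ^ 2) ^ 4) (𝓝 0)).mul
      h3
  refine (h1.add h2).congr_left fun s => ?_
  rw [hav s]
  field_simp
  ring

end IndexExpansion

/-! ### Comparison of the index with the graded characters -/

section Index

variable (u v : ℂˣ)

theorem chi_two (w : ℂˣ) : chi 2 w = (w : ℂ) + (w : ℂ)⁻¹ := by
  simp [chi, Finset.sum_range_succ]

theorem chi_three (w : ℂˣ) : chi 3 w = chi 2 w ^ 2 - 1 := by
  rw [chi_two]
  simp [chi, Finset.sum_range_succ, zpow_neg]
  field_simp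
  ring

theorem chi_four (w : ℂˣ) : chi 4 w = chi 2 w ^ 3 - 2 * chi 2 w := by
  rw [chi_two]
  simp [chi, Finset.sum_range_succ, zpow_neg]
  field_simp
  ring

variable {k : ℕ}

theorem zeroFluxIndex_sub_superTrace_isBigO (hk : 0 < k) :
    (fun s : ℂ => zeroFluxIndex 2 s u v - ∑ d ∈ Finset.range 4,
      superTrace (⊤ : Submodule ℂ (Coh 2 k d)) u v * (s ^ 2) ^ d)
        =O[nhds 0] fun s : ℂ => (s ^ 2) ^ 4 := by
  refine (zeroFluxIndex_sub_isBigO u v).congr_left fun s => ?_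
  simp only [Finset.sum_range_succ, Finset.sum_range_zero, superTrace_top_zero hk,
    superTrace_top_one hk, superTrace_top_two hk, superTrace_top_three hk, indexPoly, chi_three,
    chi_four, ← chi_two]
  ring

theorem zeroFluxIndex_sub_superTrace_gravitons_isBigO (hk : 0 < k) :
    (fun s : ℂ => (zeroFluxIndex 2 s u v - ∑ d ∈ Finset.range 4,
      superTrace (gravitons 2 k d) u v * (s ^ 2) ^ d) - (-(chi 2 u * chi 2 v) * (s ^ 2) ^ 3))
        =O[nhds 0] fun s : ℂ => (s ^ 2) ^ 4 := by
  refine (zeroFluxIndex_sub_superTrace_isBigO u v hk).congr_left fun s => ?_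
  simp only [Finset.sum_range_succ, Finset.sum_range_zero, superTrace_top_three hk,
    superTrace_gravitons_three hk, superTrace_gravitons_of_lt hk (show 0 < 3 by norm_num),
    superTrace_gravitons_of_lt hk (show 1 < 3 by norm_num),
    superTrace_gravitons_of_lt hk (show 2 < 3 by norm_num)]
  ring

end Index

end ABJM

end

theorem mainTheorem2 (k : ℕ) (hk : 0 < k) :
    -- the representatives other than `𝒪_f` are closed gauge-invariant operators for every rank
    (∀ m : ABJM.Multiplet, m ≠ .fortuitous → ∀ T ∈ m.reps, T ∈ ABJM.monotone k m.order) ∧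
    -- the operators `𝒪_f` are closed for rank `2`, but not for any higher rank
    (∀ T ∈ ABJM.Multiplet.fortuitous.reps, T ∈ ABJM.formalOps 3 ∧
      ABJM.Q 2 k (ABJM.ev 2 T) = 0 ∧ ∀ N : ℕ, 3 ≤ N → ABJM.Q N k (ABJM.ev N T) ≠ 0) ∧
    -- up to order `x^3` the cohomology is the direct sum of the multiplets, and its monotone part
    -- is the sum of the multiplets other than `𝒪_f`
    (∀ d : ℕ, d ≤ 3 →
      iSupIndep (fun m : {m : ABJM.Multiplet // m.order = d} => m.1.space k d) ∧
      (⨆ m : {m : ABJM.Multiplet // m.order = d}, m.1.space k d) = ⊤ ∧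
      ABJM.gravitons 2 k d =
        ⨆ m : {m : ABJM.Multiplet // m.order = d ∧ m ≠ .fortuitous}, m.1.space k d) ∧
    -- flavour representation and statistics of every multiplet
    (∀ m : ABJM.Multiplet,
      (∃ W : Subrepresentation (ABJM.flavorRep 2 k m.order),
        W.toSubmodule = m.space k m.order ∧
        Nonempty ((ABJM.irrepTensor m.dimU m.dimV).Equiv W.toRepresentation)) ∧
      ∀ X ∈ m.space k m.order,
        ABJM.parityCoh 2 k m.order X = (if m.odd then (-1 : ℂ) else 1) • X) ∧
    -- the index, with `x = s ^ 2`
    (∀ u v : ℂˣ,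
      -- graded characters of the full cohomology
      ABJM.superTrace (⊤ : Submodule ℂ (ABJM.Coh 2 k 0)) u v = 1 ∧
      ABJM.superTrace (⊤ : Submodule ℂ (ABJM.Coh 2 k 1)) u v = ABJM.chi 2 u * ABJM.chi 2 v ∧
      ABJM.superTrace (⊤ : Submodule ℂ (ABJM.Coh 2 k 2)) u v =
        2 * ABJM.chi 3 u * ABJM.chi 3 v - ABJM.chi 3 u - ABJM.chi 3 v ∧
      ABJM.superTrace (⊤ : Submodule ℂ (ABJM.Coh 2 k 3)) u v =
        2 * ABJM.chi 4 u * ABJM.chi 4 v - ABJM.chi 4 u * ABJM.chi 2 v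
          - ABJM.chi 2 u * ABJM.chi 4 v - 2 * ABJM.chi 2 u * ABJM.chi 2 v ∧
      -- graded characters of the multi-gravitons
      ABJM.superTrace (ABJM.gravitons 2 k 0) u v = 1 ∧
      ABJM.superTrace (ABJM.gravitons 2 k 1) u v = ABJM.chi 2 u * ABJM.chi 2 v ∧
      ABJM.superTrace (ABJM.gravitons 2 k 2) u v =
        2 * ABJM.chi 3 u * ABJM.chi 3 v - ABJM.chi 3 u - ABJM.chi 3 v ∧
      ABJM.superTrace (ABJM.gravitons 2 k 3) u v =
        2 * ABJM.chi 4 u * ABJM.chi 4 v - ABJM.chi 4 u * ABJM.chi 2 v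
          - ABJM.chi 2 u * ABJM.chi 4 v - ABJM.chi 2 u * ABJM.chi 2 v ∧
      -- the full cohomology reproduces the matrix integral up to order `x^3`
      (fun s : ℂ => ABJM.zeroFluxIndex 2 s u v - ∑ d ∈ Finset.range 4,
          ABJM.superTrace (⊤ : Submodule ℂ (ABJM.Coh 2 k d)) u v * (s ^ 2) ^ d)
        =O[nhds 0] (fun s : ℂ => (s ^ 2) ^ 4) ∧
      -- the full index minus the multi-graviton index is `-χ₂(u) χ₂(v) x^3` up to that order
      (fun s : ℂ => (ABJM.zeroFluxIndex 2 s u v - ∑ d ∈ Finset.range 4,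
          ABJM.superTrace (ABJM.gravitons 2 k d) u v * (s ^ 2) ^ d) -
            (-(ABJM.chi 2 u * ABJM.chi 2 v) * (s ^ 2) ^ 3))
        =O[nhds 0] (fun s : ℂ => (s ^ 2) ^ 4)) := by
  have h1 : ∀ m : ABJM.Multiplet, m ≠ .fortuitous → ∀ T ∈ m.reps, T ∈ ABJM.monotone k m.order :=
    fun m hm T hT => ABJM.Multiplet.span_reps_le_monotone k hm (Submodule.subset_span hT)
  have h2 : ∀ T ∈ ABJM.Multiplet.fortuitous.reps, T ∈ ABJM.formalOps 3 ∧
      ABJM.Q 2 k (ABJM.ev 2 T) = 0 ∧ ∀ N : ℕ, 3 ≤ N → ABJM.Q N k (ABJM.ev N T) ≠ 0 := by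
    intro T hT
    refine ⟨ABJM.Multiplet.fortuitous.reps_subset_formalOps hT,
      ABJM.Multiplet.fortuitous.Q_two_reps k hT, ?_⟩
    obtain ⟨i, p, rfl⟩ := hT
    exact fun N hN => ABJM.Q_fort_ne_zero hk hN p i
  refine ⟨h1, h2, fun d hd => ⟨ABJM.iSupIndep_space, ABJM.iSup_space hk hd, ABJM.gravitons_eq hk hd⟩,
    fun m => ⟨m.exists_subrepresentation k, fun X hX => m.parityCoh_space k hX⟩,
    fun u v => ⟨ABJM.superTrace_top_zero hk u v, ABJM.superTrace_top_one hk u v,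
      ABJM.superTrace_top_two hk u v, ABJM.superTrace_top_three hk u v, ?_, ?_, ?_,
      ABJM.superTrace_gravitons_three hk u v, ABJM.zeroFluxIndex_sub_superTrace_isBigO u v hk,
      ABJM.zeroFluxIndex_sub_superTrace_gravitons_isBigO u v hk⟩⟩
  · rw [ABJM.superTrace_gravitons_of_lt hk (by norm_num), ABJM.superTrace_top_zero hk]
  · rw [ABJM.superTrace_gravitons_of_lt hk (by norm_num), ABJM.superTrace_top_one hk]
  · rw [ABJM.superTrace_gravitons_of_lt hk (by norm_num), ABJM.superTrace_top_two hk]
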